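/- Let $A\neq B$ be positive integers. Let $\mathbb C_{+}$ (resp. $\mathbb C_-$) be the plane cut along the closed vertical half-lines going down (resp. up) from the integers. Let $\Sigma$ be the surface obtained from $\mathbb C_+\times\mathbb Z\sqcup\mathbb C_-\times\mathbb Z$, with points written $(z_+,m_+)$ and $(z_-,m_-)$, by the identifications $(z,m)_+\sim(z,m+B\lfloor\mathrm{Re}\,z\rfloor)_-$ for $z\in\mathbb C_+\cap\mathbb C_-$, $(z,m+A)_+\sim(z+1,m)_+$ and $(z,n+A)_-\sim(z+1,n+B)_-$. (Equivalently: sheets $(z,m)$, $z\in\mathbb C_+$, with $(k+0+iy,m)\sim(k-0+iy,m+B)$ for $y<0$, $k\in\mathbb Z$, and $(z,m+A)\sim(z+1,m)$.) For $\epsilon,M>0$ let $\Sigma^{\pm}=\Sigma^{\pm}_{\epsilon,M}$ be the union over $m\in\{0,\dots,A-1\}$ of the sets of points having a coordinate $(z_\pm,m_\pm)$ with $m_\pm=m$ and either $\pm\mathrm{Im}\,z_\pm\ge \epsilon/M$, or $|\mathrm{Re}\,z_\pm|\le M$, $\pm\mathrm{Im}\,z_\pm\ge-\epsilon/M$ and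 $|z_\pm-k|\ge\epsilon/(1+|k|)$ for all $k\in\mathbb Z$. Let $X_{\epsilon,M}=\Sigma^+\cup\Sigma^-$. For $L\in\mathbb R$ and $\theta\in(0,2\pi)$ let $D_{L,\theta}=D^+_{L,\theta}\cup D^-_{L,\theta}$, where, with $P_+=\frac A2z_+^2$ and $P_-=\frac{A-B}2z_-^2$, $D_{L,\theta}^{\pm}$ is the union over the sheets $m_\pm=m\in\{0,\dots,A-1\}$ of the path component of the part of the sheet of $\Sigma^\pm$ where $-\mathrm{Im}(P_\pm e^{-i\theta})>L$ that contains the points $z_+=re^{i\theta/2-iA\epsilon}$ (resp. $z_-=-re^{i\theta/2-i(A-B)\epsilon}$) for all large $r$ (empty if there is none). Homology is singular, with coefficients in an arbitrary commutative ring $R$ (for instance a field or $\mathbb Z$), and $H_\bullet(X_{\epsilon,M},D_{\infty,\theta}):=H_\bullet\big(\varprojlim_{L\ge M}C_\bullet(X_{\epsilon,M},D_{L,\theta})\big)$. For $\tau\in\mathbb C\setminus\mathbb R_{\le0}$ with $\arg(-1/\tau)=\theta$, $\ell\in\mathbb Z$ and $m\in\{0,\dots,A-1\}$, let $\tilde{\mathcal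 J}_{\ell,m,\tau}$ be the continuous lift to $\Sigma$ of the contour $\mathcal J_{\ell,\tau}=(\tfrac i{\sqrt\tau}e^{-iA\epsilon}\mathbb R_{\ge0}-\tfrac12+\ell)\cup(\tfrac i{\sqrt\tau}e^{-i(A-B)\epsilon}\mathbb R_{\le0}-\tfrac12+\ell)$ whose crossing point with the real line is $(z_+,m_+)=(\ell-\frac12,m)$. Then, for $\theta\in(0,2\pi)$: (1) For all $\epsilon,M,L>0$ the relative homology $H_1(X_{\epsilon,M},D_{L,\theta})$ is finite dimensional (a finitely generated $R$-module). (2) For every $M>0$, every sufficiently small $\epsilon>0$ and every sufficiently large $L$, the Mayer–Vietoris connecting map is an isomorphism $H_1(X_{\epsilon,M},D_{L,\theta})\cong H_0(\Sigma^+\cap\Sigma^-)$. That is, there is an isomorphism sending $h$ to $k$ exactly when $h$ is the class of $a+b$ and $k$ is the class of $c$, for some chains $a$ in $\Sigma^+$, $b$ in $\Sigma^-$ and $c$ in $\Sigma^+\cap\Sigma^-$ such that $\partial a-c$ is a chain in $D^+_{L,\theta}$ and $\partial b+c$ is a chain in $D^-_{L,\theta}$. (3) Let $M>0$ be such that every interval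 $(k,k+1)$, $k\in\mathbb Z$, that meets $(-M,M)$ has its midpoint in $(-M,M)$ (for instance, $M$ a positive integer). Then for every sufficiently small $\epsilon>0$ and every $\tau$ with $\arg(-1/\tau)=\theta$, the classes of those $\tilde{\mathcal J}_{\ell,m,\tau}$, $\ell\in\mathbb Z$, $m\in\{0,\dots,A-1\}$, that are contained in $X_{\epsilon,M}$ form a basis of $H_1(X_{\epsilon,M},D_{\infty,\theta})$. All of them satisfy $|\ell|<\max\{1,|A-B|/A\}\,\lceil M\rceil+2$, so they are finite in number; and if $B\le 2A$, then all the $\tilde{\mathcal J}_{\ell,m,\tau}$ with $|\ell|<M$ are among them. -/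

import Mathlib

open CategoryTheory CategoryTheory.Limits AlgebraicTopology

namespace StateInt

/-! ### The surface `Σ` -/

/-- The plane cut along the downward vertical half-lines starting at the integers:
the domain of the coordinate `z₊` on a sheet of the surface. -/
def cutPlus : Set ℂ := {z | ¬ ∃ k : ℤ, z.re = k ∧ z.im ≤ 0}

/-- The plane cut along the upward vertical half-lines starting at the integers:
the domain of the coordinate `z₋` on a sheet of the surface. -/
def cutMinus : Set ℂ := {z | ¬ ∃ k : ℤ, z.re = k ∧ 0 ≤ z.im}

/-- Points `(z₊, m₊)` and points `(z₋, m₋)`, before gluing. -/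
abbrev PreSurface : Type := (cutPlus × ℤ) ⊕ (cutMinus × ℤ)

/-- The gluing relations. The first one is `z₋ = z₊`, `m₋ = m₊ + B ⌊Re z₊⌋`, and it encodes that
`(k + 0 + iy, m)` is glued to `(k - 0 + iy, m + B)` for `y < 0`, in the coordinates `(z₊, m₊)`: both
are the point `(k + iy, m + B k)` in the coordinates `(z₋, m₋)`. The second one is
`(z, m + A) ∼ (z + 1, m)` in the coordinates `(z₊, m₊)`, and the third one is the same relation
written in the coordinates `(z₋, m₋)`. -/
inductive Glue (A B : ℕ) : PreSurface → PreSurface → Prop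
  | coord (z : ℂ) (hp : z ∈ cutPlus) (hm : z ∈ cutMinus) (m : ℤ) :
      Glue A B (Sum.inl (⟨z, hp⟩, m)) (Sum.inr (⟨z, hm⟩, m + B * ⌊z.re⌋))
  | shiftPlus (z : ℂ) (h : z ∈ cutPlus) (h' : z + 1 ∈ cutPlus) (m : ℤ) :
      Glue A B (Sum.inl (⟨z, h⟩, m + A)) (Sum.inl (⟨z + 1, h'⟩, m))
  | shiftMinus (z : ℂ) (h : z ∈ cutMinus) (h' : z + 1 ∈ cutMinus) (n : ℤ) :
      Glue A B (Sum.inr (⟨z, h⟩, n + A)) (Sum.inr (⟨z + 1, h'⟩, n + B))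

/-- The surface `Σ`, with the quotient topology (`ℤ` is discrete). -/
def Surface (A B : ℕ) : Type := Quot (Glue A B)

instance (A B : ℕ) : TopologicalSpace (Surface A B) :=
  inferInstanceAs (TopologicalSpace (Quot (Glue A B)))

/-- The point of `Σ` with coordinates `(z₊, m₊) = (z, m)`. -/
def ptPlus (A B : ℕ) (m : ℤ) (z : cutPlus) : Surface A B := Quot.mk _ (Sum.inl (z, m))

/-- The point of `Σ` with coordinates `(z₋, m₋) = (z, m)`. -/
def ptMinus (A B : ℕ) (m : ℤ) (z : cutMinus) : Surface A B := Quot.mk _ (Sum.inr (z, m))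

/-! ### The surface `X_{ε,M}` -/

/-- The set `U ∩ V ∪ W` in a coordinate plane; `s = 1` for `z₊` and `s = -1` for `z₋`. -/
def sheetRegion (s ε M : ℝ) : Set ℂ :=
  ({z | |z.re| ≤ M ∧ -(ε / M) ≤ s * z.im} ∩ {z | ∀ k : ℤ, ε / (1 + |(k : ℝ)|) ≤ ‖z - k‖}) ∪
    {z | ε / M ≤ s * z.im}

/-- `Σ⁺_{ε,M}`, the union over the sheets `m₊ = 0, …, A - 1`. -/
def SigmaPlus (A B : ℕ) (ε M : ℝ) : Set (Surface A B) :=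
  ⋃ m : Fin A, ptPlus A B (m : ℕ) '' {z | (z : ℂ) ∈ sheetRegion 1 ε M}

/-- `Σ⁻_{ε,M}`, the union over the sheets `m₋ = 0, …, A - 1`. -/
def SigmaMinus (A B : ℕ) (ε M : ℝ) : Set (Surface A B) :=
  ⋃ m : Fin A, ptMinus A B (m : ℕ) '' {z | (z : ℂ) ∈ sheetRegion (-1) ε M}

/-- `X_{ε,M}`. -/
def XSurf (A B : ℕ) (ε M : ℝ) : Set (Surface A B) := SigmaPlus A B ε M ∪ SigmaMinus A B ε M

/-! ### The regions at infinity `D_{L,θ}` -/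

/-- The points of the sheet `m₊ = m` of `Σ⁺_{ε,M}` where `-Im(P₊ e^{-iθ}) > L`,
with `P₊ = (A/2) z₊²`. -/
def decayPlus (A B : ℕ) (ε M L θ : ℝ) (m : ℤ) : Set (Surface A B) :=
  ptPlus A B m '' {z | (z : ℂ) ∈ sheetRegion 1 ε M ∧
    L < -(((A : ℂ) / 2 * (z : ℂ) ^ 2) * Complex.exp (-(θ * Complex.I))).im}

/-- The points of the sheet `m₋ = m` of `Σ⁻_{ε,M}` where `-Im(P₋ e^{-iθ}) > L`,
with `P₋ = ((A-B)/2) z₋²`. -/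
def decayMinus (A B : ℕ) (ε M L θ : ℝ) (m : ℤ) : Set (Surface A B) :=
  ptMinus A B m '' {z | (z : ℂ) ∈ sheetRegion (-1) ε M ∧
    L < -((((A : ℂ) - B) / 2 * (z : ℂ) ^ 2) * Complex.exp (-(θ * Complex.I))).im}

/-- `D⁺_{L,θ}`: on every sheet, the (path) component of `decayPlus` that contains the points with
`z₊ = r e^{iθ/2} e^{-iAε}` for all large `r`. -/
def DPlus (A B : ℕ) (ε M L θ : ℝ) : Set (Surface A B) :=
  {p | ∃ m : Fin A, ∃ r₀ : ℝ, ∀ r : ℝ, r₀ ≤ r →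
    ∃ h : (r : ℂ) * Complex.exp ((θ / 2 - A * ε : ℝ) * Complex.I) ∈ cutPlus,
      JoinedIn (decayPlus A B ε M L θ (m : ℕ)) p (ptPlus A B (m : ℕ) ⟨_, h⟩)}

/-- `D⁻_{L,θ}`: on every sheet, the (path) component of `decayMinus` that contains the points with
`z₋ = -r e^{iθ/2} e^{-i(A-B)ε}` for all large `r`. -/
def DMinus (A B : ℕ) (ε M L θ : ℝ) : Set (Surface A B) :=
  {p | ∃ m : Fin A, ∃ r₀ : ℝ, ∀ r : ℝ, r₀ ≤ r →
    ∃ h : -(r : ℂ) * Complex.exp ((θ / 2 - (A - B) * ε : ℝ) * Complex.I) ∈ cutMinus,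
      JoinedIn (decayMinus A B ε M L θ (m : ℕ)) p (ptMinus A B (m : ℕ) ⟨_, h⟩)}

/-- `D_{L,θ}`. -/
def DReg (A B : ℕ) (ε M L θ : ℝ) : Set (Surface A B) :=
  DPlus A B ε M L θ ∪ DMinus A B ε M L θ

theorem DPlus_subset (A B : ℕ) (ε M L θ : ℝ) : DPlus A B ε M L θ ⊆ SigmaPlus A B ε M := by
  rintro p ⟨m, r₀, h⟩
  obtain ⟨_, hj⟩ := h r₀ le_rfl
  obtain ⟨z, hz, rfl⟩ := hj.source_mem
  exact Set.mem_iUnion.2 ⟨m, z, hz.1, rfl⟩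

theorem DMinus_subset (A B : ℕ) (ε M L θ : ℝ) : DMinus A B ε M L θ ⊆ SigmaMinus A B ε M := by
  rintro p ⟨m, r₀, h⟩
  obtain ⟨_, hj⟩ := h r₀ le_rfl
  obtain ⟨z, hz, rfl⟩ := hj.source_mem
  exact Set.mem_iUnion.2 ⟨m, z, hz.1, rfl⟩

theorem DReg_subset (A B : ℕ) (ε M L θ : ℝ) : DReg A B ε M L θ ⊆ XSurf A B ε M :=
  Set.union_subset_union (DPlus_subset A B ε M L θ) (DMinus_subset A B ε M L θ)

theorem DReg_antitone (A B : ℕ) (ε M θ : ℝ) {L L' : ℝ} (hL : L ≤ L') :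
    DReg A B ε M L' θ ⊆ DReg A B ε M L θ := by
  apply Set.union_subset_union
  · rintro p ⟨m, r₀, h⟩
    refine ⟨m, r₀, fun r hr => ?_⟩
    obtain ⟨hc, hj⟩ := h r hr
    exact ⟨hc, hj.mono (Set.image_mono fun z hz => ⟨hz.1, hL.trans_lt hz.2⟩)⟩
  · rintro p ⟨m, r₀, h⟩
    refine ⟨m, r₀, fun r hr => ?_⟩
    obtain ⟨hc, hj⟩ := h r hr
    exact ⟨hc, hj.mono (Set.image_mono fun z hz => ⟨hz.1, hL.trans_lt hz.2⟩)⟩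

/-! ### Relative singular homology -/

noncomputable section

universe u

variable (R : Type u) [CommRing R]

/-- The singular chain complex of a subspace `S`, with coefficients in `R`. -/
abbrev chains {Y : Type} [TopologicalSpace Y] (S : Set Y) : ChainComplex (ModuleCat.{u} R) ℕ :=
  ((singularChainComplexFunctor (ModuleCat.{u} R)).obj (ModuleCat.of R R)).obj (TopCat.of S)

/-- The map of singular chain complexes induced by an inclusion of subspaces. -/
def chainsIncl {Y : Type} [TopologicalSpace Y] {S T : Set Y} (h : S ⊆ T) :
    chains R S ⟶ chains R T :=
  ((singularChainComplexFunctor (ModuleCat.{u} R)).obj (ModuleCat.of R R)).map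
    (TopCat.ofHom ⟨Set.inclusion h, continuous_inclusion h⟩)

theorem chainsIncl_comp {Y : Type} [TopologicalSpace Y] {S T U : Set Y} (h : S ⊆ T) (h' : T ⊆ U) :
    chainsIncl R h ≫ chainsIncl R h' = chainsIncl R (h.trans h') := by
  unfold chainsIncl
  rw [← Functor.map_comp]
  rfl

theorem chainsIncl_refl {Y : Type} [TopologicalSpace Y] {S : Set Y} (h : S ⊆ S) :
    chainsIncl R h = 𝟙 _ := by
  unfold chainsIncl
  exact ((singularChainComplexFunctor (ModuleCat.{u} R)).obj (ModuleCat.of R R)).map_id _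

/-- The relative singular chain complex `C_•(X, D) = C_•(X) / C_•(D)`. -/
abbrev relChains {Y : Type} [TopologicalSpace Y] {D X : Set Y} (h : D ⊆ X) :
    ChainComplex (ModuleCat.{u} R) ℕ :=
  cokernel (chainsIncl R h)

/-- The projection `C_•(X, D') → C_•(X, D)` for `D' ⊆ D ⊆ X`. -/
def relProj {Y : Type} [TopologicalSpace Y] {D' D X : Set Y} (h' : D' ⊆ D) (h : D ⊆ X) :
    relChains R (h'.trans h) ⟶ relChains R h :=
  cokernel.map _ _ (chainsIncl R h') (𝟙 _) (by rw [chainsIncl_comp, Category.comp_id])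

/-- `x` is a cycle of degree `n` of the complex `K`, and `h` is its homology class. -/
def IsClass {R : Type u} [CommRing R] (K : ChainComplex (ModuleCat.{u} R) ℕ) (n : ℕ)
    (x : K.X n) (h : K.homology n) : Prop :=
  ∃ z : K.cycles n, (K.iCycles n).hom z = x ∧ (K.homologyπ n).hom z = h

/-- The inverse system `L ↦ C_•(X_{ε,M}, D_{L,θ})`, for `L ≥ M`. -/
def relSystem (A B : ℕ) (ε M θ : ℝ) :
    {L : ℝ // M ≤ L}ᵒᵖ ⥤ ChainComplex (ModuleCat.{u} R) ℕ where
  obj L := relChains R (DReg_subset A B ε M L.unop θ)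
  map f := relProj R (DReg_antitone A B ε M θ (leOfHom f.unop)) (DReg_subset A B ε M _ θ)
  map_id L := by
    apply coequalizer.hom_ext
    simp [relProj]
  map_comp f g := by
    apply coequalizer.hom_ext
    simp [relProj]

/-- The complex `C_•(X_{ε,M}, D_{∞,θ})`, the inverse limit of `C_•(X_{ε,M}, D_{L,θ})`. -/
abbrev relChainsInf (A B : ℕ) (ε M θ : ℝ) : ChainComplex (ModuleCat.{u} R) ℕ :=
  limit (relSystem R A B ε M θ)

/-- The Mayer–Vietoris connecting homomorphism `H₁(X, D) → H₀(Σ⁺ ∩ Σ⁻)`, as a relation: `h` is the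
class of `a + b` where `a` is a chain in `Σ⁺` with `∂a = c + (chain in D⁺)` and `b` is a chain in `Σ⁻`
with `∂b = -c + (chain in D⁻)`, and `k` is the class of the chain `c` in `Σ⁺ ∩ Σ⁻`. -/
def MVConnecting (A B : ℕ) (ε M L θ : ℝ)
    (h : (relChains R (DReg_subset A B ε M L θ)).homology 1)
    (k : (chains R (SigmaPlus A B ε M ∩ SigmaMinus A B ε M)).homology 0) : Prop :=
  ∃ (a : (chains R (SigmaPlus A B ε M)).X 1) (b : (chains R (SigmaMinus A B ε M)).X 1)
    (c : (chains R (SigmaPlus A B ε M ∩ SigmaMinus A B ε M)).X 0)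
    (d : (chains R (DPlus A B ε M L θ)).X 0) (d' : (chains R (DMinus A B ε M L θ)).X 0),
    ((chains R (SigmaPlus A B ε M)).d 1 0).hom a =
      ((chainsIncl R Set.inter_subset_left).f 0).hom c +
        ((chainsIncl R (DPlus_subset A B ε M L θ)).f 0).hom d ∧
    ((chains R (SigmaMinus A B ε M)).d 1 0).hom b =
      -((chainsIncl R Set.inter_subset_right).f 0).hom c +
        ((chainsIncl R (DMinus_subset A B ε M L θ)).f 0).hom d' ∧
    IsClass _ 1 (((cokernel.π (chainsIncl R (DReg_subset A B ε M L θ))).f 1).hom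
      (((chainsIncl R (Set.subset_union_left : SigmaPlus A B ε M ⊆ XSurf A B ε M)).f 1).hom a +
        ((chainsIncl R (Set.subset_union_right : SigmaMinus A B ε M ⊆ XSurf A B ε M)).f 1).hom b)) h ∧
    IsClass _ 0 c k

/-! ### The state integral contours -/

/-- `γ` is the lift of the contour
`(i τ^{-1/2} e^{-iAε} ℝ_{≥0} - 1/2 + ℓ) ∪ (i τ^{-1/2} e^{-i(A-B)ε} ℝ_{≤0} - 1/2 + ℓ)`
to `Σ` that crosses the real line on the sheet `m₊ = m`. Since `⌊ℓ - 1/2⌋ = ℓ - 1`, the crossing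
point has `m₋ = m + B (ℓ - 1)`. -/
def IsContourLift (A B : ℕ) (ε : ℝ) (τ : ℂ) (ℓ m : ℤ) (γ : ℝ → Surface A B) : Prop :=
  (∀ t : ℝ, 0 ≤ t →
    ∃ h : Complex.I / τ ^ (1 / 2 : ℂ) * Complex.exp (-(Complex.I * A * ε)) * t - 1 / 2 + ℓ ∈ cutPlus,
      γ t = ptPlus A B m ⟨_, h⟩) ∧
  (∀ t : ℝ, t ≤ 0 →
    ∃ h : Complex.I / τ ^ (1 / 2 : ℂ) * Complex.exp (-(Complex.I * (A - B) * ε)) * t - 1 / 2 + ℓ ∈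
        cutMinus,
      γ t = ptMinus A B (m + B * (ℓ - 1)) ⟨_, h⟩)

/-- The pairs `(ℓ, m)`, `m = 0, …, A - 1`, for which the lifted contour is contained in `X_{ε,M}`. -/
def contourIndex (A B : ℕ) (ε M : ℝ) (τ : ℂ) : Set (ℤ × Fin A) :=
  {q | ∃ γ : C(ℝ, XSurf A B ε M), IsContourLift A B ε τ q.1 (q.2 : ℕ) fun t => γ t}

/-- The singular 1-simplex `γ|_{[n, n+1]}`. -/
def segment {Y : Type} [TopologicalSpace Y] (γ : C(ℝ, Y)) (n : ℤ) :
    C(stdSimplex ℝ (Fin 2), Y) :=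
  γ.comp ⟨fun x => (n : ℝ) + x.1 1,
    continuous_const.add ((continuous_apply 1).comp continuous_subtype_val)⟩

/-- The singular chain consisting of one 1-simplex with coefficient `1`. -/
def simplexChain {Y : Type} [TopologicalSpace Y] {S : Set Y} (σ : C(stdSimplex ℝ (Fin 2), S)) :
    (chains R S).X 1 :=
  (SSet.ιChainComplex (R := ModuleCat.of R R) (TopCat.toSSet.obj (TopCat.of S))
    (((TopCat.of S).toSSetObjEquiv (Opposite.op (SimplexCategory.mk 1))).symm σ)).hom (1 : R)

/-- `h` is the class in `H₁(X_{ε,M}, D_{∞,θ})` of the infinite chain `∑_{n ∈ ℤ} γ|_{[n, n+1]}`: it is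
the class of a cycle in the inverse limit whose component in `C₁(X_{ε,M}, D_{L,θ})` is, for every
`L`, the image of `∑_{-N ≤ n < N} γ|_{[n, n+1]}` for all large `N`. -/
def Represents (A B : ℕ) (ε M θ : ℝ) (γ : C(ℝ, XSurf A B ε M))
    (h : (relChainsInf R A B ε M θ).homology 1) : Prop :=
  ∃ x : (relChainsInf R A B ε M θ).X 1, IsClass _ 1 x h ∧
    ∀ L : {L : ℝ // M ≤ L}, ∃ N₀ : ℕ, ∀ N : ℕ, N₀ ≤ N →
      ((limit.π (relSystem R A B ε M θ) (Opposite.op L)).f 1).hom x =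
        ((cokernel.π (chainsIncl R (DReg_subset A B ε M L θ))).f 1).hom
          (∑ n ∈ Finset.Ico (-N : ℤ) N, simplexChain R (segment γ n))

end

end StateInt

/-!
The first homology of `X` relative to a region `D` is studied through the map sending a singular
path to its class among the relative `1`-chains modulo boundaries (`RelOp`, `relClass`). This is a
cocycle, hence additive under concatenation and invariant under homotopies, and `H₁(X, D)` is what
it takes on cycles. The upper and the lower half of `X` retract vertically into half-planes, so on
each half the cocycle is the difference of a potential at the endpoints (`exists_upper_potential`,
`exists_lower_potential`). On all of `X` it is so up to the jumps of the two potentials across the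
real line (`relClass_sub_glue_mem`). Over each strip `k < Re z < k + 1` the jump is constant along
the real trace of a leg of `Σ⁺` or `Σ⁻`, and there are finitely many legs and finitely many
components of `D`; this gives finiteness (`finite_homology`).

When `ε` is small and `L` is large, the part of `D⁺` or `D⁻` on a sheet is one branch of a hyperbolic
region, contained in a half-plane (`sheetDPlus_eq`), and the potentials may be normalized to vanish
on it. The jump is then constant on cells, that is on the strips, or on their halves if no leg
passes the midpoint. Correcting by the jump gives potentials on `Σ⁺` and on `Σ⁻` that vanish on `D⁺`
and on `D⁻` (`exists_side_potentials`). Their difference on `Σ⁺ ∩ Σ⁻` inverts the connecting map: it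
shows that the Mayer–Vietoris relation determines `h` from `k`, and, since the jumps span, that
every `h` occurs. Conversely every component of `Σ⁺ ∩ Σ⁻` has a cocycle that counts the crossings of
its cell, as the winding of a map to the circle (`exists_crossing_cocycle`,
`exists_component_functional`). These cocycles determine `k` from `h`, whence the isomorphism
`exists_mvEquiv`.

If midpoints are as in the third assertion, the cells that meet `X` are whole strips, and each of
those belonging to `Σ⁺ ∩ Σ⁻` is crossed by exactly one contour in `X` (`mem_contourIndex_iff`). The
connecting map sends the class of the contour to minus its crossing point (`mvConnecting_line`), so
the contours form a basis of `H₁(X, D_L)` (`basis_of_points`). To pass to the limit, translation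
along the directions of decay deforms `D_L` inside itself into any `D_{L'}` (`exists_deformation`).
The prism operator of this deformation turns a primitive modulo `D_L` into a primitive modulo
`D_{L'}` without changing it modulo `D_L` (`exists_lift_primitive`), so repeated correction gives a
primitive in the inverse limit (`exists_primitive_inf`). Hence the homology of the limit injects into
`H₁(X, D_L)`, while each contour, cut off further and further out, defines a class in the limit
(`exists_represents`). The bounds on the indices are arithmetic of the numbering of the sheets
(`index_bound`, `shifts_nonempty_of_le`).
-/


namespace StateInt

noncomputable section

universe u

variable {R : Type u} [CommRing R]

/-! ### Singular chains and homology classes -/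

section Chains

variable {Y : Type} [TopologicalSpace Y] {S T : Set Y}

variable (R) in
/-- The singular chain consisting of one `n`-simplex with coefficient `1`. -/
def simplexN {n : ℕ} (σ : C(stdSimplex ℝ (Fin (n + 1)), S)) : (chains R S).X n :=
  (SSet.ιChainComplex (R := ModuleCat.of R R) (TopCat.toSSet.obj (TopCat.of S))
    (((TopCat.of S).toSSetObjEquiv (Opposite.op (SimplexCategory.mk n))).symm σ)).hom (1 : R)

theorem simplexChain_eq_simplexN (σ : C(stdSimplex ℝ (Fin 2), S)) :
    simplexChain R σ = simplexN R (n := 1) σ := rfl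

variable (R) in
/-- The `0`-chain consisting of one point. -/
def pointChain (p : S) : (chains R S).X 0 := simplexN R (n := 0) (ContinuousMap.const _ p)

/-- The linear map out of the singular chains with given values on the simplices. -/
def chainLift {n : ℕ} {Q : Type u} [AddCommGroup Q] [Module R Q]
    (κ : C(stdSimplex ℝ (Fin (n + 1)), S) → Q) : (chains R S).X n →ₗ[R] Q :=
  (Sigma.desc (fun x : (TopCat.toSSet.obj (TopCat.of S)).obj (Opposite.op (SimplexCategory.mk n)) =>
    ModuleCat.ofHom (LinearMap.toSpanSingleton R Q
      (κ ((TopCat.of S).toSSetObjEquiv _ x))))).hom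

theorem chainLift_simplexN {n : ℕ} {Q : Type u} [AddCommGroup Q] [Module R Q]
    (κ : C(stdSimplex ℝ (Fin (n + 1)), S) → Q) (σ : C(stdSimplex ℝ (Fin (n + 1)), S)) :
    chainLift κ (simplexN R σ) = κ σ := by
  have := congrArg (fun f => f.hom (1 : R)) (Sigma.ι_desc (fun x : (TopCat.toSSet.obj
      (TopCat.of S)).obj (Opposite.op (SimplexCategory.mk n)) =>
    ModuleCat.ofHom (LinearMap.toSpanSingleton R Q
      (κ ((TopCat.of S).toSSetObjEquiv _ x))))
    (((TopCat.of S).toSSetObjEquiv (Opposite.op (SimplexCategory.mk n))).symm σ))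
  refine Eq.trans ?_ (this.trans ?_)
  · rfl
  · simp

theorem chain_hom_ext {n : ℕ} {Q : Type u} [AddCommGroup Q] [Module R Q]
    {f g : (chains R S).X n →ₗ[R] Q} (h : ∀ σ, f (simplexN R σ) = g (simplexN R σ)) : f = g := by
  have : ModuleCat.ofHom f = ModuleCat.ofHom g := by
    apply SSet.chainComplex_hom_ext
    intro x
    apply ModuleCat.hom_ext
    apply LinearMap.ext_ring
    have := h ((TopCat.of S).toSSetObjEquiv _ x)
    rw [simplexN, Equiv.symm_apply_apply] at this
    exact this
  simpa using congrArg ModuleCat.Hom.hom this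

theorem span_simplexN (n : ℕ) :
    Submodule.span R (Set.range (simplexN R (S := S) (n := n))) = ⊤ := by
  set N := Submodule.span R (Set.range (simplexN R (S := S) (n := n)))
  have : N.mkQ = 0 := by
    apply chain_hom_ext
    intro σ
    have : simplexN R σ ∈ N := Submodule.subset_span ⟨σ, rfl⟩
    simpa using this
  rw [← Submodule.ker_mkQ N, this, LinearMap.ker_zero]

theorem chain_induction {n : ℕ} {P : (chains R S).X n → Prop} (h0 : P 0)
    (hadd : ∀ x y, P x → P y → P (x + y)) (hsmul : ∀ (r : R) x, P x → P (r • x))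
    (hσ : ∀ σ, P (simplexN R σ)) (x : (chains R S).X n) : P x := by
  have hx : x ∈ Submodule.span R (Set.range (simplexN R (S := S) (n := n))) := by
    rw [span_simplexN]; trivial
  induction hx using Submodule.span_induction with
  | mem y hy => obtain ⟨σ, rfl⟩ := hy; exact hσ σ
  | zero => exact h0
  | add x y _ _ hx hy => exact hadd x y hx hy
  | smul r x _ hx => exact hsmul r x hx

/-- The `i`-th face of a singular simplex. -/
def face {n : ℕ} (i : Fin (n + 2)) (σ : C(stdSimplex ℝ (Fin (n + 2)), S)) :
    C(stdSimplex ℝ (Fin (n + 1)), S) :=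
  σ.comp ⟨stdSimplex.map i.succAbove, by continuity⟩

theorem d_simplexN {n : ℕ} (σ : C(stdSimplex ℝ (Fin (n + 2)), S)) :
    ((chains R S).d (n + 1) n).hom (simplexN R (n := n + 1) σ) =
      ∑ i : Fin (n + 2), (-1 : ℤ) ^ (i : ℕ) • simplexN R (face i σ) := by
  have := congrArg (fun f => f.hom (1 : R)) (SSet.ιChainComplex_d
    (R := ModuleCat.of R R) (TopCat.toSSet.obj (TopCat.of S))
    (((TopCat.of S).toSSetObjEquiv (Opposite.op (SimplexCategory.mk (n + 1)))).symm σ))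
  refine Eq.trans ?_ (this.trans ?_)
  · rfl
  · simp only [ModuleCat.hom_sum, LinearMap.sum_apply]
    rfl

theorem d_simplexN_two (σ : C(stdSimplex ℝ (Fin 3), S)) :
    ((chains R S).d 2 1).hom (simplexN R (n := 2) σ) =
      simplexN R (n := 1) (face 0 σ) - simplexN R (n := 1) (face 1 σ) +
        simplexN R (n := 1) (face 2 σ) := by
  rw [d_simplexN (n := 1)]
  simp [Fin.sum_univ_three, sub_eq_add_neg]

theorem simplexN_zero (σ : C(stdSimplex ℝ (Fin 1), S)) :
    simplexN R (n := 0) σ = pointChain R (σ (stdSimplex.vertex 0)) := by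
  unfold pointChain
  congr 1
  ext x
  have : x = stdSimplex.vertex 0 := Subsingleton.elim _ _
  simp [this]

theorem d_simplexN_one (σ : C(stdSimplex ℝ (Fin 2), S)) :
    ((chains R S).d 1 0).hom (simplexN R (n := 1) σ) =
      pointChain R (σ (stdSimplex.vertex 1)) - pointChain R (σ (stdSimplex.vertex 0)) := by
  rw [d_simplexN (n := 0)]
  simp [Fin.sum_univ_two, simplexN_zero, face, sub_eq_add_neg]

theorem chainsIncl_simplexN (h : S ⊆ T) {n : ℕ} (σ : C(stdSimplex ℝ (Fin (n + 1)), S)) :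
    ((chainsIncl R h).f n).hom (simplexN R σ) =
      simplexN R ((⟨Set.inclusion h, continuous_inclusion h⟩ : C(S, T)).comp σ) := by
  have := congrArg (fun f => f.hom (1 : R)) (SSet.ι_chainComplexMap_f
    (TopCat.toSSet.obj (TopCat.of S)) (TopCat.toSSet.obj (TopCat.of T))
    (TopCat.toSSet.map
      (TopCat.ofHom ⟨Set.inclusion h, continuous_inclusion h⟩ : TopCat.of S ⟶ TopCat.of T))
    (ModuleCat.of R R) (((TopCat.of S).toSSetObjEquiv (Opposite.op (SimplexCategory.mk n))).symm σ))
  refine Eq.trans ?_ (this.trans ?_)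
  · rfl
  · rfl

theorem chainsIncl_pointChain (h : S ⊆ T) (p : S) :
    ((chainsIncl R h).f 0).hom (pointChain R p) = pointChain R (⟨p, h p.2⟩ : T) := by
  unfold pointChain
  rw [chainsIncl_simplexN]
  rfl

end Chains

section Classes

variable {K : ChainComplex (ModuleCat.{u} R) ℕ}

theorem d_comp_d_apply (i j k : ℕ) (x : K.X i) : (K.d j k).hom ((K.d i j).hom x) = 0 := by
  have := congrArg (fun f => f.hom x) (K.d_comp_d i j k)
  exact this

theorem comm_apply {K' : ChainComplex (ModuleCat.{u} R) ℕ} (f : K ⟶ K') (i j : ℕ) (x : K.X i) :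
    (K'.d i j).hom ((f.f i).hom x) = (f.f j).hom ((K.d i j).hom x) := by
  have := congrArg (fun g => g.hom x) (f.comm i j)
  exact this

theorem pOpcycles_surjective (n : ℕ) : Function.Surjective (K.pOpcycles n).hom :=
  (ModuleCat.epi_iff_surjective _).1 inferInstance

theorem homologyι_injective (n : ℕ) : Function.Injective (K.homologyι n).hom :=
  (ModuleCat.mono_iff_injective _).1 inferInstance

theorem pOpcycles_eq_zero_iff (n : ℕ) (x : K.X n) :
    (K.pOpcycles n).hom x = 0 ↔ ∃ w : K.X (n + 1), (K.d (n + 1) n).hom w = x := by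
  constructor
  · intro hx
    have hex : (ShortComplex.mk (K.d (n + 1) n) (K.pOpcycles n) (K.d_pOpcycles _ _)).Exact :=
      ShortComplex.exact_of_g_is_cokernel _ (K.opcyclesIsCokernel (n + 1) n (by simp))
    rw [ShortComplex.moduleCat_exact_iff] at hex
    exact hex x hx
  · rintro ⟨w, rfl⟩
    have := congrArg (fun f => f.hom w) (K.d_pOpcycles (n + 1) n)
    exact this

theorem IsClass.homologyι_eq {n : ℕ} {x : K.X n} {h : K.homology n} (hx : IsClass K n x h) :
    (K.homologyι n).hom h = (K.pOpcycles n).hom x := by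
  obtain ⟨z, rfl, rfl⟩ := hx
  have := congrArg (fun f => f.hom z) (K.homology_π_ι n)
  exact this

theorem IsClass.unique {n : ℕ} {x : K.X n} {h h' : K.homology n} (hx : IsClass K n x h)
    (hx' : IsClass K n x h') : h = h' :=
  homologyι_injective n (by rw [hx.homologyι_eq, hx'.homologyι_eq])

theorem exists_isClass_rep (n : ℕ) (h : K.homology n) : ∃ x, IsClass K n x h := by
  obtain ⟨z, rfl⟩ := (ModuleCat.epi_iff_surjective (K.homologyπ n)).1 inferInstance h
  exact ⟨_, z, rfl, rfl⟩

theorem exists_isClass_of_d_eq_zero (n : ℕ) (x : K.X n)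
    (hx : (K.d n ((ComplexShape.down ℕ).next n)).hom x = 0) : ∃ h, IsClass K n x h := by
  have hex : (ShortComplex.mk (K.iCycles n) (K.d n _) (K.iCycles_d n _)).Exact :=
    ShortComplex.exact_of_f_is_kernel _ (K.cyclesIsKernel n _ rfl)
  rw [ShortComplex.moduleCat_exact_iff] at hex
  obtain ⟨z, hz⟩ := hex x hx
  exact ⟨_, z, hz, rfl⟩

theorem exists_isClass_zero (x : K.X 0) : ∃ h, IsClass K 0 x h := by
  apply exists_isClass_of_d_eq_zero
  rw [K.shape _ _ (by simp)]
  simp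

theorem exists_isClass_succ (n : ℕ) (x : K.X (n + 1)) (hx : (K.d (n + 1) n).hom x = 0) :
    ∃ h, IsClass K (n + 1) x h := by
  apply exists_isClass_of_d_eq_zero
  rw [ChainComplex.next_nat_succ]
  exact hx

theorem IsClass.d_eq_zero {n m : ℕ} {x : K.X n} {h : K.homology n} (hx : IsClass K n x h) :
    (K.d n m).hom x = 0 := by
  obtain ⟨z, rfl, -⟩ := hx
  have := congrArg (fun f => f.hom z) (K.iCycles_d n m)
  exact this

theorem IsClass.add {n : ℕ} {x y : K.X n} {h k : K.homology n} (hx : IsClass K n x h)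
    (hy : IsClass K n y k) : IsClass K n (x + y) (h + k) := by
  obtain ⟨z, rfl, rfl⟩ := hx
  obtain ⟨w, rfl, rfl⟩ := hy
  exact ⟨z + w, map_add _ _ _, map_add _ _ _⟩

theorem IsClass.smul {n : ℕ} {x : K.X n} {h : K.homology n} (r : R) (hx : IsClass K n x h) :
    IsClass K n (r • x) (r • h) := by
  obtain ⟨z, rfl, rfl⟩ := hx
  exact ⟨r • z, map_smul _ _ _, map_smul _ _ _⟩

theorem isClass_zero {n : ℕ} : IsClass K n 0 0 := ⟨0, map_zero _, map_zero _⟩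

theorem isClass_of_pOpcycles {n : ℕ} {x : K.X n} {h : K.homology n}
    (hx : (K.homologyι n).hom h = (K.pOpcycles n).hom x) : IsClass K n x h := by
  obtain ⟨y, hy⟩ := exists_isClass_rep n h
  have h1 : (K.pOpcycles n).hom (x - y) = 0 := by
    rw [map_sub, ← hx, hy.homologyι_eq, sub_self]
  obtain ⟨w, hw⟩ := (pOpcycles_eq_zero_iff n _).1 h1
  obtain ⟨k, hk⟩ := exists_isClass_of_d_eq_zero n (x - y) (by
    rw [← hw]; exact d_comp_d_apply _ _ _ _)
  have hk0 : k = 0 := homologyι_injective n (by rw [hk.homologyι_eq, h1, map_zero])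
  have := hy.add hk
  rwa [hk0, add_zero, add_sub_cancel] at this

theorem isClass_zero_iff {n : ℕ} {x : K.X n} :
    IsClass K n x 0 ↔ ∃ w : K.X (n + 1), (K.d (n + 1) n).hom w = x := by
  rw [← pOpcycles_eq_zero_iff]
  exact ⟨fun h => by rw [← h.homologyι_eq, map_zero],
    fun h => isClass_of_pOpcycles (by rw [h, map_zero])⟩

end Classes

section Relative

variable {Y : Type} [TopologicalSpace Y] {D X : Set Y} (hD : D ⊆ X)

variable (R) in
/-- The projection of the chains of `X` to the relative chains, in degree `n`. -/
def relπ (n : ℕ) : (chains R X).X n →ₗ[R] (relChains R hD).X n :=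
  ((cokernel.π (chainsIncl R hD)).f n).hom

theorem relπ_surjective (n : ℕ) : Function.Surjective (relπ R hD n) := by
  have : Epi ((cokernel.π (chainsIncl R hD)).f n) := inferInstance
  exact (ModuleCat.epi_iff_surjective _).1 this

theorem relπ_eq_zero_iff (n : ℕ) (x : (chains R X).X n) :
    relπ R hD n x = 0 ↔ ∃ y, ((chainsIncl R hD).f n).hom y = x := by
  constructor
  · intro hx
    have hex : (ShortComplex.mk (chainsIncl R hD) (cokernel.π (chainsIncl R hD))
        (cokernel.condition _)).Exact :=
      ShortComplex.exact_of_g_is_cokernel _ (cokernelIsCokernel _)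
    have hex' := hex.map (HomologicalComplex.eval (ModuleCat.{u} R) (ComplexShape.down ℕ) n)
    rw [ShortComplex.moduleCat_exact_iff] at hex'
    exact hex' x hx
  · rintro ⟨y, rfl⟩
    have := congrArg (fun f => (f.f n).hom y) (cokernel.condition (chainsIncl R hD))
    exact this

theorem d_relπ (i j : ℕ) (x : (chains R X).X i) :
    ((relChains R hD).d i j).hom (relπ R hD i x) = relπ R hD j (((chains R X).d i j).hom x) :=
  comm_apply (cokernel.π (chainsIncl R hD)) i j x

theorem relProj_relπ {D' : Set Y} (h' : D' ⊆ D) (n : ℕ) (x : (chains R X).X n) :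
    ((relProj R h' hD).f n).hom (relπ R (h'.trans hD) n x) = relπ R hD n x := by
  have : cokernel.π (chainsIncl R (h'.trans hD)) ≫ relProj R h' hD =
      𝟙 _ ≫ cokernel.π (chainsIncl R hD) := cokernel.π_desc _ _ _
  rw [Category.id_comp] at this
  exact congrArg (fun f => (f.f n).hom x) this

end Relative

/-! ### Cocycles on singular paths -/

section Cocycle

open Set Topology

variable {Y : Type} [TopologicalSpace Y] {X : Set Y} {Q : Type*} [AddCommGroup Q]

/-- A function on singular `1`-simplices which is additive over the edges of every singular
triangle, that is, a singular `1`-cocycle. -/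
def IsCocycle (κ : C(stdSimplex ℝ (Fin 2), X) → Q) : Prop :=
  ∀ τ : C(stdSimplex ℝ (Fin 3), X), κ (face 1 τ) = κ (face 2 τ) + κ (face 0 τ)

section Edge

variable {E F : Type*} [NormedAddCommGroup E] [NormedSpace ℝ E] [NormedAddCommGroup F]
  [NormedSpace ℝ F]

theorem stdSimplex_map_apply {m n : ℕ} (f : Fin m → Fin n) (s : stdSimplex ℝ (Fin m))
    (j : Fin n) : (stdSimplex.map f s).1 j = ∑ i, if f i = j then s.1 i else 0 := by
  have h := congrFun (stdSimplex.map_coe (S := ℝ) f s) j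
  rw [FunOnFinite.linearMap_apply_apply, Finset.sum_filter] at h
  exact h

theorem mem_segment_of_stdSimplex (a b : E) (s : stdSimplex ℝ (Fin 2)) :
    s.1 0 • a + s.1 1 • b ∈ _root_.segment ℝ a b :=
  ⟨s.1 0, s.1 1, s.2.1 0, s.2.1 1, by have := s.2.2; simpa [Fin.sum_univ_two] using this, rfl⟩

/-- The singular simplex `t ↦ G ((1 - t) a + t b)` in `X`. -/
def edgeSimplex (G : E → Y) (a b : E)
    (h : ContinuousOn G (_root_.segment ℝ a b) ∧ MapsTo G (_root_.segment ℝ a b) X) :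
    C(stdSimplex ℝ (Fin 2), X) where
  toFun s := ⟨G (s.1 0 • a + s.1 1 • b), h.2 (mem_segment_of_stdSimplex a b s)⟩
  continuous_toFun := by
    refine Continuous.subtype_mk (h.1.comp_continuous ?_ (mem_segment_of_stdSimplex a b)) _
    have h0 : Continuous fun s : stdSimplex ℝ (Fin 2) => s.1 0 :=
      (continuous_apply 0).comp continuous_subtype_val
    have h1 : Continuous fun s : stdSimplex ℝ (Fin 2) => s.1 1 :=
      (continuous_apply 1).comp continuous_subtype_val
    exact (h0.smul continuous_const).add (h1.smul continuous_const)

open Classical in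
/-- The value of `κ` on the image under `G` of the straight path from `a` to `b`
(zero if this image is not a path in `X`). -/
def edge (κ : C(stdSimplex ℝ (Fin 2), X) → Q) (G : E → Y) (a b : E) : Q :=
  if h : ContinuousOn G (_root_.segment ℝ a b) ∧ MapsTo G (_root_.segment ℝ a b) X then
    κ (edgeSimplex G a b h) else 0

variable {κ : C(stdSimplex ℝ (Fin 2), X) → Q}

theorem edge_eq {G : E → Y} {a b : E}
    (h : ContinuousOn G (_root_.segment ℝ a b) ∧ MapsTo G (_root_.segment ℝ a b) X) :
    edge κ G a b = κ (edgeSimplex G a b h) := dif_pos h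

theorem edge_congr {G : E → Y} {G' : F → Y} {a b : E} {a' b' : F}
    (h : ∀ s t : ℝ, 0 ≤ s → 0 ≤ t → s + t = 1 → G (s • a + t • b) = G' (s • a' + t • b'))
    (hc : ContinuousOn G (_root_.segment ℝ a b)) (hc' : ContinuousOn G' (_root_.segment ℝ a' b'))
    (hm : MapsTo G (_root_.segment ℝ a b) X) : edge κ G a b = edge κ G' a' b' := by
  have hm' : MapsTo G' (_root_.segment ℝ a' b') X := by
    rintro _ ⟨s, t, hs, ht, hst, rfl⟩
    rw [← h s t hs ht hst]
    exact hm ⟨s, t, hs, ht, hst, rfl⟩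
  rw [edge_eq ⟨hc, hm⟩, edge_eq ⟨hc', hm'⟩]
  congr 1
  ext s
  exact h _ _ (s.2.1 0) (s.2.1 1) (by have := s.2.2; simpa [Fin.sum_univ_two] using this)

theorem edge_congr_on {G G' : E → Y} {a b : E} (h : EqOn G G' (_root_.segment ℝ a b)) :
    edge κ G a b = edge κ G' a b := by
  unfold edge
  by_cases hG : ContinuousOn G (_root_.segment ℝ a b) ∧ MapsTo G (_root_.segment ℝ a b) X
  · have hG' : ContinuousOn G' (_root_.segment ℝ a b) ∧ MapsTo G' (_root_.segment ℝ a b) X :=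
      ⟨hG.1.congr h.symm, hG.2.congr h⟩
    rw [dif_pos hG, dif_pos hG']
    congr 1
    ext s
    exact h (mem_segment_of_stdSimplex a b s)
  · have hG' : ¬ (ContinuousOn G' (_root_.segment ℝ a b) ∧ MapsTo G' (_root_.segment ℝ a b) X) :=
      fun h' => hG ⟨h'.1.congr h, h'.2.congr h.symm⟩
    rw [dif_neg hG, dif_neg hG']

theorem edge_add (hκ : IsCocycle κ) {G : E → Y} {K : Set E} (hK : Convex ℝ K)
    (hG : ContinuousOn G K) (hX : MapsTo G K X) {a b c : E} (ha : a ∈ K) (hb : b ∈ K)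
    (hc : c ∈ K) : edge κ G a c = edge κ G a b + edge κ G b c := by
  have key : ∀ {x y : E}, x ∈ K → y ∈ K →
      ContinuousOn G (_root_.segment ℝ x y) ∧ MapsTo G (_root_.segment ℝ x y) X :=
    fun hx hy => ⟨hG.mono (hK.segment_subset hx hy), hX.mono (hK.segment_subset hx hy) le_rfl⟩
  have hmem : ∀ s : stdSimplex ℝ (Fin 3), s.1 0 • a + s.1 1 • b + s.1 2 • c ∈ K := by
    intro s
    have h1 : s.1 0 + s.1 1 + s.1 2 = 1 := by
      have := s.2.2; simpa [Fin.sum_univ_three] using this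
    have := hK.sum_mem (t := Finset.univ) (w := s.1) (z := ![a, b, c])
      (fun i _ => s.2.1 i) s.2.2 (by
        intro i _
        fin_cases i <;> simp [ha, hb, hc])
    simpa [Fin.sum_univ_three] using this
  let τ : C(stdSimplex ℝ (Fin 3), X) :=
    ⟨fun s => ⟨G (s.1 0 • a + s.1 1 • b + s.1 2 • c), hX (hmem s)⟩, by
      refine Continuous.subtype_mk (hG.comp_continuous ?_ hmem) _
      have h0 : ∀ i, Continuous fun s : stdSimplex ℝ (Fin 3) => s.1 i :=
        fun i => (continuous_apply i).comp continuous_subtype_val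
      exact (((h0 0).smul continuous_const).add ((h0 1).smul continuous_const)).add
        ((h0 2).smul continuous_const)⟩
  rw [edge_eq (key ha hc), edge_eq (key ha hb), edge_eq (key hb hc)]
  have e1 : face 1 τ = edgeSimplex G a c (key ha hc) := by
    ext s
    simp [face, τ, edgeSimplex, stdSimplex_map_apply, Fin.sum_univ_two, Fin.succAbove]
  have e2 : face 2 τ = edgeSimplex G a b (key ha hb) := by
    ext s
    simp [face, τ, edgeSimplex, stdSimplex_map_apply, Fin.sum_univ_two, Fin.succAbove]
  have e0 : face 0 τ = edgeSimplex G b c (key hb hc) := by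
    ext s
    simp [face, τ, edgeSimplex, stdSimplex_map_apply, Fin.sum_univ_two]
  rw [← e1, ← e2, ← e0]
  exact hκ τ

theorem edge_self (hκ : IsCocycle κ) (G : E → Y) (a : E) : edge κ G a a = 0 := by
  by_cases h : G a ∈ X
  · have := edge_add hκ (convex_singleton a) (continuousOn_singleton G a)
      (fun x hx => by rw [mem_singleton_iff.1 hx]; exact h) rfl rfl rfl
    simpa using this
  · unfold edge
    rw [dif_neg]
    intro h'
    exact h (h'.2 (left_mem_segment ℝ a a))

/-- Reparametrization by an affine map. -/
theorem edge_comp_affine {G : F → Y} (φ : E →ᵃ[ℝ] F) (hφ : Continuous φ) {a b : E}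
    (hG : ContinuousOn G (_root_.segment ℝ (φ a) (φ b)))
    (hX : MapsTo G (_root_.segment ℝ (φ a) (φ b)) X) :
    edge κ (fun x => G (φ x)) a b = edge κ G (φ a) (φ b) := by
  have hφm : ∀ s t : ℝ, 0 ≤ s → 0 ≤ t → s + t = 1 → φ (s • a + t • b) = s • φ a + t • φ b :=
    fun s t _ _ h => Convex.combo_affine_apply h
  refine edge_congr ?_ ?_ hG ?_
  · intro s t hs ht hst
    rw [hφm s t hs ht hst]
  · refine hG.comp hφ.continuousOn ?_
    rintro _ ⟨s, t, hs, ht, hst, rfl⟩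
    rw [hφm s t hs ht hst]
    exact ⟨s, t, hs, ht, hst, rfl⟩
  · rintro _ ⟨s, t, hs, ht, hst, rfl⟩
    change G (φ _) ∈ X
    rw [hφm s t hs ht hst]
    exact hX ⟨s, t, hs, ht, hst, rfl⟩

end Edge

theorem lineMap_mem_segment {E : Type*} [NormedAddCommGroup E] [NormedSpace ℝ E] (a b : E) {s : ℝ}
    (hs : s ∈ Icc (0 : ℝ) 1) : AffineMap.lineMap a b s ∈ _root_.segment ℝ a b := by
  rw [segment_eq_image_lineMap]
  exact mem_image_of_mem _ hs

section Paths

variable {κ : C(stdSimplex ℝ (Fin 2), X) → Q}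

/-- The value of `κ` on the path `γ|_{[0,1]}`. -/
def val (κ : C(stdSimplex ℝ (Fin 2), X) → Q) (γ : ℝ → Y) : Q := edge κ γ (0 : ℝ) 1

theorem segment_zero_one : _root_.segment ℝ (0 : ℝ) 1 = Icc 0 1 := segment_eq_Icc zero_le_one

theorem edge_eq_val {E : Type*} [NormedAddCommGroup E] [NormedSpace ℝ E] {G : E → Y} {a b : E}
    (hG : ContinuousOn G (_root_.segment ℝ a b)) (hX : MapsTo G (_root_.segment ℝ a b) X) :
    edge κ G a b = val κ (fun t => G (AffineMap.lineMap a b t)) := by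
  unfold val
  rw [edge_comp_affine (G := G) (AffineMap.lineMap a b) AffineMap.lineMap_continuous] <;>
    simp [hG, hX]

theorem val_congr {γ γ' : ℝ → Y} (h : EqOn γ γ' (Icc 0 1)) : val κ γ = val κ γ' :=
  edge_congr_on (by rwa [segment_zero_one])

theorem val_const (hκ : IsCocycle κ) (p : Y) : val κ (fun _ => p) = 0 := by
  by_cases hp : p ∈ X
  · have := edge_comp_affine (κ := κ) (G := fun _ : ℝ => p) (AffineMap.const ℝ ℝ (0 : ℝ))
      continuous_const (a := 0) (b := 1) continuousOn_const (fun _ _ => hp)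
    unfold val
    rw [this]
    exact edge_self hκ _ _
  · unfold val edge
    rw [dif_neg]
    intro h
    exact hp (h.2 (left_mem_segment ℝ 0 1))

/-- The four sides of a square. -/
theorem val_homotopy (hκ : IsCocycle κ) {H : ℝ → ℝ → Y}
    (hc : ContinuousOn (fun p : ℝ × ℝ => H p.1 p.2) (Icc 0 1 ×ˢ Icc 0 1))
    (hm : ∀ t ∈ Icc (0 : ℝ) 1, ∀ s ∈ Icc (0 : ℝ) 1, H t s ∈ X) :
    val κ (fun t => H t 0) + val κ (fun s => H 1 s) =
      val κ (fun s => H 0 s) + val κ (fun t => H t 1) := by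
  set K : Set (ℝ × ℝ) := Icc 0 1 ×ˢ Icc 0 1
  have hK : Convex ℝ K := (convex_Icc 0 1).prod (convex_Icc 0 1)
  have hX : MapsTo (fun p : ℝ × ℝ => H p.1 p.2) K X := fun p hp => hm _ hp.1 _ hp.2
  have m00 : ((0, 0) : ℝ × ℝ) ∈ K := by simp [K]
  have m01 : ((0, 1) : ℝ × ℝ) ∈ K := by simp [K]
  have m10 : ((1, 0) : ℝ × ℝ) ∈ K := by simp [K]
  have m11 : ((1, 1) : ℝ × ℝ) ∈ K := by simp [K]
  have key : ∀ {a b : ℝ × ℝ}, a ∈ K → b ∈ K →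
      edge κ (fun p : ℝ × ℝ => H p.1 p.2) a b =
        val κ (fun t => H (AffineMap.lineMap a b t : ℝ × ℝ).1 (AffineMap.lineMap a b t : ℝ × ℝ).2) :=
    fun ha hb => edge_eq_val (hc.mono (hK.segment_subset ha hb))
      (hX.mono (hK.segment_subset ha hb) le_rfl)
  have h1 := edge_add hκ hK hc hX m00 m10 m11
  have h2 := edge_add hκ hK hc hX m00 m01 m11
  rw [h1, key m00 m10, key m10 m11, key m00 m01, key m01 m11] at h2
  simpa [AffineMap.lineMap_apply] using h2

/-- The path `[0,1] → X` of a singular `1`-simplex, extended to `ℝ` by constants. -/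
def toPath (σ : C(stdSimplex ℝ (Fin 2), X)) : ℝ → Y := fun t =>
  σ (stdSimplexHomeomorphUnitInterval.symm (projIcc 0 1 zero_le_one t))

theorem continuous_toPath (σ : C(stdSimplex ℝ (Fin 2), X)) : Continuous (toPath σ) := by
  unfold toPath
  have := continuous_projIcc (h := zero_le_one (α := ℝ))
  fun_prop

theorem toPath_mem (σ : C(stdSimplex ℝ (Fin 2), X)) (t : ℝ) : toPath σ t ∈ X :=
  Subtype.coe_prop _

theorem toPath_apply (σ : C(stdSimplex ℝ (Fin 2), X)) (s : stdSimplex ℝ (Fin 2)) :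
    toPath σ (s.1 1) = σ s := by
  unfold toPath
  congr 2
  rw [Homeomorph.symm_apply_eq]
  apply Subtype.ext
  have h1 : s.1 1 ∈ Icc (0 : ℝ) 1 := mem_Icc_of_mem_stdSimplex s.2 1
  rw [projIcc_of_mem zero_le_one h1]
  rfl

theorem toPath_zero (σ : C(stdSimplex ℝ (Fin 2), X)) :
    toPath σ 0 = σ (stdSimplex.vertex 0) := by
  rw [← toPath_apply]
  simp

theorem toPath_one (σ : C(stdSimplex ℝ (Fin 2), X)) :
    toPath σ 1 = σ (stdSimplex.vertex 1) := by
  rw [← toPath_apply]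
  simp

theorem val_toPath (σ : C(stdSimplex ℝ (Fin 2), X)) : val κ (toPath σ) = κ σ := by
  unfold val
  rw [edge_eq ⟨(continuous_toPath σ).continuousOn, fun t _ => toPath_mem σ t⟩]
  congr 1
  ext s
  refine Eq.trans ?_ (toPath_apply σ s)
  simp only [edgeSimplex, ContinuousMap.coe_mk, smul_eq_mul, mul_zero, zero_add,
    mul_one]

theorem exists_simplex_of_joinedIn {S : Set Y} {p q : Y} (h : JoinedIn S p q) :
    ∃ σ : C(stdSimplex ℝ (Fin 2), S), (σ (stdSimplex.vertex 0) : Y) = p ∧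
      (σ (stdSimplex.vertex 1) : Y) = q := by
  refine ⟨edgeSimplex (fun t : ℝ => h.somePath.extend t) 0 1
    ⟨h.somePath.continuous_extend.continuousOn, fun t _ => ?_⟩, ?_, ?_⟩
  · exact h.somePath_mem _
  · simp [edgeSimplex]
  · simp [edgeSimplex]

theorem joinedIn_of_simplex {S : Set Y} (σ : C(stdSimplex ℝ (Fin 2), S)) :
    JoinedIn S (σ (stdSimplex.vertex 0)) (σ (stdSimplex.vertex 1)) := by
  refine ⟨⟨⟨fun t => toPath σ t, (continuous_toPath σ).comp continuous_subtype_val⟩, ?_, ?_⟩,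
    fun t => toPath_mem σ t⟩
  · simp [toPath_zero]
  · simp [toPath_one]

/-- If a `1`-cocycle is, modulo a subgroup `N`, locally on `S` the coboundary of a function `u`,
then it is so on all paths in `S`. -/
theorem val_mem_of_local (hκ : IsCocycle κ) {S : Set Y} (hS : S ⊆ X) (u : Y → Q)
    (N : AddSubgroup Q)
    (hloc : ∀ p ∈ S, ∃ U : Set Y, IsOpen U ∧ p ∈ U ∧ ∀ γ : ℝ → Y, ContinuousOn γ (Icc 0 1) →
      MapsTo γ (Icc 0 1) (S ∩ U) → val κ γ - (u (γ 1) - u (γ 0)) ∈ N)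
    {γ : ℝ → Y} (hγ : ContinuousOn γ (Icc 0 1)) (hm : MapsTo γ (Icc 0 1) S) :
    val κ γ - (u (γ 1) - u (γ 0)) ∈ N := by
  choose U hUo hUp hU using hloc
  have hm01 : ∀ x : unitInterval, γ x ∈ S := fun x => hm x.2
  have hcont : Continuous fun x : unitInterval => γ x := hγ.comp_continuous continuous_subtype_val
    (fun x => x.2)
  obtain ⟨t, ht0, htm, ⟨n, hn⟩, htU⟩ := exists_monotone_Icc_subset_open_cover_unitInterval
    (c := fun x : unitInterval => {y | γ y ∈ U (γ x) (hm01 x)})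
    (fun x => (hUo _ _).preimage hcont)
    (fun x _ => mem_iUnion.2 ⟨x, hUp _ _⟩)
  have hseg : ∀ {a b : ℝ}, a ∈ Icc (0 : ℝ) 1 → b ∈ Icc (0 : ℝ) 1 →
      _root_.segment ℝ a b ⊆ Icc 0 1 := fun ha hb => (convex_Icc 0 1).segment_subset ha hb
  have hstep : ∀ k, edge κ γ (0 : ℝ) (t k) - (u (γ (t k)) - u (γ 0)) ∈ N := by
    intro k
    induction k with
    | zero => rw [ht0]; simp [edge_self hκ]
    | succ k ih =>
      have hadd := edge_add hκ (convex_Icc (0 : ℝ) 1) hγ (hm.mono le_rfl hS)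
        (show (0 : ℝ) ∈ Icc (0 : ℝ) 1 by simp) (t k).2 (t (k + 1)).2
      obtain ⟨i, hi⟩ := htU k
      have hle : (t k : ℝ) ≤ t (k + 1) := htm k.le_succ
      have hmaps : MapsTo (fun s : ℝ => γ (AffineMap.lineMap (t k : ℝ) (t (k + 1) : ℝ) s))
          (Icc 0 1) (S ∩ U (γ i) (hm01 i)) := by
        intro s hs
        have h1 : AffineMap.lineMap (t k : ℝ) (t (k + 1) : ℝ) s ∈ Icc (t k : ℝ) (t (k + 1)) := by
          rw [← segment_eq_Icc hle]
          exact lineMap_mem_segment _ _ hs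
        have h2 : AffineMap.lineMap (t k : ℝ) (t (k + 1) : ℝ) s ∈ Icc (0 : ℝ) 1 :=
          ⟨(t k).2.1.trans h1.1, h1.2.trans (t (k + 1)).2.2⟩
        exact ⟨hm h2, @hi ⟨_, h2⟩ h1⟩
      have := hU (γ i) (hm01 i) (fun s : ℝ => γ (AffineMap.lineMap (t k : ℝ) (t (k + 1) : ℝ) s))
        (hγ.comp AffineMap.lineMap_continuous.continuousOn (by
          intro s hs
          exact hseg (t k).2 (t (k + 1)).2 (lineMap_mem_segment _ _ hs))) hmaps
      rw [← edge_eq_val (hγ.mono (hseg (t k).2 (t (k + 1)).2))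
        ((hm.mono le_rfl hS).mono (hseg (t k).2 (t (k + 1)).2) le_rfl)] at this
      simp only [AffineMap.lineMap_apply_zero, AffineMap.lineMap_apply_one] at this
      rw [hadd]
      have h3 := N.add_mem ih this
      convert h3 using 1
      abel
  have := hstep n
  rw [hn n le_rfl] at this
  simpa [val] using this

/-- The value of a cocycle on the paths in `X` near points of `S` determines it. -/
theorem val_eq_of_local (hκ : IsCocycle κ) {S : Set Y} (hS : S ⊆ X) (u : Y → Q)
    (hloc : ∀ p ∈ S, ∃ U : Set Y, IsOpen U ∧ p ∈ U ∧ ∀ γ : ℝ → Y, ContinuousOn γ (Icc 0 1) →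
      MapsTo γ (Icc 0 1) (S ∩ U) → val κ γ = u (γ 1) - u (γ 0))
    {γ : ℝ → Y} (hγ : ContinuousOn γ (Icc 0 1)) (hm : MapsTo γ (Icc 0 1) S) :
    val κ γ = u (γ 1) - u (γ 0) := by
  have := val_mem_of_local hκ hS u ⊥ (fun p hp => by
    obtain ⟨U, h1, h2, h3⟩ := hloc p hp
    exact ⟨U, h1, h2, fun γ h4 h5 => by rw [h3 γ h4 h5]; simp⟩) hγ hm
  rw [AddSubgroup.mem_bot, sub_eq_zero] at this
  exact this

end Paths

end Cocycle

/-! ### Classes of paths in relative homology -/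

section RelClass

open Set

variable {R : Type u} [CommRing R] {Y : Type} [TopologicalSpace Y] {D X : Set Y} (hD : D ⊆ X)

variable (R) in
/-- The relative `1`-chains modulo boundaries. It contains `H₁(X, D)` as the kernel of the
boundary map, and every path in `X` has a class in it. -/
abbrev RelOp : Type u := (relChains R hD).opcycles 1

variable (R) in
/-- The class of a relative `1`-chain modulo boundaries. -/
def opClass : (chains R X).X 1 →ₗ[R] RelOp R hD :=
  ((relChains R hD).pOpcycles 1).hom.comp (relπ R hD 1)

variable (R) in
/-- The class of a singular path in `X` modulo boundaries and paths in `D`. -/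
def relClass (σ : C(stdSimplex ℝ (Fin 2), X)) : RelOp R hD := opClass R hD (simplexN R (n := 1) σ)

theorem isCocycle_relClass : IsCocycle (relClass R hD) := by
  intro τ
  have h1 : ((relChains R hD).pOpcycles 1).hom
      (((relChains R hD).d 2 1).hom (relπ R hD 2 (simplexN R (n := 2) τ))) = 0 :=
    (pOpcycles_eq_zero_iff 1 _).2 ⟨_, rfl⟩
  rw [d_relπ, d_simplexN_two, map_add, map_sub, map_add, map_sub] at h1
  change relClass R hD _ - relClass R hD _ + relClass R hD _ = 0 at h1
  rw [← sub_eq_zero, ← neg_eq_zero, ← h1]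
  abel

theorem relClass_eq_zero (σ : C(stdSimplex ℝ (Fin 2), X)) (h : ∀ s, (σ s : Y) ∈ D) :
    relClass R hD σ = 0 := by
  let σ' : C(stdSimplex ℝ (Fin 2), D) := ⟨fun s => ⟨σ s, h s⟩, by
    exact Continuous.subtype_mk (continuous_subtype_val.comp σ.continuous) _⟩
  have : relπ R hD 1 (simplexN R (n := 1) σ) = 0 := by
    rw [relπ_eq_zero_iff]
    exact ⟨simplexN R (n := 1) σ', by rw [chainsIncl_simplexN]; rfl⟩
  rw [relClass, opClass, LinearMap.comp_apply, this, map_zero]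

theorem val_relClass_eq_zero {γ : ℝ → Y} (hγ : ContinuousOn γ (Icc 0 1))
    (hm : MapsTo γ (Icc 0 1) D) : val (relClass R hD) γ = 0 := by
  unfold val
  rw [edge_eq ⟨by rwa [segment_zero_one], by rw [segment_zero_one]; exact hm.mono le_rfl hD⟩]
  apply relClass_eq_zero
  intro s
  exact hm (by rw [← segment_zero_one]; exact mem_segment_of_stdSimplex _ _ s)

variable (R) in
/-- The boundary of a class of relative `1`-chains. -/
def opBdry : RelOp R hD →ₗ[R] (relChains R hD).X 0 :=
  ((relChains R hD).fromOpcycles 1 0).hom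

theorem opBdry_opClass (x : (chains R X).X 1) :
    opBdry R hD (opClass R hD x) = relπ R hD 0 (((chains R X).d 1 0).hom x) := by
  rw [← d_relπ]
  exact congrArg (fun f => f.hom (relπ R hD 1 x)) ((relChains R hD).p_fromOpcycles 1 0)

theorem exists_isClass_of_opBdry (x : (chains R X).X 1) (hx : opBdry R hD (opClass R hD x) = 0) :
    ∃ h, IsClass (relChains R hD) 1 (relπ R hD 1 x) h ∧
      ((relChains R hD).homologyι 1).hom h = opClass R hD x := by
  obtain ⟨h, hh⟩ := exists_isClass_succ 0 (relπ R hD 1 x) (by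
    rw [d_relπ, ← opBdry_opClass, hx])
  exact ⟨h, hh, hh.homologyι_eq⟩

variable (R) in
/-- The class of a point in the relative `0`-chains. -/
def relPoint (p : X) : (relChains R hD).X 0 := relπ R hD 0 (pointChain R p)

theorem relPoint_eq_zero (p : X) (hp : (p : Y) ∈ D) : relPoint R hD p = 0 := by
  rw [relPoint, relπ_eq_zero_iff]
  exact ⟨pointChain R ⟨p, hp⟩, chainsIncl_pointChain _ _⟩

theorem opBdry_relClass (σ : C(stdSimplex ℝ (Fin 2), X)) :
    opBdry R hD (relClass R hD σ) =
      relPoint R hD (σ (stdSimplex.vertex 1)) - relPoint R hD (σ (stdSimplex.vertex 0)) := by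
  rw [relClass, opBdry_opClass, d_simplexN_one, map_sub]
  rfl

/-- A class in `H₁(X, D)` lies in the span of the elements `κ(σ) - w(σ(1)) + w(σ(0))`, over all
paths `σ`, and of the elements `w(d)`, `d ∈ D`, for any function `w`. -/
theorem homologyι_mem_of_potential (N : Submodule R (RelOp R hD)) (w : X → RelOp R hD)
    (hσ : ∀ σ, relClass R hD σ - w (σ (stdSimplex.vertex 1)) + w (σ (stdSimplex.vertex 0)) ∈ N)
    (hw : ∀ p : X, (p : Y) ∈ D → w p ∈ N) (h : (relChains R hD).homology 1) :
    ((relChains R hD).homologyι 1).hom h ∈ N := by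
  obtain ⟨x', hx'⟩ := exists_isClass_rep 1 h
  obtain ⟨x, rfl⟩ := relπ_surjective hD 1 x'
  rw [hx'.homologyι_eq]
  change opClass R hD x ∈ N
  let W : (chains R X).X 0 →ₗ[R] RelOp R hD :=
    chainLift (n := 0) fun σ => w (σ (stdSimplex.vertex 0))
  have hWp : ∀ p, W (pointChain R p) = w p := fun p => chainLift_simplexN _ _
  have h1 : ∀ y, (opClass R hD - W.comp ((chains R X).d 1 0).hom) y ∈ N := by
    refine chain_induction (n := 1) ?_ ?_ ?_ ?_
    · rw [map_zero]; exact N.zero_mem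
    · intro y z hy hz
      rw [map_add]
      exact N.add_mem hy hz
    · intro r y hy
      rw [map_smul]
      exact N.smul_mem r hy
    · intro σ
      have := hσ σ
      rw [LinearMap.sub_apply, LinearMap.comp_apply, d_simplexN_one, map_sub, hWp, hWp]
      convert this using 1
      change relClass R hD σ - _ = _
      abel
  have h2 : relπ R hD 0 (((chains R X).d 1 0).hom x) = 0 := by
    rw [← d_relπ]
    exact hx'.d_eq_zero
  obtain ⟨y, hy⟩ := (relπ_eq_zero_iff hD 0 _).1 h2
  have h3 : ∀ y, W (((chainsIncl R hD).f 0).hom y) ∈ N := by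
    refine chain_induction (n := 0) ?_ ?_ ?_ ?_
    · rw [map_zero, map_zero]; exact N.zero_mem
    · intro y z hy hz
      rw [map_add, map_add]
      exact N.add_mem hy hz
    · intro r y hy
      rw [map_smul, map_smul]
      exact N.smul_mem r hy
    · intro σ
      rw [simplexN_zero, chainsIncl_pointChain, hWp]
      exact hw _ (Subtype.coe_prop _)
  have h4 := N.add_mem (h1 x) (h3 y)
  rw [hy] at h4
  simpa using h4

/-- If modulo a finitely generated subgroup the classes of all paths in `X` are differences of a
function of the endpoints, and `D` has finitely many path components, then `H₁(X, D)` is finitely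
generated. Over `ℤ` a subgroup of a finitely generated group is finitely generated; this replaces
the missing Noetherian property of the coefficient ring. -/
theorem finite_homology_of_potential {ι : Type*} [Finite ι] (P : ι → Set Y)
    (hP : D ⊆ ⋃ i, P i) (hPD : ∀ i, ∀ p ∈ P i, ∀ q ∈ P i, JoinedIn D p q)
    (E : Set (RelOp R hD)) (hE : E.Finite) (u : Y → RelOp R hD)
    (hu : ∀ σ, relClass R hD σ -
      (u (σ (stdSimplex.vertex 1)) - u (σ (stdSimplex.vertex 0))) ∈ AddSubgroup.closure E) :
    Module.Finite R ((relChains R hD).homology 1) := by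
  classical
  -- a base point in every path component of `X`, taken in `D` if possible
  have hrep : ∀ c : ZerothHomotopy X, ∃ x : X, (Quotient.mk _ x : ZerothHomotopy X) = c ∧
      ((∃ d : X, (d : Y) ∈ D ∧ (Quotient.mk _ d : ZerothHomotopy X) = c) → (x : Y) ∈ D) := by
    intro c
    by_cases h : ∃ d : X, (d : Y) ∈ D ∧ (Quotient.mk _ d : ZerothHomotopy X) = c
    · obtain ⟨d, hd, hc⟩ := h
      exact ⟨d, hc, fun _ => hd⟩
    · obtain ⟨x, hx⟩ := Quotient.exists_rep c
      exact ⟨x, hx, fun h' => absurd h' h⟩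
  choose rep hrep1 hrep2 using hrep
  let β : X → X := fun p => rep (Quotient.mk _ p)
  have hβ : ∀ p : X, ∃ σ : C(stdSimplex ℝ (Fin 2), X), σ (stdSimplex.vertex 0) = β p ∧
      σ (stdSimplex.vertex 1) = p := by
    intro p
    have h1 : Joined (β p) p := Quotient.exact (hrep1 (Quotient.mk _ p))
    have h2 : JoinedIn X (β p : Y) p := joinedIn_iff_joined (β p).2 p.2 |>.2 h1
    obtain ⟨σ, h3, h4⟩ := exists_simplex_of_joinedIn h2
    exact ⟨σ, Subtype.ext h3, Subtype.ext h4⟩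
  choose path hpath0 hpath1 using hβ
  let w : X → RelOp R hD := fun p => relClass R hD (path p)
  have hwb : ∀ p, opBdry R hD (w p) = relPoint R hD p - relPoint R hD (β p) := by
    intro p
    rw [opBdry_relClass, hpath0, hpath1]
  have hβσ : ∀ σ : C(stdSimplex ℝ (Fin 2), X),
      β (σ (stdSimplex.vertex 1)) = β (σ (stdSimplex.vertex 0)) := by
    intro σ
    have h1 := joinedIn_of_simplex σ
    have h2 : Joined (σ (stdSimplex.vertex 0)) (σ (stdSimplex.vertex 1)) :=
      (joinedIn_iff_joined _ _).1 h1
    exact congrArg rep (Quotient.sound h2.symm)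
  have hβD : ∀ p : X, (p : Y) ∈ D → (β p : Y) ∈ D := fun p hp => hrep2 _ ⟨p, hp, rfl⟩
  let cyc : C(stdSimplex ℝ (Fin 2), X) → RelOp R hD := fun σ =>
    relClass R hD σ - w (σ (stdSimplex.vertex 1)) + w (σ (stdSimplex.vertex 0))
  let Z : AddSubgroup (RelOp R hD) := (LinearMap.ker (opBdry R hD)).toAddSubgroup
  let N : AddSubgroup (RelOp R hD) := AddSubgroup.closure E
  have hcyc : ∀ σ, cyc σ ∈ N ⊓ Z := by
    intro σ
    refine ⟨?_, ?_⟩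
    · have h1 := hu σ
      have h2 := hu (path (σ (stdSimplex.vertex 1)))
      have h3 := hu (path (σ (stdSimplex.vertex 0)))
      rw [hpath0, hpath1] at h2 h3
      rw [hβσ] at h2
      have h4 := N.add_mem (N.sub_mem h1 h2) h3
      change cyc σ ∈ N
      convert h4 using 1
      simp only [cyc, w]
      abel
    · change opBdry R hD (cyc σ) = 0
      simp only [cyc, map_add, map_sub, hwb, opBdry_relClass, hβσ]
      abel
  obtain ⟨G, hG⟩ : ∃ G : Set (RelOp R hD), G.Finite ∧ AddSubgroup.closure G = N ⊓ Z := by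
    have hfg : (AddSubgroup.toIntSubmodule N).FG := by
      rw [Submodule.fg_iff_addSubgroup_fg]
      exact (AddSubgroup.fg_iff _).2 ⟨E, rfl, hE⟩
    have hNo : IsNoetherian ℤ (AddSubgroup.toIntSubmodule N) :=
      isNoetherian_of_fg_of_noetherian _ hfg
    have h2 : (AddSubgroup.toIntSubmodule (N ⊓ Z)).FG := by
      have := (isNoetherian_submodule.1 hNo) (AddSubgroup.toIntSubmodule (N ⊓ Z))
        (fun x hx => hx.1)
      exact this
    obtain ⟨G, h3, h4⟩ := (Submodule.fg_def.1 h2)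
    refine ⟨G, h3, ?_⟩
    rw [← Submodule.span_int_eq_addSubgroupClosure, h4]
    rfl
  choose i hi using fun p : D => mem_iUnion.1 (hP p.2)
  -- one point in every nonempty piece of `D`
  let T : Set (RelOp R hD) := ⋃ j : ι, {v | ∃ hne : ∃ p : D, i p = j,
    v = w ⟨hne.choose, hD hne.choose.2⟩}
  have hT : T.Finite := by
    refine finite_iUnion fun j => Set.Subsingleton.finite ?_
    rintro v ⟨h1, rfl⟩ v' ⟨h2, rfl⟩
    rfl
  let M : Submodule R (RelOp R hD) := Submodule.span R (G ∪ T)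
  have hM : ∀ v ∈ N ⊓ Z, v ∈ M := by
    intro v hv
    rw [← hG.2] at hv
    have : AddSubgroup.closure G ≤ M.toAddSubgroup :=
      (AddSubgroup.closure_le _).2 fun x hx => Submodule.subset_span (Or.inl hx)
    exact this hv
  have hwM : ∀ p : X, (p : Y) ∈ D → w p ∈ M := by
    intro p hp
    have hne : ∃ q : D, i q = i ⟨p, hp⟩ := ⟨_, rfl⟩
    set q := hne.choose with hq
    have hqs : i q = i ⟨p, hp⟩ := hne.choose_spec
    have hqM : w ⟨q, hD q.2⟩ ∈ M :=
      Submodule.subset_span (Or.inr (mem_iUnion.2 ⟨i ⟨p, hp⟩, hne, rfl⟩))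
    have hj : JoinedIn D (p : Y) q := hPD (i ⟨p, hp⟩) _ (hi ⟨p, hp⟩) _ (by
      rw [← hqs]; exact hi q)
    obtain ⟨σ, h0, h1⟩ := exists_simplex_of_joinedIn hj
    let σ' : C(stdSimplex ℝ (Fin 2), X) :=
      (⟨Set.inclusion hD, continuous_inclusion hD⟩ : C(D, X)).comp σ
    have h2 := hM _ (hcyc σ')
    have h3 : relClass R hD σ' = 0 := relClass_eq_zero hD _ fun s => (σ s).2
    have h4 : σ' (stdSimplex.vertex 0) = p := Subtype.ext h0
    have h5 : σ' (stdSimplex.vertex 1) = ⟨q, hD q.2⟩ := Subtype.ext h1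
    simp only [cyc, h3, h4, h5] at h2
    have := M.add_mem h2 hqM
    convert this using 1
    abel
  have hιM : LinearMap.range ((relChains R hD).homologyι 1).hom = M := by
    apply le_antisymm
    · rintro _ ⟨h, rfl⟩
      exact homologyι_mem_of_potential hD M w (fun σ => hM _ (hcyc σ)) hwM h
    · have hZ : ∀ v, opBdry R hD v = 0 → v ∈ LinearMap.range ((relChains R hD).homologyι 1).hom := by
        intro v hv
        obtain ⟨x', rfl⟩ := pOpcycles_surjective 1 v
        obtain ⟨x, rfl⟩ := relπ_surjective hD 1 x'
        obtain ⟨h, -, hh⟩ := exists_isClass_of_opBdry hD x hv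
        exact ⟨h, hh⟩
      apply Submodule.span_le.2
      rintro v (hv | hv)
      · have : v ∈ N ⊓ Z := by rw [← hG.2]; exact AddSubgroup.subset_closure hv
        exact hZ v this.2
      · obtain ⟨j, hne, rfl⟩ := mem_iUnion.1 hv
        apply hZ
        rw [hwb, relPoint_eq_zero hD _ (hne.choose.2), relPoint_eq_zero hD _ (hβD _ hne.choose.2),
          sub_zero]
  have hfin : Module.Finite R (LinearMap.range ((relChains R hD).homologyι 1).hom) := by
    rw [hιM, Module.Finite.iff_fg]
    exact Submodule.fg_span (hG.1.union hT)
  exact Module.Finite.equiv (LinearEquiv.ofInjective _ (homologyι_injective 1)).symm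

end RelClass

/-! ### Coordinates on the surface -/

section Coordinates

open Set Topology

theorem mem_cutPlus {z : ℂ} : z ∈ cutPlus ↔ (∀ k : ℤ, z.re ≠ k) ∨ 0 < z.im := by
  unfold cutPlus
  simp only [mem_ofPred_eq, not_exists, not_and, not_le]
  refine ⟨fun h => ?_, ?_⟩
  · by_cases h' : ∀ k : ℤ, z.re ≠ k
    · exact Or.inl h'
    · push Not at h'
      obtain ⟨k, hk⟩ := h'
      exact Or.inr (h k hk)
  · rintro (h | h) k hk
    · exact absurd hk (h k)
    · exact h

theorem mem_cutMinus {z : ℂ} : z ∈ cutMinus ↔ (∀ k : ℤ, z.re ≠ k) ∨ z.im < 0 := by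
  unfold cutMinus
  simp only [mem_ofPred_eq, not_exists, not_and, not_le]
  refine ⟨fun h => ?_, ?_⟩
  · by_cases h' : ∀ k : ℤ, z.re ≠ k
    · exact Or.inl h'
    · push Not at h'
      obtain ⟨k, hk⟩ := h'
      exact Or.inr (h k hk)
  · rintro (h | h) k hk
    · exact absurd hk (h k)
    · exact h

theorem ne_int_add {x : ℝ} (j : ℤ) : (∀ k : ℤ, x + j ≠ k) ↔ ∀ k : ℤ, x ≠ k := by
  constructor
  · intro h k hk
    exact h (k + j) (by push_cast; rw [hk])
  · intro h k hk
    exact h (k - j) (by push_cast; linarith)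

theorem add_int_mem_cutPlus {z : ℂ} (j : ℤ) : z + j ∈ cutPlus ↔ z ∈ cutPlus := by
  rw [mem_cutPlus, mem_cutPlus]
  simp only [Complex.add_re, Complex.intCast_re, Complex.add_im, Complex.intCast_im, add_zero,
    ne_int_add]

theorem add_int_mem_cutMinus {z : ℂ} (j : ℤ) : z + j ∈ cutMinus ↔ z ∈ cutMinus := by
  rw [mem_cutMinus, mem_cutMinus]
  simp only [Complex.add_re, Complex.intCast_re, Complex.add_im, Complex.intCast_im, add_zero,
    ne_int_add]

theorem ne_int_of_mem {k : ℤ} {x : ℝ} (h : (k : ℝ) < x) (h' : x < k + 1) : ∀ i : ℤ, x ≠ i := by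
  rintro i rfl
  have h1 : k < i := by exact_mod_cast h
  have h2 : i < k + 1 := by exact_mod_cast h'
  omega

theorem floor_add_int_re (z : ℂ) (j : ℤ) : ⌊(z + j).re⌋ = ⌊z.re⌋ + j := by simp

theorem ne_int_of_cutPlus_cutMinus {z : ℂ} (h : z ∈ cutPlus) (h' : z ∈ cutMinus) :
    ∀ k : ℤ, z.re ≠ k := by
  rw [mem_cutPlus] at h
  rw [mem_cutMinus] at h'
  rcases h with h | h
  · exact h
  · rcases h' with h' | h'
    · exact h'
    · linarith

theorem I_mem_cutPlus : Complex.I ∈ cutPlus := by rw [mem_cutPlus]; right; simp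

theorem negI_mem_cutMinus : -Complex.I ∈ cutMinus := by rw [mem_cutMinus]; right; simp

variable (A B : ℕ)

open Classical in
/-- The point with coordinates `(z₊, m₊) = (z, m)` (a fixed point if `z` is on the cuts). -/
def plusPt (m : ℤ) (z : ℂ) : Surface A B :=
  if h : z ∈ cutPlus then ptPlus A B m ⟨z, h⟩ else ptPlus A B m ⟨Complex.I, I_mem_cutPlus⟩

open Classical in
/-- The point with coordinates `(z₋, m₋) = (z, n)` (a fixed point if `z` is on the cuts). -/
def minusPt (n : ℤ) (z : ℂ) : Surface A B :=
  if h : z ∈ cutMinus then ptMinus A B n ⟨z, h⟩ else ptMinus A B n ⟨-Complex.I, negI_mem_cutMinus⟩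

variable {A B}

theorem plusPt_of_mem (m : ℤ) {z : ℂ} (h : z ∈ cutPlus) : plusPt A B m z = ptPlus A B m ⟨z, h⟩ :=
  dif_pos h

theorem minusPt_of_mem (n : ℤ) {z : ℂ} (h : z ∈ cutMinus) :
    minusPt A B n z = ptMinus A B n ⟨z, h⟩ := dif_pos h

theorem ptPlus_eq (m : ℤ) (z : cutPlus) : ptPlus A B m z = plusPt A B m z :=
  (plusPt_of_mem m z.2).symm

theorem ptMinus_eq (m : ℤ) (z : cutMinus) : ptMinus A B m z = minusPt A B m z :=
  (minusPt_of_mem m z.2).symm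

theorem plusPt_eq_minusPt_floor (m : ℤ) {z : ℂ} (h : ∀ k : ℤ, z.re ≠ k) :
    plusPt A B m z = minusPt A B (m + B * ⌊z.re⌋) z := by
  rw [plusPt_of_mem m (mem_cutPlus.2 (Or.inl h)), minusPt_of_mem _ (mem_cutMinus.2 (Or.inl h))]
  exact Quot.sound (Glue.coord z _ _ m)

theorem plusPt_shift (m j : ℤ) {z : ℂ} (h : z ∈ cutPlus) :
    plusPt A B (m - A * j) (z + j) = plusPt A B m z := by
  have one : ∀ (m : ℤ) {w : ℂ}, w ∈ cutPlus → plusPt A B (m - A) (w + 1) = plusPt A B m w := by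
    intro m w hw
    have hw' : w + 1 ∈ cutPlus := by
      have := (add_int_mem_cutPlus (z := w) 1).2 hw
      simpa using this
    rw [plusPt_of_mem _ hw, plusPt_of_mem _ hw']
    have := Quot.sound (Glue.shiftPlus (A := A) (B := B) w hw hw' (m - A))
    rw [sub_add_cancel] at this
    exact this.symm
  induction j with
  | zero => simp
  | succ i ih =>
    rw [← ih, ← one (m - A * i) (w := z + ((i : ℤ) : ℂ)) ((add_int_mem_cutPlus _).2 h)]
    push_cast
    congr 1 <;> ring
  | pred i ih =>
    rw [← ih]
    have := one (m - A * (-i - 1)) (w := z + ((-i - 1 : ℤ) : ℂ)) ((add_int_mem_cutPlus _).2 h)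
    rw [← this]
    push_cast
    congr 1 <;> ring

theorem minusPt_shift (n j : ℤ) {z : ℂ} (h : z ∈ cutMinus) :
    minusPt A B (n + (B - A) * j) (z + j) = minusPt A B n z := by
  have one : ∀ (n : ℤ) {w : ℂ}, w ∈ cutMinus →
      minusPt A B (n + (B - A)) (w + 1) = minusPt A B n w := by
    intro m w hw
    have hw' : w + 1 ∈ cutMinus := by
      have := (add_int_mem_cutMinus (z := w) 1).2 hw
      simpa using this
    rw [minusPt_of_mem _ hw, minusPt_of_mem _ hw']
    have := Quot.sound (Glue.shiftMinus (A := A) (B := B) w hw hw' (m - A))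
    rw [sub_add_cancel, sub_add_eq_add_sub, add_sub_assoc] at this
    exact this.symm
  induction j with
  | zero => simp
  | succ i ih =>
    rw [← ih, ← one (n + (B - A) * i) (w := z + ((i : ℤ) : ℂ)) ((add_int_mem_cutMinus _).2 h)]
    push_cast
    congr 1 <;> ring
  | pred i ih =>
    rw [← ih]
    have := one (n + (B - A) * (-i - 1)) (w := z + ((-i - 1 : ℤ) : ℂ))
      ((add_int_mem_cutMinus _).2 h)
    rw [← this]
    push_cast
    congr 1 <;> ring

/-- As a set, `Σ` is the quotient of `(ℂ ∖ ℤ) × ℤ` by the action `j · (z, n) = (z + j, n + (B - A) j)`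
of `ℤ`, where `n` is the label `m₋`, extended to the upper cuts by `m₋ = m₊ + B ⌊Re z⌋`. -/
def orbitRel (A B : ℕ) : Setoid (ℂ × ℤ) where
  r x y := ∃ j : ℤ, y.1 = x.1 + j ∧ y.2 = x.2 + ((B : ℤ) - A) * j
  iseqv := by
    refine ⟨fun x => ⟨0, by simp⟩, ?_, ?_⟩
    · rintro x y ⟨j, h1, h2⟩
      exact ⟨-j, by rw [h1]; push_cast; ring, by rw [h2]; ring⟩
    · rintro x y z ⟨j, h1, h2⟩ ⟨i, h3, h4⟩
      exact ⟨j + i, by rw [h3, h1]; push_cast; ring, by rw [h4, h2]; ring⟩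

/-- The point `(z, n)` of the quotient `orbitRel`, see there. -/
def orbitCode (A B : ℕ) : Surface A B → Quotient (orbitRel A B) :=
  Quot.lift (fun a => Quotient.mk (orbitRel A B)
    (Sum.elim (fun x : cutPlus × ℤ => ((x.1 : ℂ), x.2 + B * ⌊(x.1 : ℂ).re⌋))
      (fun x : cutMinus × ℤ => ((x.1 : ℂ), x.2)) a)) (by
    intro a b h
    apply Quotient.sound
    cases h with
    | coord z hp hm m => exact ⟨0, by simp, by simp⟩
    | shiftPlus z h h' m =>
      refine ⟨1, by simp, ?_⟩
      simp only [Sum.elim_inl, Complex.add_re, Complex.one_re, Int.floor_add_one]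
      ring
    | shiftMinus z h h' m =>
      refine ⟨1, by simp, ?_⟩
      simp only [Sum.elim_inr]
      ring)

theorem plusPt_eq_plusPt {m m' : ℤ} {z z' : ℂ} (h : z ∈ cutPlus) (h' : z' ∈ cutPlus) :
    plusPt A B m z = plusPt A B m' z' ↔ ∃ j : ℤ, z' = z + j ∧ m' = m - A * j := by
  constructor
  · intro he
    rw [plusPt_of_mem _ h, plusPt_of_mem _ h'] at he
    obtain ⟨j, h1, h2⟩ := Quotient.exact (congrArg (orbitCode A B) he)
    simp only [Sum.elim_inl] at h1 h2
    refine ⟨j, h1, ?_⟩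
    rw [h1, floor_add_int_re] at h2
    linarith
  · rintro ⟨j, rfl, rfl⟩
    exact (plusPt_shift m j h).symm

theorem minusPt_eq_minusPt {m m' : ℤ} {z z' : ℂ} (h : z ∈ cutMinus) (h' : z' ∈ cutMinus) :
    minusPt A B m z = minusPt A B m' z' ↔ ∃ j : ℤ, z' = z + j ∧ m' = m + (B - A) * j := by
  constructor
  · intro he
    rw [minusPt_of_mem _ h, minusPt_of_mem _ h'] at he
    obtain ⟨j, h1, h2⟩ := Quotient.exact (congrArg (orbitCode A B) he)
    exact ⟨j, h1, h2⟩
  · rintro ⟨j, rfl, rfl⟩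
    exact (minusPt_shift m j h).symm

theorem plusPt_eq_minusPt {m n : ℤ} {z z' : ℂ} (h : z ∈ cutPlus) (h' : z' ∈ cutMinus) :
    plusPt A B m z = minusPt A B n z' ↔
      ∃ j : ℤ, z' = z + j ∧ n = m + B * ⌊z.re⌋ + (B - A) * j := by
  constructor
  · intro he
    rw [plusPt_of_mem _ h, minusPt_of_mem _ h'] at he
    obtain ⟨j, h1, h2⟩ := Quotient.exact (congrArg (orbitCode A B) he)
    exact ⟨j, h1, h2⟩
  · rintro ⟨j, rfl, rfl⟩
    have hz := ne_int_of_cutPlus_cutMinus h ((add_int_mem_cutMinus j).1 h')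
    rw [minusPt_shift _ j (mem_cutMinus.2 (Or.inl hz)), plusPt_eq_minusPt_floor m hz]

theorem plusPt_injOn (m : ℤ) (hA : 0 < A) : InjOn (plusPt A B m) cutPlus := by
  intro z hz z' hz' h
  obtain ⟨j, rfl, hj⟩ := (plusPt_eq_plusPt hz hz').1 h
  have h0 : (A : ℤ) * j = 0 := by linarith
  have : j = 0 := by
    rcases mul_eq_zero.1 h0 with h1 | h1
    · omega
    · exact h1
  simp [this]

theorem minusPt_injOn (m : ℤ) (hAB : A ≠ B) : InjOn (minusPt A B m) cutMinus := by
  intro z hz z' hz' h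
  obtain ⟨j, rfl, hj⟩ := (minusPt_eq_minusPt hz hz').1 h
  have h0 : ((B : ℤ) - A) * j = 0 := by linarith
  have : j = 0 := by
    rcases mul_eq_zero.1 h0 with h1 | h1
    · omega
    · exact h1
  simp [this]

theorem isOpen_of_slices {Z : Type*} [TopologicalSpace Z] {s : Set (Z × ℤ)}
    (h : ∀ m : ℤ, IsOpen {z | (z, m) ∈ s}) : IsOpen s := by
  have : s = ⋃ m : ℤ, {z | (z, m) ∈ s} ×ˢ {m} := by
    ext ⟨z, m⟩
    simp
  rw [this]
  exact isOpen_iUnion fun m => (h m).prod (isOpen_discrete _)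

theorem isOpen_surface {s : Set (Surface A B)}
    (hp : ∀ m : ℤ, IsOpen {z : cutPlus | plusPt A B m z ∈ s})
    (hm : ∀ n : ℤ, IsOpen {z : cutMinus | minusPt A B n z ∈ s}) : IsOpen s := by
  have hq : IsQuotientMap (Quot.mk (Glue A B)) := isQuotientMap_quot_mk
  refine (hq.isOpen_preimage (s := s)).1 (isOpen_sum_iff.2 ⟨?_, ?_⟩)
  · refine isOpen_of_slices fun m => ?_
    convert hp m using 1
    ext z
    exact iff_of_eq (congrArg (· ∈ s) (ptPlus_eq m z))
  · refine isOpen_of_slices fun m => ?_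
    convert hm m using 1
    ext z
    exact iff_of_eq (congrArg (· ∈ s) (ptMinus_eq m z))

theorem isOpen_strip (k : ℤ) : IsOpen {z : ℂ | (k : ℝ) < z.re ∧ z.re < k + 1} :=
  (isOpen_lt continuous_const Complex.continuous_re).inter
    (isOpen_lt Complex.continuous_re continuous_const)

theorem floor_eq_of_strip {z : ℂ} (h : ∀ k : ℤ, z.re ≠ k) (k : ℤ) :
    ⌊z.re⌋ = k ↔ (k : ℝ) < z.re ∧ z.re < k + 1 := by
  rw [Int.floor_eq_iff]
  exact ⟨fun h' => ⟨lt_of_le_of_ne h'.1 (h k).symm, h'.2⟩, fun h' => ⟨h'.1.le, h'.2⟩⟩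

theorem isOpen_image_plusPt (m : ℤ) {V : Set ℂ} (hV : IsOpen V) :
    IsOpen (plusPt A B m '' (V ∩ cutPlus)) := by
  apply isOpen_surface
  · intro m'
    have : {z : cutPlus | plusPt A B m' z ∈ plusPt A B m '' (V ∩ cutPlus)} =
        ⋃ j : ℤ, {z : cutPlus | m = m' - A * j ∧ (z : ℂ) + j ∈ V} := by
      ext z
      simp only [mem_ofPred_eq, mem_image, mem_iUnion]
      constructor
      · rintro ⟨w, ⟨hw, hwc⟩, he⟩
        obtain ⟨j, rfl, h2⟩ := (plusPt_eq_plusPt z.2 hwc).1 he.symm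
        exact ⟨j, h2, hw⟩
      · rintro ⟨j, rfl, h⟩
        exact ⟨z + j, ⟨h, (add_int_mem_cutPlus j).2 z.2⟩, plusPt_shift _ _ z.2⟩
    rw [this]
    refine isOpen_iUnion fun j => isOpen_const.and ?_
    exact hV.preimage (continuous_subtype_val.add continuous_const)
  · intro n
    have : {z : cutMinus | minusPt A B n z ∈ plusPt A B m '' (V ∩ cutPlus)} =
        ⋃ j : ℤ, ⋃ k : ℤ, {z : cutMinus | n = m + B * k + (B - A) * j ∧
          ((z : ℂ) - j ∈ V ∧ (z : ℂ) - j ∈ {w : ℂ | (k : ℝ) < w.re ∧ w.re < k + 1})} := by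
      ext z
      simp only [mem_ofPred_eq, mem_image, mem_iUnion]
      constructor
      · rintro ⟨w, ⟨hw, hwc⟩, he⟩
        obtain ⟨j, h1, h2⟩ := (plusPt_eq_minusPt hwc z.2).1 he
        have hz : (z : ℂ) - j = w := by rw [h1]; ring
        have hw' : w ∈ cutMinus := by
          rw [← add_int_mem_cutMinus j, ← h1]; exact z.2
        exact ⟨j, ⌊w.re⌋, h2, by rwa [hz], by
          rw [hz]; exact (floor_eq_of_strip (ne_int_of_cutPlus_cutMinus hwc hw') _).1 rfl⟩
      · rintro ⟨j, k, rfl, h, h3⟩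
        have hne := ne_int_of_mem h3.1 h3.2
        have hc : (z : ℂ) - j ∈ cutPlus := mem_cutPlus.2 (Or.inl hne)
        refine ⟨z - j, ⟨h, hc⟩, (plusPt_eq_minusPt hc z.2).2 ⟨j, by ring, ?_⟩⟩
        rw [(floor_eq_of_strip hne k).2 h3]
    rw [this]
    refine isOpen_iUnion fun j => isOpen_iUnion fun k => isOpen_const.and ?_
    exact (hV.inter (isOpen_strip k)).preimage (continuous_subtype_val.sub continuous_const)

theorem isOpen_image_minusPt (n : ℤ) {V : Set ℂ} (hV : IsOpen V) :
    IsOpen (minusPt A B n '' (V ∩ cutMinus)) := by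
  apply isOpen_surface
  · intro m
    have : {z : cutPlus | plusPt A B m z ∈ minusPt A B n '' (V ∩ cutMinus)} =
        ⋃ j : ℤ, ⋃ k : ℤ, {z : cutPlus | n = m + B * k + (B - A) * j ∧
          ((z : ℂ) + j ∈ V ∧ (z : ℂ) ∈ {w : ℂ | (k : ℝ) < w.re ∧ w.re < k + 1})} := by
      ext z
      simp only [mem_ofPred_eq, mem_image, mem_iUnion]
      constructor
      · rintro ⟨w, ⟨hw, hwc⟩, he⟩
        obtain ⟨j, rfl, h2⟩ := (plusPt_eq_minusPt z.2 hwc).1 he.symm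
        have hz' : (z : ℂ) ∈ cutMinus := (add_int_mem_cutMinus j).1 hwc
        exact ⟨j, ⌊(z : ℂ).re⌋, h2, hw,
          (floor_eq_of_strip (ne_int_of_cutPlus_cutMinus z.2 hz') _).1 rfl⟩
      · rintro ⟨j, k, rfl, h, h3⟩
        have hne := ne_int_of_mem h3.1 h3.2
        have hc : (z : ℂ) + j ∈ cutMinus :=
          (add_int_mem_cutMinus j).2 (mem_cutMinus.2 (Or.inl hne))
        refine ⟨z + j, ⟨h, hc⟩, ((plusPt_eq_minusPt z.2 hc).2 ⟨j, rfl, ?_⟩).symm⟩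
        rw [(floor_eq_of_strip hne k).2 h3]
    rw [this]
    refine isOpen_iUnion fun j => isOpen_iUnion fun k => isOpen_const.and ?_
    exact (hV.preimage (continuous_subtype_val.add continuous_const)).inter
      ((isOpen_strip k).preimage continuous_subtype_val)
  · intro m'
    have : {z : cutMinus | minusPt A B m' z ∈ minusPt A B n '' (V ∩ cutMinus)} =
        ⋃ j : ℤ, {z : cutMinus | n = m' + (B - A) * j ∧ (z : ℂ) + j ∈ V} := by
      ext z
      simp only [mem_ofPred_eq, mem_image, mem_iUnion]
      constructor
      · rintro ⟨w, ⟨hw, hwc⟩, he⟩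
        obtain ⟨j, rfl, h2⟩ := (minusPt_eq_minusPt z.2 hwc).1 he.symm
        exact ⟨j, h2, hw⟩
      · rintro ⟨j, rfl, h⟩
        exact ⟨z + j, ⟨h, (add_int_mem_cutMinus j).2 z.2⟩, minusPt_shift _ _ z.2⟩
    rw [this]
    refine isOpen_iUnion fun j => isOpen_const.and ?_
    exact hV.preimage (continuous_subtype_val.add continuous_const)

theorem continuous_ptPlus (m : ℤ) : Continuous (ptPlus A B m) := by
  have : Continuous (Quot.mk (Glue A B)) := continuous_quot_mk
  exact this.comp (continuous_inl.comp (continuous_id.prodMk continuous_const))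

theorem continuous_ptMinus (m : ℤ) : Continuous (ptMinus A B m) := by
  have : Continuous (Quot.mk (Glue A B)) := continuous_quot_mk
  exact this.comp (continuous_inr.comp (continuous_id.prodMk continuous_const))

theorem continuousOn_plusPt (m : ℤ) : ContinuousOn (plusPt A B m) cutPlus := by
  rw [continuousOn_iff_continuous_domRestrict]
  convert continuous_ptPlus (A := A) (B := B) m using 1
  ext z
  exact (ptPlus_eq m z).symm

theorem continuousOn_minusPt (m : ℤ) : ContinuousOn (minusPt A B m) cutMinus := by
  rw [continuousOn_iff_continuous_domRestrict]
  convert continuous_ptMinus (A := A) (B := B) m using 1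
  ext z
  exact (ptMinus_eq m z).symm

/-- The coordinate `z₊` on the sheet `m₊ = m`. -/
def coordPlus (m : ℤ) : Surface A B → ℂ := Function.invFunOn (plusPt A B m) cutPlus

/-- The coordinate `z₋` on the sheet `m₋ = n`. -/
def coordMinus (n : ℤ) : Surface A B → ℂ := Function.invFunOn (minusPt A B n) cutMinus

theorem coordPlus_plusPt (hA : 0 < A) (m : ℤ) {z : ℂ} (h : z ∈ cutPlus) :
    coordPlus m (plusPt A B m z) = z := (plusPt_injOn m hA).leftInvOn_invFunOn h

theorem coordMinus_minusPt (hAB : A ≠ B) (m : ℤ) {z : ℂ} (h : z ∈ cutMinus) :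
    coordMinus m (minusPt A B m z) = z := (minusPt_injOn m hAB).leftInvOn_invFunOn h

theorem continuousOn_coordPlus (hA : 0 < A) (m : ℤ) :
    ContinuousOn (coordPlus m) (plusPt A B m '' cutPlus) := by
  rw [continuousOn_iff']
  intro V hV
  refine ⟨_, isOpen_image_plusPt (A := A) (B := B) m hV, ?_⟩
  ext p
  constructor
  · rintro ⟨h1, z, hz, rfl⟩
    rw [mem_preimage, coordPlus_plusPt hA m hz] at h1
    exact ⟨⟨z, ⟨h1, hz⟩, rfl⟩, z, hz, rfl⟩
  · rintro ⟨⟨z, ⟨h1, hz⟩, rfl⟩, h2⟩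
    refine ⟨?_, h2⟩
    rw [mem_preimage, coordPlus_plusPt hA m hz]
    exact h1

theorem continuousOn_coordMinus (hAB : A ≠ B) (m : ℤ) :
    ContinuousOn (coordMinus m) (minusPt A B m '' cutMinus) := by
  rw [continuousOn_iff']
  intro V hV
  refine ⟨_, isOpen_image_minusPt (A := A) (B := B) m hV, ?_⟩
  ext p
  constructor
  · rintro ⟨h1, z, hz, rfl⟩
    rw [mem_preimage, coordMinus_minusPt hAB m hz] at h1
    exact ⟨⟨z, ⟨h1, hz⟩, rfl⟩, z, hz, rfl⟩
  · rintro ⟨⟨z, ⟨h1, hz⟩, rfl⟩, h2⟩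
    refine ⟨?_, h2⟩
    rw [mem_preimage, coordMinus_minusPt hAB m hz]
    exact h1

/-- Paths in a coordinate sheet lift to the coordinate plane. -/
theorem exists_lift_plus (hA : 0 < A) (m : ℤ) {V : Set ℂ} (hV : V ⊆ cutPlus) {T : Set ℝ}
    {γ : ℝ → Surface A B} (hγ : ContinuousOn γ T) (hm : MapsTo γ T (plusPt A B m '' V)) :
    ∃ z : ℝ → ℂ, ContinuousOn z T ∧ ∀ t ∈ T, z t ∈ V ∧ γ t = plusPt A B m (z t) := by
  refine ⟨fun t => coordPlus m (γ t), (continuousOn_coordPlus hA m).comp hγ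
    (hm.mono le_rfl (image_mono hV)), fun t ht => ?_⟩
  obtain ⟨z, hz, h⟩ := hm ht
  simp only [← h, coordPlus_plusPt hA m (hV hz)]
  exact ⟨hz, trivial⟩

theorem exists_lift_minus (hAB : A ≠ B) (m : ℤ) {V : Set ℂ} (hV : V ⊆ cutMinus) {T : Set ℝ}
    {γ : ℝ → Surface A B} (hγ : ContinuousOn γ T) (hm : MapsTo γ T (minusPt A B m '' V)) :
    ∃ z : ℝ → ℂ, ContinuousOn z T ∧ ∀ t ∈ T, z t ∈ V ∧ γ t = minusPt A B m (z t) := by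
  refine ⟨fun t => coordMinus m (γ t), (continuousOn_coordMinus hAB m).comp hγ
    (hm.mono le_rfl (image_mono hV)), fun t ht => ?_⟩
  obtain ⟨z, hz, h⟩ := hm ht
  simp only [← h, coordMinus_minusPt hAB m (hV hz)]
  exact ⟨hz, trivial⟩

end Coordinates

/-! ### The surface `X` in coordinates -/

section Region

open Set Topology

variable {A B : ℕ} {ε M : ℝ}

theorem plusPt_mem_SigmaPlus {m : ℤ} (hm : 0 ≤ m) (hmA : m < A) {z : ℂ} (hz : z ∈ cutPlus) :
    plusPt A B m z ∈ SigmaPlus A B ε M ↔ z ∈ sheetRegion 1 ε M := by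
  constructor
  · intro h
    obtain ⟨i, w, hw, he⟩ := mem_iUnion.1 h
    rw [ptPlus_eq] at he
    obtain ⟨j, rfl, hj⟩ := (plusPt_eq_plusPt w.2 hz).1 he
    have hi := i.2
    have hj0 : j = 0 := by
      have h1 : (A : ℤ) * j < A * 1 := by omega
      have h2 : (A : ℤ) * (-1) < A * j := by omega
      have hA : (0 : ℤ) < A := by omega
      have := lt_of_mul_lt_mul_left h1 hA.le
      have := lt_of_mul_lt_mul_left h2 hA.le
      omega
    simpa [hj0] using hw
  · intro h
    refine mem_iUnion.2 ⟨⟨m.toNat, by omega⟩, ⟨z, hz⟩, h, ?_⟩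
    rw [ptPlus_eq]
    simp [Int.toNat_of_nonneg hm]

theorem minusPt_mem_SigmaMinus {n : ℤ} {z : ℂ} (hz : z ∈ cutMinus) :
    minusPt A B n z ∈ SigmaMinus A B ε M ↔
      ∃ j : ℤ, 0 ≤ n + (B - A) * j ∧ n + (B - A) * j < A ∧ z + j ∈ sheetRegion (-1) ε M := by
  constructor
  · intro h
    obtain ⟨i, w, hw, he⟩ := mem_iUnion.1 h
    rw [ptMinus_eq] at he
    obtain ⟨j, h1, h2⟩ := (minusPt_eq_minusPt hz w.2).1 he.symm
    have hi := i.2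
    exact ⟨j, by omega, by omega, h1 ▸ hw⟩
  · rintro ⟨j, h1, h2, h3⟩
    refine mem_iUnion.2 ⟨⟨(n + (B - A) * j).toNat, by omega⟩,
      ⟨z + j, (add_int_mem_cutMinus j).2 hz⟩, h3, ?_⟩
    rw [ptMinus_eq]
    simp only [Int.toNat_of_nonneg h1]
    exact minusPt_shift n j hz

theorem exists_plusPt_of_mem_SigmaPlus {p : Surface A B} (hp : p ∈ SigmaPlus A B ε M) :
    ∃ (m : ℤ) (z : ℂ), 0 ≤ m ∧ m < A ∧ z ∈ cutPlus ∧ z ∈ sheetRegion 1 ε M ∧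
      p = plusPt A B m z := by
  obtain ⟨i, w, hw, rfl⟩ := mem_iUnion.1 hp
  exact ⟨i, w, by positivity, by exact_mod_cast i.2, w.2, hw, ptPlus_eq _ _⟩

theorem exists_minusPt_of_mem_SigmaMinus {p : Surface A B} (hp : p ∈ SigmaMinus A B ε M) :
    ∃ (m : ℤ) (z : ℂ), 0 ≤ m ∧ m < A ∧ z ∈ cutMinus ∧ z ∈ sheetRegion (-1) ε M ∧
      p = minusPt A B m z := by
  obtain ⟨i, w, hw, rfl⟩ := mem_iUnion.1 hp
  exact ⟨i, w, by positivity, by exact_mod_cast i.2, w.2, hw, ptMinus_eq _ _⟩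

theorem exists_normalized_plusPt (hA : 0 < A) (m : ℤ) {z : ℂ} (hz : z ∈ cutPlus) :
    ∃ (m' j : ℤ), 0 ≤ m' ∧ m' < A ∧ plusPt A B m z = plusPt A B m' (z + j) := by
  refine ⟨m % A, m / A, Int.emod_nonneg _ (by omega), Int.emod_lt_of_pos _ (by omega), ?_⟩
  rw [← plusPt_shift m (m / A) hz]
  congr 1
  have := Int.emod_add_mul_ediv m A
  linarith

/-- A point of `Σ` has a coordinate `z₊` on one of the sheets `0, …, A - 1`, or it is on a downward
cut. -/
theorem surface_cases (hA : 0 < A) (p : Surface A B) :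
    (∃ (m : ℤ) (z : ℂ), 0 ≤ m ∧ m < A ∧ z ∈ cutPlus ∧ p = plusPt A B m z) ∨
      ∃ (n : ℤ) (z : ℂ), (∃ k : ℤ, z.re = k) ∧ z.im < 0 ∧ p = minusPt A B n z := by
  obtain ⟨a, rfl⟩ := Quot.exists_rep p
  rcases a with ⟨z, m⟩ | ⟨z, n⟩
  · obtain ⟨m', j, h1, h2, h3⟩ := exists_normalized_plusPt (B := B) hA m z.2
    refine Or.inl ⟨m', z + j, h1, h2, (add_int_mem_cutPlus j).2 z.2, ?_⟩
    rw [← h3, ← ptPlus_eq]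
    rfl
  · have he : (Quot.mk _ (Sum.inr (z, n)) : Surface A B) = minusPt A B n z := ptMinus_eq n z
    by_cases hz : ∀ k : ℤ, (z : ℂ).re ≠ k
    · have hz' : (z : ℂ) ∈ cutPlus := mem_cutPlus.2 (Or.inl hz)
      obtain ⟨m', j, h1, h2, h3⟩ :=
        exists_normalized_plusPt (B := B) hA (n - B * ⌊(z : ℂ).re⌋) hz'
      refine Or.inl ⟨m', z + j, h1, h2, (add_int_mem_cutPlus j).2 hz', ?_⟩
      rw [← h3, plusPt_eq_minusPt_floor _ hz]
      change (Quot.mk _ (Sum.inr (z, n)) : Surface A B) = _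
      rw [he]
      congr 1
      ring
    · push Not at hz
      refine Or.inr ⟨n, z, hz, ?_, he⟩
      rcases mem_cutMinus.1 z.2 with h | h
      · obtain ⟨k, hk⟩ := hz
        exact absurd hk (h k)
      · exact h

theorem plusPt_notMem_SigmaMinus {m k : ℤ} {z : ℂ} (hz : z ∈ cutPlus) (hk : z.re = k) :
    plusPt A B m z ∉ SigmaMinus A B ε M := by
  intro h
  obtain ⟨n, w, -, -, hw, -, he⟩ := exists_minusPt_of_mem_SigmaMinus h
  obtain ⟨j, rfl, -⟩ := (plusPt_eq_minusPt hz hw).1 he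
  exact ne_int_of_cutPlus_cutMinus hz ((add_int_mem_cutMinus j).1 hw) k hk

theorem minusPt_notMem_SigmaPlus {n k : ℤ} {z : ℂ} (hz : z ∈ cutMinus) (hk : z.re = k) :
    minusPt A B n z ∉ SigmaPlus A B ε M := by
  intro h
  obtain ⟨m, w, -, -, hw, -, he⟩ := exists_plusPt_of_mem_SigmaPlus h
  obtain ⟨j, rfl, -⟩ := (plusPt_eq_minusPt hw hz).1 he.symm
  have hw' := ne_int_of_cutPlus_cutMinus hw ((add_int_mem_cutMinus j).1 hz)
  exact (ne_int_add j).2 hw' k (by simpa using hk)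

end Region

section SheetRegion

open Set Topology

variable {s ε M : ℝ}

/-- The part of `sheetRegion` over the interval `[-M, M]`, with discs around the integers removed. -/
def leg (s ε M : ℝ) : Set ℂ :=
  {z | |z.re| ≤ M ∧ -(ε / M) ≤ s * z.im ∧ ∀ k : ℤ, ε / (1 + |(k : ℝ)|) ≤ ‖z - k‖}

theorem mem_sheetRegion {z : ℂ} : z ∈ sheetRegion s ε M ↔ z ∈ leg s ε M ∨ ε / M ≤ s * z.im := by
  simp only [sheetRegion, leg, mem_union, mem_inter_iff, mem_ofPred_eq, and_assoc]

theorem mem_leg_of_lt {z : ℂ} (hz : z ∈ sheetRegion s ε M) (h : s * z.im < ε / M) :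
    z ∈ leg s ε M := (mem_sheetRegion.1 hz).resolve_right (not_le.2 h)

theorem leg_subset : leg s ε M ⊆ sheetRegion s ε M := fun _ hz => mem_sheetRegion.2 (Or.inl hz)

theorem norm_sub_int_sq (z : ℂ) (k : ℤ) : ‖z - k‖ ^ 2 = (z.re - k) ^ 2 + z.im ^ 2 := by
  rw [← Complex.normSq_eq_norm_sq, Complex.normSq_apply]
  simp
  ring

theorem le_norm_sub_int {r : ℝ} (hr : 0 ≤ r) {z : ℂ} {k : ℤ} :
    r ≤ ‖z - k‖ ↔ r ^ 2 ≤ (z.re - k) ^ 2 + z.im ^ 2 := by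
  rw [← norm_sub_int_sq, sq_le_sq₀ hr (norm_nonneg _)]

theorem radius_nonneg (hε : 0 < ε) (k : ℤ) : 0 ≤ ε / (1 + |(k : ℝ)|) := by positivity

theorem isClosed_sheetRegion : IsClosed (sheetRegion s ε M) := by
  have h1 : IsClosed {z : ℂ | |z.re| ≤ M ∧ -(ε / M) ≤ s * z.im} :=
    (isClosed_le (continuous_abs.comp Complex.continuous_re) continuous_const).inter
      (isClosed_le continuous_const (continuous_const.mul Complex.continuous_im))
  have h2 : IsClosed {z : ℂ | ∀ k : ℤ, ε / (1 + |(k : ℝ)|) ≤ ‖z - k‖} := by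
    simp only [ofPred_forall]
    exact isClosed_iInter fun k => isClosed_le continuous_const (by fun_prop)
  exact (h1.inter h2).union
    (isClosed_le continuous_const (continuous_const.mul Complex.continuous_im))

/-- The removed discs are centred at the integers, so over the strip between two consecutive
integers a leg is closed under horizontal moves towards any point of it which is lower or equally
high. -/
theorem leg_horizontal (hε : 0 < ε) {k : ℤ} {z w : ℂ} (hz : z ∈ leg s ε M) (hw : w ∈ leg s ε M)
    (hzk : (k : ℝ) ≤ z.re ∧ z.re ≤ k + 1) (hwk : (k : ℝ) ≤ w.re ∧ w.re ≤ k + 1)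
    (him : w.im ^ 2 ≤ z.im ^ 2) {v : ℂ} (hvi : v.im = z.im) (hv : v.re ∈ uIcc z.re w.re) :
    v ∈ leg s ε M := by
  have hvb : v.re ∈ Icc (-M) M := by
    have h1 : z.re ∈ Icc (-M) M := abs_le.1 hz.1
    have h2 : w.re ∈ Icc (-M) M := abs_le.1 hw.1
    exact uIcc_subset_Icc h1 h2 hv
  refine ⟨abs_le.2 hvb, by rw [hvi]; exact hz.2.1, fun i => ?_⟩
  rw [le_norm_sub_int (radius_nonneg hε i), hvi]
  have h1 := (le_norm_sub_int (radius_nonneg hε i)).1 (hz.2.2 i)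
  have h2 := (le_norm_sub_int (radius_nonneg hε i)).1 (hw.2.2 i)
  rcases le_or_gt i k with hik | hik
  · have hik' : (i : ℝ) ≤ k := by exact_mod_cast hik
    rcases mem_uIcc.1 hv with h | h
    · nlinarith [h.1]
    · nlinarith [h.1]
  · have hik' : (k : ℝ) + 1 ≤ i := by exact_mod_cast hik
    rcases mem_uIcc.1 hv with h | h
    · nlinarith [h.2]
    · nlinarith [h.2]

/-- A leg is closed under vertical moves away from the real line. -/
theorem leg_vertical (hε : 0 < ε) {z v : ℂ} (hz : z ∈ leg s ε M) (hre : v.re = z.re)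
    (him : z.im ^ 2 ≤ v.im ^ 2) (h : -(ε / M) ≤ s * v.im) : v ∈ leg s ε M := by
  refine ⟨by rw [hre]; exact hz.1, h, fun i => ?_⟩
  have h1 := (le_norm_sub_int (radius_nonneg hε i)).1 (hz.2.2 i)
  rw [le_norm_sub_int (radius_nonneg hε i), hre]
  linarith

theorem sheetRegion_up (hε : 0 < ε) {z v : ℂ} (hz : z ∈ sheetRegion s ε M)
    (hre : v.re = z.re) (h0 : 0 ≤ s * z.im) (h : s * z.im ≤ s * v.im) (hs : s ^ 2 = 1) :
    v ∈ sheetRegion s ε M := by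
  rcases mem_sheetRegion.1 hz with h1 | h1
  · refine leg_subset (leg_vertical hε h1 hre ?_ (h1.2.1.trans h))
    have h2 : (s * z.im) ^ 2 ≤ (s * v.im) ^ 2 := pow_le_pow_left₀ h0 h 2
    rwa [mul_pow, mul_pow, hs, one_mul, one_mul] at h2
  · exact mem_sheetRegion.2 (Or.inr (h1.trans h))

theorem sheetRegion_down (hε : 0 < ε) (hM : 0 < M) {z v : ℂ} (hz : z ∈ sheetRegion s ε M)
    (hre : v.re = z.re) (h0 : s * z.im ≤ 0) (h : s * v.im ≤ s * z.im) (hb : -(ε / M) ≤ s * v.im)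
    (hs : s ^ 2 = 1) : v ∈ sheetRegion s ε M := by
  have hη : 0 < ε / M := by positivity
  refine leg_subset (leg_vertical hε (mem_leg_of_lt hz (by linarith)) hre ?_ hb)
  have h2 : (-(s * z.im)) ^ 2 ≤ (-(s * v.im)) ^ 2 := pow_le_pow_left₀ (by linarith) (by linarith) 2
  rwa [neg_sq, neg_sq, mul_pow, mul_pow, hs, one_mul, one_mul] at h2

end SheetRegion

section Moves

open Set Topology

variable {A B : ℕ} {ε M : ℝ}

theorem plusPt_mem_SigmaPlus_iff (hA : 0 < A) {m : ℤ} {z : ℂ} (hz : z ∈ cutPlus) :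
    plusPt A B m z ∈ SigmaPlus A B ε M ↔
      ∃ j : ℤ, 0 ≤ m - A * j ∧ m - A * j < A ∧ z + j ∈ sheetRegion 1 ε M := by
  constructor
  · intro h
    obtain ⟨m', j, h1, h2, h3⟩ := exists_normalized_plusPt (B := B) hA m hz
    have hzj := (add_int_mem_cutPlus j).2 hz
    obtain ⟨i, h4, h5⟩ := (plusPt_eq_plusPt hz hzj).1 h3
    rw [h3, plusPt_mem_SigmaPlus h1 h2 hzj, h4] at h
    exact ⟨i, by omega, by omega, h⟩
  · rintro ⟨j, h1, h2, h3⟩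
    rw [← plusPt_shift m j hz]
    exact (plusPt_mem_SigmaPlus h1 h2 ((add_int_mem_cutPlus j).2 hz)).2 h3

/-- The sheet `m₋ = n` belongs to `Σ⁻`, up to a translation. -/
def HasSheet (A B : ℕ) (n : ℤ) : Prop := ∃ j : ℤ, 0 ≤ n + (B - A) * j ∧ n + (B - A) * j < A

theorem vertical_mem_cutPlus {z v : ℂ} (hz : z ∈ cutPlus) (hre : v.re = z.re) (h : z.im ≤ v.im) :
    v ∈ cutPlus := by
  rw [mem_cutPlus] at hz ⊢
  rcases hz with h' | h'
  · exact Or.inl (by rwa [hre])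
  · exact Or.inr (h'.trans_le h)

theorem vertical_mem_cutMinus {z v : ℂ} (hz : z ∈ cutMinus) (hre : v.re = z.re)
    (h : v.im ≤ z.im) : v ∈ cutMinus := by
  rw [mem_cutMinus] at hz ⊢
  rcases hz with h' | h'
  · exact Or.inl (by rwa [hre])
  · exact Or.inr (h.trans_lt h')

theorem minusPt_eq_plusPt_floor (n : ℤ) {z : ℂ} (h : ∀ k : ℤ, z.re ≠ k) :
    minusPt A B n z = plusPt A B (n - B * ⌊z.re⌋) z := by
  rw [plusPt_eq_minusPt_floor _ h, sub_add_cancel]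

theorem minusPt_mem_SigmaPlus {n : ℤ} {z : ℂ} (hz : z ∈ cutMinus)
    (h : minusPt A B n z ∈ SigmaPlus A B ε M) : ∀ k : ℤ, z.re ≠ k :=
  fun _ hk => minusPt_notMem_SigmaPlus hz hk h

theorem plusPt_mem_SigmaMinus {m : ℤ} {z : ℂ} (hz : z ∈ cutPlus)
    (h : plusPt A B m z ∈ SigmaMinus A B ε M) : ∀ k : ℤ, z.re ≠ k :=
  fun _ hk => plusPt_notMem_SigmaMinus hz hk h

theorem high_mem_SigmaPlus (hA : 0 < A) {m : ℤ} {z : ℂ} (hz : z ∈ cutPlus) (h : ε / M ≤ z.im) :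
    plusPt A B m z ∈ SigmaPlus A B ε M := by
  rw [plusPt_mem_SigmaPlus_iff hA hz]
  refine ⟨m / A, ?_, ?_, mem_sheetRegion.2 (Or.inr (by simpa using h))⟩
  · have := Int.mul_ediv_self_le (x := m) (k := (A : ℤ)) (by omega); linarith
  · have := Int.lt_mul_ediv_self_add (x := m) (k := (A : ℤ)) (by omega); linarith

theorem low_mem_SigmaMinus {n : ℤ} (hn : HasSheet A B n) {z : ℂ} (hz : z ∈ cutMinus)
    (h : z.im ≤ -(ε / M)) : minusPt A B n z ∈ SigmaMinus A B ε M := by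
  rw [minusPt_mem_SigmaMinus hz]
  obtain ⟨j, h1, h2⟩ := hn
  refine ⟨j, h1, h2, mem_sheetRegion.2 (Or.inr ?_)⟩
  simp only [Complex.add_im, Complex.intCast_im, add_zero]
  linarith

theorem SigmaPlus_up (hA : 0 < A) (hε : 0 < ε) {m : ℤ} {z v : ℂ} (hz : z ∈ cutPlus)
    (hX : plusPt A B m z ∈ SigmaPlus A B ε M) (hre : v.re = z.re) (h0 : 0 ≤ z.im)
    (h : z.im ≤ v.im) : plusPt A B m v ∈ SigmaPlus A B ε M := by
  have hv := vertical_mem_cutPlus hz hre h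
  rw [plusPt_mem_SigmaPlus_iff hA hz] at hX
  rw [plusPt_mem_SigmaPlus_iff hA hv]
  obtain ⟨j, h1, h2, h3⟩ := hX
  exact ⟨j, h1, h2, sheetRegion_up hε h3 (by simp [hre]) (by simpa using h0) (by simpa using h)
    (by norm_num)⟩

theorem SigmaPlus_down (hA : 0 < A) (hε : 0 < ε) (hM : 0 < M) {m : ℤ} {z v : ℂ} (hz : z ∈ cutPlus)
    (hv : v ∈ cutPlus) (hX : plusPt A B m z ∈ SigmaPlus A B ε M) (hre : v.re = z.re)
    (h0 : z.im ≤ 0) (h : v.im ≤ z.im) (hb : -(ε / M) ≤ v.im) :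
    plusPt A B m v ∈ SigmaPlus A B ε M := by
  rw [plusPt_mem_SigmaPlus_iff hA hz] at hX
  rw [plusPt_mem_SigmaPlus_iff hA hv]
  obtain ⟨j, h1, h2, h3⟩ := hX
  exact ⟨j, h1, h2, sheetRegion_down hε hM h3 (by simp [hre]) (by simpa using h0) (by simpa using h)
    (by simpa using hb) (by norm_num)⟩

theorem SigmaMinus_down (hε : 0 < ε) {n : ℤ} {z v : ℂ} (hz : z ∈ cutMinus)
    (hX : minusPt A B n z ∈ SigmaMinus A B ε M) (hre : v.re = z.re) (h0 : z.im ≤ 0)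
    (h : v.im ≤ z.im) : minusPt A B n v ∈ SigmaMinus A B ε M := by
  have hv := vertical_mem_cutMinus hz hre h
  rw [minusPt_mem_SigmaMinus hz] at hX
  rw [minusPt_mem_SigmaMinus hv]
  obtain ⟨j, h1, h2, h3⟩ := hX
  exact ⟨j, h1, h2, sheetRegion_up hε h3 (by simp [hre]) (by simpa using h0) (by simpa using h)
    (by norm_num)⟩

theorem SigmaMinus_up (hε : 0 < ε) (hM : 0 < M) {n : ℤ} {z v : ℂ} (hz : z ∈ cutMinus)
    (hv : v ∈ cutMinus) (hX : minusPt A B n z ∈ SigmaMinus A B ε M) (hre : v.re = z.re)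
    (h0 : 0 ≤ z.im) (h : z.im ≤ v.im) (hb : v.im ≤ ε / M) :
    minusPt A B n v ∈ SigmaMinus A B ε M := by
  rw [minusPt_mem_SigmaMinus hz] at hX
  rw [minusPt_mem_SigmaMinus hv]
  obtain ⟨j, h1, h2, h3⟩ := hX
  exact ⟨j, h1, h2, sheetRegion_down hε hM h3 (by simp [hre]) (by simpa using h0)
    (by simpa using h) (by simpa using hb) (by norm_num)⟩

theorem plusPt_eq_minusPt_of_re {m : ℤ} {z v : ℂ} (hz : ∀ k : ℤ, z.re ≠ k) (hre : v.re = z.re) :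
    plusPt A B m v = minusPt A B (m + B * ⌊z.re⌋) v := by
  rw [plusPt_eq_minusPt_floor m (by rwa [hre]), hre]

theorem minusPt_eq_plusPt_of_re {n : ℤ} {z v : ℂ} (hz : ∀ k : ℤ, z.re ≠ k) (hre : v.re = z.re) :
    minusPt A B n v = plusPt A B (n - B * ⌊z.re⌋) v := by
  rw [minusPt_eq_plusPt_floor n (by rwa [hre]), hre]

/-- The part of `X` in the closed upper half plane of a sheet is closed under upward moves. -/
theorem XSurf_up (hA : 0 < A) (hε : 0 < ε) (hM : 0 < M) {m : ℤ} {z v : ℂ} (hz : z ∈ cutPlus)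
    (hX : plusPt A B m z ∈ XSurf A B ε M) (hre : v.re = z.re) (h0 : 0 ≤ z.im)
    (h : z.im ≤ v.im) : plusPt A B m v ∈ XSurf A B ε M := by
  have hv := vertical_mem_cutPlus hz hre h
  rcases hX with hX | hX
  · exact Or.inl (SigmaPlus_up hA hε hz hX hre h0 h)
  · have hne := plusPt_mem_SigmaMinus hz hX
    rcases le_total v.im (ε / M) with hb | hb
    · right
      rw [plusPt_eq_minusPt_of_re hne rfl] at hX
      rw [plusPt_eq_minusPt_of_re hne hre]
      exact SigmaMinus_up hε hM (mem_cutMinus.2 (Or.inl hne))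
        (mem_cutMinus.2 (Or.inl (by rwa [hre]))) hX hre h0 h hb
    · exact Or.inl (high_mem_SigmaPlus hA hv hb)

theorem XSurf_down (hA : 0 < A) (hε : 0 < ε) (hM : 0 < M) {n : ℤ} (hn : HasSheet A B n) {z v : ℂ}
    (hz : z ∈ cutMinus) (hX : minusPt A B n z ∈ XSurf A B ε M) (hre : v.re = z.re) (h0 : z.im ≤ 0)
    (h : v.im ≤ z.im) : minusPt A B n v ∈ XSurf A B ε M := by
  have hv := vertical_mem_cutMinus hz hre h
  rcases hX with hX | hX
  · have hne := minusPt_mem_SigmaPlus hz hX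
    rcases le_total (-(ε / M)) v.im with hb | hb
    · left
      rw [minusPt_eq_plusPt_of_re hne rfl] at hX
      rw [minusPt_eq_plusPt_of_re hne hre]
      exact SigmaPlus_down hA hε hM (mem_cutPlus.2 (Or.inl hne))
        (mem_cutPlus.2 (Or.inl (by rwa [hre]))) hX hre h0 h hb
    · exact Or.inr (low_mem_SigmaMinus hn hv hb)
  · exact Or.inr (SigmaMinus_down hε hz hX hre h0 h)

end Moves

/-! ### Potentials of a cocycle on `X` -/

section Potential

open Set Topology

variable {Y : Type} [TopologicalSpace Y] {X : Set Y} {Q : Type*} [AddCommGroup Q]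
  {κ : C(stdSimplex ℝ (Fin 2), X) → Q}

/-- Minus the value of `κ` on the path in the chart `c` which goes straight from `z` to `z + w z`
and then straight to `b`. -/
def pot (κ : C(stdSimplex ℝ (Fin 2), X) → Q) (c : ℂ → Y) (w : ℂ → ℂ) (b z : ℂ) : Q :=
  -(val κ (fun s => c (z + s * w z)) + val κ (fun s => c (AffineMap.lineMap (z + w z) b s)))

/-- On a part of a chart contracted in `X` in two steps, by `z ↦ z + w z` and inside a convex set
`K`, a cocycle is the coboundary of `pot`. -/
theorem val_eq_pot (hκ : IsCocycle κ) {c : ℂ → Y} {U K : Set ℂ} {w : ℂ → ℂ} {b : ℂ}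
    (hc : ContinuousOn c U) (hw : Continuous w) (hK : Convex ℝ K) (hKU : K ⊆ U)
    (hKX : MapsTo c K X) (hb : b ∈ K) {z : ℝ → ℂ} (hz : ContinuousOn z (Icc 0 1))
    (h : ∀ t ∈ Icc (0 : ℝ) 1, ∀ s ∈ Icc (0 : ℝ) 1, z t + s * w (z t) ∈ U ∧
      c (z t + s * w (z t)) ∈ X)
    (h1 : ∀ t ∈ Icc (0 : ℝ) 1, z t + w (z t) ∈ K) :
    val κ (fun t => c (z t)) = pot κ c w b (z 1) - pot κ c w b (z 0) := by
  have hz2 : ContinuousOn (fun p : ℝ × ℝ => z p.1) (Icc 0 1 ×ˢ Icc 0 1) :=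
    hz.comp continuous_fst.continuousOn (fun p hp => hp.1)
  have hwz : ContinuousOn (fun p : ℝ × ℝ => w (z p.1)) (Icc 0 1 ×ˢ Icc 0 1) :=
    hw.comp_continuousOn hz2
  have e1 := val_homotopy hκ (H := fun t s => c (z t + s * w (z t)))
    (hc.comp (hz2.add ((Complex.continuous_ofReal.comp continuous_snd).continuousOn.mul hwz))
      (fun p hp => (h p.1 hp.1 p.2 hp.2).1))
    (fun t ht s hs => (h t ht s hs).2)
  have hline : ∀ t ∈ Icc (0 : ℝ) 1, ∀ s ∈ Icc (0 : ℝ) 1,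
      AffineMap.lineMap (z t + w (z t)) b s ∈ K := fun t ht s hs =>
    hK.segment_subset (h1 t ht) hb (lineMap_mem_segment _ _ hs)
  have e2 := val_homotopy hκ (H := fun t s => c (AffineMap.lineMap (z t + w (z t)) b s))
    (hc.comp (by
      simp only [AffineMap.lineMap_apply_module]
      exact ((continuous_const.sub continuous_snd).continuousOn.smul (hz2.add hwz)).add
        (continuous_snd.continuousOn.smul continuousOn_const))
      (fun p hp => hKU (hline p.1 hp.1 p.2 hp.2)))
    (fun t ht s hs => hKX (hline t ht s hs))
  simp only [AffineMap.lineMap_apply_zero, AffineMap.lineMap_apply_one, val_const hκ, add_zero,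
    Complex.ofReal_zero, zero_mul, Complex.ofReal_one, one_mul] at e1 e2
  unfold pot
  rw [eq_comm, ← sub_eq_zero]
  rw [← sub_eq_zero] at e1 e2
  have := congrArg₂ (· + ·) e1 e2
  simp only [add_zero] at this
  rw [← neg_eq_zero, ← this]
  abel

end Potential

/-! ### The height on `Σ` and functions given in normalized coordinates -/

section Height

open Set Topology

variable {A B : ℕ} {ε M : ℝ}

/-- The imaginary part of either coordinate. -/
def height : Surface A B → ℝ :=
  Quot.lift (Sum.elim (fun x : cutPlus × ℤ => (x.1 : ℂ).im) (fun x : cutMinus × ℤ => (x.1 : ℂ).im))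
    (by intro a b h; cases h <;> simp)

theorem continuous_height : Continuous (height : Surface A B → ℝ) := by
  have hq : IsQuotientMap (Quot.mk (Glue A B)) := isQuotientMap_quot_mk
  refine (IsQuotientMap.continuous_iff hq).2 (continuous_sum_dom.2 ⟨?_, ?_⟩)
  · exact Complex.continuous_im.comp (continuous_subtype_val.comp continuous_fst)
  · exact Complex.continuous_im.comp (continuous_subtype_val.comp continuous_fst)

theorem height_plusPt (m : ℤ) {z : ℂ} (hz : z ∈ cutPlus) : height (plusPt A B m z) = z.im := by
  rw [plusPt_of_mem m hz]; rfl

theorem height_minusPt (n : ℤ) {z : ℂ} (hz : z ∈ cutMinus) : height (minusPt A B n z) = z.im := by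
  rw [minusPt_of_mem n hz]; rfl

theorem exists_normalized_minusPt (hAB : A ≠ B) (n : ℤ) {z : ℂ} (hz : z ∈ cutMinus) :
    ∃ n' j : ℤ, 0 ≤ n' ∧ n' < |(B : ℤ) - A| ∧ minusPt A B n z = minusPt A B n' (z + j) := by
  have hne : (B : ℤ) - A ≠ 0 := by omega
  refine ⟨n % (B - A), -(n / (B - A)), Int.emod_nonneg _ hne, Int.emod_lt_abs _ hne, ?_⟩
  rw [← minusPt_shift n (-(n / (B - A))) hz]
  congr 1
  have := Int.emod_add_mul_ediv n (B - A)
  linarith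

theorem exists_plusPt_of_height (hA : 0 < A) {p : Surface A B} (hp : 0 ≤ height p) :
    ∃ (m : ℤ) (z : ℂ), 0 ≤ m ∧ m < A ∧ z ∈ cutPlus ∧ p = plusPt A B m z := by
  rcases surface_cases hA p with h | ⟨n, z, -, hz, rfl⟩
  · exact h
  · rw [height_minusPt n (mem_cutMinus.2 (Or.inr hz))] at hp
    exact absurd hp (not_le.2 hz)

theorem exists_minusPt_of_height (hA : 0 < A) (hAB : A ≠ B) {p : Surface A B} (hp : height p ≤ 0) :
    ∃ (n : ℤ) (z : ℂ), 0 ≤ n ∧ n < |(B : ℤ) - A| ∧ z ∈ cutMinus ∧ p = minusPt A B n z := by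
  have : ∃ (n : ℤ) (z : ℂ), z ∈ cutMinus ∧ p = minusPt A B n z := by
    rcases surface_cases hA p with ⟨m, z, -, -, hz, rfl⟩ | ⟨n, z, -, hz, rfl⟩
    · rw [height_plusPt m hz] at hp
      have hne : ∀ k : ℤ, z.re ≠ k := (mem_cutPlus.1 hz).resolve_right (not_lt.2 hp)
      exact ⟨_, z, mem_cutMinus.2 (Or.inl hne), plusPt_eq_minusPt_floor m hne⟩
    · exact ⟨n, z, mem_cutMinus.2 (Or.inr hz), rfl⟩
  obtain ⟨n, z, hz, rfl⟩ := this
  obtain ⟨n', j, h1, h2, h3⟩ := exists_normalized_minusPt hAB n hz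
  exact ⟨n', z + j, h1, h2, (add_int_mem_cutMinus j).2 hz, h3⟩

theorem eq_of_normalized {a d m m' j : ℤ} (h : m' = m + d * j) (hd : |d| = a) (h1 : 0 ≤ m)
    (h2 : m < a) (h3 : 0 ≤ m') (h4 : m' < a) : j = 0 := by
  by_contra hj
  have h5 : a ≤ |d * j| := by
    rw [abs_mul, hd]
    have := Int.one_le_abs hj
    nlinarith
  have h6 : |d * j| < a := by rw [abs_lt]; constructor <;> linarith
  omega

theorem plusPt_normalized_eq {m m' : ℤ} {z z' : ℂ} (h1 : 0 ≤ m) (h2 : m < A) (h3 : 0 ≤ m')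
    (h4 : m' < A) (hz : z ∈ cutPlus) (hz' : z' ∈ cutPlus)
    (h : plusPt A B m z = plusPt A B m' z') : m = m' ∧ z = z' := by
  obtain ⟨j, rfl, hj⟩ := (plusPt_eq_plusPt hz hz').1 h
  have : j = 0 := eq_of_normalized (d := -A) (a := A) (by rw [hj]; ring) (by simp) h1 h2 h3 h4
  subst this
  simp [hj]

theorem minusPt_normalized_eq {n n' : ℤ} {z z' : ℂ} (h1 : 0 ≤ n) (h2 : n < |(B : ℤ) - A|)
    (h3 : 0 ≤ n') (h4 : n' < |(B : ℤ) - A|) (hz : z ∈ cutMinus) (hz' : z' ∈ cutMinus)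
    (h : minusPt A B n z = minusPt A B n' z') : n = n' ∧ z = z' := by
  obtain ⟨j, rfl, hj⟩ := (minusPt_eq_minusPt hz hz').1 h
  have : j = 0 := eq_of_normalized hj rfl h1 h2 h3 h4
  subst this
  simp [hj]

theorem exists_fun_plusPt {Q : Type*} [Inhabited Q] (F : ℤ → ℂ → Q) :
    ∃ f : Surface A B → Q, ∀ (m : ℤ) (z : ℂ), 0 ≤ m → m < A → z ∈ cutPlus → f (plusPt A B m z) = F m z := by
  classical
  refine ⟨fun p => if h : ∃ x : ℤ × ℂ, 0 ≤ x.1 ∧ x.1 < A ∧ x.2 ∈ cutPlus ∧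
    p = plusPt A B x.1 x.2 then F h.choose.1 h.choose.2 else default, fun m z h1 h2 hz => ?_⟩
  have h : ∃ x : ℤ × ℂ, 0 ≤ x.1 ∧ x.1 < A ∧ x.2 ∈ cutPlus ∧
    plusPt A B m z = plusPt A B x.1 x.2 := ⟨(m, z), h1, h2, hz, rfl⟩
  simp only [dif_pos h]
  obtain ⟨h3, h4, h5, h6⟩ := h.choose_spec
  obtain ⟨h7, h8⟩ := plusPt_normalized_eq h1 h2 h3 h4 hz h5 h6
  rw [← h7, ← h8]

theorem exists_fun_minusPt {Q : Type*} [Inhabited Q] (F : ℤ → ℂ → Q) :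
    ∃ f : Surface A B → Q, ∀ (n : ℤ) (z : ℂ), 0 ≤ n → n < |(B : ℤ) - A| → z ∈ cutMinus →
      f (minusPt A B n z) = F n z := by
  classical
  refine ⟨fun p => if h : ∃ x : ℤ × ℂ, 0 ≤ x.1 ∧ x.1 < |(B : ℤ) - A| ∧ x.2 ∈ cutMinus ∧
    p = minusPt A B x.1 x.2 then F h.choose.1 h.choose.2 else default, fun m z h1 h2 hz => ?_⟩
  have h : ∃ x : ℤ × ℂ, 0 ≤ x.1 ∧ x.1 < |(B : ℤ) - A| ∧ x.2 ∈ cutMinus ∧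
    minusPt A B m z = minusPt A B x.1 x.2 := ⟨(m, z), h1, h2, hz, rfl⟩
  simp only [dif_pos h]
  obtain ⟨h3, h4, h5, h6⟩ := h.choose_spec
  obtain ⟨h7, h8⟩ := minusPt_normalized_eq h1 h2 h3 h4 hz h5 h6
  rw [← h7, ← h8]

end Height

/-! ### Potentials on the upper and on the lower half of `X` -/

section Halves

open Set Topology

variable {A B : ℕ} {ε M : ℝ} {Q : Type*} [AddCommGroup Q]
  {κ : C(stdSimplex ℝ (Fin 2), XSurf A B ε M) → Q}

/-- The closed upper half of `X`. -/
def upperX (A B : ℕ) (ε M : ℝ) : Set (Surface A B) := XSurf A B ε M ∩ {p | 0 ≤ height p}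

/-- The closed lower half of `X`. -/
def lowerX (A B : ℕ) (ε M : ℝ) : Set (Surface A B) := XSurf A B ε M ∩ {p | height p ≤ 0}

/-- `u` is a potential of the cocycle `κ` on `S`. -/
def IsPotential {Y : Type} [TopologicalSpace Y] {X : Set Y} (κ : C(stdSimplex ℝ (Fin 2), X) → Q)
    (S : Set Y) (u : Y → Q) : Prop :=
  ∀ γ : ℝ → Y, ContinuousOn γ (Icc 0 1) → MapsTo γ (Icc 0 1) S → val κ γ = u (γ 1) - u (γ 0)

theorem convex_le_im (c : ℝ) : Convex ℝ {z : ℂ | c ≤ z.im} := convex_halfSpace_im_ge c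

/-- The upper half of `X` retracts onto the half-planes `{ε/M ≤ Im z₊}` of the sheets of `Σ⁺` by moving
vertically upwards, and half-planes are convex. So every cocycle has a potential there, with a
prescribed zero on each sheet. -/
theorem exists_upper_potential (hA : 0 < A) (hε : 0 < ε) (hM : 0 < M) (hκ : IsCocycle κ)
    (b : ℤ → ℂ) (hb : ∀ m, ε / M ≤ (b m).im) :
    ∃ u : Surface A B → Q, IsPotential κ (upperX A B ε M) u ∧
      ∀ m : ℤ, 0 ≤ m → m < A → u (plusPt A B m (b m)) = 0 := by
  have hη : 0 < ε / M := by positivity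
  let F : ℤ → ℂ → Q := fun m z =>
    pot κ (plusPt A B m) (fun _ => (ε / M : ℝ) * Complex.I) (b m) z -
      pot κ (plusPt A B m) (fun _ => (ε / M : ℝ) * Complex.I) (b m) (b m)
  have : Inhabited Q := ⟨0⟩
  obtain ⟨u, hu⟩ := exists_fun_plusPt (A := A) (B := B) F
  refine ⟨u, fun γ hγ hm => ?_, fun m h1 h2 => ?_⟩
  · refine val_eq_of_local hκ inter_subset_left u ?_ hγ hm
    rintro p ⟨-, hp0⟩
    obtain ⟨m, z, h1, h2, hz, rfl⟩ := exists_plusPt_of_height hA hp0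
    refine ⟨plusPt A B m '' (univ ∩ cutPlus), isOpen_image_plusPt m isOpen_univ,
      ⟨z, ⟨mem_univ _, hz⟩, rfl⟩, fun γ hγ hm => ?_⟩
    obtain ⟨z, hzc, hz⟩ := exists_lift_plus hA m inter_subset_right hγ
      (hm.mono le_rfl inter_subset_right)
    have e : EqOn γ (fun t => plusPt A B m (z t)) (Icc 0 1) := fun t ht => (hz t ht).2
    have m0 : (0 : ℝ) ∈ Icc (0 : ℝ) 1 := by simp
    have m1 : (1 : ℝ) ∈ Icc (0 : ℝ) 1 := by simp
    rw [val_congr e, e m0, e m1]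
    simp only
    rw [hu m _ h1 h2 (hz 0 m0).1.2, hu m _ h1 h2 (hz 1 m1).1.2]
    have him : ∀ t ∈ Icc (0 : ℝ) 1, 0 ≤ (z t).im := fun t ht => by
      have := (hm ht).1.2
      rwa [mem_ofPred_eq, e ht, height_plusPt m (hz t ht).1.2] at this
    rw [val_eq_pot hκ (continuousOn_plusPt m) (w := fun _ => (ε / M : ℝ) * Complex.I)
      continuous_const (convex_le_im (ε / M))
      (fun w hw => mem_cutPlus.2 (Or.inr (hη.trans_le hw)))
      (fun w hw => Or.inl (high_mem_SigmaPlus hA (mem_cutPlus.2 (Or.inr (hη.trans_le hw))) hw))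
      (hb m) hzc (fun t ht s hs => ?_) (fun t ht => ?_)]
    · simp only [F, sub_sub_sub_cancel_right]
    · have hre : (z t + s * ((ε / M : ℝ) * Complex.I)).re = (z t).re := by simp
      have hle : (z t).im ≤ (z t + s * ((ε / M : ℝ) * Complex.I)).im := by
        simp only [Complex.add_im, Complex.im_ofReal_mul, Complex.I_im]
        have := mul_nonneg hs.1 hη.le
        linarith
      refine ⟨vertical_mem_cutPlus (hz t ht).1.2 hre hle, XSurf_up hA hε hM (hz t ht).1.2 ?_ hre
        (him t ht) hle⟩
      have := (hm ht).1.1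
      rwa [e ht] at this
    · have := him t ht
      simp only [mem_ofPred_eq, Complex.add_im, Complex.im_ofReal_mul, Complex.I_im]
      linarith
  · rw [hu m _ h1 h2 (mem_cutPlus.2 (Or.inr (hη.trans_le (hb m))))]
    simp [F]

/-- Over a sheet which does not meet `Σ⁻`, the surface `X` is a union of legs of `Σ⁺`. -/
theorem exists_shift_of_not_hasSheet (hA : 0 < A) {n k : ℤ} (hn : ¬ HasSheet A B n) :
    ∃ j : ℤ, ∀ z : ℂ, (k : ℝ) < z.re → z.re < k + 1 →
      (minusPt A B n z ∈ XSurf A B ε M ↔ z + j ∈ sheetRegion 1 ε M) := by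
  refine ⟨(n - B * k) / A, fun z h1 h2 => ?_⟩
  have hne := ne_int_of_mem h1 h2
  have hk := (floor_eq_of_strip hne k).2 ⟨h1, h2⟩
  have hzp : z ∈ cutPlus := mem_cutPlus.2 (Or.inl hne)
  have hzm : z ∈ cutMinus := mem_cutMinus.2 (Or.inl hne)
  have e1 := Int.mul_ediv_self_le (x := n - B * k) (k := (A : ℤ)) (by omega)
  have e2 := Int.lt_mul_ediv_self_add (x := n - B * k) (k := (A : ℤ)) (by omega)
  constructor
  · rintro (h | h)
    · rw [minusPt_eq_plusPt_floor n hne, hk, plusPt_mem_SigmaPlus_iff hA hzp] at h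
      obtain ⟨j, h3, h4, h5⟩ := h
      have : (n - B * k) / A = j := by
        rw [Int.ediv_eq_iff_of_pos (by omega)]
        constructor <;> nlinarith
      rwa [this]
    · obtain ⟨j, h3, h4, -⟩ := (minusPt_mem_SigmaMinus hzm).1 h
      exact absurd ⟨j, h3, h4⟩ hn
  · intro h
    left
    rw [minusPt_eq_plusPt_floor n hne, hk, plusPt_mem_SigmaPlus_iff hA hzp]
    exact ⟨_, by linarith, by linarith, h⟩

/-- The lower half of `X` retracts downwards onto half-planes only over the sheets of `Σ⁻`. Over the
other strips it consists of legs of `Σ⁺` that lie in one strip and contract inside it; there the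
constant of the potential is chosen so that it agrees with `v` on the real line. Hence the jump
across the real line can be nonzero only at points of a sheet of `Σ⁻`. -/
theorem exists_lower_potential (hA : 0 < A) (hAB : A ≠ B) (hε : 0 < ε) (hM : 0 < M)
    (hκ : IsCocycle κ) (b : ℤ → ℂ) (hb : ∀ n, (b n).im ≤ -(ε / M)) {v : Surface A B → Q}
    (hv : IsPotential κ (upperX A B ε M) v) :
    ∃ u : Surface A B → Q, IsPotential κ (lowerX A B ε M) u ∧
      (∀ n : ℤ, 0 ≤ n → n < |(B : ℤ) - A| → HasSheet A B n → u (minusPt A B n (b n)) = 0) ∧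
      ∀ p ∈ XSurf A B ε M, height p = 0 → u p ≠ v p →
        ∃ (n : ℤ) (z : ℂ), z ∈ cutMinus ∧ HasSheet A B n ∧ p = minusPt A B n z := by
  classical
  have hη : 0 < ε / M := by positivity
  let K : ℤ → ℤ → Set ℂ := fun n k =>
    {z | z.im = -(ε / M) ∧ (k : ℝ) < z.re ∧ z.re < k + 1 ∧ minusPt A B n z ∈ XSurf A B ε M}
  let b' : ℤ → ℤ → ℂ := fun n k => if h : (K n k).Nonempty then h.choose else 0
  let W : ℂ → ℂ := fun z => (-(ε / M + z.im) : ℝ) * Complex.I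
  let C : ℤ → ℤ → Q := fun n k =>
    if h : ∃ x : ℝ, (k : ℝ) < x ∧ x < k + 1 ∧ minusPt A B n x ∈ XSurf A B ε M then
      v (minusPt A B n h.choose) - pot κ (minusPt A B n) W (b' n k) h.choose else 0
  let F₁ : ℤ → ℂ → Q := fun n z =>
    pot κ (minusPt A B n) (fun _ => (-(ε / M) : ℝ) * Complex.I) (b n) z -
      pot κ (minusPt A B n) (fun _ => (-(ε / M) : ℝ) * Complex.I) (b n) (b n)
  let F₂ : ℤ → ℤ → ℂ → Q := fun n k z => pot κ (minusPt A B n) W (b' n k) z + C n k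
  have : Inhabited Q := ⟨0⟩
  obtain ⟨u, hu⟩ := exists_fun_minusPt (A := A) (B := B) fun n z =>
    if HasSheet A B n then F₁ n z else F₂ n ⌊z.re⌋ z
  have hlow : IsPotential κ (lowerX A B ε M) u := by
    refine fun γ hγ hm => val_eq_of_local hκ inter_subset_left u ?_ hγ hm
    rintro p ⟨hpX, hp0⟩
    obtain ⟨n, z₀, h1, h2, hz₀, rfl⟩ := exists_minusPt_of_height hA hAB hp0
    have m0 : (0 : ℝ) ∈ Icc (0 : ℝ) 1 := by simp
    have m1 : (1 : ℝ) ∈ Icc (0 : ℝ) 1 := by simp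
    by_cases hn : HasSheet A B n
    · refine ⟨minusPt A B n '' (univ ∩ cutMinus), isOpen_image_minusPt n isOpen_univ,
        ⟨z₀, ⟨mem_univ _, hz₀⟩, rfl⟩, fun γ hγ hm => ?_⟩
      obtain ⟨z, hzc, hz⟩ := exists_lift_minus hAB n inter_subset_right hγ
        (hm.mono le_rfl inter_subset_right)
      have e : EqOn γ (fun t => minusPt A B n (z t)) (Icc 0 1) := fun t ht => (hz t ht).2
      rw [val_congr e, e m0, e m1]
      simp only
      rw [hu n _ h1 h2 (hz 0 m0).1.2, hu n _ h1 h2 (hz 1 m1).1.2, if_pos hn, if_pos hn]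
      have him : ∀ t ∈ Icc (0 : ℝ) 1, (z t).im ≤ 0 := fun t ht => by
        have := (hm ht).1.2
        rwa [mem_ofPred_eq, e ht, height_minusPt n (hz t ht).1.2] at this
      rw [val_eq_pot hκ (continuousOn_minusPt n) (w := fun _ => (-(ε / M) : ℝ) * Complex.I)
        continuous_const
        (convex_halfSpace_im_le (-(ε / M)))
        (fun w hw => mem_cutMinus.2 (Or.inr (lt_of_le_of_lt hw (by linarith))))
        (fun w hw => Or.inr (low_mem_SigmaMinus hn
          (mem_cutMinus.2 (Or.inr (lt_of_le_of_lt hw (by linarith)))) hw))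
        (hb n) hzc (fun t ht s hs => ?_) (fun t ht => ?_)]
      · simp only [F₁, sub_sub_sub_cancel_right]
      · have hre : (z t + s * ((-(ε / M) : ℝ) * Complex.I)).re = (z t).re := by simp
        have hle : (z t + s * ((-(ε / M) : ℝ) * Complex.I)).im ≤ (z t).im := by
          simp only [Complex.add_im, Complex.im_ofReal_mul, Complex.I_im]
          have := mul_nonneg hs.1 hη.le
          linarith
        refine ⟨vertical_mem_cutMinus (hz t ht).1.2 hre hle, XSurf_down hA hε hM hn (hz t ht).1.2 ?_
          hre (him t ht) hle⟩
        have := (hm ht).1.1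
        rwa [e ht] at this
      · have := him t ht
        simp only [mem_ofPred_eq, Complex.add_im, Complex.im_ofReal_mul, Complex.I_im]
        linarith
    · -- without `Σ⁻`, the point lies on a leg of `Σ⁺`, which is contracted inside one strip
      have hne : ∀ k : ℤ, z₀.re ≠ k := by
        rcases hpX with h | h
        · exact minusPt_mem_SigmaPlus hz₀ h
        · obtain ⟨j, h3, h4, -⟩ := (minusPt_mem_SigmaMinus hz₀).1 h
          exact absurd ⟨j, h3, h4⟩ hn
      set k := ⌊z₀.re⌋ with hk
      have hstrip : {z : ℂ | (k : ℝ) < z.re ∧ z.re < k + 1} ⊆ cutMinus := fun z hz =>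
        mem_cutMinus.2 (Or.inl (ne_int_of_mem hz.1 hz.2))
      obtain ⟨j, hj⟩ := exists_shift_of_not_hasSheet (ε := ε) (M := M) (k := k) hA hn
      refine ⟨minusPt A B n '' ({z : ℂ | (k : ℝ) < z.re ∧ z.re < k + 1} ∩ cutMinus),
        isOpen_image_minusPt n (isOpen_strip k), ⟨z₀, ⟨(floor_eq_of_strip hne k).1 hk.symm, hz₀⟩, rfl⟩,
        fun γ hγ hm => ?_⟩
      obtain ⟨z, hzc, hz⟩ := exists_lift_minus hAB n inter_subset_right hγ
        (hm.mono le_rfl inter_subset_right)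
      have e : EqOn γ (fun t => minusPt A B n (z t)) (Icc 0 1) := fun t ht => (hz t ht).2
      have him : ∀ t ∈ Icc (0 : ℝ) 1, (z t).im ≤ 0 := fun t ht => by
        have := (hm ht).1.2
        rwa [mem_ofPred_eq, e ht, height_minusPt n (hz t ht).1.2] at this
      have hs : ∀ t ∈ Icc (0 : ℝ) 1, z t + j ∈ sheetRegion 1 ε M := fun t ht => by
        have := (hm ht).1.1
        rw [e ht] at this
        exact (hj _ (hz t ht).1.1.1 (hz t ht).1.1.2).1 this
      have hfl : ∀ t ∈ Icc (0 : ℝ) 1, ⌊(z t).re⌋ = k := fun t ht =>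
        (floor_eq_of_strip (ne_int_of_mem (hz t ht).1.1.1 (hz t ht).1.1.2) k).2 (hz t ht).1.1
      have hdown : ∀ t ∈ Icc (0 : ℝ) 1, ∀ s ∈ Icc (0 : ℝ) 1,
          z t + s * W (z t) ∈ cutMinus ∧ minusPt A B n (z t + s * W (z t)) ∈ XSurf A B ε M := by
        intro t ht s hs'
        have hre : (z t + s * W (z t)).re = (z t).re := by simp [W]
        have him' : (z t + s * W (z t)).im = (z t).im - s * (ε / M + (z t).im) := by
          simp only [W, Complex.add_im, Complex.im_ofReal_mul, Complex.I_im]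
          ring
        have hleg := mem_leg_of_lt (hs t ht) (by
          have := him t ht
          simp only [Complex.add_im, Complex.intCast_im, add_zero, one_mul]
          linarith)
        have hlow : -(ε / M) ≤ (z t).im := by simpa using hleg.2.1
        have h3 : 0 ≤ s * (ε / M + (z t).im) := mul_nonneg hs'.1 (by linarith)
        have h4 : s * (ε / M + (z t).im) ≤ ε / M + (z t).im :=
          mul_le_of_le_one_left (by linarith) hs'.2
        refine ⟨hstrip (by rw [mem_ofPred_eq, hre]; exact (hz t ht).1.1), ?_⟩
        refine (hj _ (by rw [hre]; exact (hz t ht).1.1.1) (by rw [hre]; exact (hz t ht).1.1.2)).2 ?_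
        refine sheetRegion_down hε hM (hs t ht) (by simp [hre]) ?_ ?_ ?_ (by norm_num) <;>
        simp only [Complex.add_im (_ + _) (j : ℂ), Complex.add_im (z t) (j : ℂ), him',
          Complex.intCast_im, add_zero, one_mul]
        · exact him t ht
        · linarith
        · linarith
      have hKend : ∀ t ∈ Icc (0 : ℝ) 1, z t + W (z t) ∈ K n k := by
        intro t ht
        have := (hdown t ht 1 m1).2
        simp only [Complex.ofReal_one, one_mul] at this
        refine ⟨?_, ?_, ?_, this⟩
        · simp only [W, Complex.add_im, Complex.im_ofReal_mul, Complex.I_im]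
          ring
        · simpa [W] using (hz t ht).1.1.1
        · simpa [W] using (hz t ht).1.1.2
      have hKn : (K n k).Nonempty := ⟨_, hKend 0 m0⟩
      have hKconv : Convex ℝ (K n k) := by
        rw [convex_iff_segment_subset]
        rintro x ⟨hx1, hx2, hx3, hx4⟩ y ⟨hy1, hy2, hy3, hy4⟩ w hw
        have hwim : w.im = -(ε / M) := by
          have h5 : Convex ℝ {z : ℂ | z.im = -(ε / M)} :=
            convex_hyperplane (Complex.imLm.isLinear) (-(ε / M))
          exact h5.segment_subset hx1 hy1 hw
        have hwre : w.re ∈ uIcc x.re y.re := by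
          rw [segment_eq_image_lineMap] at hw
          obtain ⟨s, hs, rfl⟩ := hw
          have h6 : (AffineMap.lineMap x y s : ℂ).re = AffineMap.lineMap x.re y.re s := by
            simp [AffineMap.lineMap_apply]
          rw [h6, ← segment_eq_uIcc]
          exact lineMap_mem_segment _ _ hs
        have hwk : (k : ℝ) < w.re ∧ w.re < k + 1 := by
          rcases mem_uIcc.1 hwre with h | h
          · exact ⟨hx2.trans_le h.1, h.2.trans_lt hy3⟩
          · exact ⟨hy2.trans_le h.1, h.2.trans_lt hx3⟩
        refine ⟨hwim, hwk.1, hwk.2, (hj w hwk.1 hwk.2).2 (leg_subset ?_)⟩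
        have hx5 := mem_leg_of_lt ((hj x hx2 hx3).1 hx4) (by simp [hx1]; linarith)
        have hy5 := mem_leg_of_lt ((hj y hy2 hy3).1 hy4) (by simp [hy1]; linarith)
        refine leg_horizontal hε (k := k + j) hx5 hy5 ?_ ?_ ?_ ?_ ?_
        · simp only [Complex.add_re, Complex.intCast_re, Int.cast_add]
          constructor <;> linarith
        · simp only [Complex.add_re, Complex.intCast_re, Int.cast_add]
          constructor <;> linarith
        · simp [hx1, hy1]
        · simp [hwim, hx1]
        · simp only [Complex.add_re, Complex.intCast_re]
          rcases mem_uIcc.1 hwre with h | h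
          · exact mem_uIcc.2 (Or.inl ⟨by linarith, by linarith⟩)
          · exact mem_uIcc.2 (Or.inr ⟨by linarith, by linarith⟩)
      have hb' : b' n k ∈ K n k := by
        simp only [b', dif_pos hKn]
        exact hKn.choose_spec
      rw [val_congr e, e m0, e m1]
      simp only
      rw [hu n _ h1 h2 (hz 0 m0).1.2, hu n _ h1 h2 (hz 1 m1).1.2, if_neg hn, if_neg hn, hfl 0 m0,
        hfl 1 m1]
      rw [val_eq_pot hκ (continuousOn_minusPt n) (w := W) (by fun_prop) hKconv
        (fun w hw => hstrip ⟨hw.2.1, hw.2.2.1⟩) (fun w hw => hw.2.2.2) hb' hzc hdown hKend]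
      simp only [F₂, add_sub_add_right_eq_sub]
  refine ⟨u, hlow, fun n h1 h2 hn => ?_, fun p hpX hp0 hne => ?_⟩
  · rw [hu n _ h1 h2 (mem_cutMinus.2 (Or.inr ((hb n).trans_lt (by linarith)))), if_pos hn]
    simp [F₁]
  · obtain ⟨n, z, h1, h2, hz, rfl⟩ := exists_minusPt_of_height hA hAB hp0.le
    refine ⟨n, z, hz, ?_, rfl⟩
    by_contra hn
    apply hne
    rw [height_minusPt n hz] at hp0
    have hint : ∀ k : ℤ, z.re ≠ k := (mem_cutMinus.1 hz).resolve_right (by rw [hp0]; exact lt_irrefl 0)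
    set k := ⌊z.re⌋ with hk
    have hzk := (floor_eq_of_strip hint k).1 hk.symm
    obtain ⟨x, rfl⟩ : ∃ x : ℝ, z = x := ⟨z.re, Complex.ext (by simp) (by simpa using hp0)⟩
    simp only [Complex.ofReal_re] at hzk hk
    have hx : ∃ x : ℝ, (k : ℝ) < x ∧ x < k + 1 ∧ minusPt A B n x ∈ XSurf A B ε M :=
      ⟨x, hzk.1, hzk.2, hpX⟩
    obtain ⟨hy1, hy2, hy3⟩ := hx.choose_spec
    set y := hx.choose with hy
    have hymem : (y : ℂ) ∈ cutMinus := mem_cutMinus.2 (Or.inl (ne_int_of_mem hy1 hy2))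
    have hyfl : ⌊(y : ℂ).re⌋ = k := (floor_eq_of_strip (ne_int_of_mem hy1 hy2) k).2 ⟨hy1, hy2⟩
    have huy : u (minusPt A B n y) = v (minusPt A B n y) := by
      rw [hu n _ h1 h2 hymem, if_neg hn, hyfl]
      simp only [F₂, C, dif_pos hx, ← hy]
      abel
    obtain ⟨j, hj⟩ := exists_shift_of_not_hasSheet (ε := ε) (M := M) (k := k) hA hn
    have hseg : ∀ w ∈ uIcc y x, (k : ℝ) < w ∧ w < k + 1 ∧ minusPt A B n w ∈ XSurf A B ε M := by
      intro w hw
      have hwk : (k : ℝ) < w ∧ w < k + 1 := by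
        rcases mem_uIcc.1 hw with h | h
        · exact ⟨hy1.trans_le h.1, h.2.trans_lt hzk.2⟩
        · exact ⟨hzk.1.trans_le h.1, h.2.trans_lt hy2⟩
      refine ⟨hwk.1, hwk.2, (hj w hwk.1 hwk.2).2 (leg_subset ?_)⟩
      have hx5 := mem_leg_of_lt ((hj y hy1 hy2).1 hy3) (by simpa using hη)
      have hy5 := mem_leg_of_lt ((hj x hzk.1 hzk.2).1 hpX) (by simpa using hη)
      refine leg_horizontal hε (k := k + j) hx5 hy5 ?_ ?_ ?_ ?_ ?_
      · simp only [Complex.add_re, Complex.intCast_re, Int.cast_add, Complex.ofReal_re]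
        constructor <;> linarith
      · simp only [Complex.add_re, Complex.intCast_re, Int.cast_add, Complex.ofReal_re]
        constructor <;> linarith
      · simp
      · simp
      · simp only [Complex.add_re, Complex.intCast_re, Complex.ofReal_re]
        rcases mem_uIcc.1 hw with h | h
        · exact mem_uIcc.2 (Or.inl ⟨by linarith, by linarith⟩)
        · exact mem_uIcc.2 (Or.inr ⟨by linarith, by linarith⟩)
    have hγ : ContinuousOn (fun t : ℝ => minusPt A B n (AffineMap.lineMap y x t : ℝ)) (Icc 0 1) :=
      (continuousOn_minusPt n).comp (Complex.continuous_ofReal.comp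
        AffineMap.lineMap_continuous).continuousOn (fun t ht => by
          have := hseg _ (segment_eq_uIcc y x ▸ lineMap_mem_segment y x ht)
          exact mem_cutMinus.2 (Or.inl (ne_int_of_mem this.1 this.2.1)))
    have hγm : ∀ t ∈ Icc (0 : ℝ) 1, minusPt A B n (AffineMap.lineMap y x t : ℝ) ∈ XSurf A B ε M ∧
        height (minusPt A B n (AffineMap.lineMap y x t : ℝ)) = 0 := fun t ht => by
      have := hseg _ (segment_eq_uIcc y x ▸ lineMap_mem_segment y x ht)
      refine ⟨this.2.2, ?_⟩
      rw [height_minusPt n (mem_cutMinus.2 (Or.inl (ne_int_of_mem this.1 this.2.1)))]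
      simp
    have e1 := hv _ hγ (fun t ht => ⟨(hγm t ht).1, (hγm t ht).2.ge⟩)
    have e2 := hlow _ hγ (fun t ht => ⟨(hγm t ht).1, (hγm t ht).2.le⟩)
    simp only [AffineMap.lineMap_apply_zero, AffineMap.lineMap_apply_one] at e1 e2
    rw [e1, huy] at e2
    simpa using e2.symm

end Halves

/-! ### A potential on `X` with jumps across the real line -/

section Local

open Set Topology

variable {A B : ℕ} {ε M : ℝ} {Q : Type*} [AddCommGroup Q]
  {κ : C(stdSimplex ℝ (Fin 2), XSurf A B ε M) → Q}

/-- The jump of a potential across the real line: the points of `X` over the real line at which it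
is evaluated, and its values. -/
def jumps (A B : ℕ) (ε M : ℝ) (v w : Surface A B → Q) : Set Q :=
  {e | ∃ p ∈ XSurf A B ε M, height p = 0 ∧ e = v p - w p}

open Classical in
/-- The function equal to `v` on the closed upper half and to `w` on the open lower half. -/
def glue (v w : Surface A B → Q) (p : Surface A B) : Q := if 0 ≤ height p then v p else w p

/-- Near a point `x` of the real line, the points of `Σ⁺` and `Σ⁻` on the given sheets can be moved
horizontally to the vertical line through `x`. -/
theorem eventually_horizontal (hA : 0 < A) (hAB : A ≠ B) (hε : 0 < ε) (hM : 0 < M) {m k : ℤ} {x : ℝ}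
    (h1 : (k : ℝ) < x) (h2 : x < k + 1) :
    ∃ δ > 0, δ ≤ ε / M ∧ k < x - δ ∧ x + δ < k + 1 ∧ ∀ z : ℂ, |z.re - x| < δ → |z.im| < δ →
      plusPt A B m z ∈ XSurf A B ε M → ∀ s ∈ Icc (0 : ℝ) 1,
        plusPt A B m (z + s * ((x - z.re : ℝ) : ℂ)) ∈ XSurf A B ε M := by
  have hη : 0 < ε / M := by positivity
  have hABi : (B : ℤ) - A ≠ 0 := by omega
  have f1 : {j : ℤ | 0 ≤ m - A * j ∧ m - A * j < A}.Finite := by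
    refine (Set.finite_Icc (-(|m| + A)) (|m| + A)).subset fun j hj => ?_
    have h3 : |A * j| ≤ |m| + A := by
      rw [abs_le]; constructor <;> cases abs_cases m <;> linarith [hj.1, hj.2]
    rw [abs_mul, Nat.abs_cast] at h3
    rw [mem_Icc, ← abs_le]
    have : (1 : ℤ) ≤ A := by omega
    nlinarith [abs_nonneg j]
  set n := m + B * k
  have f2 : {j : ℤ | 0 ≤ n + (B - A) * j ∧ n + (B - A) * j < A}.Finite := by
    refine (Set.finite_Icc (-(|n| + A)) (|n| + A)).subset fun j hj => ?_
    have h3 : |((B : ℤ) - A) * j| ≤ |n| + A := by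
      rw [abs_le]; constructor <;> cases abs_cases n <;> linarith [hj.1, hj.2]
    rw [abs_mul] at h3
    rw [mem_Icc, ← abs_le]
    have := Int.one_le_abs hABi
    nlinarith [abs_nonneg j]
  have ev : ∀ᶠ z : ℂ in 𝓝 (x : ℂ),
      (∀ j ∈ {j : ℤ | 0 ≤ m - A * j ∧ m - A * j < A}, (x : ℂ) + j ∉ sheetRegion 1 ε M →
        z + j ∉ sheetRegion 1 ε M) ∧
      ∀ j ∈ {j : ℤ | 0 ≤ n + (B - A) * j ∧ n + (B - A) * j < A},
        (x : ℂ) + j ∉ sheetRegion (-1) ε M → z + j ∉ sheetRegion (-1) ε M := by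
    refine Filter.Eventually.and ?_ ?_
    · rw [Filter.eventually_all_finite f1]
      intro j _
      by_cases hx : (x : ℂ) + j ∈ sheetRegion 1 ε M
      · exact Filter.Eventually.of_forall fun z h => absurd hx h
      · have : ∀ᶠ z : ℂ in 𝓝 (x : ℂ), z + j ∈ (sheetRegion 1 ε M)ᶜ :=
          (continuous_id.add continuous_const).continuousAt.eventually_mem
            ((isClosed_sheetRegion.isOpen_compl).mem_nhds hx)
        exact this.mono fun z h _ => h
    · rw [Filter.eventually_all_finite f2]
      intro j _
      by_cases hx : (x : ℂ) + j ∈ sheetRegion (-1) ε M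
      · exact Filter.Eventually.of_forall fun z h => absurd hx h
      · have : ∀ᶠ z : ℂ in 𝓝 (x : ℂ), z + j ∈ (sheetRegion (-1) ε M)ᶜ :=
          (continuous_id.add continuous_const).continuousAt.eventually_mem
            ((isClosed_sheetRegion.isOpen_compl).mem_nhds hx)
        exact this.mono fun z h _ => h
  obtain ⟨r, hr, hball⟩ := Metric.eventually_nhds_iff.1 ev
  obtain ⟨δ, hδ0, hδ1⟩ : ∃ δ > 0, δ ≤ min (min (r / 2) (ε / (2 * M))) (min ((x - k) / 2) ((k + 1 - x) / 2)) :=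
    ⟨_, lt_min (lt_min (by linarith) (by positivity)) (lt_min (by linarith) (by linarith)), le_rfl⟩
  have hδr : δ ≤ r / 2 := hδ1.trans ((min_le_left _ _).trans (min_le_left _ _))
  have hδη : δ ≤ ε / (2 * M) := hδ1.trans ((min_le_left _ _).trans (min_le_right _ _))
  have hδa : δ ≤ (x - k) / 2 := hδ1.trans ((min_le_right _ _).trans (min_le_left _ _))
  have hδb : δ ≤ (k + 1 - x) / 2 := hδ1.trans ((min_le_right _ _).trans (min_le_right _ _))
  have hη2 : ε / (2 * M) = ε / M / 2 := by field_simp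
  rw [hη2] at hδη
  refine ⟨δ, hδ0, by linarith, by linarith, by linarith, fun z hzr hzi hX s hs => ?_⟩
  have hdist : dist z x < r := by
    rw [dist_eq_norm]
    refine (Complex.norm_le_abs_re_add_abs_im _).trans_lt ?_
    simp only [Complex.sub_re, Complex.ofReal_re, Complex.sub_im, Complex.ofReal_im, sub_zero]
    linarith
  obtain ⟨g1, g2⟩ := hball hdist
  set v := z + s * ((x - z.re : ℝ) : ℂ) with hv
  have hvre : v.re = z.re + s * (x - z.re) := by simp [hv]
  have hvim : v.im = z.im := by simp [hv]
  have hvr : v.re ∈ uIcc z.re x := by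
    rw [← segment_eq_uIcc, segment_eq_image_lineMap]
    exact ⟨s, hs, by rw [hvre]; simp [AffineMap.lineMap_apply]; ring⟩
  rw [abs_lt] at hzr
  have hzk : (k : ℝ) < z.re ∧ z.re < k + 1 := ⟨by linarith, by linarith⟩
  have hvk : (k : ℝ) < v.re ∧ v.re < k + 1 := by
    rcases mem_uIcc.1 hvr with h | h
    · exact ⟨hzk.1.trans_le h.1, h.2.trans_lt h2⟩
    · exact ⟨h1.trans_le h.1, h.2.trans_lt hzk.2⟩
  have hzne := ne_int_of_mem hzk.1 hzk.2
  have hvne := ne_int_of_mem hvk.1 hvk.2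
  have hzfl := (floor_eq_of_strip hzne k).2 hzk
  have hvfl := (floor_eq_of_strip hvne k).2 hvk
  have key : ∀ (t : ℝ) (j : ℤ), |t| = 1 → z + j ∈ sheetRegion t ε M →
      (x : ℂ) + j ∈ sheetRegion t ε M → v + j ∈ sheetRegion t ε M := by
    intro t j ht hz hx
    have ht1 : t * z.im ≤ |z.im| := (le_abs_self _).trans (by rw [abs_mul, ht, one_mul])
    have hz' := mem_leg_of_lt hz (by
      simp only [Complex.add_im, Complex.intCast_im, add_zero]
      linarith)
    have hx' := mem_leg_of_lt hx (by simpa using hη)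
    refine leg_subset (leg_horizontal hε (k := k + j) hz' hx' ?_ ?_ ?_ ?_ ?_)
    · simp only [Complex.add_re, Complex.intCast_re, Int.cast_add]
      constructor <;> linarith
    · simp only [Complex.add_re, Complex.intCast_re, Int.cast_add, Complex.ofReal_re]
      constructor <;> linarith
    · simp only [Complex.add_im, Complex.ofReal_im, Complex.intCast_im, add_zero]
      nlinarith [sq_nonneg z.im]
    · simp [hvim]
    · simp only [Complex.add_re, Complex.intCast_re, Complex.ofReal_re]
      rcases mem_uIcc.1 hvr with h | h
      · exact mem_uIcc.2 (Or.inl ⟨by linarith, by linarith⟩)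
      · exact mem_uIcc.2 (Or.inr ⟨by linarith, by linarith⟩)
  rcases hX with hX | hX
  · left
    rw [plusPt_mem_SigmaPlus_iff hA (mem_cutPlus.2 (Or.inl hzne))] at hX
    obtain ⟨j, h3, h4, h5⟩ := hX
    rw [plusPt_mem_SigmaPlus_iff hA (mem_cutPlus.2 (Or.inl hvne))]
    exact ⟨j, h3, h4, key 1 j (by simp) h5 (by_contra fun h => g1 j ⟨h3, h4⟩ h h5)⟩
  · right
    rw [plusPt_eq_minusPt_floor m hzne, hzfl, minusPt_mem_SigmaMinus (mem_cutMinus.2 (Or.inl hzne))]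
      at hX
    obtain ⟨j, h3, h4, h5⟩ := hX
    rw [plusPt_eq_minusPt_floor m hvne, hvfl, minusPt_mem_SigmaMinus (mem_cutMinus.2 (Or.inl hvne))]
    exact ⟨j, h3, h4, key (-1) j (by simp) h5 (by_contra fun h => g2 j ⟨h3, h4⟩ h h5)⟩

/-- The vertical line through a point of `X` over the real line lies in `X` near that point. -/
theorem vertical_mem_XSurf (hA : 0 < A) (hε : 0 < ε) (hM : 0 < M) {m : ℤ} {x y : ℝ}
    (hx : ∀ k : ℤ, x ≠ k) (hX : plusPt A B m x ∈ XSurf A B ε M) (hy : |y| ≤ ε / M) :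
    plusPt A B m (x + y * Complex.I) ∈ XSurf A B ε M := by
  rw [abs_le] at hy
  have hre : ((x : ℂ) + y * Complex.I).re = x := by simp
  have him : ((x : ℂ) + y * Complex.I).im = y := by simp
  have hxp : (x : ℂ) ∈ cutPlus := mem_cutPlus.2 (Or.inl hx)
  have hxm : (x : ℂ) ∈ cutMinus := mem_cutMinus.2 (Or.inl hx)
  rcases le_total 0 y with h0 | h0
  · exact XSurf_up hA hε hM hxp hX (by simp) (by simp) (by simpa using h0)
  · rcases hX with hX | hX
    · left
      exact SigmaPlus_down hA hε hM hxp (mem_cutPlus.2 (Or.inl (by rwa [hre]))) hX (by simp)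
        (by simp) (by simpa using h0) (by rw [him]; exact hy.1)
    · right
      rw [plusPt_eq_minusPt_of_re (z := (x : ℂ)) hx rfl] at hX
      rw [plusPt_eq_minusPt_of_re (z := (x : ℂ)) hx (by simp)]
      exact SigmaMinus_down hε hxm hX (by simp) (by simp) (by simpa using h0)

/-- Near a point `p` of `X` over the real line, a cocycle is the coboundary of the function which is
equal to `v` on the closed upper half and to `w + v p - w p` on the open lower half. -/
theorem exists_nhds_potential (hA : 0 < A) (hAB : A ≠ B) (hε : 0 < ε) (hM : 0 < M)
    (hκ : IsCocycle κ) {v w : Surface A B → Q} (hv : IsPotential κ (upperX A B ε M) v)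
    (hw : IsPotential κ (lowerX A B ε M) w) {p : Surface A B} (hp : p ∈ XSurf A B ε M)
    (h0 : height p = 0) : ∃ U, IsOpen U ∧ p ∈ U ∧
      IsPotential κ (XSurf A B ε M ∩ U) (glue v fun q => w q + (v p - w p)) := by
  have m0 : (0 : ℝ) ∈ Icc (0 : ℝ) 1 := by simp
  have m1 : (1 : ℝ) ∈ Icc (0 : ℝ) 1 := by simp
  obtain ⟨m, z₀, -, -, hz₀, rfl⟩ := exists_plusPt_of_height hA h0.ge
  rw [height_plusPt m hz₀] at h0
  have hint : ∀ k : ℤ, z₀.re ≠ k := (mem_cutPlus.1 hz₀).resolve_right (by rw [h0]; exact lt_irrefl 0)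
  obtain ⟨x, rfl⟩ : ∃ x : ℝ, z₀ = x := ⟨z₀.re, Complex.ext (by simp) (by simpa using h0)⟩
  set k := ⌊x⌋ with hk
  have hxk : (k : ℝ) < x ∧ x < k + 1 := (floor_eq_of_strip (z := (x : ℂ)) hint k).1 hk.symm
  obtain ⟨δ, hδ, hδη, hδ1, hδ2, hor⟩ := eventually_horizontal (m := m) hA hAB hε hM hxk.1 hxk.2
  let V : Set ℂ := {z | |z.re - x| < δ ∧ |z.im| < δ}
  have hV : IsOpen V := by
    have h3 : IsOpen {z : ℂ | |z.re - x| < δ} := isOpen_lt (by fun_prop) continuous_const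
    have h4 : IsOpen {z : ℂ | |z.im| < δ} := isOpen_lt (by fun_prop) continuous_const
    exact h3.inter h4
  have hVk : ∀ z ∈ V, ∀ i : ℤ, z.re ≠ i := fun z hz => by
    have := abs_lt.1 hz.1
    exact ne_int_of_mem (k := k) (by linarith) (by linarith)
  have hVc : V ⊆ cutPlus := fun z hz => mem_cutPlus.2 (Or.inl (hVk z hz))
  have hVmove : ∀ z ∈ V, ∀ s ∈ Icc (0 : ℝ) 1, z + s * ((x - z.re : ℝ) : ℂ) ∈ V := by
    intro z hz s hs
    refine ⟨?_, by simpa using hz.2⟩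
    have : (z + s * ((x - z.re : ℝ) : ℂ)).re - x = (1 - s) * (z.re - x) := by
      simp only [Complex.add_re, Complex.re_ofReal_mul, Complex.ofReal_re]
      ring
    rw [this, abs_mul, abs_of_nonneg (by linarith [hs.2])]
    have := hz.1
    nlinarith [abs_nonneg (z.re - x), hs.1, hs.2]
  let K : Set ℂ := {z | z.re = x ∧ |z.im| < δ}
  have hKV : K ⊆ V := fun z hz => ⟨by simpa [hz.1] using hδ, hz.2⟩
  have hKX : MapsTo (plusPt A B m) K (XSurf A B ε M) := fun z hz => by
    have := vertical_mem_XSurf (x := x) hA hε hM hint hp (hz.2.le.trans hδη)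
    have e : (x : ℂ) + z.im * Complex.I = z := by rw [← hz.1]; exact Complex.re_add_im z
    rwa [e] at this
  have hKc : Convex ℝ K := by
    have h3 : Convex ℝ {z : ℂ | z.re = x} := convex_hyperplane (Complex.reLm.isLinear) x
    have h4 : Convex ℝ {z : ℂ | |z.im| < δ} := by
      simp only [abs_lt]
      exact (convex_halfSpace_im_gt (-δ)).inter (convex_halfSpace_im_lt δ)
    exact h3.inter h4
  let W : ℂ → ℂ := fun z => ((x - z.re : ℝ) : ℂ)
  have hWK : ∀ z ∈ V, z + W z ∈ K := fun z hz => ⟨by simp [W], by simpa [W] using hz.2⟩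
  have hxK : (x : ℂ) ∈ K := ⟨by simp, by simpa using hδ⟩
  -- the contraction to the point `x`
  have hpot : ∀ z : ℝ → ℂ, ContinuousOn z (Icc 0 1) → (∀ t ∈ Icc (0 : ℝ) 1, z t ∈ V ∧
      plusPt A B m (z t) ∈ XSurf A B ε M) → val κ (fun t => plusPt A B m (z t)) =
        pot κ (plusPt A B m) W x (z 1) - pot κ (plusPt A B m) W x (z 0) := by
    intro z hzc hz
    exact val_eq_pot hκ ((continuousOn_plusPt m).mono hVc) (w := W) (by fun_prop) hKc hKV hKX hxK
      hzc (fun t ht s hs => ⟨hVmove _ (hz t ht).1 s hs,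
        hor _ (hz t ht).1.1 (hz t ht).1.2 (hz t ht).2 s hs⟩) (fun t ht => hWK _ (hz t ht).1)
  have hpot0 : pot κ (plusPt A B m) W x x = 0 := by
    simp [pot, W, val_const hκ]
  -- the same contraction inside one of the halves
  have hhalf : ∀ z ∈ V, plusPt A B m z ∈ XSurf A B ε M → ∀ (T : Set (Surface A B))
      (u : Surface A B → Q), IsPotential κ T u →
      (∀ y ∈ V, plusPt A B m y ∈ XSurf A B ε M → (∃ c ∈ Icc (0 : ℝ) 1, y.im = c * z.im) →
        plusPt A B m y ∈ T) →
      pot κ (plusPt A B m) W x z = u (plusPt A B m z) - u (plusPt A B m x) := by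
    intro z hz hzX T u hu hT
    have c1 : ContinuousOn (fun s : ℝ => plusPt A B m (z + s * W z)) (Icc 0 1) :=
      ((continuousOn_plusPt m).mono hVc).comp (by fun_prop) (hVmove z hz)
    have c2 : ContinuousOn (fun s : ℝ => plusPt A B m (AffineMap.lineMap (z + W z) (x : ℂ) s))
        (Icc 0 1) :=
      ((continuousOn_plusPt m).mono hVc).comp AffineMap.lineMap_continuous.continuousOn
        (fun s hs => hKV (hKc.segment_subset (hWK z hz) hxK (lineMap_mem_segment _ _ hs)))
    have e1 := hu _ c1 (fun s hs => hT _ (hVmove z hz s hs) (hor _ hz.1 hz.2 hzX s hs)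
      ⟨1, m1, by simp [W]⟩)
    have e2 := hu _ c2 (fun s hs => hT _
      (hKV (hKc.segment_subset (hWK z hz) hxK (lineMap_mem_segment _ _ hs)))
      (hKX (hKc.segment_subset (hWK z hz) hxK (lineMap_mem_segment _ _ hs)))
      ⟨1 - s, ⟨by linarith [hs.2], by linarith [hs.1]⟩, by
        simp [AffineMap.lineMap_apply, W]; ring⟩)
    simp only [AffineMap.lineMap_apply_zero, AffineMap.lineMap_apply_one, Complex.ofReal_zero,
      zero_mul, add_zero, Complex.ofReal_one, one_mul] at e1 e2
    rw [pot, e1, e2]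
    abel
  have hval : ∀ z ∈ V, plusPt A B m z ∈ XSurf A B ε M → pot κ (plusPt A B m) W x z =
      glue v (fun q => w q + (v (plusPt A B m x) - w (plusPt A B m x))) (plusPt A B m z) -
        v (plusPt A B m x) := by
    intro z hz hzX
    have hzh := height_plusPt (A := A) (B := B) m (hVc hz)
    rcases le_or_gt 0 z.im with h | h
    · rw [hhalf z hz hzX _ v hv, glue, if_pos (by rwa [hzh])]
      rintro y hy hyX ⟨c, hc, hyc⟩
      refine ⟨hyX, ?_⟩
      rw [mem_ofPred_eq, height_plusPt m (hVc hy), hyc]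
      exact mul_nonneg hc.1 h
    · rw [hhalf z hz hzX _ w hw, glue, if_neg (by rw [hzh]; exact not_le.2 h)]
      · abel
      · rintro y hy hyX ⟨c, hc, hyc⟩
        refine ⟨hyX, ?_⟩
        rw [mem_ofPred_eq, height_plusPt m (hVc hy), hyc]
        exact mul_nonpos_of_nonneg_of_nonpos hc.1 h.le
  refine ⟨plusPt A B m '' (V ∩ cutPlus), isOpen_image_plusPt m hV,
    ⟨x, ⟨hKV hxK, hz₀⟩, rfl⟩, fun γ hγ hm => ?_⟩
  obtain ⟨z, hzc, hz⟩ := exists_lift_plus hA m inter_subset_right hγ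
    (hm.mono le_rfl inter_subset_right)
  have e : EqOn γ (fun t => plusPt A B m (z t)) (Icc 0 1) := fun t ht => (hz t ht).2
  have hzX : ∀ t ∈ Icc (0 : ℝ) 1, plusPt A B m (z t) ∈ XSurf A B ε M := fun t ht => by
    have := (hm ht).1
    rwa [e ht] at this
  rw [val_congr e, e m0, e m1, hpot z hzc (fun t ht => ⟨(hz t ht).1.1, hzX t ht⟩),
    hval _ (hz 1 m1).1.1 (hzX 1 m1), hval _ (hz 0 m0).1.1 (hzX 0 m0)]
  exact sub_sub_sub_cancel_right _ _ _

/-- A cocycle on `X` is the coboundary of a function which is a potential on the two halves, up to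
the jumps of that function across the real line. -/
theorem val_sub_glue_mem (hA : 0 < A) (hAB : A ≠ B) (hε : 0 < ε) (hM : 0 < M) (hκ : IsCocycle κ)
    {v w : Surface A B → Q} (hv : IsPotential κ (upperX A B ε M) v)
    (hw : IsPotential κ (lowerX A B ε M) w) {γ : ℝ → Surface A B} (hγ : ContinuousOn γ (Icc 0 1))
    (hm : MapsTo γ (Icc 0 1) (XSurf A B ε M)) :
    val κ γ - (glue v w (γ 1) - glue v w (γ 0)) ∈ AddSubgroup.closure (jumps A B ε M v w) := by
  refine val_mem_of_local hκ le_rfl (glue v w) _ ?_ hγ hm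
  intro p hp
  have m0 : (0 : ℝ) ∈ Icc (0 : ℝ) 1 := by simp
  have m1 : (1 : ℝ) ∈ Icc (0 : ℝ) 1 := by simp
  rcases lt_trichotomy (height p) 0 with h0 | h0 | h0
  · refine ⟨{p | height p < 0}, isOpen_lt continuous_height continuous_const, h0,
      fun γ hγ hm => ?_⟩
    rw [hw γ hγ (fun t ht => ⟨(hm ht).1, le_of_lt (show height (γ t) < 0 from (hm ht).2)⟩), glue, glue, if_neg (not_le.2 (show height (γ 0) < 0 from (hm m0).2)),
      if_neg (not_le.2 (show height (γ 1) < 0 from (hm m1).2)), sub_self]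
    exact zero_mem _
  · obtain ⟨U, hU, hpU, h⟩ := exists_nhds_potential hA hAB hε hM hκ hv hw hp h0
    refine ⟨U, hU, hpU, fun γ hγ hm => ?_⟩
    have key : ∀ q, glue v (fun q => w q + (v p - w p)) q - glue v w q ∈
        AddSubgroup.closure (jumps A B ε M v w) := by
      intro q
      unfold glue
      split_ifs
      · rw [sub_self]; exact zero_mem _
      · rw [add_sub_cancel_left]
        exact AddSubgroup.subset_closure ⟨p, hp, h0, rfl⟩
    rw [h γ hγ hm]
    convert sub_mem (key (γ 1)) (key (γ 0)) using 1
    abel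
  · refine ⟨{p | 0 < height p}, isOpen_lt continuous_const continuous_height, h0,
      fun γ hγ hm => ?_⟩
    rw [hv γ hγ (fun t ht => ⟨(hm ht).1, le_of_lt (show 0 < height (γ t) from (hm ht).2)⟩), glue, glue, if_pos (le_of_lt (show 0 < height (γ 0) from (hm m0).2)),
      if_pos (le_of_lt (show 0 < height (γ 1) from (hm m1).2)), sub_self]
    exact zero_mem _

end Local

/-! ### Finiteness of the relative homology -/

section Finite

open Set Topology

variable {A B : ℕ} {ε M : ℝ} {Q : Type*} [AddCommGroup Q]
  {κ : C(stdSimplex ℝ (Fin 2), XSurf A B ε M) → Q}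

theorem strip_of_uIcc {k : ℤ} {x y t : ℝ} (hx : (k : ℝ) < x ∧ x < k + 1)
    (hy : (k : ℝ) < y ∧ y < k + 1) (ht : t ∈ uIcc x y) : (k : ℝ) < t ∧ t < k + 1 := by
  rcases mem_uIcc.1 ht with h | h
  · exact ⟨hx.1.trans_le h.1, h.2.trans_lt hy.2⟩
  · exact ⟨hy.1.trans_le h.1, h.2.trans_lt hx.2⟩

/-- The jump is constant along real segments in `X`. -/
theorem jump_eq_of_uIcc {v w : Surface A B → Q} (hv : IsPotential κ (upperX A B ε M) v)
    (hw : IsPotential κ (lowerX A B ε M) w) {m k : ℤ} {x y : ℝ} (hx : (k : ℝ) < x ∧ x < k + 1)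
    (hy : (k : ℝ) < y ∧ y < k + 1) (h : ∀ t ∈ uIcc x y, plusPt A B m t ∈ XSurf A B ε M) :
    v (plusPt A B m x) - w (plusPt A B m x) = v (plusPt A B m y) - w (plusPt A B m y) := by
  have hl : ∀ t ∈ Icc (0 : ℝ) 1, AffineMap.lineMap x y t ∈ uIcc x y := fun t ht =>
    segment_eq_uIcc x y ▸ lineMap_mem_segment x y ht
  have hc : ∀ t ∈ Icc (0 : ℝ) 1, ((AffineMap.lineMap x y t : ℝ) : ℂ) ∈ cutPlus := fun t ht => by
    have := strip_of_uIcc hx hy (hl t ht)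
    exact mem_cutPlus.2 (Or.inl (ne_int_of_mem this.1 this.2))
  have hγ : ContinuousOn (fun t : ℝ => plusPt A B m (AffineMap.lineMap x y t : ℝ)) (Icc 0 1) :=
    (continuousOn_plusPt m).comp (Complex.continuous_ofReal.comp
      AffineMap.lineMap_continuous).continuousOn hc
  have h0 : ∀ t ∈ Icc (0 : ℝ) 1, height (plusPt A B m (AffineMap.lineMap x y t : ℝ)) = 0 :=
    fun t ht => by rw [height_plusPt m (hc t ht)]; simp
  have e1 := hv _ hγ (fun t ht => ⟨h _ (hl t ht), (h0 t ht).ge⟩)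
  have e2 := hw _ hγ (fun t ht => ⟨h _ (hl t ht), (h0 t ht).le⟩)
  simp only [AffineMap.lineMap_apply_zero, AffineMap.lineMap_apply_one] at e1 e2
  rw [sub_eq_sub_iff_sub_eq_sub]
  rw [← neg_sub (v _), ← neg_sub (w _), ← e1, ← e2]

theorem exists_real_of_height {p : Surface A B} (hA : 0 < A) (hp : height p = 0) :
    ∃ (m : ℤ) (x : ℝ), 0 ≤ m ∧ m < A ∧ (∀ k : ℤ, x ≠ k) ∧ p = plusPt A B m x := by
  obtain ⟨m, z, h1, h2, hz, rfl⟩ := exists_plusPt_of_height hA hp.ge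
  rw [height_plusPt m hz] at hp
  have hint := (mem_cutPlus.1 hz).resolve_right (by rw [hp]; exact lt_irrefl 0)
  refine ⟨m, z.re, h1, h2, hint, ?_⟩
  congr 1
  exact Complex.ext (by simp) (by simpa using hp)

/-- The real points of a leg over a strip form a segment. -/
theorem sheetRegion_real_uIcc (hε : 0 < ε) (hM : 0 < M) {s : ℝ} {k : ℤ} {x y t : ℝ}
    (hx : (k : ℝ) < x ∧ x < k + 1) (hy : (k : ℝ) < y ∧ y < k + 1)
    (hxs : (x : ℂ) ∈ sheetRegion s ε M) (hys : (y : ℂ) ∈ sheetRegion s ε M) (ht : t ∈ uIcc x y) :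
    (t : ℂ) ∈ sheetRegion s ε M := by
  have hη : 0 < ε / M := by positivity
  exact leg_subset (leg_horizontal hε (k := k) (mem_leg_of_lt hxs (by simpa using hη))
    (mem_leg_of_lt hys (by simpa using hη)) ⟨hx.1.le, hx.2.le⟩ ⟨hy.1.le, hy.2.le⟩ (by simp) (by simp)
    (by simpa using ht))

theorem abs_le_of_real_mem (hε : 0 < ε) (hM : 0 < M) {s x : ℝ} (hx : (x : ℂ) ∈ sheetRegion s ε M) :
    |x| ≤ M := by
  have hη : 0 < ε / M := by positivity
  simpa using (mem_leg_of_lt hx (by simpa using hη)).1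

/-- On each strip the real points of one leg form an interval, on which the jump is constant, and only
finitely many legs meet the real line. -/
theorem finite_jumps (hA : 0 < A) (hε : 0 < ε) (hM : 0 < M)
    {v w : Surface A B → Q} (hv : IsPotential κ (upperX A B ε M) v)
    (hw : IsPotential κ (lowerX A B ε M) w) : (jumps A B ε M v w).Finite := by
  -- jumps indexed by a sheet and a strip over which there is a leg
  let E : ℝ → ℤ → ℤ → Set Q := fun s m k => {e | ∃ (i : ℤ) (x : ℝ), ((i : ℝ) < x ∧ x < i + 1) ∧
    ((x + k : ℝ) : ℂ) ∈ sheetRegion s ε M ∧ e = v (plusPt A B m x) - w (plusPt A B m x)}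
  have fin : (Icc (0 : ℤ) A ×ˢ Icc (⌊-M⌋) ⌊M⌋ : Set (ℤ × ℤ)).Finite :=
    (finite_Icc _ _).prod (finite_Icc _ _)
  let P : ℤ × ℤ → Set Q := fun q => {e | ∃ x : ℝ, ((q.2 : ℝ) < x ∧ x < q.2 + 1) ∧
    (x : ℂ) ∈ sheetRegion 1 ε M ∧ e = v (plusPt A B q.1 x) - w (plusPt A B q.1 x)}
  let N : ℤ × ℤ → Set Q := fun q => {e | ∃ x : ℝ, ((q.2 : ℝ) < x ∧ x < q.2 + 1) ∧
    (x : ℂ) ∈ sheetRegion (-1) ε M ∧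
    e = v (plusPt A B (q.1 - B * q.2) x) - w (plusPt A B (q.1 - B * q.2) x)}
  have hint : ∀ {k : ℤ} {x : ℝ}, (k : ℝ) < x ∧ x < k + 1 → ∀ i : ℤ, (x : ℂ).re ≠ i :=
    fun h => ne_int_of_mem h.1 h.2
  have hP : ∀ q ∈ Icc (0 : ℤ) A ×ˢ Icc (⌊-M⌋) ⌊M⌋, (if q.1 < A then P q ∪ N q else ∅).Finite := by
    rintro ⟨m, k⟩ ⟨⟨hm, -⟩, -⟩
    split_ifs with hmA
    · refine Set.Finite.union (Set.Subsingleton.finite ?_) (Set.Subsingleton.finite ?_)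
      · rintro _ ⟨x, hx, hxs, rfl⟩ _ ⟨y, hy, hys, rfl⟩
        refine jump_eq_of_uIcc hv hw hx hy fun t ht => Or.inl ?_
        have := hint (strip_of_uIcc hx hy ht)
        rw [plusPt_mem_SigmaPlus hm hmA (mem_cutPlus.2 (Or.inl this))]
        exact sheetRegion_real_uIcc hε hM hx hy hxs hys ht
      · rintro _ ⟨x, hx, hxs, rfl⟩ _ ⟨y, hy, hys, rfl⟩
        refine jump_eq_of_uIcc hv hw hx hy fun t ht => Or.inr ?_
        have h1 := hint (strip_of_uIcc hx hy ht)
        have h2 : ⌊(t : ℂ).re⌋ = k := (floor_eq_of_strip h1 k).2 (strip_of_uIcc hx hy ht)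
        rw [plusPt_eq_minusPt_floor _ h1, minusPt_mem_SigmaMinus (mem_cutMinus.2 (Or.inl h1)), h2]
        exact ⟨0, by simpa using hm, by simpa using hmA,
          by simpa using sheetRegion_real_uIcc hε hM hx hy hxs hys ht⟩
    · exact finite_empty
  refine (fin.biUnion hP).subset ?_
  rintro e ⟨p, hp, hp0, rfl⟩
  have hfl : ∀ x : ℝ, |x| ≤ M → ⌊x⌋ ∈ Icc ⌊-M⌋ ⌊M⌋ := fun x hx =>
    ⟨Int.floor_le_floor (abs_le.1 hx).1, Int.floor_le_floor (abs_le.1 hx).2⟩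
  obtain ⟨m, x, h1, h2, hx, rfl⟩ := exists_real_of_height hA hp0
  have hxp : (x : ℂ) ∈ cutPlus := mem_cutPlus.2 (Or.inl hx)
  rcases hp with hp | hp
  · rw [plusPt_mem_SigmaPlus h1 h2 hxp] at hp
    refine mem_biUnion (x := (m, ⌊x⌋)) ⟨⟨h1, h2.le⟩, hfl x (abs_le_of_real_mem hε hM hp)⟩ ?_
    simp only [if_pos h2]
    exact Or.inl ⟨x, (floor_eq_of_strip (z := (x : ℂ)) hx _).1 rfl, hp, rfl⟩
  · rw [plusPt_eq_minusPt_floor m (z := (x : ℂ)) hx,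
      minusPt_mem_SigmaMinus (mem_cutMinus.2 (Or.inl hx))] at hp
    obtain ⟨j, h3, h4, h5⟩ := hp
    have hxj : ∀ k : ℤ, x + j ≠ k := (ne_int_add j).2 hx
    have h5' : ((x + j : ℝ) : ℂ) ∈ sheetRegion (-1) ε M := by push_cast; exact h5
    refine mem_biUnion (x := (m + B * ⌊(x : ℂ).re⌋ + (B - A) * j, ⌊x + j⌋)) ⟨⟨h3, h4.le⟩,
      hfl _ (abs_le_of_real_mem hε hM h5')⟩ ?_
    simp only [if_pos h4]
    refine Or.inr ⟨x + j, (floor_eq_of_strip (z := ((x + j : ℝ) : ℂ)) hxj _).1 rfl, h5', ?_⟩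
    have h6 : plusPt A B (m + B * ⌊(x : ℂ).re⌋ + (B - A) * j - B * ⌊x + j⌋) ((x + j : ℝ) : ℂ) =
        plusPt A B m x := by
      rw [← plusPt_shift m j hxp]
      push_cast
      congr 1
      simp
      ring
    simp only [h6]

variable {L θ : ℝ}

/-- The part of `D⁺` on the sheet `m₊ = m`. -/
def sheetDPlus (A B : ℕ) (ε M L θ : ℝ) (m : ℤ) : Set (Surface A B) :=
  {p | ∃ r₀ : ℝ, ∀ r : ℝ, r₀ ≤ r →
    ∃ h : (r : ℂ) * Complex.exp ((θ / 2 - A * ε : ℝ) * Complex.I) ∈ cutPlus,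
      JoinedIn (decayPlus A B ε M L θ m) p (ptPlus A B m ⟨_, h⟩)}

/-- The part of `D⁻` on the sheet `m₋ = n`. -/
def sheetDMinus (A B : ℕ) (ε M L θ : ℝ) (n : ℤ) : Set (Surface A B) :=
  {p | ∃ r₀ : ℝ, ∀ r : ℝ, r₀ ≤ r →
    ∃ h : -(r : ℂ) * Complex.exp ((θ / 2 - (A - B) * ε : ℝ) * Complex.I) ∈ cutMinus,
      JoinedIn (decayMinus A B ε M L θ n) p (ptMinus A B n ⟨_, h⟩)}

theorem mem_DPlus {p : Surface A B} :
    p ∈ DPlus A B ε M L θ ↔ ∃ m : Fin A, p ∈ sheetDPlus A B ε M L θ (m : ℕ) := Iff.rfl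

theorem mem_DMinus {p : Surface A B} :
    p ∈ DMinus A B ε M L θ ↔ ∃ m : Fin A, p ∈ sheetDMinus A B ε M L θ (m : ℕ) := Iff.rfl

/-- A set of points joined in `F` to a given family of points is closed under joining in `F`. -/
theorem JoinedIn.of_eventually {Y : Type*} [TopologicalSpace Y] {F : Set Y} {H : ℝ → Prop}
    {g : ∀ r, H r → Y} {p q : Y} (hpq : JoinedIn F p q)
    (hp : ∃ r₀ : ℝ, ∀ r : ℝ, r₀ ≤ r → ∃ h : H r, JoinedIn F p (g r h)) :
    JoinedIn {p | ∃ r₀ : ℝ, ∀ r : ℝ, r₀ ≤ r → ∃ h : H r, JoinedIn F p (g r h)} p q := by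
  obtain ⟨γ, hγ⟩ := hpq
  refine ⟨γ, fun t => ?_⟩
  obtain ⟨r₀, h⟩ := hp
  refine ⟨r₀, fun r hr => ?_⟩
  obtain ⟨h1, h2⟩ := h r hr
  have : JoinedIn F (γ t) p := by
    refine JoinedIn.symm ⟨(γ.truncateOfLE (t₀ := 0) (t₁ := t) t.2.1).cast ?_ ?_, fun s => ?_⟩
    · simp
    · simp
    · have := γ.truncate_range (t₀ := 0) (t₁ := t)
      obtain ⟨s', hs'⟩ := this (mem_range_self s)
      have h3 := hγ s'
      rw [hs'] at h3
      exact h3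
  exact ⟨h1, this.trans h2⟩

theorem joinedIn_sheetDPlus {m : ℤ} {p q : Surface A B} (hp : p ∈ sheetDPlus A B ε M L θ m)
    (hq : q ∈ sheetDPlus A B ε M L θ m) : JoinedIn (sheetDPlus A B ε M L θ m) p q := by
  obtain ⟨r₁, h1⟩ := id hp
  obtain ⟨r₂, h2⟩ := id hq
  obtain ⟨_, h3⟩ := h1 (max r₁ r₂) (le_max_left _ _)
  obtain ⟨_, h4⟩ := h2 (max r₁ r₂) (le_max_right _ _)
  exact JoinedIn.of_eventually (h3.trans h4.symm) hp

theorem joinedIn_sheetDMinus {m : ℤ} {p q : Surface A B} (hp : p ∈ sheetDMinus A B ε M L θ m)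
    (hq : q ∈ sheetDMinus A B ε M L θ m) : JoinedIn (sheetDMinus A B ε M L θ m) p q := by
  obtain ⟨r₁, h1⟩ := id hp
  obtain ⟨r₂, h2⟩ := id hq
  obtain ⟨_, h3⟩ := h1 (max r₁ r₂) (le_max_left _ _)
  obtain ⟨_, h4⟩ := h2 (max r₁ r₂) (le_max_right _ _)
  exact JoinedIn.of_eventually (h3.trans h4.symm) hp

theorem sheetDPlus_subset (m : Fin A) : sheetDPlus A B ε M L θ (m : ℕ) ⊆ DReg A B ε M L θ :=
  fun _ hp => Or.inl (mem_DPlus.2 ⟨m, hp⟩)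

theorem sheetDMinus_subset (m : Fin A) : sheetDMinus A B ε M L θ (m : ℕ) ⊆ DReg A B ε M L θ :=
  fun _ hp => Or.inr (mem_DMinus.2 ⟨m, hp⟩)

theorem relClass_sub_glue_mem {R : Type u} [CommRing R] (hA : 0 < A) (hAB : A ≠ B) (hε : 0 < ε)
    (hM : 0 < M) {D : Set (Surface A B)} (hD : D ⊆ XSurf A B ε M)
    {v w : Surface A B → RelOp R hD} (hv : IsPotential (relClass R hD) (upperX A B ε M) v)
    (hw : IsPotential (relClass R hD) (lowerX A B ε M) w)
    (σ : C(stdSimplex ℝ (Fin 2), XSurf A B ε M)) :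
    relClass R hD σ - (glue v w (σ (stdSimplex.vertex 1)) - glue v w (σ (stdSimplex.vertex 0))) ∈
      AddSubgroup.closure (jumps A B ε M v w) := by
  have := val_sub_glue_mem hA hAB hε hM (isCocycle_relClass hD) hv hw
    (continuous_toPath σ).continuousOn (fun t _ => toPath_mem σ t)
  rwa [val_toPath, toPath_zero, toPath_one] at this

/-- Modulo boundaries, every path is its potential difference plus a combination of the finitely many
jumps; a cycle relative to `D` is thus a combination of jumps and of the values of the potential on
the finitely many path components of `D`. -/
theorem finite_homology (R : Type u) [CommRing R] (hA : 0 < A) (hAB : A ≠ B) (hε : 0 < ε)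
    (hM : 0 < M) :
    Module.Finite R ((relChains R (DReg_subset A B ε M L θ)).homology 1) := by
  obtain ⟨v, hv, -⟩ := exists_upper_potential hA hε hM
    (isCocycle_relClass (R := R) (DReg_subset A B ε M L θ)) (fun _ => (ε / M : ℝ) * Complex.I)
    (fun m => by simp)
  obtain ⟨w, hw, -⟩ := exists_lower_potential hA hAB hε hM
    (isCocycle_relClass (R := R) (DReg_subset A B ε M L θ)) (fun _ => (-(ε / M) : ℝ) * Complex.I)
    (fun m => by simp) hv
  refine finite_homology_of_potential (DReg_subset A B ε M L θ)
    (Sum.elim (fun m : Fin A => sheetDPlus A B ε M L θ (m : ℕ))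
      (fun m : Fin A => sheetDMinus A B ε M L θ (m : ℕ))) ?_ ?_ _ (finite_jumps hA hε hM hv hw)
    (glue v w) (relClass_sub_glue_mem hA hAB hε hM _ hv hw)
  · rintro p (hp | hp)
    · obtain ⟨m, hm⟩ := mem_DPlus.1 hp
      exact mem_iUnion.2 ⟨Sum.inl m, hm⟩
    · obtain ⟨m, hm⟩ := mem_DMinus.1 hp
      exact mem_iUnion.2 ⟨Sum.inr m, hm⟩
  · rintro (m | m) p hp q hq
    · exact (joinedIn_sheetDPlus hp hq).mono (sheetDPlus_subset m)
    · exact (joinedIn_sheetDMinus hp hq).mono (sheetDMinus_subset m)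

end Finite

/-! ### Regions of decay in the plane -/

section Decay

open Set Topology

/-- The quadratic form `-Im (c z²)`. -/
def quad (c z : ℂ) : ℝ := -(c * z ^ 2).im

/-- The symmetric bilinear form associated with `quad c`. -/
def polar (c w z : ℂ) : ℝ := -(c * w * z).im

/-- One branch of the hyperbolic region `quad c > L`, the one in the direction of `ω`, above the
line `Im z = η`. -/
def decay (c ω : ℂ) (η L : ℝ) : Set ℂ := {z | η ≤ z.im ∧ L < quad c z ∧ 0 < polar c ω z}

variable {c ω : ℂ} {η L : ℝ}

theorem quad_add_mul (c z ω : ℂ) (t : ℝ) :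
    quad c (z + t * ω) = quad c z + 2 * t * polar c ω z + t ^ 2 * quad c ω := by
  simp only [quad, polar]
  rw [show c * (z + t * ω) ^ 2 = c * z ^ 2 + ((2 * t : ℝ) : ℂ) * (c * ω * z) +
    ((t ^ 2 : ℝ) : ℂ) * (c * ω ^ 2) by push_cast; ring]
  simp only [Complex.add_im, Complex.im_ofReal_mul]
  ring

theorem polar_add_mul (c z ω : ℂ) (t : ℝ) :
    polar c ω (z + t * ω) = polar c ω z + t * quad c ω := by
  simp only [quad, polar]
  rw [show c * ω * (z + t * ω) = c * ω * z + (t : ℂ) * (c * ω ^ 2) by ring]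
  simp only [Complex.add_im, Complex.im_ofReal_mul]
  ring

/-- `quad c` is a form of signature `(1, 1)`. -/
theorem polar_sq (c z ω : ℂ) :
    polar c ω z ^ 2 = quad c ω * quad c z + Complex.normSq c * (z.re * ω.im - z.im * ω.re) ^ 2 := by
  simp only [quad, polar, Complex.mul_im, Complex.mul_re, Complex.normSq_apply, pow_two]
  ring

theorem quad_le (c z : ℂ) : quad c z ≤ ‖c‖ * (z.re ^ 2 + z.im ^ 2) := by
  have h1 : z.re ^ 2 + z.im ^ 2 = ‖z‖ ^ 2 := by
    rw [← Complex.normSq_eq_norm_sq, Complex.normSq_apply]; ring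
  rw [h1, ← norm_pow, ← norm_mul]
  exact (neg_le_abs _).trans (Complex.abs_im_le_norm _)

theorem quad_neg (c z : ℂ) : quad c (-z) = quad c z := by simp [quad]

/-- The region is the inside of one branch of a hyperbola, cut by a half-plane. -/
theorem convex_decay (hμ : 0 < quad c ω) (hL : 0 ≤ L) : Convex ℝ (decay c ω η L) := by
  have h1 : decay c ω η L = {z : ℂ | η ≤ z.im} ∩ {z | 0 < polar c ω z ∧ L < quad c z} := by
    ext z; simp [decay]; tauto
  rw [h1]
  refine (convex_le_im η).inter ?_
  rintro z ⟨hz, hz'⟩ w ⟨hw, hw'⟩ a b ha hb hab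
  have hp : polar c ω (a • z + b • w) = a * polar c ω z + b * polar c ω w := by
    simp [polar, mul_add]; ring
  have hpos : 0 < a * polar c ω z + b * polar c ω w := by
    rcases eq_or_lt_of_le ha with h | h
    · have : b = 1 := by linarith
      subst this; rw [← h]; simpa using hw
    · have := mul_pos h hz
      have := mul_nonneg hb hw.le
      linarith
  refine ⟨show 0 < polar c ω (a • z + b • w) from hp ▸ hpos, ?_⟩
  change L < quad c (a • z + b • w)
  set μ := quad c ω
  set C := Complex.normSq c
  have hC : 0 ≤ C := Complex.normSq_nonneg c
  set yz := z.re * ω.im - z.im * ω.re with hyz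
  set yw := w.re * ω.im - w.im * ω.re with hyw
  have e1 := polar_sq c z ω
  have e2 := polar_sq c w ω
  have e3 := polar_sq c (a • z + b • w) ω
  rw [hp] at e3
  have hy : (a • z + b • w).re * ω.im - (a • z + b • w).im * ω.re = a * yz + b * yw := by
    simp [hyz, hyw]; ring
  rw [hy] at e3
  have k1 : μ * L + C * yz ^ 2 < polar c ω z ^ 2 := by
    rw [e1]; have := mul_lt_mul_of_pos_left hz' hμ; linarith
  have k2 : μ * L + C * yw ^ 2 < polar c ω w ^ 2 := by
    rw [e2]; have := mul_lt_mul_of_pos_left hw' hμ; linarith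
  have hK : 0 ≤ μ * L := by positivity
  -- the Cauchy–Schwarz inequality
  have k3 : μ * L + C * (yz * yw) < polar c ω z * polar c ω w := by
    refine lt_of_pow_lt_pow_left₀ 2 (by positivity) ?_
    rw [mul_pow]
    refine lt_of_le_of_lt ?_ (mul_lt_mul'' k1 k2 (by positivity) (by positivity))
    nlinarith [mul_nonneg (mul_nonneg hK hC) (sq_nonneg (yz - yw))]
  have k4 : μ * L + C * (a * yz + b * yw) ^ 2 < (a * polar c ω z + b * polar c ω w) ^ 2 := by
    have hb' : b = 1 - a := by linarith
    have hab' : 0 < a ^ 2 + b ^ 2 := by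
      rcases eq_or_lt_of_le ha with h | h
      · rw [← h] at hab; have : b = 1 := by linarith
        rw [this, ← h]; norm_num
      · positivity
    have l1 := mul_nonneg (mul_nonneg ha hb) (sub_pos.2 k3).le
    have l2 : 0 < a ^ 2 * (polar c ω z ^ 2 - (μ * L + C * yz ^ 2)) +
        b ^ 2 * (polar c ω w ^ 2 - (μ * L + C * yw ^ 2)) := by
      rcases eq_or_lt_of_le ha with h | h
      · rw [← h] at hab; have : b = 1 := by linarith
        rw [this, ← h]; linarith
      · have := mul_pos (pow_pos h 2) (sub_pos.2 k1)
        have := mul_nonneg (sq_nonneg b) (sub_pos.2 k2).le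
        linarith
    have l3 : (a + b) ^ 2 = 1 := by rw [hab]; norm_num
    have l4 : μ * L = (a + b) ^ 2 * (μ * L) := by rw [l3, one_mul]
    rw [l4]
    linarith
  rw [e3] at k4
  have : μ * L < μ * quad c (a • z + b • w) := by linarith
  exact lt_of_mul_lt_mul_left this hμ.le

theorem decay_translate (hμ : 0 < quad c ω) (hω : 0 < ω.im) {z : ℂ} (hz : z ∈ decay c ω η L) {t : ℝ}
    (ht : 0 ≤ t) : z + t * ω ∈ decay c ω η (L + t ^ 2 * quad c ω) := by
  obtain ⟨h1, h2, h3⟩ := hz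
  refine ⟨?_, ?_, ?_⟩
  · simp only [Complex.add_im, Complex.im_ofReal_mul]
    have := mul_nonneg ht hω.le
    linarith
  · rw [quad_add_mul]
    have := mul_nonneg ht h3.le
    linarith
  · rw [polar_add_mul]
    have := mul_nonneg ht hμ.le
    linarith

theorem eventually_mem_decay (hμ : 0 < quad c ω) (hω : 0 < ω.im) (s : ℂ) :
    ∀ᶠ r : ℝ in Filter.atTop, s + r * ω ∈ decay c ω η L := by
  have h1 : Filter.Tendsto (fun r : ℝ => s.im + r * ω.im) Filter.atTop Filter.atTop :=
    Filter.tendsto_atTop_add_const_left _ _ (Filter.tendsto_id.atTop_mul_const hω)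
  have h3 : Filter.Tendsto (fun r : ℝ => polar c ω s + r * quad c ω) Filter.atTop Filter.atTop :=
    Filter.tendsto_atTop_add_const_left _ _ (Filter.tendsto_id.atTop_mul_const hμ)
  have h2 : Filter.Tendsto (fun r : ℝ => quad c s + r * (2 * polar c ω s + r * quad c ω))
      Filter.atTop Filter.atTop :=
    Filter.tendsto_atTop_add_const_left _ _ (Filter.tendsto_id.atTop_mul_atTop₀
      (Filter.tendsto_atTop_add_const_left _ _ (Filter.tendsto_id.atTop_mul_const hμ)))
  filter_upwards [h1.eventually_ge_atTop η, h2.eventually_gt_atTop L, h3.eventually_gt_atTop 0]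
    with r e1 e2 e3
  refine ⟨by simpa using e1, ?_, by rw [polar_add_mul]; exact e3⟩
  rw [quad_add_mul]
  linarith

theorem decay_mono {L' : ℝ} (h : L ≤ L') : decay c ω η L' ⊆ decay c ω η L :=
  fun _ hz => ⟨hz.1, h.trans_lt hz.2.1, hz.2.2⟩

/-- On a path in the region `quad c > L ≥ 0`, the sign of `polar c ω` does not change. -/
theorem polar_pos_of_path (hμ : 0 < quad c ω) (hL : 0 ≤ L) {z : ℝ → ℂ}
    (hz : ContinuousOn z (Icc 0 1)) (h : ∀ t ∈ Icc (0 : ℝ) 1, L < quad c (z t))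
    (h1 : 0 < polar c ω (z 1)) : 0 < polar c ω (z 0) := by
  by_contra h0
  have hc : ContinuousOn (fun t => polar c ω (z t)) (Icc 0 1) := by
    unfold polar
    exact (Complex.continuous_im.comp_continuousOn (continuousOn_const.mul hz)).neg
  obtain ⟨t, ht, ht0⟩ := intermediate_value_Icc zero_le_one hc ⟨not_lt.1 h0, h1.le⟩
  have e := polar_sq c (z t) ω
  simp only at ht0
  rw [ht0] at e
  have := mul_pos hμ (hL.trans_lt (h t ht))
  have := mul_nonneg (Complex.normSq_nonneg c)
    (sq_nonneg ((z t).re * ω.im - (z t).im * ω.re))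
  linarith

end Decay

/-! ### The regions at infinity of the surface -/

section AtInfinity

open Set Topology

variable {A B : ℕ} {ε M L θ : ℝ}

/-- The coefficient of `z₊²` in `P₊ e^{-iθ}`. -/
def coefPlus (A : ℕ) (θ : ℝ) : ℂ := (A : ℂ) / 2 * Complex.exp (-(θ * Complex.I))

/-- The coefficient of `z₋²` in `P₋ e^{-iθ}`. -/
def coefMinus (A B : ℕ) (θ : ℝ) : ℂ := ((A : ℂ) - B) / 2 * Complex.exp (-(θ * Complex.I))

/-- The direction of the contours in the upper half plane. -/
def dirPlus (A : ℕ) (ε θ : ℝ) : ℂ := Complex.exp ((θ / 2 - A * ε : ℝ) * Complex.I)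

/-- Minus the direction of the contours in the lower half plane. -/
def dirMinus (A B : ℕ) (ε θ : ℝ) : ℂ := Complex.exp ((θ / 2 - (A - B) * ε : ℝ) * Complex.I)

/-- The tilts by `Aε` and by `(A-B)ε` turn the directions `±e^{iθ/2}` into directions of decay,
without leaving the half planes. -/
structure SmallTilt (A B : ℕ) (ε θ : ℝ) : Prop where
  imPlus : 0 < (dirPlus A ε θ).im
  imMinus : 0 < (dirMinus A B ε θ).im
  quadPlus : 0 < quad (coefPlus A θ) (dirPlus A ε θ)
  quadMinus : 0 < quad (coefMinus A B θ) (dirMinus A B ε θ)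

theorem quad_exp (a θ φ : ℝ) :
    quad ((a : ℂ) * Complex.exp (-(θ * Complex.I))) (Complex.exp (φ * Complex.I)) =
      a * Real.sin (θ - 2 * φ) := by
  have : (a : ℂ) * Complex.exp (-(θ * Complex.I)) * Complex.exp (φ * Complex.I) ^ 2 =
      a * Complex.exp ((2 * φ - θ : ℝ) * Complex.I) := by
    rw [← Complex.exp_nat_mul, mul_assoc, ← Complex.exp_add]
    congr 2
    push_cast
    ring
  rw [quad, this, Complex.im_ofReal_mul, Complex.exp_ofReal_mul_I_im, ← neg_sub θ, Real.sin_neg]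
  ring

theorem mul_sin_pos {x : ℝ} (hx : x ≠ 0) (h : |x| < Real.pi) : 0 < x * Real.sin x := by
  rcases lt_or_gt_of_ne hx with h0 | h0
  · rw [abs_of_neg h0] at h
    exact mul_pos_of_neg_of_neg h0 (Real.sin_neg_of_neg_of_neg_pi_lt h0 (by linarith))
  · rw [abs_of_pos h0] at h
    exact mul_pos h0 (Real.sin_pos_of_pos_of_lt_pi h0 h)

/-- The form `-Im (P e^{-iθ})` vanishes on the directions `± e^{iθ/2}`; the rotations by `-Aε` and by
`-(A - B)ε` make it positive, and for small `ε` they do not leave the upper or lower half-plane. -/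
theorem exists_smallTilt (hA : 0 < A) (hAB : A ≠ B) (hθ : 0 < θ) (hθ' : θ < 2 * Real.pi) :
    ∃ ε₀ > 0, ∀ ε, 0 < ε → ε < ε₀ → SmallTilt A B ε θ := by
  have hA' : (0 : ℝ) < A := by exact_mod_cast hA
  have hAB' : (A : ℝ) - B ≠ 0 := sub_ne_zero.2 (by exact_mod_cast hAB)
  set K : ℝ := A + |(A : ℝ) - B| with hK
  have hK0 : 0 < K := by positivity
  refine ⟨min (θ / 2) (Real.pi - θ / 2) / (2 * K), by
    have : 0 < min (θ / 2) (Real.pi - θ / 2) := lt_min (by linarith) (by linarith)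
    positivity, fun ε hε h => ?_⟩
  rw [lt_div_iff₀ (by positivity), lt_min_iff] at h
  have h1 : A * ε ≤ K * ε := mul_le_mul_of_nonneg_right (by rw [hK]; linarith [abs_nonneg ((A : ℝ) - B)]) hε.le
  have h2 : |((A : ℝ) - B) * ε| ≤ K * ε := by
    rw [abs_mul, abs_of_pos hε]
    exact mul_le_mul_of_nonneg_right (by rw [hK]; linarith) hε.le
  have h3 := abs_le.1 h2
  have h4 : 0 < A * ε := by positivity
  refine ⟨?_, ?_, ?_, ?_⟩
  · rw [dirPlus, Complex.exp_ofReal_mul_I_im]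
    exact Real.sin_pos_of_pos_of_lt_pi (by linarith) (by linarith)
  · rw [dirMinus, Complex.exp_ofReal_mul_I_im]
    exact Real.sin_pos_of_pos_of_lt_pi (by linarith) (by linarith)
  · have := quad_exp (A / 2) θ (θ / 2 - A * ε)
    push_cast at this
    rw [coefPlus, dirPlus]
    push_cast
    rw [this, show θ - 2 * (θ / 2 - A * ε) = 2 * (A * ε) by ring]
    exact mul_pos (by positivity) (Real.sin_pos_of_pos_of_lt_pi (by linarith) (by linarith))
  · have := quad_exp ((A - B) / 2) θ (θ / 2 - (A - B) * ε)
    push_cast at this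
    rw [coefMinus, dirMinus]
    push_cast
    rw [this, show θ - 2 * (θ / 2 - (A - B) * ε) = 2 * ((A - B) * ε) by ring]
    have h5 := mul_sin_pos (x := 2 * (((A : ℝ) - B) * ε)) (by positivity) (by
      rw [abs_mul, abs_two]; linarith)
    have h6 : ((A : ℝ) - B) / 2 * Real.sin (2 * ((A - B) * ε)) =
        (2 * (((A : ℝ) - B) * ε) * Real.sin (2 * ((A - B) * ε))) / (4 * ε) := by
      field_simp
      ring
    rw [h6]
    positivity

theorem joinedIn_plusPt {S : Set (Surface A B)} {m : ℤ} {T : Set ℂ} (hT : Convex ℝ T)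
    (h : ∀ z ∈ T, z ∈ cutPlus ∧ plusPt A B m z ∈ S) {z w : ℂ} (hz : z ∈ T) (hw : w ∈ T) :
    JoinedIn S (plusPt A B m z) (plusPt A B m w) := by
  have h1 : JoinedIn T z w := (hT.isPathConnected ⟨z, hz⟩).joinedIn z hz w hw
  exact (h1.map_continuousOn ((continuousOn_plusPt m).mono fun z hz => (h z hz).1)).mono
    (image_subset_iff.2 fun z hz => (h z hz).2)

theorem joinedIn_minusPt {S : Set (Surface A B)} {n : ℤ} {T : Set ℂ} (hT : Convex ℝ T)
    (h : ∀ z ∈ T, z ∈ cutMinus ∧ minusPt A B n z ∈ S) {z w : ℂ} (hz : z ∈ T) (hw : w ∈ T) :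
    JoinedIn S (minusPt A B n z) (minusPt A B n w) := by
  have h1 : JoinedIn T z w := (hT.isPathConnected ⟨z, hz⟩).joinedIn z hz w hw
  exact (h1.map_continuousOn ((continuousOn_minusPt n).mono fun z hz => (h z hz).1)).mono
    (image_subset_iff.2 fun z hz => (h z hz).2)

/-- A bound beyond which the legs do not meet the regions of decay. -/
def levelBound (A B : ℕ) (ε M : ℝ) : ℝ := (A + |(A : ℝ) - B|) * (M ^ 2 + (ε / M) ^ 2)

theorem levelBound_nonneg : 0 ≤ levelBound A B ε M := by unfold levelBound; positivity

theorem norm_coefPlus : ‖coefPlus A θ‖ = A / 2 := by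
  rw [coefPlus, norm_mul, ← neg_mul, ← Complex.ofReal_neg, Complex.norm_exp_ofReal_mul_I]
  simp

theorem norm_coefMinus : ‖coefMinus A B θ‖ = |(A : ℝ) - B| / 2 := by
  rw [coefMinus, norm_mul, ← neg_mul, ← Complex.ofReal_neg, Complex.norm_exp_ofReal_mul_I]
  rw [norm_div, ← Complex.ofReal_natCast, ← Complex.ofReal_natCast, ← Complex.ofReal_sub,
    Complex.norm_real]
  simp

theorem le_im_of_sheetRegion {s : ℝ} (hs : s ^ 2 = 1) {c z : ℂ}
    (hc : ‖c‖ ≤ A + |(A : ℝ) - B|) (hL : levelBound A B ε M ≤ L)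
    (hz : z ∈ sheetRegion s ε M) (h : L < quad c z) : ε / M ≤ s * z.im := by
  by_contra hlt
  rw [not_le] at hlt
  obtain ⟨h1, h2, -⟩ := mem_leg_of_lt hz hlt
  have h3 : z.re ^ 2 ≤ M ^ 2 := by rw [← sq_abs]; exact pow_le_pow_left₀ (abs_nonneg _) h1 2
  have h4 : z.im ^ 2 ≤ (ε / M) ^ 2 := by
    have : (s * z.im) ^ 2 ≤ (ε / M) ^ 2 := sq_le_sq' h2 hlt.le
    rwa [mul_pow, hs, one_mul] at this
  have h5 := quad_le c z
  have h6 : ‖c‖ * (z.re ^ 2 + z.im ^ 2) ≤ levelBound A B ε M := by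
    unfold levelBound
    gcongr
  linarith

theorem decayPlus_eq (m : ℤ) : decayPlus A B ε M L θ m =
    plusPt A B m '' {z | z ∈ cutPlus ∧ z ∈ sheetRegion 1 ε M ∧ L < quad (coefPlus A θ) z} := by
  have e : ∀ z : ℂ, -(((A : ℂ) / 2 * z ^ 2) * Complex.exp (-(θ * Complex.I))).im =
      quad (coefPlus A θ) z := fun z => by
    rw [quad, coefPlus]; congr 2; ring
  ext p
  constructor
  · rintro ⟨z, ⟨h1, h2⟩, rfl⟩
    rw [e] at h2
    exact ⟨z, ⟨z.2, h1, h2⟩, (ptPlus_eq m z).symm⟩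
  · rintro ⟨z, ⟨h0, h1, h2⟩, rfl⟩
    rw [← e] at h2
    exact ⟨⟨z, h0⟩, ⟨h1, h2⟩, ptPlus_eq m _⟩

theorem decayMinus_eq (n : ℤ) : decayMinus A B ε M L θ n =
    minusPt A B n '' {z | z ∈ cutMinus ∧ z ∈ sheetRegion (-1) ε M ∧
      L < quad (coefMinus A B θ) z} := by
  have e : ∀ z : ℂ, -((((A : ℂ) - B) / 2 * z ^ 2) * Complex.exp (-(θ * Complex.I))).im =
      quad (coefMinus A B θ) z := fun z => by
    rw [quad, coefMinus]; congr 2; ring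
  ext p
  constructor
  · rintro ⟨z, ⟨h1, h2⟩, rfl⟩
    rw [e] at h2
    exact ⟨z, ⟨z.2, h1, h2⟩, (ptMinus_eq n z).symm⟩
  · rintro ⟨z, ⟨h0, h1, h2⟩, rfl⟩
    rw [← e] at h2
    exact ⟨⟨z, h0⟩, ⟨h1, h2⟩, ptMinus_eq n _⟩

theorem pos_im_mem_cutPlus {z : ℂ} (h : 0 < z.im) : z ∈ cutPlus := mem_cutPlus.2 (Or.inr h)

theorem neg_im_mem_cutMinus {z : ℂ} (h : z.im < 0) : z ∈ cutMinus := mem_cutMinus.2 (Or.inr h)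

/-- For large `L`, the part of `D⁺` on a sheet is one branch of a hyperbolic region. -/
theorem sheetDPlus_eq (hA : 0 < A) (hε : 0 < ε) (hM : 0 < M) (hs : SmallTilt A B ε θ)
    (hL : levelBound A B ε M ≤ L) (m : ℤ) : sheetDPlus A B ε M L θ m =
      plusPt A B m '' decay (coefPlus A θ) (dirPlus A ε θ) (ε / M) L := by
  have hη : 0 < ε / M := by positivity
  have hL0 : 0 ≤ L := levelBound_nonneg.trans hL
  have hcut : ∀ z ∈ decay (coefPlus A θ) (dirPlus A ε θ) (ε / M) L, z ∈ cutPlus :=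
    fun z hz => pos_im_mem_cutPlus (hη.trans_le hz.1)
  ext p
  constructor
  · rintro ⟨r₀, h⟩
    obtain ⟨h1, h2⟩ := h (max r₀ 1) (le_max_left _ _)
    obtain ⟨γ, hγ⟩ := h2
    rw [decayPlus_eq] at hγ
    obtain ⟨z, hzc, hz⟩ := exists_lift_plus hA m (fun z hz => hz.1)
      (γ.continuous_extend.continuousOn (s := Icc 0 1)) (fun t _ => hγ _)
    have m0 : (0 : ℝ) ∈ Icc (0 : ℝ) 1 := by simp
    have m1 : (1 : ℝ) ∈ Icc (0 : ℝ) 1 := by simp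
    refine ⟨z 0, ⟨?_, (hz 0 m0).1.2.2, ?_⟩, by rw [← (hz 0 m0).2]; simp⟩
    · have := le_im_of_sheetRegion (A := A) (B := B) (by norm_num) (by
        rw [norm_coefPlus]; have := abs_nonneg ((A : ℝ) - B); linarith [Nat.cast_nonneg (α := ℝ) A])
        hL (hz 0 m0).1.2.1 (hz 0 m0).1.2.2
      rwa [one_mul] at this
    · refine polar_pos_of_path hs.quadPlus hL0 hzc (fun t ht => (hz t ht).1.2.2) ?_
      have e : z 1 = (max r₀ 1 : ℝ) * dirPlus A ε θ := by
        refine plusPt_injOn (A := A) (B := B) m hA (hz 1 m1).1.1 h1 ?_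
        rw [← (hz 1 m1).2, dirPlus, plusPt_of_mem m h1]
        simp
      rw [e]
      have := polar_add_mul (coefPlus A θ) 0 (dirPlus A ε θ) (max r₀ 1)
      rw [zero_add] at this
      rw [this]
      have h3 : 0 < max r₀ 1 := lt_max_of_lt_right one_pos
      have h4 := mul_pos h3 hs.quadPlus
      simpa [polar] using h4
  · rintro ⟨z, hz, rfl⟩
    obtain ⟨r₀, hr₀⟩ := Filter.eventually_atTop.1
      (eventually_mem_decay (η := ε / M) (L := L) hs.quadPlus hs.imPlus 0)
    refine ⟨r₀, fun r hr => ?_⟩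
    have h1 := hr₀ r hr
    rw [zero_add] at h1
    refine ⟨hcut _ h1, ?_⟩
    rw [ptPlus_eq]
    refine joinedIn_plusPt (convex_decay hs.quadPlus hL0) (fun w hw => ⟨hcut w hw, ?_⟩) hz h1
    rw [decayPlus_eq]
    exact ⟨w, ⟨hcut w hw, mem_sheetRegion.2 (Or.inr (by simpa using hw.1)), hw.2.1⟩, rfl⟩

/-- For large `L`, the part of `D⁻` on a sheet is one branch of a hyperbolic region. -/
theorem sheetDMinus_eq (hAB : A ≠ B) (hε : 0 < ε) (hM : 0 < M) (hs : SmallTilt A B ε θ)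
    (hL : levelBound A B ε M ≤ L) (n : ℤ) : sheetDMinus A B ε M L θ n =
      (fun z => minusPt A B n (-z)) ''
        decay (coefMinus A B θ) (dirMinus A B ε θ) (ε / M) L := by
  have hη : 0 < ε / M := by positivity
  have hL0 : 0 ≤ L := levelBound_nonneg.trans hL
  have hcut : ∀ z ∈ decay (coefMinus A B θ) (dirMinus A B ε θ) (ε / M) L, -z ∈ cutMinus :=
    fun z hz => neg_im_mem_cutMinus (by
      rw [Complex.neg_im]
      have := hη.trans_le hz.1
      linarith)
  ext p
  constructor
  · rintro ⟨r₀, h⟩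
    obtain ⟨h1, h2⟩ := h (max r₀ 1) (le_max_left _ _)
    obtain ⟨γ, hγ⟩ := h2
    rw [decayMinus_eq] at hγ
    obtain ⟨z, hzc, hz⟩ := exists_lift_minus hAB n (fun z hz => hz.1)
      (γ.continuous_extend.continuousOn (s := Icc 0 1)) (fun t _ => hγ _)
    have m0 : (0 : ℝ) ∈ Icc (0 : ℝ) 1 := by simp
    have m1 : (1 : ℝ) ∈ Icc (0 : ℝ) 1 := by simp
    refine ⟨-z 0, ⟨?_, by rw [quad_neg]; exact (hz 0 m0).1.2.2, ?_⟩, by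
      simp only [neg_neg]
      rw [← (hz 0 m0).2]; simp⟩
    · have := le_im_of_sheetRegion (A := A) (B := B) (by norm_num) (by
        rw [norm_coefMinus]
        have := abs_nonneg ((A : ℝ) - B)
        linarith [Nat.cast_nonneg (α := ℝ) A]) hL (hz 0 m0).1.2.1 (hz 0 m0).1.2.2
      rw [Complex.neg_im]
      linarith
    · refine polar_pos_of_path (z := fun t => -z t) hs.quadMinus hL0 hzc.neg
        (fun t ht => by rw [quad_neg]; exact (hz t ht).1.2.2) ?_
      have e : z 1 = -((max r₀ 1 : ℝ) : ℂ) * dirMinus A B ε θ := by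
        refine minusPt_injOn (A := A) (B := B) n hAB (hz 1 m1).1.1 h1 ?_
        rw [← (hz 1 m1).2, dirMinus, minusPt_of_mem n h1]
        simp
      simp only [e]
      have := polar_add_mul (coefMinus A B θ) 0 (dirMinus A B ε θ) (max r₀ 1)
      rw [zero_add] at this
      rw [neg_mul, neg_neg, this]
      have h3 : 0 < max r₀ 1 := lt_max_of_lt_right one_pos
      have h4 := mul_pos h3 hs.quadMinus
      simpa [polar] using h4
  · rintro ⟨z, hz, rfl⟩
    obtain ⟨r₀, hr₀⟩ := Filter.eventually_atTop.1
      (eventually_mem_decay (η := ε / M) (L := L) hs.quadMinus hs.imMinus 0)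
    refine ⟨r₀, fun r hr => ?_⟩
    have h1 := hr₀ r hr
    rw [zero_add] at h1
    have h2 := hcut _ h1
    rw [← neg_mul] at h2
    refine ⟨h2, ?_⟩
    rw [ptMinus_eq]
    simp only [neg_mul]
    refine joinedIn_minusPt (T := -decay (coefMinus A B θ) (dirMinus A B ε θ) (ε / M) L)
      (convex_decay hs.quadMinus hL0).neg (fun w hw => ⟨by simpa using hcut _ hw, ?_⟩)
      (by simpa using hz) (by rw [Set.mem_neg, neg_neg]; exact h1)
    rw [decayMinus_eq]
    refine ⟨w, ⟨by simpa using hcut _ hw, mem_sheetRegion.2 (Or.inr ?_), ?_⟩, rfl⟩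
    · have := hw.1
      rw [Complex.neg_im] at this
      linarith
    · have := hw.2.1
      rwa [quad_neg] at this

end AtInfinity

/-! ### Cells -/

section Cells

open Set Topology

variable {A B : ℕ} {ε M : ℝ}

/-- The radius `ε` is small compared with `M`. The last condition says that an interval
`(k, i + M]` with `k, i ∈ ℤ`, if not empty, has length at least `ε`. -/
structure SmallRadius (ε M : ℝ) : Prop where
  hε : 0 < ε
  hM : 0 < M
  half : ε < 1 / 2
  ceil : ε ≤ M - ⌈M⌉ + 1

theorem exists_smallRadius (hM : 0 < M) : ∃ ε₀ > 0, ∀ ε, 0 < ε → ε < ε₀ → SmallRadius ε M := by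
  refine ⟨min (1 / 2) (M - ⌈M⌉ + 1), lt_min (by norm_num) ?_, fun ε hε h => ?_⟩
  · linarith [Int.ceil_lt_add_one M]
  · rw [lt_min_iff] at h
    exact ⟨hε, hM, h.1, h.2.le⟩

theorem SmallRadius.height_pos (h : SmallRadius ε M) : 0 < ε / M := div_pos h.hε h.hM

/-- The points of the strip `k < x < k + 1` at distance at least `ε` from the integers. -/
def Inner (ε : ℝ) (k : ℤ) (x : ℝ) : Prop := k + ε ≤ x ∧ x ≤ k + 1 - ε

theorem Inner.strip (h : SmallRadius ε M) {k : ℤ} {x : ℝ} (hx : Inner ε k x) :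
    (k : ℝ) < x ∧ x < k + 1 := ⟨by linarith [hx.1, h.hε], by linarith [hx.2, h.hε]⟩

theorem le_ceil_sub_one {N : ℤ} (h : (N : ℝ) < M) : (N : ℝ) ≤ ⌈M⌉ - 1 := by
  have : N ≤ ⌈M⌉ - 1 := by have := Int.lt_ceil.2 h; omega
  exact_mod_cast this

/-- A point of a strip can be moved away from the integers inside any interval `[i - M, i + M]`
which contains it. -/
theorem exists_inner (h : SmallRadius ε M) {k i : ℤ} {x : ℝ} (hx : (k : ℝ) < x ∧ x < k + 1)
    (hi : |x - i| ≤ M) : ∃ y, Inner ε k y ∧ |y - i| ≤ M ∧ (x < k + 1 / 2 → y < k + 1 / 2) ∧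
      (k + 1 / 2 < x → k + 1 / 2 < y) := by
  rw [abs_le] at hi
  have h1 := h.half
  have h2 := h.ceil
  have h3 := h.hε
  rcases lt_or_ge x (k + ε) with hxk | hxk
  · refine ⟨k + ε, ⟨le_rfl, by linarith⟩, abs_le.2 ⟨by linarith, ?_⟩, fun _ => by linarith,
      fun _ => by linarith⟩
    have := le_ceil_sub_one (M := M) (N := k - i) (by push_cast; linarith)
    push_cast at this
    linarith
  · rcases lt_or_ge (k + 1 - ε) x with hxk' | hxk'
    · refine ⟨k + 1 - ε, ⟨by linarith, le_rfl⟩, abs_le.2 ⟨?_, by linarith⟩, fun _ => by linarith,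
        fun _ => by linarith⟩
      have := le_ceil_sub_one (M := M) (N := i - k - 1) (by push_cast; linarith)
      push_cast at this
      linarith
    · exact ⟨x, ⟨hxk, hxk'⟩, abs_le.2 hi, id, id⟩

theorem inner_mid (h : SmallRadius ε M) (k : ℤ) : Inner ε k (k + 1 / 2) :=
  ⟨by linarith [h.half], by linarith [h.half]⟩

/-- If `[p - M, p + M]` meets a strip but not its midpoint, then the distance from `p` to the strip
is `⌈M⌉ - 1`, and the intervals `[r - M, r + M]` which contain the midpoint contain the strip. -/
theorem center_of_not_mid {k p : ℤ} {x : ℝ} (hx : (k : ℝ) < x ∧ x < k + 1) (hp : |x - p| ≤ M)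
    (hmid : ¬ |(k : ℝ) + 1 / 2 - p| ≤ M) :
    M < ⌈M⌉ - 1 + 1 / 2 ∧ ((x < k + 1 / 2 ∧ p = k - (⌈M⌉ - 1)) ∨
      (k + 1 / 2 < x ∧ p = k + 1 + (⌈M⌉ - 1))) := by
  rw [abs_le] at hp
  have hc := Int.le_ceil M
  have hc' := Int.ceil_lt_add_one M
  rcases le_or_gt p k with hpk | hpk
  · have hpk' : (p : ℝ) ≤ k := by exact_mod_cast hpk
    have h0 : M < k + 1 / 2 - p := by
      by_contra h
      exact hmid (abs_le.2 ⟨by linarith, by linarith⟩)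
    have h1 := le_ceil_sub_one (M := M) (N := k - p) (by push_cast; linarith)
    have h2 : k - p ≤ ⌈M⌉ - 1 := by exact_mod_cast h1
    have h3 : ⌈M⌉ - 1 < k - p + 1 := by
      have : ((⌈M⌉ - 1 : ℤ) : ℝ) < ((k - p + 1 : ℤ) : ℝ) := by push_cast; linarith
      exact_mod_cast this
    push_cast at h1
    have h4 : p = k - (⌈M⌉ - 1) := by omega
    have h5 : (p : ℝ) = k - (⌈M⌉ - 1) := by rw [h4]; push_cast; ring
    exact ⟨by linarith, Or.inl ⟨by linarith, h4⟩⟩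
  · have hpk' : (k : ℝ) + 1 ≤ p := by exact_mod_cast hpk
    have h0 : M < p - k - 1 / 2 := by
      by_contra h
      exact hmid (abs_le.2 ⟨by linarith, by linarith⟩)
    have h1 := le_ceil_sub_one (M := M) (N := p - k - 1) (by push_cast; linarith)
    have h2 : p - k - 1 ≤ ⌈M⌉ - 1 := by exact_mod_cast h1
    have h3 : ⌈M⌉ - 1 < p - k - 1 + 1 := by
      have : ((⌈M⌉ - 1 : ℤ) : ℝ) < ((p - k - 1 + 1 : ℤ) : ℝ) := by push_cast; linarith
      exact_mod_cast this
    push_cast at h1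
    have h4 : p = k + 1 + (⌈M⌉ - 1) := by omega
    have h5 : (p : ℝ) = k + 1 + (⌈M⌉ - 1) := by rw [h4]; push_cast; ring
    exact ⟨by linarith, Or.inr ⟨by linarith, h4⟩⟩

theorem mem_of_mid {k r : ℤ} {x : ℝ} (hx : (k : ℝ) < x ∧ x < k + 1) (hM : M < ⌈M⌉ - 1 + 1 / 2)
    (hr : |(k : ℝ) + 1 / 2 - r| ≤ M) : |x - r| ≤ M := by
  rw [abs_le] at hr ⊢
  have hc' := Int.ceil_lt_add_one M
  have h1 : k - r < ⌈M⌉ - 1 := by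
    have : ((k - r : ℤ) : ℝ) < ((⌈M⌉ - 1 : ℤ) : ℝ) := by push_cast; linarith
    exact_mod_cast this
  have h2 : r - k - 1 < ⌈M⌉ - 1 := by
    have : ((r - k - 1 : ℤ) : ℝ) < ((⌈M⌉ - 1 : ℤ) : ℝ) := by push_cast; linarith
    exact_mod_cast this
  have h3 : ((k - r + 1 : ℤ) : ℝ) ≤ ((⌈M⌉ - 1 : ℤ) : ℝ) := by exact_mod_cast (by omega)
  have h4 : ((r - k : ℤ) : ℝ) ≤ ((⌈M⌉ - 1 : ℤ) : ℝ) := by exact_mod_cast (by omega)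
  push_cast at h3 h4
  constructor <;> linarith

/-- Over the strip `k < x < k + 1`, the intervals `[i - M, i + M]`, `i ∈ I`, contain the midpoint. -/
def HasMid (M : ℝ) (I : Set ℤ) (k : ℤ) : Prop := ∃ r ∈ I, |(k : ℝ) + 1 / 2 - r| ≤ M

/-- `x` and `y` lie in the same cell: the strip is divided in two at its midpoint, unless the
midpoint belongs to the union of the intervals `[i - M, i + M]`. -/
def SameCell (M : ℝ) (I : Set ℤ) (k : ℤ) (x y : ℝ) : Prop :=
  HasMid M I k ∨ (x < k + 1 / 2 ∧ y < k + 1 / 2) ∨ (k + 1 / 2 < x ∧ k + 1 / 2 < y)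

/-- The points of a cell which lie in the union of the intervals `[i - M, i + M]` form an interval;
they are connected through three of these intervals. -/
theorem exists_chain (h : SmallRadius ε M) {I : Set ℤ} {k p q : ℤ} {x y : ℝ} (hp : p ∈ I)
    (hq : q ∈ I) (hx : Inner ε k x) (hy : Inner ε k y) (hxp : |x - p| ≤ M) (hyq : |y - q| ≤ M)
    (hxy : SameCell M I k x y) : ∃ r ∈ I, ∃ x' y', Inner ε k x' ∧ Inner ε k y' ∧ |x' - p| ≤ M ∧
      |x' - r| ≤ M ∧ |y' - r| ≤ M ∧ |y' - q| ≤ M := by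
  have hxs := hx.strip h
  have hys := hy.strip h
  by_cases h1 : |(k : ℝ) + 1 / 2 - p| ≤ M
  · by_cases h2 : |(k : ℝ) + 1 / 2 - q| ≤ M
    · exact ⟨p, hp, _, _, inner_mid h k, inner_mid h k, h1, h1, h1, h2⟩
    · have := mem_of_mid hys (center_of_not_mid hys hyq h2).1 h1
      exact ⟨p, hp, y, y, hy, hy, this, this, this, hyq⟩
  · obtain ⟨hM, h3⟩ := center_of_not_mid hxs hxp h1
    by_cases h2 : |(k : ℝ) + 1 / 2 - q| ≤ M
    · have := mem_of_mid hxs hM h2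
      exact ⟨q, hq, x, x, hx, hx, hxp, this, this, this⟩
    · obtain ⟨-, h4⟩ := center_of_not_mid hys hyq h2
      rcases hxy with ⟨r, hr, hrm⟩ | hxy
      · exact ⟨r, hr, x, y, hx, hy, hxp, mem_of_mid hxs hM hrm, mem_of_mid hys hM hrm, hyq⟩
      · have hpq : p = q := by
          rcases hxy with hxy | hxy
          · rcases h3 with h3 | h3
            · rcases h4 with h4 | h4
              · rw [h3.2, h4.2]
              · linarith [h4.1, hxy.2]
            · linarith [h3.1, hxy.1]
          · rcases h3 with h3 | h3
            · linarith [h3.1, hxy.1]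
            · rcases h4 with h4 | h4
              · linarith [h4.1, hxy.2]
              · rw [h3.2, h4.2]
        subst hpq
        exact ⟨p, hp, y, y, hy, hy, hyq, hyq, hyq, hyq⟩

/-- The translations which bring the strip `k < Re z₊ < k + 1` of the sheet `m₊ = m` into one of the
sheets `m₋ = 0, …, A - 1`, up to sign. -/
def shifts (A B : ℕ) (m k : ℤ) : Set ℤ :=
  {i | 0 ≤ m + B * k - (B - A) * i ∧ m + B * k - (B - A) * i < A}

/-- The centres of the intervals which are the real traces of the legs over a strip. -/
def centers (A B : ℕ) (m k : ℤ) : Set ℤ := insert 0 (shifts A B m k)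

theorem hasSheet_iff {m k : ℤ} : HasSheet A B (m + B * k) ↔ (shifts A B m k).Nonempty := by
  constructor
  · rintro ⟨j, h1, h2⟩
    exact ⟨-j, by rwa [mul_neg, sub_neg_eq_add], by rwa [mul_neg, sub_neg_eq_add]⟩
  · rintro ⟨i, h1, h2⟩
    exact ⟨-i, by rwa [mul_neg, ← sub_eq_add_neg], by rwa [mul_neg, ← sub_eq_add_neg]⟩

theorem plusPt_mem_SigmaMinus_iff {m k : ℤ} {z : ℂ} (hz : (k : ℝ) < z.re ∧ z.re < k + 1) :
    plusPt A B m z ∈ SigmaMinus A B ε M ↔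
      ∃ i ∈ shifts A B m k, z - i ∈ sheetRegion (-1) ε M := by
  have h1 := ne_int_of_mem hz.1 hz.2
  rw [plusPt_eq_minusPt_floor m h1, (floor_eq_of_strip h1 k).2 hz,
    minusPt_mem_SigmaMinus (mem_cutMinus.2 (Or.inl h1))]
  constructor
  · rintro ⟨j, h2, h3, h4⟩
    exact ⟨-j, ⟨by rwa [mul_neg, sub_neg_eq_add], by rwa [mul_neg, sub_neg_eq_add]⟩,
      by simpa using h4⟩
  · rintro ⟨i, ⟨h2, h3⟩, h4⟩
    exact ⟨-i, by rwa [mul_neg, ← sub_eq_add_neg], by rwa [mul_neg, ← sub_eq_add_neg],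
      by simpa [← sub_eq_add_neg] using h4⟩

theorem strip_mem_cutPlus {k : ℤ} {z : ℂ} (hz : (k : ℝ) < z.re ∧ z.re < k + 1) : z ∈ cutPlus :=
  mem_cutPlus.2 (Or.inl (ne_int_of_mem hz.1 hz.2))

theorem strip_mem_cutMinus {k : ℤ} {z : ℂ} (hz : (k : ℝ) < z.re ∧ z.re < k + 1) : z ∈ cutMinus :=
  mem_cutMinus.2 (Or.inl (ne_int_of_mem hz.1 hz.2))

/-- Over the inner part of a strip, only the condition on the real part matters. -/
theorem Inner.mem_leg (h : SmallRadius ε M) {s : ℝ} {k i : ℤ} {z : ℂ} (hz : Inner ε k z.re)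
    (hi : |z.re - i| ≤ M) (hy : -(ε / M) ≤ s * z.im) : z - i ∈ leg s ε M := by
  refine ⟨by simpa using hi, by simpa using hy, fun j => ?_⟩
  have h1 : ε / (1 + |(j : ℝ)|) ≤ ε := by
    apply div_le_self h.hε.le
    linarith [abs_nonneg (j : ℝ)]
  refine h1.trans (le_trans ?_ (Complex.abs_re_le_norm _))
  simp only [Complex.sub_re, Complex.intCast_re]
  rcases le_or_gt (i + j) k with hk | hk
  · have : ((i + j : ℤ) : ℝ) ≤ k := by exact_mod_cast hk
    push_cast at this
    rw [le_abs]; left; linarith [hz.1]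
  · have : (k + 1 : ℝ) ≤ ((i + j : ℤ) : ℝ) := by exact_mod_cast hk
    push_cast at this
    rw [le_abs]; right; linarith [hz.2]

end Cells

/-! ### Real points of `X` in a cell -/

section RealPoints

open Set Topology

variable {A B : ℕ} {ε M : ℝ} {Q : Type*} [AddCommGroup Q]
  {κ : C(stdSimplex ℝ (Fin 2), XSurf A B ε M) → Q}

theorem sheetRegion_real_iff (hε : 0 < ε) (hM : 0 < M) {x : ℝ} :
    (x : ℂ) ∈ sheetRegion (-1) ε M ↔ (x : ℂ) ∈ sheetRegion 1 ε M := by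
  have hη : 0 < ε / M := by positivity
  simp [mem_sheetRegion, leg, hη.not_ge]

theorem real_mem_XSurf_iff (hε : 0 < ε) (hM : 0 < M) {m k : ℤ} (hm : 0 ≤ m) (hmA : m < A) {x : ℝ}
    (hx : (k : ℝ) < x ∧ x < k + 1) : plusPt A B m x ∈ XSurf A B ε M ↔
      ∃ i ∈ centers A B m k, ((x - i : ℝ) : ℂ) ∈ sheetRegion 1 ε M := by
  rw [XSurf, mem_union, plusPt_mem_SigmaPlus hm hmA (strip_mem_cutPlus hx),
    plusPt_mem_SigmaMinus_iff hx]
  constructor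
  · rintro (h | ⟨i, hi, h⟩)
    · exact ⟨0, mem_insert _ _, by simpa using h⟩
    · refine ⟨i, mem_insert_of_mem _ hi, ?_⟩
      rw [← sheetRegion_real_iff hε hM]
      push_cast
      exact h
  · rintro ⟨i, rfl | hi, h⟩
    · exact Or.inl (by simpa using h)
    · refine Or.inr ⟨i, hi, ?_⟩
      rw [← sheetRegion_real_iff hε hM] at h
      push_cast at h
      exact h

theorem Inner.real_mem (h : SmallRadius ε M) {k i : ℤ} {x : ℝ} (hx : Inner ε k x)
    (hi : |x - i| ≤ M) : ((x - i : ℝ) : ℂ) ∈ sheetRegion 1 ε M := by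
  have := Inner.mem_leg h (s := 1) (z := x) (by simpa using hx) (by simpa using hi)
    (by simpa using h.height_pos.le)
  push_cast
  exact leg_subset this

/-- The jump is the same at all the real points of a cell. -/
theorem jump_eq_of_sameCell (h : SmallRadius ε M) {v w : Surface A B → Q}
    (hv : IsPotential κ (upperX A B ε M) v) (hw : IsPotential κ (lowerX A B ε M) w) {m k : ℤ}
    (hm : 0 ≤ m) (hmA : m < A) {x y : ℝ} (hx : (k : ℝ) < x ∧ x < k + 1)
    (hy : (k : ℝ) < y ∧ y < k + 1) (hxX : plusPt A B m x ∈ XSurf A B ε M)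
    (hyX : plusPt A B m y ∈ XSurf A B ε M) (hxy : SameCell M (centers A B m k) k x y) :
    v (plusPt A B m x) - w (plusPt A B m x) = v (plusPt A B m y) - w (plusPt A B m y) := by
  have hX := fun {t : ℝ} (ht : (k : ℝ) < t ∧ t < k + 1) =>
    real_mem_XSurf_iff (A := A) (B := B) h.hε h.hM hm hmA ht
  -- along one leg
  have along : ∀ i ∈ centers A B m k, ∀ s t : ℝ, (k : ℝ) < s ∧ s < k + 1 →
      (k : ℝ) < t ∧ t < k + 1 → ((s - i : ℝ) : ℂ) ∈ sheetRegion 1 ε M →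
      ((t - i : ℝ) : ℂ) ∈ sheetRegion 1 ε M →
      v (plusPt A B m s) - w (plusPt A B m s) = v (plusPt A B m t) - w (plusPt A B m t) := by
    intro i hi s t hs ht hs' ht'
    refine jump_eq_of_uIcc hv hw hs ht fun r hr => (hX (strip_of_uIcc hs ht hr)).2 ⟨i, hi, ?_⟩
    refine sheetRegion_real_uIcc h.hε h.hM (k := k - i) ?_ ?_ hs' ht' ?_
    · push_cast; constructor <;> linarith
    · push_cast; constructor <;> linarith
    · rcases mem_uIcc.1 hr with h | h
      · exact mem_uIcc.2 (Or.inl ⟨by linarith, by linarith⟩)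
      · exact mem_uIcc.2 (Or.inr ⟨by linarith, by linarith⟩)
  obtain ⟨p, hp, hxp⟩ := (hX hx).1 hxX
  obtain ⟨q, hq, hyq⟩ := (hX hy).1 hyX
  obtain ⟨x₁, hx1, hx1p, hxl, hxr⟩ := exists_inner h hx (abs_le_of_real_mem h.hε h.hM hxp)
  obtain ⟨y₁, hy1, hy1q, hyl, hyr⟩ := exists_inner h hy (abs_le_of_real_mem h.hε h.hM hyq)
  have hcell : SameCell M (centers A B m k) k x₁ y₁ := by
    rcases hxy with h1 | h1 | h1
    · exact Or.inl h1
    · exact Or.inr (Or.inl ⟨hxl h1.1, hyl h1.2⟩)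
    · exact Or.inr (Or.inr ⟨hxr h1.1, hyr h1.2⟩)
  obtain ⟨r, hr, x₂, y₂, hx2, hy2, hx2p, hx2r, hy2r, hy2q⟩ :=
    exists_chain h hp hq hx1 hy1 hx1p hy1q hcell
  rw [along p hp x x₁ hx (hx1.strip h) hxp (hx1.real_mem h hx1p),
    along p hp x₁ x₂ (hx1.strip h) (hx2.strip h) (hx1.real_mem h hx1p) (hx2.real_mem h hx2p),
    along r hr x₂ y₂ (hx2.strip h) (hy2.strip h) (hx2.real_mem h hx2r) (hy2.real_mem h hy2r),
    along q hq y₂ y₁ (hy2.strip h) (hy1.strip h) (hy2.real_mem h hy2q) (hy1.real_mem h hy1q),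
    along q hq y₁ y (hy1.strip h) hy (hy1.real_mem h hy1q) hyq]

end RealPoints

/-! ### The path components of `Σ⁺ ∩ Σ⁻` -/

section Intersection

open Set Topology

variable {A B : ℕ} {ε M : ℝ}

theorem convex_rect (a b c d : ℝ) :
    Convex ℝ {z : ℂ | z.re ∈ uIcc a b ∧ z.im ∈ uIcc c d} := by
  have h1 : Convex ℝ {z : ℂ | z.re ∈ uIcc a b} :=
    (convex_uIcc a b).is_linear_preimage Complex.reLm.isLinear
  have h2 : Convex ℝ {z : ℂ | z.im ∈ uIcc c d} :=
    (convex_uIcc c d).is_linear_preimage Complex.imLm.isLinear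
  exact h1.inter h2

/-- Two points of a strip are joined if the horizontal or vertical segment between them lies in
the set. -/
theorem joinedIn_segment {S : Set (Surface A B)} {m k : ℤ} {z w : ℂ}
    (hz : (k : ℝ) < z.re ∧ z.re < k + 1) (hw : (k : ℝ) < w.re ∧ w.re < k + 1)
    (h : ∀ v : ℂ, (k : ℝ) < v.re ∧ v.re < k + 1 → v.re ∈ uIcc z.re w.re → v.im ∈ uIcc z.im w.im →
      plusPt A B m v ∈ S) : JoinedIn S (plusPt A B m z) (plusPt A B m w) :=
  joinedIn_plusPt (convex_rect z.re w.re z.im w.im)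
    (fun v hv => ⟨strip_mem_cutPlus (strip_of_uIcc hz hw hv.1), h v (strip_of_uIcc hz hw hv.1) hv.1 hv.2⟩)
    ⟨left_mem_uIcc, left_mem_uIcc⟩ ⟨right_mem_uIcc, right_mem_uIcc⟩

theorem SigmaPlus_of_high {m : ℤ} (hm : 0 ≤ m) (hmA : m < A) {z : ℂ} (hz : z ∈ cutPlus)
    (h : ε / M ≤ z.im) : plusPt A B m z ∈ SigmaPlus A B ε M :=
  (plusPt_mem_SigmaPlus hm hmA hz).2 (mem_sheetRegion.2 (Or.inr (by simpa using h)))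

theorem SigmaMinus_of_low {m k i : ℤ} {z : ℂ} (hz : (k : ℝ) < z.re ∧ z.re < k + 1)
    (hi : i ∈ shifts A B m k) (h : z.im ≤ -(ε / M)) : plusPt A B m z ∈ SigmaMinus A B ε M :=
  (plusPt_mem_SigmaMinus_iff hz).2 ⟨i, hi, mem_sheetRegion.2 (Or.inr (by
    simp only [Complex.sub_im, Complex.intCast_im, sub_zero]; linarith))⟩

open Classical in
/-- The point over `x` on the line on which the leg with centre `i` ends: `Im z = ε/M` for the
legs of `Σ⁻` and `Im z = -ε/M` for the leg of `Σ⁺`. -/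
def linePt (A B : ℕ) (ε M : ℝ) (m k i : ℤ) (x : ℝ) : ℂ :=
  ⟨x, if i ∈ shifts A B m k then ε / M else -(ε / M)⟩

theorem linePt_re {m k i : ℤ} {x : ℝ} : (linePt A B ε M m k i x).re = x := rfl

variable {m k : ℤ}

/-- The vertical segment over a point common to the leg of `Σ⁺` and a leg of `Σ⁻`. -/
theorem vertical_mem_inter (h : SmallRadius ε M) (hm : 0 ≤ m) (hmA : m < A) {i : ℤ}
    (hi : i ∈ shifts A B m k) {z : ℂ} (hz : Inner ε k z.re) (h0 : |z.re| ≤ M)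
    (h1 : |z.re - i| ≤ M) (hy : |z.im| ≤ ε / M) :
    plusPt A B m z ∈ SigmaPlus A B ε M ∩ SigmaMinus A B ε M := by
  rw [abs_le] at hy
  have hs := hz.strip h
  constructor
  · rw [plusPt_mem_SigmaPlus hm hmA (strip_mem_cutPlus hs)]
    have := Inner.mem_leg h (s := 1) (i := 0) hz (by simpa using h0) (by simpa using hy.1)
    exact leg_subset (by simpa using this)
  · rw [plusPt_mem_SigmaMinus_iff hs]
    exact ⟨i, hi, leg_subset (hz.mem_leg h h1 (by linarith))⟩

/-- Points of the line of a leg. -/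
theorem line_mem_inter (h : SmallRadius ε M) (hm : 0 ≤ m) (hmA : m < A)
    (hne : (shifts A B m k).Nonempty) {i : ℤ} (hi : i ∈ centers A B m k) {x : ℝ}
    (hx : Inner ε k x) (hxi : |x - i| ≤ M) :
    plusPt A B m (linePt A B ε M m k i x) ∈ SigmaPlus A B ε M ∩ SigmaMinus A B ε M := by
  have hη := h.height_pos
  have hs : (k : ℝ) < (linePt A B ε M m k i x).re ∧ (linePt A B ε M m k i x).re < k + 1 := hx.strip h
  by_cases his : i ∈ shifts A B m k
  · have him : (linePt A B ε M m k i x).im = ε / M := if_pos his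
    refine ⟨SigmaPlus_of_high hm hmA (strip_mem_cutPlus hs) him.ge, ?_⟩
    rw [plusPt_mem_SigmaMinus_iff hs]
    exact ⟨i, his, leg_subset (Inner.mem_leg h hx hxi (by rw [him]; linarith))⟩
  · have him : (linePt A B ε M m k i x).im = -(ε / M) := if_neg his
    obtain ⟨j, hj⟩ := hne
    refine ⟨?_, SigmaMinus_of_low hs hj him.le⟩
    have hi0 : i = 0 := hi.resolve_right his
    subst hi0
    rw [plusPt_mem_SigmaPlus hm hmA (strip_mem_cutPlus hs)]
    have := Inner.mem_leg h (s := 1) (i := 0) (z := linePt A B ε M m k 0 x) hx hxi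
      (by rw [him]; linarith)
    exact leg_subset (by simpa using this)

theorem joinedIn_line (h : SmallRadius ε M) (hm : 0 ≤ m) (hmA : m < A)
    (hne : (shifts A B m k).Nonempty) {i : ℤ} (hi : i ∈ centers A B m k) {x y : ℝ}
    (hx : Inner ε k x) (hy : Inner ε k y) (hxi : |x - i| ≤ M) (hyi : |y - i| ≤ M) :
    JoinedIn (SigmaPlus A B ε M ∩ SigmaMinus A B ε M) (plusPt A B m (linePt A B ε M m k i x))
      (plusPt A B m (linePt A B ε M m k i y)) := by
  refine joinedIn_segment (k := k) (hx.strip h) (hy.strip h) fun v _ hvr hvi => ?_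
  have h1 : v = linePt A B ε M m k i v.re := by
    refine Complex.ext rfl ?_
    have : (linePt A B ε M m k i x).im = (linePt A B ε M m k i y).im := rfl
    rw [this, uIcc_self] at hvi
    exact hvi
  rw [h1]
  rw [linePt_re, linePt_re] at hvr
  refine line_mem_inter h hm hmA hne hi ?_ ?_
  · exact ⟨(le_min hx.1 hy.1).trans hvr.1, hvr.2.trans (max_le hx.2 hy.2)⟩
  · rw [abs_le] at hxi hyi ⊢
    rcases mem_uIcc.1 hvr with h | h
    · constructor <;> linarith
    · constructor <;> linarith

/-- The same real point, moved to two heights that belong to different legs over it. If both legs are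
of `Σ⁻` the heights agree; if one is the leg of `Σ⁺`, the vertical segment between the two heights
lies in `Σ⁺ ∩ Σ⁻`. -/
theorem joinedIn_switch (h : SmallRadius ε M) (hm : 0 ≤ m) (hmA : m < A)
    (hne : (shifts A B m k).Nonempty) {p q : ℤ} (hp : p ∈ centers A B m k)
    (hq : q ∈ centers A B m k) {x : ℝ} (hx : Inner ε k x) (hxp : |x - p| ≤ M) (hxq : |x - q| ≤ M) :
    JoinedIn (SigmaPlus A B ε M ∩ SigmaMinus A B ε M) (plusPt A B m (linePt A B ε M m k p x))
      (plusPt A B m (linePt A B ε M m k q x)) := by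
  have key : ∀ {p q : ℤ}, p ∈ shifts A B m k → q ∉ shifts A B m k → q ∈ centers A B m k →
      |x - p| ≤ M → |x - q| ≤ M → JoinedIn (SigmaPlus A B ε M ∩ SigmaMinus A B ε M)
        (plusPt A B m (linePt A B ε M m k p x)) (plusPt A B m (linePt A B ε M m k q x)) := by
    intro p q hp hq' hq hxp hxq
    have hq0 : q = 0 := hq.resolve_right hq'
    subst hq0
    refine joinedIn_segment (k := k) (hx.strip h) (hx.strip h) fun v _ hvr hvi => ?_
    rw [linePt_re, linePt_re, uIcc_self, mem_singleton_iff] at hvr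
    simp only [linePt, if_pos hp, if_neg hq'] at hvi
    have hη := h.height_pos
    refine vertical_mem_inter h hm hmA hp (by rwa [hvr]) (by rw [hvr]; simpa using hxq)
      (by rwa [hvr]) (abs_le.2 ?_)
    rw [uIcc_of_ge (by linarith)] at hvi
    exact hvi
  by_cases h1 : p ∈ shifts A B m k
  · by_cases h2 : q ∈ shifts A B m k
    · have : linePt A B ε M m k p x = linePt A B ε M m k q x := by simp [linePt, h1, h2]
      rw [this]
      exact JoinedIn.refl (line_mem_inter h hm hmA hne hq hx hxq)
    · exact key h1 h2 hq hxp hxq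
  · by_cases h2 : q ∈ shifts A B m k
    · exact (key h2 h1 hp hxq hxp).symm
    · have : linePt A B ε M m k p x = linePt A B ε M m k q x := by simp [linePt, h1, h2]
      rw [this]
      exact JoinedIn.refl (line_mem_inter h hm hmA hne hq hx hxq)

/-- Every point of `Σ⁺ ∩ Σ⁻` is joined to an inner point of the line of some leg. -/
theorem exists_joinedIn_line (h : SmallRadius ε M) (hm : 0 ≤ m) (hmA : m < A) {z : ℂ}
    (hz : (k : ℝ) < z.re ∧ z.re < k + 1)
    (hC : plusPt A B m z ∈ SigmaPlus A B ε M ∩ SigmaMinus A B ε M) :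
    ∃ i ∈ centers A B m k, ∃ x, Inner ε k x ∧ |x - i| ≤ M ∧
      (z.re < k + 1 / 2 → x < k + 1 / 2) ∧ (k + 1 / 2 < z.re → k + 1 / 2 < x) ∧
      JoinedIn (SigmaPlus A B ε M ∩ SigmaMinus A B ε M) (plusPt A B m z)
        (plusPt A B m (linePt A B ε M m k i x)) := by
  have hη := h.height_pos
  have hzp := (plusPt_mem_SigmaPlus hm hmA (strip_mem_cutPlus hz)).1 hC.1
  obtain ⟨i, hi, hzi⟩ := (plusPt_mem_SigmaMinus_iff hz).1 hC.2
  have hne : (shifts A B m k).Nonempty := ⟨i, hi⟩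
  -- the upper case: vertically to the line `Im z = ε/M`, then along it
  have upper : 0 ≤ z.im → ∃ i ∈ centers A B m k, ∃ x, Inner ε k x ∧ |x - i| ≤ M ∧
      (z.re < k + 1 / 2 → x < k + 1 / 2) ∧ (k + 1 / 2 < z.re → k + 1 / 2 < x) ∧
      JoinedIn (SigmaPlus A B ε M ∩ SigmaMinus A B ε M) (plusPt A B m z)
        (plusPt A B m (linePt A B ε M m k i x)) := by
    intro h0
    have hleg := mem_leg_of_lt hzi (by
      simp only [Complex.sub_im, Complex.intCast_im, sub_zero]; linarith)
    have hle : z.im ≤ ε / M := by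
      have := hleg.2.1
      simp only [Complex.sub_im, Complex.intCast_im, sub_zero] at this
      linarith
    have hup : ∀ y : ℝ, z.im ≤ y → y ≤ ε / M → (⟨z.re, y⟩ : ℂ) - i ∈ leg (-1) ε M := by
      intro y h1 h2
      refine leg_vertical h.hε hleg (by simp) ?_ ?_
      · simp only [Complex.sub_im, Complex.intCast_im, sub_zero]
        exact pow_le_pow_left₀ h0 h1 2
      · simp only [Complex.sub_im, Complex.intCast_im, sub_zero]; linarith
    have hri : |z.re - i| ≤ M := by simpa using hleg.1
    obtain ⟨x, hx, hxi, hxl, hxr⟩ := exists_inner h hz hri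
    have him : (linePt A B ε M m k i x).im = ε / M := if_pos hi
    refine ⟨i, mem_insert_of_mem _ hi, x, hx, hxi, hxl, hxr, ?_⟩
    have j1 : JoinedIn (SigmaPlus A B ε M ∩ SigmaMinus A B ε M) (plusPt A B m z)
        (plusPt A B m ⟨z.re, ε / M⟩) := by
      refine joinedIn_segment (k := k) hz hz fun v hv hvr hvi => ?_
      simp only [uIcc_self, mem_singleton_iff] at hvr
      simp only [uIcc_of_le hle] at hvi
      refine ⟨(plusPt_mem_SigmaPlus hm hmA (strip_mem_cutPlus hv)).2
        (sheetRegion_up h.hε hzp hvr (by simpa using h0) (by simpa using hvi.1) (by norm_num)),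
        (plusPt_mem_SigmaMinus_iff hv).2 ⟨i, hi, leg_subset ?_⟩⟩
      have := hup v.im hvi.1 hvi.2
      rwa [← hvr] at this
    refine j1.trans (joinedIn_segment (k := k) hz (hx.strip h) fun v hv hvr hvi => ?_)
    simp only [him, uIcc_self, mem_singleton_iff] at hvi
    rw [linePt_re] at hvr
    refine ⟨SigmaPlus_of_high hm hmA (strip_mem_cutPlus hv) hvi.ge,
      (plusPt_mem_SigmaMinus_iff hv).2 ⟨i, hi, leg_subset ?_⟩⟩
    have hx' : linePt A B ε M m k i x - i ∈ leg (-1) ε M :=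
      Inner.mem_leg h hx hxi (by rw [him]; linarith)
    refine leg_horizontal h.hε (k := k - i) (hup _ hle le_rfl) hx' ?_ ?_ ?_ ?_ ?_
    · simp only [Complex.sub_re, Complex.intCast_re, Int.cast_sub]
      constructor <;> linarith
    · have := hx.strip h
      simp only [Complex.sub_re, Complex.intCast_re, Int.cast_sub, linePt_re]
      constructor <;> linarith
    · simp [him]
    · simp [hvi]
    · simp only [Complex.sub_re, Complex.intCast_re, linePt_re]
      rcases mem_uIcc.1 hvr with h | h
      · simp only at h
        exact mem_uIcc.2 (Or.inl ⟨by linarith, by linarith⟩)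
      · simp only at h
        exact mem_uIcc.2 (Or.inr ⟨by linarith, by linarith⟩)
  rcases le_or_gt 0 z.im with h0 | h0
  · exact upper h0
  -- the lower case: vertically to the line `Im z = -ε/M`, then along it
  · have hleg := mem_leg_of_lt hzp (by linarith)
    have hge : -(ε / M) ≤ z.im := by simpa using hleg.2.1
    have hdown : ∀ y : ℝ, y ≤ z.im → -(ε / M) ≤ y → (⟨z.re, y⟩ : ℂ) ∈ leg 1 ε M := by
      intro y h1 h2
      refine leg_vertical h.hε hleg rfl ?_ (by simpa using h2)
      simp only
      nlinarith
    have hri : |z.re - (0 : ℤ)| ≤ M := by simpa using hleg.1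
    obtain ⟨x, hx, hxi, hxl, hxr⟩ := exists_inner h hz hri
    have j1 : JoinedIn (SigmaPlus A B ε M ∩ SigmaMinus A B ε M) (plusPt A B m z)
        (plusPt A B m ⟨z.re, -(ε / M)⟩) := by
      refine joinedIn_segment (k := k) hz hz fun v hv hvr hvi => ?_
      simp only [uIcc_self, mem_singleton_iff] at hvr
      simp only [uIcc_of_ge hge] at hvi
      refine ⟨(plusPt_mem_SigmaPlus hm hmA (strip_mem_cutPlus hv)).2 (leg_subset ?_),
        (plusPt_mem_SigmaMinus_iff hv).2 ⟨i, hi, sheetRegion_up h.hε hzi (by simp [hvr]) ?_ ?_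
          (by norm_num)⟩⟩
      · have := hdown v.im hvi.2 hvi.1
        rwa [← hvr] at this
      · simp only [Complex.sub_im, Complex.intCast_im, sub_zero]; linarith
      · simp only [Complex.sub_im, Complex.intCast_im, sub_zero]; linarith [hvi.2]
    have j2 : JoinedIn (SigmaPlus A B ε M ∩ SigmaMinus A B ε M)
        (plusPt A B m ⟨z.re, -(ε / M)⟩) (plusPt A B m ⟨x, -(ε / M)⟩) := by
      refine joinedIn_segment (k := k) hz (hx.strip h) fun v hv hvr hvi => ?_
      simp only [uIcc_self, mem_singleton_iff] at hvi
      refine ⟨(plusPt_mem_SigmaPlus hm hmA (strip_mem_cutPlus hv)).2 (leg_subset ?_),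
        SigmaMinus_of_low hv hi hvi.le⟩
      have hx' : (⟨x, -(ε / M)⟩ : ℂ) ∈ leg 1 ε M := by
        have := Inner.mem_leg h (s := 1) (i := 0) (z := ⟨x, -(ε / M)⟩) hx hxi (by simp)
        simpa using this
      refine leg_horizontal h.hε (k := k) (hdown _ hge le_rfl) hx' ⟨hz.1.le, hz.2.le⟩
        ⟨(hx.strip h).1.le, (hx.strip h).2.le⟩ le_rfl hvi hvr
    have j3 := j1.trans j2
    by_cases h0s : (0 : ℤ) ∈ shifts A B m k
    · refine ⟨0, mem_insert _ _, x, hx, hxi, hxl, hxr, j3.trans ?_⟩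
      refine joinedIn_segment (k := k) (hx.strip h) (hx.strip h) fun v hv hvr hvi => ?_
      simp only [linePt_re, uIcc_self, mem_singleton_iff] at hvr
      simp only [linePt, if_pos h0s] at hvi
      rw [uIcc_of_le (by linarith)] at hvi
      exact vertical_mem_inter h hm hmA h0s (by rwa [hvr]) (by rw [hvr]; simpa using hxi)
        (by rwa [hvr]) (abs_le.2 hvi)
    · refine ⟨0, mem_insert _ _, x, hx, hxi, hxl, hxr, ?_⟩
      have : linePt A B ε M m k 0 x = ⟨x, -(ε / M)⟩ := by simp [linePt, h0s]
      rwa [this]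

/-- Points of `Σ⁺ ∩ Σ⁻` in the same cell are joined in `Σ⁺ ∩ Σ⁻`. -/
theorem joinedIn_of_sameCell (h : SmallRadius ε M) (hm : 0 ≤ m) (hmA : m < A) {z w : ℂ}
    (hz : (k : ℝ) < z.re ∧ z.re < k + 1) (hw : (k : ℝ) < w.re ∧ w.re < k + 1)
    (hzC : plusPt A B m z ∈ SigmaPlus A B ε M ∩ SigmaMinus A B ε M)
    (hwC : plusPt A B m w ∈ SigmaPlus A B ε M ∩ SigmaMinus A B ε M)
    (hzw : SameCell M (centers A B m k) k z.re w.re) :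
    JoinedIn (SigmaPlus A B ε M ∩ SigmaMinus A B ε M) (plusPt A B m z) (plusPt A B m w) := by
  have hne : (shifts A B m k).Nonempty := by
    obtain ⟨i, hi, -⟩ := (plusPt_mem_SigmaMinus_iff hz).1 hzC.2
    exact ⟨i, hi⟩
  obtain ⟨p, hp, x, hx, hxp, hxl, hxr, jx⟩ := exists_joinedIn_line h hm hmA hz hzC
  obtain ⟨q, hq, y, hy, hyq, hyl, hyr, jy⟩ := exists_joinedIn_line h hm hmA hw hwC
  have hcell : SameCell M (centers A B m k) k x y := by
    rcases hzw with h1 | h1 | h1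
    · exact Or.inl h1
    · exact Or.inr (Or.inl ⟨hxl h1.1, hyl h1.2⟩)
    · exact Or.inr (Or.inr ⟨hxr h1.1, hyr h1.2⟩)
  obtain ⟨r, hr, x', y', hx', hy', hx'p, hx'r, hy'r, hy'q⟩ := exists_chain h hp hq hx hy hxp hyq hcell
  exact jx.trans <| (joinedIn_line h hm hmA hne hp hx hx' hxp hx'p).trans <|
    (joinedIn_switch h hm hmA hne hp hr hx' hx'p hx'r).trans <|
    (joinedIn_line h hm hmA hne hr hx' hy' hx'r hy'r).trans <|
    (joinedIn_switch h hm hmA hne hr hq hy' hy'r hy'q).trans <|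
    (joinedIn_line h hm hmA hne hq hy' hy hy'q hyq).trans jy.symm

end Intersection

/-! ### Potentials on `Σ⁺` and on `Σ⁻` -/

section SidePotentials

open Set Topology

variable {A B : ℕ} {ε M : ℝ} {Q : Type*} [AddCommGroup Q]
  {κ : C(stdSimplex ℝ (Fin 2), XSurf A B ε M) → Q}

theorem SameCell.symm {I : Set ℤ} {k : ℤ} {x y : ℝ} (h : SameCell M I k x y) :
    SameCell M I k y x := by
  unfold SameCell at *; tauto

theorem SameCell.trans {I : Set ℤ} {k : ℤ} {x y z : ℝ} (h : SameCell M I k x y)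
    (h' : SameCell M I k y z) : SameCell M I k x z := by
  rcases h with h | h | h
  · exact Or.inl h
  · rcases h' with h' | h' | h'
    · exact Or.inl h'
    · exact Or.inr (Or.inl ⟨h.1, h'.2⟩)
    · linarith [h.2, h'.1]
  · rcases h' with h' | h' | h'
    · exact Or.inl h'
    · linarith [h.2, h'.1]
    · exact Or.inr (Or.inr ⟨h.1, h'.2⟩)

theorem sameCell_self {I : Set ℤ} {k i : ℤ} {x : ℝ} (hi : i ∈ I) (hx : |x - i| ≤ M) :
    SameCell M I k x x := by
  rcases lt_trichotomy x (k + 1 / 2) with h | h | h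
  · exact Or.inr (Or.inl ⟨h, h⟩)
  · exact Or.inl ⟨i, hi, by rwa [← h]⟩
  · exact Or.inr (Or.inr ⟨h, h⟩)

theorem isOpen_sameCell (I : Set ℤ) (k : ℤ) (x : ℝ) :
    IsOpen {z : ℂ | ((k : ℝ) < z.re ∧ z.re < k + 1) ∧ SameCell M I k x z.re} := by
  have h1 : IsOpen {z : ℂ | z.re < k + 1 / 2} := isOpen_lt Complex.continuous_re continuous_const
  have h2 : IsOpen {z : ℂ | k + 1 / 2 < z.re} := isOpen_lt continuous_const Complex.continuous_re
  have h3 : IsOpen {_z : ℂ | HasMid M I k} := isOpen_const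
  have h4 : IsOpen {_z : ℂ | x < k + 1 / 2} := isOpen_const
  have h5 : IsOpen {_z : ℂ | k + 1 / 2 < x} := isOpen_const
  exact (isOpen_strip k).inter (h3.union ((h4.inter h1).union (h5.inter h2)))

/-- A function on the surface which is constant on the cells, and equal to the jump at the real points
of `X`. -/
theorem exists_jump_fun (h : SmallRadius ε M) {v w : Surface A B → Q}
    (hv : IsPotential κ (upperX A B ε M) v) (hw : IsPotential κ (lowerX A B ε M) w) :
    ∃ J : Surface A B → Q,
      (∀ (m k : ℤ) (x : ℝ) (z : ℂ), 0 ≤ m → m < A → (k : ℝ) < x ∧ x < k + 1 →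
        (k : ℝ) < z.re ∧ z.re < k + 1 → plusPt A B m x ∈ XSurf A B ε M →
        SameCell M (centers A B m k) k x z.re →
          J (plusPt A B m z) = v (plusPt A B m x) - w (plusPt A B m x)) ∧
      ∀ (m k : ℤ) (y z : ℂ), 0 ≤ m → m < A → (k : ℝ) < y.re ∧ y.re < k + 1 →
        (k : ℝ) < z.re ∧ z.re < k + 1 → SameCell M (centers A B m k) k y.re z.re →
          J (plusPt A B m y) = J (plusPt A B m z) := by
  classical
  let P : ℤ → ℤ → ℂ → ℝ → Prop := fun m k z x => ((k : ℝ) < x ∧ x < k + 1) ∧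
    plusPt A B m x ∈ XSurf A B ε M ∧ SameCell M (centers A B m k) k x z.re
  have : Inhabited Q := ⟨0⟩
  obtain ⟨J, hJ⟩ := exists_fun_plusPt (A := A) (B := B) fun m z =>
    if hx : ∃ x, P m ⌊z.re⌋ z x then
      v (plusPt A B m hx.choose) - w (plusPt A B m hx.choose) else 0
  have hfl : ∀ {k : ℤ} {z : ℂ}, (k : ℝ) < z.re ∧ z.re < k + 1 → ⌊z.re⌋ = k := fun hz =>
    (floor_eq_of_strip (ne_int_of_mem hz.1 hz.2) _).2 hz
  have h1 : ∀ (m k : ℤ) (x : ℝ) (z : ℂ), 0 ≤ m → m < A → (k : ℝ) < x ∧ x < k + 1 →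
      (k : ℝ) < z.re ∧ z.re < k + 1 → plusPt A B m x ∈ XSurf A B ε M →
      SameCell M (centers A B m k) k x z.re →
        J (plusPt A B m z) = v (plusPt A B m x) - w (plusPt A B m x) := by
    intro m k x z hm hmA hx hz hxX hxz
    rw [hJ m z hm hmA (strip_mem_cutPlus hz), hfl hz]
    have hex : ∃ x, P m k z x := ⟨x, hx, hxX, hxz⟩
    rw [dif_pos hex]
    obtain ⟨h3, h4, h5⟩ := hex.choose_spec
    exact jump_eq_of_sameCell h hv hw hm hmA h3 hx h4 hxX (h5.trans hxz.symm)
  refine ⟨J, h1, fun m k y z hm hmA hy hz hyz => ?_⟩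
  by_cases hex : ∃ x, P m k z x
  · obtain ⟨x, hx, hxX, hxz⟩ := hex
    rw [h1 m k x z hm hmA hx hz hxX hxz, h1 m k x y hm hmA hx hy hxX (hxz.trans hyz.symm)]
  · have hex' : ¬ ∃ x, P m k y x := by
      rintro ⟨x, hx, hxX, hxy⟩
      exact hex ⟨x, hx, hxX, hxy.trans hyz⟩
    rw [hJ m y hm hmA (strip_mem_cutPlus hy), hJ m z hm hmA (strip_mem_cutPlus hz), hfl hy, hfl hz,
      dif_neg hex, dif_neg hex']

/-- The potential on `Σ⁺`: the potential `w` of the lower half is corrected by the jump. -/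
def potPlus (v w J : Surface A B → Q) (q : Surface A B) : Q := glue v (fun q => w q + J q) q

open Classical in
/-- The potential on `Σ⁻`: the potential `v` of the upper half is corrected by the jump. -/
def potMinus (v w J : Surface A B → Q) (q : Surface A B) : Q :=
  if height q ≤ 0 then w q else v q - J q

/-- A point of `Σ⁺` in the closed lower half lies in a strip, on the leg with centre `0`. -/
theorem SigmaPlus_low {p : Surface A B} (hp : p ∈ SigmaPlus A B ε M)
    (h0 : height p < ε / M) (hre : ∀ (m : ℤ) (z : ℂ), z ∈ cutPlus → p = plusPt A B m z →
      ∀ k : ℤ, z.re ≠ k) :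
    ∃ (m k : ℤ) (z : ℂ), 0 ≤ m ∧ m < A ∧ ((k : ℝ) < z.re ∧ z.re < k + 1) ∧ p = plusPt A B m z ∧
      (0 : ℤ) ∈ centers A B m k ∧ |z.re - (0 : ℤ)| ≤ M := by
  obtain ⟨m, z, hm, hmA, hz, hzs, rfl⟩ := exists_plusPt_of_mem_SigmaPlus hp
  rw [height_plusPt m hz] at h0
  have hne := hre m z hz rfl
  exact ⟨m, ⌊z.re⌋, z, hm, hmA, (floor_eq_of_strip hne _).1 rfl, rfl, mem_insert _ _,
    by simpa using (mem_leg_of_lt hzs (by simpa using h0)).1⟩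

/-- A point of `Σ⁻` in the closed upper half lies in a strip, on a leg. -/
theorem SigmaMinus_high (hA : 0 < A) {p : Surface A B} (hp : p ∈ SigmaMinus A B ε M)
    (h0 : -(ε / M) < height p) (h0' : 0 ≤ height p) :
    ∃ (m k : ℤ) (z : ℂ), 0 ≤ m ∧ m < A ∧ ((k : ℝ) < z.re ∧ z.re < k + 1) ∧ p = plusPt A B m z ∧
      ∃ i ∈ centers A B m k, |z.re - i| ≤ M := by
  obtain ⟨m, z, hm, hmA, hz, rfl⟩ := exists_plusPt_of_height hA h0'
  rw [height_plusPt m hz] at h0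
  have hne := plusPt_mem_SigmaMinus hz hp
  have hzk := (floor_eq_of_strip hne _).1 rfl
  obtain ⟨i, hi, hzi⟩ := (plusPt_mem_SigmaMinus_iff hzk).1 hp
  refine ⟨m, ⌊z.re⌋, z, hm, hmA, hzk, rfl, i, mem_insert_of_mem _ hi, ?_⟩
  have := (mem_leg_of_lt hzi (by
    simp only [Complex.sub_im, Complex.intCast_im, sub_zero]; linarith)).1
  simpa using this

variable {v w J : Surface A B → Q}

/-- The cell of a point, as an open subset of the surface. -/
theorem exists_cell_nhds {m k i : ℤ} {z : ℂ}
    (hz : (k : ℝ) < z.re ∧ z.re < k + 1) (hi : i ∈ centers A B m k) (hzi : |z.re - i| ≤ M) :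
    ∃ U : Set (Surface A B), IsOpen U ∧ plusPt A B m z ∈ U ∧ ∀ q ∈ U, ∃ y : ℂ,
      ((k : ℝ) < y.re ∧ y.re < k + 1) ∧ SameCell M (centers A B m k) k z.re y.re ∧
        q = plusPt A B m y := by
  refine ⟨_, isOpen_image_plusPt m (isOpen_sameCell (M := M) (centers A B m k) k z.re),
    ⟨z, ⟨⟨hz, sameCell_self hi hzi⟩, strip_mem_cutPlus hz⟩, rfl⟩, ?_⟩
  rintro q ⟨y, ⟨⟨hy, hzy⟩, -⟩, rfl⟩
  exact ⟨y, hy, hzy, rfl⟩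

/-- If the jump is constant on cells, `J` extending it, then on `Σ⁺` the correction by `J` removes it. -/
theorem isPotential_potPlus (hA : 0 < A) (hAB : A ≠ B) (h : SmallRadius ε M) (hκ : IsCocycle κ)
    (hv : IsPotential κ (upperX A B ε M) v) (hw : IsPotential κ (lowerX A B ε M) w)
    (hJ : ∀ (m k : ℤ) (x : ℝ) (z : ℂ), 0 ≤ m → m < A → (k : ℝ) < x ∧ x < k + 1 →
        (k : ℝ) < z.re ∧ z.re < k + 1 → plusPt A B m x ∈ XSurf A B ε M →
        SameCell M (centers A B m k) k x z.re →
          J (plusPt A B m z) = v (plusPt A B m x) - w (plusPt A B m x))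
    (hJ' : ∀ (m k : ℤ) (y z : ℂ), 0 ≤ m → m < A → (k : ℝ) < y.re ∧ y.re < k + 1 →
        (k : ℝ) < z.re ∧ z.re < k + 1 → SameCell M (centers A B m k) k y.re z.re →
          J (plusPt A B m y) = J (plusPt A B m z)) :
    IsPotential κ (SigmaPlus A B ε M) (potPlus v w J) := by
  have hX : SigmaPlus A B ε M ⊆ XSurf A B ε M := subset_union_left
  have hη := h.height_pos
  have m0 : (0 : ℝ) ∈ Icc (0 : ℝ) 1 := by simp
  have m1 : (1 : ℝ) ∈ Icc (0 : ℝ) 1 := by simp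
  intro γ hγ hm
  refine val_eq_of_local hκ hX _ (fun p hp => ?_) hγ hm
  rcases lt_or_ge 0 (height p) with h0 | h0
  · refine ⟨{p | 0 < height p}, isOpen_lt continuous_const continuous_height, h0,
      fun γ hγ hm => ?_⟩
    rw [hv γ hγ (fun t ht => ⟨hX (hm ht).1, le_of_lt (show 0 < height (γ t) from (hm ht).2)⟩),
      potPlus, potPlus, glue, glue, if_pos (le_of_lt (show 0 < height (γ 0) from (hm m0).2)),
      if_pos (le_of_lt (show 0 < height (γ 1) from (hm m1).2))]
  · obtain ⟨m, k, z, hm, hmA, hz, rfl, hi, hzi⟩ := SigmaPlus_low hp (h0.trans_lt hη)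
      (fun m z hz he => (mem_cutPlus.1 hz).resolve_right
        (by rw [he, height_plusPt m hz] at h0; exact not_lt.2 h0))
    obtain ⟨U, hU, hzU, hUc⟩ := exists_cell_nhds hz hi hzi
    rcases h0.lt_or_eq with h1 | h1
    · refine ⟨U ∩ {p | height p < 0}, hU.inter (isOpen_lt continuous_height continuous_const),
        ⟨hzU, h1⟩, fun γ hγ hm' => ?_⟩
      have hneg : ∀ t ∈ Icc (0 : ℝ) 1, height (γ t) < 0 := fun t ht => (hm' ht).2.2
      rw [hw γ hγ (fun t ht => ⟨hX (hm' ht).1, (hneg t ht).le⟩), potPlus, potPlus, glue, glue,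
        if_neg (not_le.2 (hneg 0 m0)), if_neg (not_le.2 (hneg 1 m1))]
      obtain ⟨y0, hy0, hc0, e0⟩ := hUc _ (hm' m0).2.1
      obtain ⟨y1, hy1, hc1, e1⟩ := hUc _ (hm' m1).2.1
      have : J (γ 1) = J (γ 0) := by
        rw [e0, e1]
        exact hJ' m k y1 y0 hm hmA hy1 hy0 (hc1.symm.trans hc0)
      rw [this]
      abel
    · obtain ⟨U', hU', hpU', hpot⟩ := exists_nhds_potential hA hAB h.hε h.hM hκ hv hw (hX hp) h1
      refine ⟨U ∩ U', hU.inter hU', ⟨hzU, hpU'⟩, fun γ hγ hm' => ?_⟩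
      have hzx : z = (z.re : ℂ) := by
        rw [height_plusPt m (strip_mem_cutPlus hz)] at h1
        exact Complex.ext (by simp) (by simpa using h1)
      have key : ∀ q ∈ U, glue v (fun q => w q + (v (plusPt A B m z) - w (plusPt A B m z))) q =
          potPlus v w J q := by
        intro q hq
        obtain ⟨y, hy, hc, rfl⟩ := hUc q hq
        have e := hJ m k z.re y hm hmA hz hy (by rw [← hzx]; exact hX hp) hc
        rw [← hzx] at e
        simp only [potPlus, glue, e]
      rw [hpot γ hγ (fun t ht => ⟨hX (hm' ht).1, (hm' ht).2.2⟩), key _ (hm' m0).2.1,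
        key _ (hm' m1).2.1]

/-- If the jump is constant on cells, `J` extending it, then on `Σ⁻` the correction by `J` removes it. -/
theorem isPotential_potMinus (hA : 0 < A) (hAB : A ≠ B) (h : SmallRadius ε M) (hκ : IsCocycle κ)
    (hv : IsPotential κ (upperX A B ε M) v) (hw : IsPotential κ (lowerX A B ε M) w)
    (hJ : ∀ (m k : ℤ) (x : ℝ) (z : ℂ), 0 ≤ m → m < A → (k : ℝ) < x ∧ x < k + 1 →
        (k : ℝ) < z.re ∧ z.re < k + 1 → plusPt A B m x ∈ XSurf A B ε M →
        SameCell M (centers A B m k) k x z.re →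
          J (plusPt A B m z) = v (plusPt A B m x) - w (plusPt A B m x))
    (hJ' : ∀ (m k : ℤ) (y z : ℂ), 0 ≤ m → m < A → (k : ℝ) < y.re ∧ y.re < k + 1 →
        (k : ℝ) < z.re ∧ z.re < k + 1 → SameCell M (centers A B m k) k y.re z.re →
          J (plusPt A B m y) = J (plusPt A B m z)) :
    IsPotential κ (SigmaMinus A B ε M) (potMinus v w J) := by
  have hX : SigmaMinus A B ε M ⊆ XSurf A B ε M := subset_union_right
  have hη := h.height_pos
  have m0 : (0 : ℝ) ∈ Icc (0 : ℝ) 1 := by simp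
  have m1 : (1 : ℝ) ∈ Icc (0 : ℝ) 1 := by simp
  intro γ hγ hm
  refine val_eq_of_local hκ hX _ (fun p hp => ?_) hγ hm
  rcases lt_or_ge (height p) 0 with h0 | h0
  · refine ⟨{p | height p < 0}, isOpen_lt continuous_height continuous_const, h0,
      fun γ hγ hm => ?_⟩
    rw [hw γ hγ (fun t ht => ⟨hX (hm ht).1, le_of_lt (show height (γ t) < 0 from (hm ht).2)⟩),
      potMinus, potMinus, if_pos (le_of_lt (show height (γ 0) < 0 from (hm m0).2)),
      if_pos (le_of_lt (show height (γ 1) < 0 from (hm m1).2))]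
  · obtain ⟨m, k, z, hm, hmA, hz, rfl, i, hi, hzi⟩ := SigmaMinus_high hA hp (by linarith) h0
    obtain ⟨U, hU, hzU, hUc⟩ := exists_cell_nhds hz hi hzi
    rcases h0.lt_or_eq with h1 | h1
    · refine ⟨U ∩ {p | 0 < height p}, hU.inter (isOpen_lt continuous_const continuous_height),
        ⟨hzU, h1⟩, fun γ hγ hm' => ?_⟩
      have hpos : ∀ t ∈ Icc (0 : ℝ) 1, 0 < height (γ t) := fun t ht => (hm' ht).2.2
      rw [hv γ hγ (fun t ht => ⟨hX (hm' ht).1, (hpos t ht).le⟩), potMinus, potMinus,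
        if_neg (not_le.2 (hpos 0 m0)), if_neg (not_le.2 (hpos 1 m1))]
      obtain ⟨y0, hy0, hc0, e0⟩ := hUc _ (hm' m0).2.1
      obtain ⟨y1, hy1, hc1, e1⟩ := hUc _ (hm' m1).2.1
      have : J (γ 1) = J (γ 0) := by
        rw [e0, e1]
        exact hJ' m k y1 y0 hm hmA hy1 hy0 (hc1.symm.trans hc0)
      rw [this]
      abel
    · obtain ⟨U', hU', hpU', hpot⟩ :=
        exists_nhds_potential hA hAB h.hε h.hM hκ hv hw (hX hp) h1.symm
      refine ⟨U ∩ U', hU.inter hU', ⟨hzU, hpU'⟩, fun γ hγ hm' => ?_⟩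
      have hzx : z = (z.re : ℂ) := by
        rw [height_plusPt m (strip_mem_cutPlus hz)] at h1
        exact Complex.ext (by simp) (by simpa using h1.symm)
      set e := v (plusPt A B m z) - w (plusPt A B m z) with he
      -- at a real point of the cell, the jump is `e`
      have key : ∀ q ∈ U, q ∈ XSurf A B ε M → glue v (fun q => w q + e) q =
          potMinus v w J q + e := by
        intro q hq hqX
        obtain ⟨y, hy, hc, rfl⟩ := hUc q hq
        have e1 := hJ m k z.re y hm hmA hz hy (by rw [← hzx]; exact hX hp) hc
        rw [← hzx, ← he] at e1
        have hh := height_plusPt (A := A) (B := B) m (strip_mem_cutPlus hy)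
        unfold potMinus glue
        rcases lt_trichotomy y.im 0 with hy0 | hy0 | hy0
        · rw [if_neg (by rw [hh]; exact not_le.2 hy0), if_pos (by rw [hh]; exact hy0.le)]
        · rw [if_pos (by rw [hh]; exact hy0.ge), if_pos (by rw [hh]; exact hy0.le)]
          have hyx : y = (y.re : ℂ) := Complex.ext (by simp) (by simpa using hy0)
          have e2 := hJ m k y.re y hm hmA hy hy (by rwa [← hyx]) (hc.symm.trans hc)
          rw [← hyx, e1] at e2
          rw [e2]
          abel
        · rw [if_pos (by rw [hh]; exact hy0.le), if_neg (by rw [hh]; exact not_le.2 hy0), e1]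
          abel
      rw [hpot γ hγ (fun t ht => ⟨hX (hm' ht).1, (hm' ht).2.2⟩),
        key _ (hm' m0).2.1 (hX (hm' m0).1), key _ (hm' m1).2.1 (hX (hm' m1).1)]
      abel

end SidePotentials

/-! ### Potentials vanishing at infinity -/

section VanishingPotentials

open Set Topology

variable {A B : ℕ} {ε M L θ : ℝ} {R : Type u} [CommRing R]

theorem sheetDPlus_height (hA : 0 < A) (hε : 0 < ε) (hM : 0 < M) (hs : SmallTilt A B ε θ)
    (hL : levelBound A B ε M ≤ L) {m : ℤ} {p : Surface A B} (hp : p ∈ sheetDPlus A B ε M L θ m) :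
    ε / M ≤ height p := by
  have hη : 0 < ε / M := by positivity
  rw [sheetDPlus_eq hA hε hM hs hL] at hp
  obtain ⟨z, hz, rfl⟩ := hp
  rw [height_plusPt m (pos_im_mem_cutPlus (hη.trans_le hz.1))]
  exact hz.1

theorem sheetDMinus_height (hAB : A ≠ B) (hε : 0 < ε) (hM : 0 < M) (hs : SmallTilt A B ε θ)
    (hL : levelBound A B ε M ≤ L) {n : ℤ} {p : Surface A B} (hp : p ∈ sheetDMinus A B ε M L θ n) :
    height p ≤ -(ε / M) := by
  have hη : 0 < ε / M := by positivity
  rw [sheetDMinus_eq hAB hε hM hs hL] at hp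
  obtain ⟨z, hz, rfl⟩ := hp
  have h1 := hz.1
  rw [height_minusPt n (neg_im_mem_cutMinus (by rw [Complex.neg_im]; linarith)), Complex.neg_im]
  linarith

theorem IsPotential.eq_of_joinedIn {D : Set (Surface A B)} (hD : D ⊆ XSurf A B ε M)
    {S T : Set (Surface A B)} {u : Surface A B → RelOp R hD} (hu : IsPotential (relClass R hD) S u)
    (hT : T ⊆ D) (hT' : T ⊆ S) {p q : Surface A B} (h : JoinedIn T p q) : u p = u q := by
  obtain ⟨γ, hγ⟩ := h
  have hm : MapsTo γ.extend (Icc 0 1) T := fun t _ => hγ _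
  have h1 := hu γ.extend γ.continuous_extend.continuousOn (hm.mono le_rfl hT')
  rw [val_relClass_eq_zero hD γ.continuous_extend.continuousOn (hm.mono le_rfl hT),
    γ.extend_zero, γ.extend_one] at h1
  exact (sub_eq_zero.1 h1.symm).symm

/-- For large `L`, the potentials of the two halves can be chosen to vanish on `D`. -/
theorem exists_potentials (R : Type u) [CommRing R] (hA : 0 < A) (hAB : A ≠ B) (hε : 0 < ε)
    (hM : 0 < M) (hs : SmallTilt A B ε θ) (hL : levelBound A B ε M ≤ L) :
    ∃ v w : Surface A B → RelOp R (DReg_subset A B ε M L θ),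
      IsPotential (relClass R (DReg_subset A B ε M L θ)) (upperX A B ε M) v ∧
      IsPotential (relClass R (DReg_subset A B ε M L θ)) (lowerX A B ε M) w ∧
      (∀ p ∈ DPlus A B ε M L θ, v p = 0) ∧ (∀ p ∈ DMinus A B ε M L θ, w p = 0) ∧
      ∀ p ∈ XSurf A B ε M, height p = 0 → w p ≠ v p →
        ∃ (n : ℤ) (z : ℂ), z ∈ cutMinus ∧ HasSheet A B n ∧ p = minusPt A B n z := by
  have hη : 0 < ε / M := by positivity
  set hD := DReg_subset A B ε M L θ
  obtain ⟨r, hr⟩ := (eventually_mem_decay (η := ε / M) (L := L) hs.quadPlus hs.imPlus 0).exists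
  set b : ℂ := 0 + r * dirPlus A ε θ
  obtain ⟨v, hv, hv0⟩ := exists_upper_potential hA hε hM (isCocycle_relClass (R := R) hD)
    (fun _ => b) (fun _ => hr.1)
  have ev : ∀ᶠ r : ℝ in Filter.atTop, ∀ m : Fin A,
      -((((m : ℕ) : ℤ) / ((B : ℤ) - A) : ℤ) : ℂ) + r * dirMinus A B ε θ ∈
        decay (coefMinus A B θ) (dirMinus A B ε θ) (ε / M) L :=
    Filter.eventually_all.2 fun m => eventually_mem_decay hs.quadMinus hs.imMinus _
  obtain ⟨r', hr'⟩ := ev.exists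
  set b' : ℂ := -(r' * dirMinus A B ε θ) with hb'
  have hb'im : b'.im ≤ -(ε / M) := by
    have := (hr' ⟨0, hA⟩).1
    simp only [Complex.add_im, Complex.neg_im, Complex.intCast_im] at this
    rw [hb', Complex.neg_im]
    linarith
  obtain ⟨w, hw, hw0, hne⟩ := exists_lower_potential hA hAB hε hM (isCocycle_relClass (R := R) hD)
    (fun _ => b') (fun _ => hb'im) hv
  refine ⟨v, w, hv, hw, ?_, ?_, hne⟩
  · intro p hp
    obtain ⟨m, hm⟩ := mem_DPlus.1 hp
    have hb : plusPt A B (m : ℕ) b ∈ sheetDPlus A B ε M L θ (m : ℕ) := by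
      rw [sheetDPlus_eq hA hε hM hs hL]
      exact ⟨b, hr, rfl⟩
    rw [hv.eq_of_joinedIn hD (sheetDPlus_subset m) (fun q hq => ⟨hD (sheetDPlus_subset m hq),
      hη.le.trans (sheetDPlus_height hA hε hM hs hL hq)⟩) (joinedIn_sheetDPlus hm hb)]
    exact hv0 _ (by positivity) (by exact_mod_cast m.2)
  · intro p hp
    obtain ⟨m, hm⟩ := mem_DMinus.1 hp
    have hBA : (B : ℤ) - A ≠ 0 := by omega
    set n : ℤ := ((m : ℕ) : ℤ) % ((B : ℤ) - A) with hn
    set j : ℤ := ((m : ℕ) : ℤ) / ((B : ℤ) - A) with hj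
    have hnj : n + (B - A) * j = ((m : ℕ) : ℤ) := Int.emod_add_mul_ediv _ _
    have hn1 : 0 ≤ n := Int.emod_nonneg _ hBA
    have hn2 : n < |(B : ℤ) - A| := Int.emod_lt_abs _ hBA
    have hnS : HasSheet A B n := ⟨j, by rw [hnj]; positivity, by rw [hnj]; exact_mod_cast m.2⟩
    have hb'c : b' ∈ cutMinus := neg_im_mem_cutMinus (by linarith)
    have hb : minusPt A B n b' ∈ sheetDMinus A B ε M L θ (m : ℕ) := by
      rw [sheetDMinus_eq hAB hε hM hs hL]
      refine ⟨_, hr' m, ?_⟩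
      simp only
      rw [← minusPt_shift n j hb'c, hnj]
      congr 1
      rw [hb']
      ring
    rw [hw.eq_of_joinedIn hD (sheetDMinus_subset m) (fun q hq => ⟨hD (sheetDMinus_subset m hq),
      (sheetDMinus_height hAB hε hM hs hL hq).trans (by linarith)⟩) (joinedIn_sheetDMinus hm hb)]
    exact hw0 n hn1 hn2 hnS

end VanishingPotentials

/-! ### Potentials and boundaries of chains -/

section PointFunctionals

open Set

variable {R : Type u} [CommRing R] {Q : Type u} [AddCommGroup Q] [Module R Q]

/-- The linear extension to `0`-chains of a function on points. -/
def pointLift {Y : Type} [TopologicalSpace Y] {S : Set Y} (f : Y → Q) : (chains R S).X 0 →ₗ[R] Q :=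
  chainLift (n := 0) fun σ => f (σ (stdSimplex.vertex 0))

variable {Y : Type} [TopologicalSpace Y] {D S X : Set Y}

theorem pointLift_pointChain (f : Y → Q) (p : S) : pointLift f (pointChain R p) = f p :=
  chainLift_simplexN _ _

theorem pointLift_incl (f : Y → Q) (h : S ⊆ X) (c : (chains R S).X 0) :
    pointLift f (((chainsIncl R h).f 0).hom c) = pointLift f c := by
  have : (pointLift f).comp ((chainsIncl R h).f 0).hom = pointLift f :=
    chain_hom_ext fun σ => by
      rw [LinearMap.comp_apply, simplexN_zero, chainsIncl_pointChain, pointLift_pointChain,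
        pointLift_pointChain]
  exact LinearMap.congr_fun this c

theorem pointLift_eq_zero {f : Y → Q} (h : ∀ p ∈ S, f p = 0) (c : (chains R S).X 0) :
    pointLift f c = 0 := by
  have : pointLift (R := R) (S := S) f = 0 := chain_hom_ext fun σ => by
    rw [simplexN_zero, pointLift_pointChain, LinearMap.zero_apply, h _ (Subtype.coe_prop _)]
  rw [this, LinearMap.zero_apply]

theorem pointLift_sub (f g : Y → Q) (c : (chains R S).X 0) :
    pointLift (fun p => f p - g p) c = pointLift f c - pointLift g c := by
  have : pointLift (R := R) (S := S) (fun p => f p - g p) = pointLift f - pointLift g :=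
    chain_hom_ext fun σ => by
      rw [LinearMap.sub_apply, simplexN_zero, pointLift_pointChain, pointLift_pointChain,
        pointLift_pointChain]
  rw [this, LinearMap.sub_apply]

theorem IsPotential.eq_toPath {κ : C(stdSimplex ℝ (Fin 2), X) → Q} {u : Y → Q}
    (hu : IsPotential κ S u) (σ : C(stdSimplex ℝ (Fin 2), X)) (h : ∀ s, (σ s : Y) ∈ S) :
    κ σ = u (σ (stdSimplex.vertex 1)) - u (σ (stdSimplex.vertex 0)) := by
  have h1 := hu (toPath σ) (continuous_toPath σ).continuousOn (fun t _ => h _)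
  rwa [val_toPath, toPath_one, toPath_zero] at h1

/-- A cocycle with a potential is the potential of the boundary. -/
theorem IsPotential.chainLift_eq {κ : C(stdSimplex ℝ (Fin 2), X) → Q} {u : Y → Q}
    (hu : IsPotential κ S u) (h : S ⊆ X) (a : (chains R S).X 1) :
    chainLift κ (((chainsIncl R h).f 1).hom a) = pointLift u (((chains R S).d 1 0).hom a) := by
  have : (chainLift κ).comp ((chainsIncl R h).f 1).hom =
      (pointLift u).comp ((chains R S).d 1 0).hom := chain_hom_ext (n := 1) fun σ => by
    rw [LinearMap.comp_apply, LinearMap.comp_apply, d_simplexN_one, chainsIncl_simplexN,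
      chainLift_simplexN, map_sub, pointLift_pointChain, pointLift_pointChain,
      hu.eq_toPath _ fun s => Subtype.coe_prop (σ s)]
    rfl
  exact LinearMap.congr_fun this a

/-- The difference of two potentials of a cocycle kills boundaries. -/
theorem pointLift_sub_boundary {κ : C(stdSimplex ℝ (Fin 2), X) → Q} {u u' : Y → Q}
    (hu : IsPotential κ S u) (hu' : IsPotential κ S u') (h : S ⊆ X) (a : (chains R S).X 1) :
    pointLift (fun p => u p - u' p) (((chains R S).d 1 0).hom a) = 0 := by
  rw [pointLift_sub, ← hu.chainLift_eq h, ← hu'.chainLift_eq h, sub_self]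

theorem IsPotential.mono {κ : C(stdSimplex ℝ (Fin 2), X) → Q} {u : Y → Q} {T : Set Y}
    (hu : IsPotential κ S u) (h : T ⊆ S) : IsPotential κ T u :=
  fun γ hγ hm => hu γ hγ (hm.mono le_rfl h)

variable (hD : D ⊆ X)

/-- A cocycle which vanishes on `D` is defined on relative chains modulo boundaries. -/
theorem exists_relOp_lift {κ : C(stdSimplex ℝ (Fin 2), X) → Q} (hκ : IsCocycle κ)
    (h0 : ∀ σ, (∀ s, (σ s : Y) ∈ D) → κ σ = 0) :
    ∃ Φ : RelOp R hD →ₗ[R] Q, ∀ σ, Φ (relClass R hD σ) = κ σ := by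
  have hsurj : Function.Surjective (opClass R hD) :=
    (pOpcycles_surjective 1).comp (relπ_surjective hD 1)
  have hbd : ∀ w : (chains R X).X 2, chainLift κ (((chains R X).d 2 1).hom w) = 0 := by
    intro w
    have : (chainLift κ).comp ((chains R X).d 2 1).hom = 0 := chain_hom_ext (n := 2) fun τ => by
      rw [LinearMap.comp_apply, d_simplexN_two, map_add, map_sub, chainLift_simplexN,
        chainLift_simplexN, chainLift_simplexN, hκ τ, LinearMap.zero_apply]
      abel
    exact LinearMap.congr_fun this w
  have hDz : ∀ y : (chains R D).X 1, chainLift κ (((chainsIncl R hD).f 1).hom y) = 0 := by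
    intro y
    have : (chainLift κ).comp ((chainsIncl R hD).f 1).hom = 0 := chain_hom_ext (n := 1) fun σ => by
      rw [LinearMap.comp_apply, chainsIncl_simplexN, chainLift_simplexN, LinearMap.zero_apply]
      exact h0 _ fun s => Subtype.coe_prop (σ s)
    exact LinearMap.congr_fun this y
  have hker : LinearMap.ker (opClass R hD) ≤ LinearMap.ker (chainLift κ) := by
    intro x hx
    obtain ⟨w', hw'⟩ := (pOpcycles_eq_zero_iff 1 _).1 (LinearMap.mem_ker.1 hx)
    obtain ⟨w, rfl⟩ := relπ_surjective hD 2 w'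
    rw [d_relπ, ← sub_eq_zero, ← map_sub, relπ_eq_zero_iff] at hw'
    obtain ⟨y, hy⟩ := hw'
    have h1 := hDz y
    rw [hy, map_sub, hbd, zero_sub, neg_eq_zero] at h1
    exact h1
  refine ⟨((LinearMap.ker (opClass R hD)).liftQ (chainLift κ) hker).comp
    ((opClass R hD).quotKerEquivOfSurjective hsurj).symm.toLinearMap, fun σ => ?_⟩
  have h1 : ((opClass R hD).quotKerEquivOfSurjective hsurj).symm (relClass R hD σ) =
      Submodule.Quotient.mk (simplexN R (n := 1) σ) := by
    rw [LinearEquiv.symm_apply_eq]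
    rfl
  rw [LinearMap.comp_apply, LinearEquiv.coe_coe, h1]
  exact chainLift_simplexN _ _

end PointFunctionals

/-! ### The Mayer–Vietoris relation -/

section MayerVietoris

open Set

variable {A B : ℕ} {ε M L θ : ℝ} {R : Type u} [CommRing R]

theorem SigmaPlus_subset : SigmaPlus A B ε M ⊆ XSurf A B ε M := subset_union_left

theorem SigmaMinus_subset : SigmaMinus A B ε M ⊆ XSurf A B ε M := subset_union_right

/-- The definition, with the class of `a + b` taken through `relπ` and the named inclusions into `X`. -/
theorem mvConnecting_iff {h : (relChains R (DReg_subset A B ε M L θ)).homology 1}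
    {k : (chains R (SigmaPlus A B ε M ∩ SigmaMinus A B ε M)).homology 0} :
    MVConnecting R A B ε M L θ h k ↔
      ∃ (a : (chains R (SigmaPlus A B ε M)).X 1) (b : (chains R (SigmaMinus A B ε M)).X 1)
        (c : (chains R (SigmaPlus A B ε M ∩ SigmaMinus A B ε M)).X 0)
        (d : (chains R (DPlus A B ε M L θ)).X 0) (d' : (chains R (DMinus A B ε M L θ)).X 0),
        ((chains R (SigmaPlus A B ε M)).d 1 0).hom a =
          ((chainsIncl R Set.inter_subset_left).f 0).hom c +
            ((chainsIncl R (DPlus_subset A B ε M L θ)).f 0).hom d ∧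
        ((chains R (SigmaMinus A B ε M)).d 1 0).hom b =
          -((chainsIncl R Set.inter_subset_right).f 0).hom c +
            ((chainsIncl R (DMinus_subset A B ε M L θ)).f 0).hom d' ∧
        IsClass (relChains R (DReg_subset A B ε M L θ)) 1
          (relπ R (DReg_subset A B ε M L θ) 1
            (((chainsIncl R SigmaPlus_subset).f 1).hom a +
              ((chainsIncl R SigmaMinus_subset).f 1).hom b)) h ∧
        IsClass _ 0 c k := Iff.rfl

theorem MVConnecting.add {h h' : (relChains R (DReg_subset A B ε M L θ)).homology 1}
    {k k' : (chains R (SigmaPlus A B ε M ∩ SigmaMinus A B ε M)).homology 0}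
    (H : MVConnecting R A B ε M L θ h k) (H' : MVConnecting R A B ε M L θ h' k') :
    MVConnecting R A B ε M L θ (h + h') (k + k') := by
  rw [mvConnecting_iff] at *
  obtain ⟨a, b, c, d, e, h1, h2, h3, h4⟩ := H
  obtain ⟨a', b', c', d', e', h1', h2', h3', h4'⟩ := H'
  refine ⟨a + a', b + b', c + c', d + d', e + e', ?_, ?_, ?_, h4.add h4'⟩
  · simp only [map_add, h1, h1']; abel
  · simp only [map_add, h2, h2']; abel
  · have h5 := h3.add h3'
    rw [← map_add] at h5
    convert h5 using 2
    simp only [map_add]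
    abel

theorem MVConnecting.smul {h : (relChains R (DReg_subset A B ε M L θ)).homology 1}
    {k : (chains R (SigmaPlus A B ε M ∩ SigmaMinus A B ε M)).homology 0} (r : R)
    (H : MVConnecting R A B ε M L θ h k) :
    MVConnecting R A B ε M L θ (r • h) (r • k) := by
  rw [mvConnecting_iff] at *
  obtain ⟨a, b, c, d, e, h1, h2, h3, h4⟩ := H
  refine ⟨r • a, r • b, r • c, r • d, r • e, ?_, ?_, ?_, h4.smul r⟩
  · simp only [map_smul, h1, smul_add]
  · simp only [map_smul, h2, smul_add, smul_neg]
  · have h5 := h3.smul r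
    rw [← map_smul] at h5
    convert h5 using 2
    simp only [map_smul, smul_add]

theorem mvConnecting_zero : MVConnecting R A B ε M L θ 0 0 := by
  rw [mvConnecting_iff]
  refine ⟨0, 0, 0, 0, 0, by simp, by simp, ?_, isClass_zero⟩
  rw [map_zero, map_zero, add_zero, map_zero]
  exact isClass_zero

/-- The graph of the Mayer–Vietoris relation. -/
def mvGraph (R : Type u) [CommRing R] (A B : ℕ) (ε M L θ : ℝ) :
    Submodule R ((relChains R (DReg_subset A B ε M L θ)).homology 1 ×
      (chains R (SigmaPlus A B ε M ∩ SigmaMinus A B ε M)).homology 0) where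
  carrier := {x | MVConnecting R A B ε M L θ x.1 x.2}
  add_mem' h h' := MVConnecting.add h h'
  zero_mem' := mvConnecting_zero
  smul_mem' r _ h := MVConnecting.smul r h

/-- The value on `h` of a functional given by a cocycle with potentials on `Σ⁺` and on `Σ⁻` is
obtained from the difference of the potentials on the connecting class. -/
theorem MVConnecting.apply_eq {Q : Type u} [AddCommGroup Q] [Module R Q]
    {h : (relChains R (DReg_subset A B ε M L θ)).homology 1}
    {k : (chains R (SigmaPlus A B ε M ∩ SigmaMinus A B ε M)).homology 0}
    (H : MVConnecting R A B ε M L θ h k) (Φ : RelOp R (DReg_subset A B ε M L θ) →ₗ[R] Q)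
    {u u' : Surface A B → Q}
    (hu : IsPotential (fun σ => Φ (relClass R (DReg_subset A B ε M L θ) σ)) (SigmaPlus A B ε M) u)
    (hu' : IsPotential (fun σ => Φ (relClass R (DReg_subset A B ε M L θ) σ))
      (SigmaMinus A B ε M) u')
    (h0 : ∀ p ∈ DPlus A B ε M L θ, u p = 0) (h0' : ∀ p ∈ DMinus A B ε M L θ, u' p = 0)
    {c : (chains R (SigmaPlus A B ε M ∩ SigmaMinus A B ε M)).X 0} (hc : IsClass _ 0 c k) :
    Φ (((relChains R (DReg_subset A B ε M L θ)).homologyι 1).hom h) =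
      pointLift (fun p => u p - u' p) c := by
  obtain ⟨a, b, c', d, e, h1, h2, h3, h4⟩ := mvConnecting_iff.1 H
  have hcc : pointLift (fun p => u p - u' p) c = pointLift (fun p => u p - u' p) c' := by
    have h5 : IsClass _ 0 (c + (-1 : R) • c') (k + (-1 : R) • k) := hc.add (h4.smul _)
    rw [neg_one_smul, neg_one_smul, add_neg_cancel, ← sub_eq_add_neg, isClass_zero_iff] at h5
    obtain ⟨w, hw⟩ := h5
    have h6 := pointLift_sub_boundary (R := R) (hu.mono inter_subset_left)
      (hu'.mono inter_subset_right) (inter_subset_left.trans SigmaPlus_subset) w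
    rw [hw, map_sub, sub_eq_zero] at h6
    exact h6
  rw [hcc, h3.homologyι_eq]
  have hΦ : ∀ x, Φ (opClass R (DReg_subset A B ε M L θ) x) =
      chainLift (fun σ => Φ (relClass R (DReg_subset A B ε M L θ) σ)) x := by
    intro x
    have : Φ.comp (opClass R (DReg_subset A B ε M L θ)) =
        chainLift (fun σ => Φ (relClass R (DReg_subset A B ε M L θ) σ)) :=
      chain_hom_ext (n := 1) fun σ => by rw [chainLift_simplexN]; rfl
    exact LinearMap.congr_fun this x
  refine (hΦ _).trans ?_
  rw [map_add, hu.chainLift_eq SigmaPlus_subset, hu'.chainLift_eq SigmaMinus_subset, h1, h2,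
    map_add, map_add, map_neg, pointLift_incl, pointLift_incl, pointLift_incl, pointLift_incl,
    pointLift_eq_zero h0, pointLift_eq_zero h0', pointLift_sub]
  abel

/-- A point of `Σ⁺ ∩ Σ⁻` which is joined to `D⁺` in `Σ⁺` and to `D⁻` in `Σ⁻` is in the image of
the connecting map. -/
theorem exists_mvConnecting_point {p d e : Surface A B}
    (hp : p ∈ SigmaPlus A B ε M ∩ SigmaMinus A B ε M) (hd : d ∈ DPlus A B ε M L θ)
    (he : e ∈ DMinus A B ε M L θ) (h1 : JoinedIn (SigmaPlus A B ε M) d p)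
    (h2 : JoinedIn (SigmaMinus A B ε M) p e)
    {k : (chains R (SigmaPlus A B ε M ∩ SigmaMinus A B ε M)).homology 0}
    (hk : IsClass _ 0 (pointChain R ⟨p, hp⟩) k) :
    ∃ h, MVConnecting R A B ε M L θ h k := by
  obtain ⟨σ, hσ0, hσ1⟩ := exists_simplex_of_joinedIn h1
  obtain ⟨σ', hσ0', hσ1'⟩ := exists_simplex_of_joinedIn h2
  set D := DReg_subset A B ε M L θ
  have ea : ((chains R (SigmaPlus A B ε M)).d 1 0).hom (simplexN R (n := 1) σ) =
      ((chainsIncl R inter_subset_left).f 0).hom (pointChain R ⟨p, hp⟩) +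
        ((chainsIncl R (DPlus_subset A B ε M L θ)).f 0).hom (-pointChain R ⟨d, hd⟩) := by
    rw [d_simplexN_one, map_neg, chainsIncl_pointChain, chainsIncl_pointChain, ← sub_eq_add_neg]
    congr 2
    · exact Subtype.ext hσ1
    · exact Subtype.ext hσ0
  have eb : ((chains R (SigmaMinus A B ε M)).d 1 0).hom (simplexN R (n := 1) σ') =
      -((chainsIncl R inter_subset_right).f 0).hom (pointChain R ⟨p, hp⟩) +
        ((chainsIncl R (DMinus_subset A B ε M L θ)).f 0).hom (pointChain R ⟨e, he⟩) := by
    rw [d_simplexN_one, chainsIncl_pointChain, chainsIncl_pointChain, neg_add_eq_sub]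
    congr 2
    · exact Subtype.ext hσ1'
    · exact Subtype.ext hσ0'
  obtain ⟨h, hh⟩ := exists_isClass_succ (K := relChains R D) 0 (relπ R D 1
    (((chainsIncl R (SigmaPlus_subset : SigmaPlus A B ε M ⊆ XSurf A B ε M)).f 1).hom
      (simplexN R (n := 1) σ) +
    ((chainsIncl R (SigmaMinus_subset : SigmaMinus A B ε M ⊆ XSurf A B ε M)).f 1).hom
      (simplexN R (n := 1) σ'))) (by
    rw [d_relπ, map_add, comm_apply, comm_apply, ea, eb, relπ_eq_zero_iff]
    refine ⟨-pointChain R ⟨d, Or.inl hd⟩ + pointChain R ⟨e, Or.inr he⟩, ?_⟩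
    simp only [map_add, map_neg, chainsIncl_pointChain]
    abel)
  exact ⟨h, mvConnecting_iff.2 ⟨_, _, _, _, _, ea, eb, hh, hk⟩⟩

end MayerVietoris

/-- A linear relation which is total, surjective, single-valued and injective is the graph of an
isomorphism. -/
theorem exists_linearEquiv_of_graph {R H K : Type*} [CommRing R] [AddCommGroup H] [Module R H]
    [AddCommGroup K] [Module R K] (G : Submodule R (H × K)) (h1 : ∀ h, ∃ k, (h, k) ∈ G)
    (h2 : ∀ k, ∃ h, (h, k) ∈ G) (h3 : ∀ h, (h, (0 : K)) ∈ G → h = 0)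
    (h4 : ∀ k, ((0 : H), k) ∈ G → k = 0) : ∃ e : H ≃ₗ[R] K, ∀ h k, (h, k) ∈ G ↔ e h = k := by
  let f : G →ₗ[R] H := (LinearMap.fst R H K).comp G.subtype
  let g : G →ₗ[R] K := (LinearMap.snd R H K).comp G.subtype
  have hf : Function.Bijective f := by
    constructor
    · rw [← LinearMap.ker_eq_bot, LinearMap.ker_eq_bot']
      rintro ⟨⟨h, k⟩, hG⟩ hx
      obtain rfl : h = 0 := hx
      have := h4 k hG
      subst this
      rfl
    · intro h
      obtain ⟨k, hk⟩ := h1 h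
      exact ⟨⟨(h, k), hk⟩, rfl⟩
  have hg : Function.Bijective g := by
    constructor
    · rw [← LinearMap.ker_eq_bot, LinearMap.ker_eq_bot']
      rintro ⟨⟨h, k⟩, hG⟩ hx
      obtain rfl : k = 0 := hx
      have := h3 h hG
      subst this
      rfl
    · intro k
      obtain ⟨h, hk⟩ := h2 k
      exact ⟨⟨(h, k), hk⟩, rfl⟩
  refine ⟨(LinearEquiv.ofBijective f hf).symm.trans (LinearEquiv.ofBijective g hg), fun h k => ?_⟩
  constructor
  · intro hk
    have : (LinearEquiv.ofBijective f hf).symm h = ⟨(h, k), hk⟩ := by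
      rw [LinearEquiv.symm_apply_eq]; rfl
    rw [LinearEquiv.trans_apply, this]
    rfl
  · rintro rfl
    have h5 : f ((LinearEquiv.ofBijective f hf).symm h) = h :=
      (LinearEquiv.ofBijective f hf).apply_symm_apply h
    have h6 := ((LinearEquiv.ofBijective f hf).symm h).2
    convert h6 using 1
    exact Prod.ext h5.symm rfl

/-! ### The connecting map is defined everywhere, surjective and injective -/

section Connecting

open Set Topology

variable {A B : ℕ} {ε M L θ : ℝ}

/-- In the half plane `Im z₊ ≥ ε/M`, everything is joined to `D⁺`. -/
theorem exists_joinedIn_DPlus (hA : 0 < A) (hε : 0 < ε) (hM : 0 < M) (hs : SmallTilt A B ε θ)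
    (hL : levelBound A B ε M ≤ L) {m : ℤ} (hm : 0 ≤ m) (hmA : m < A) {z : ℂ} (hz : ε / M ≤ z.im) :
    ∃ d ∈ DPlus A B ε M L θ, JoinedIn (SigmaPlus A B ε M) (plusPt A B m z) d := by
  have hη : 0 < ε / M := by positivity
  obtain ⟨r, hr⟩ := (eventually_mem_decay (η := ε / M) (L := L) hs.quadPlus hs.imPlus 0).exists
  lift m to ℕ using hm
  refine ⟨plusPt A B m (0 + r * dirPlus A ε θ), mem_DPlus.2 ⟨⟨m, by exact_mod_cast hmA⟩, ?_⟩,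
    joinedIn_plusPt (convex_le_im (ε / M)) (fun v hv => ?_) hz hr.1⟩
  · rw [sheetDPlus_eq hA hε hM hs hL]
    exact ⟨_, hr, rfl⟩
  · have hv' := pos_im_mem_cutPlus (hη.trans_le hv)
    exact ⟨hv', SigmaPlus_of_high (by positivity) hmA hv' hv⟩

/-- In the half plane `Im z₋ ≤ -ε/M`, everything is joined to `D⁻`. -/
theorem exists_joinedIn_DMinus (hAB : A ≠ B) (hε : 0 < ε) (hM : 0 < M) (hs : SmallTilt A B ε θ)
    (hL : levelBound A B ε M ≤ L) {m : ℤ} (hm : 0 ≤ m) (hmA : m < A) {z : ℂ}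
    (hz : z.im ≤ -(ε / M)) :
    ∃ d ∈ DMinus A B ε M L θ, JoinedIn (SigmaMinus A B ε M) (minusPt A B m z) d := by
  have hη : 0 < ε / M := by positivity
  obtain ⟨r, hr⟩ := (eventually_mem_decay (η := ε / M) (L := L) hs.quadMinus hs.imMinus 0).exists
  lift m to ℕ using hm
  refine ⟨minusPt A B m (-(0 + r * dirMinus A B ε θ)),
    mem_DMinus.2 ⟨⟨m, by exact_mod_cast hmA⟩, ?_⟩,
    joinedIn_minusPt (convex_halfSpace_im_le (-(ε / M))) (fun v hv => ?_) hz ?_⟩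
  · rw [sheetDMinus_eq hAB hε hM hs hL]
    exact ⟨_, hr, rfl⟩
  · have hv' : v.im ≤ -(ε / M) := hv
    have hv'' : v ∈ cutMinus := neg_im_mem_cutMinus (by linarith)
    exact ⟨hv'', low_mem_SigmaMinus ⟨0, by simp, by simpa using hmA⟩ hv'' hv'⟩
  · have := hr.1
    change (-(0 + r * dirMinus A B ε θ)).im ≤ _
    rw [Complex.neg_im]
    linarith

/-- Every point of `Σ⁺ ∩ Σ⁻` is joined to `D⁺` in `Σ⁺` and to `D⁻` in `Σ⁻`. -/
theorem exists_joinedIn_D (hA : 0 < A) (hAB : A ≠ B) (h : SmallRadius ε M)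
    (hs : SmallTilt A B ε θ) (hL : levelBound A B ε M ≤ L) {p : Surface A B}
    (hp : p ∈ SigmaPlus A B ε M ∩ SigmaMinus A B ε M) :
    (∃ d ∈ DPlus A B ε M L θ, JoinedIn (SigmaPlus A B ε M) p d) ∧
      ∃ d ∈ DMinus A B ε M L θ, JoinedIn (SigmaMinus A B ε M) p d := by
  have hη := h.height_pos
  obtain ⟨m, z, hm, hmA, hz, -, rfl⟩ := exists_plusPt_of_mem_SigmaPlus hp.1
  have hne := plusPt_mem_SigmaMinus hz hp.2
  have hzk := (floor_eq_of_strip hne _).1 rfl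
  obtain ⟨i, hi, x, hx, hxi, -, -, hj⟩ := exists_joinedIn_line h hm hmA hzk hp
  obtain ⟨i', hi', -⟩ := (plusPt_mem_SigmaMinus_iff hzk).1 hp.2
  set k := ⌊z.re⌋
  have hxs := hx.strip h
  have him : i ∈ shifts A B m k → (linePt A B ε M m k i x).im = ε / M := fun h => if_pos h
  have him' : i ∉ shifts A B m k → (linePt A B ε M m k i x).im = -(ε / M) := fun h => if_neg h
  constructor
  · obtain ⟨d, hd, hj'⟩ := exists_joinedIn_DPlus hA h.hε h.hM hs hL hm hmA
      (z := (⟨x, ε / M⟩ : ℂ)) le_rfl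
    refine ⟨d, hd, (hj.mono inter_subset_left).trans (JoinedIn.trans ?_ hj')⟩
    by_cases his : i ∈ shifts A B m k
    · have : linePt A B ε M m k i x = ⟨x, ε / M⟩ := Complex.ext rfl (him his)
      rw [this]
      exact JoinedIn.refl (SigmaPlus_of_high hm hmA (strip_mem_cutPlus hxs) le_rfl)
    · have h0 : i = 0 := hi.resolve_right his
      refine joinedIn_segment (k := k) hxs hxs fun v hv hvr hvi => ?_
      rw [linePt_re, uIcc_self, mem_singleton_iff] at hvr
      rw [him' his, uIcc_of_le (by change -(ε / M) ≤ ε / M; linarith)] at hvi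
      rw [plusPt_mem_SigmaPlus hm hmA (strip_mem_cutPlus hv)]
      have := Inner.mem_leg h (s := 1) (i := 0) (z := v) (by rw [hvr]; exact hx)
        (by rw [hvr, ← h0]; exact hxi) (by simpa using hvi.1)
      exact leg_subset (by simpa using this)
  · have hz' : (⟨x, -(ε / M)⟩ - (i' : ℂ) : ℂ).im ≤ -(ε / M) := by simp
    obtain ⟨d, hd, hj'⟩ := exists_joinedIn_DMinus hAB h.hε h.hM hs hL hi'.1 hi'.2 hz'
    have e : plusPt A B m (⟨x, -(ε / M)⟩ : ℂ) =
        minusPt A B (m + B * k - (B - A) * i') (⟨x, -(ε / M)⟩ - (i' : ℂ)) := by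
      rw [plusPt_eq_minusPt_floor m (ne_int_of_mem hxs.1 hxs.2),
        (floor_eq_of_strip (ne_int_of_mem hxs.1 hxs.2) k).2 hxs,
        ← minusPt_shift (m + B * k) (-i') (strip_mem_cutMinus hxs)]
      congr 1
      · ring
      · push_cast; ring
    refine ⟨d, hd, (hj.mono inter_subset_right).trans (JoinedIn.trans ?_ (e ▸ hj'))⟩
    by_cases his : i ∈ shifts A B m k
    · refine joinedIn_segment (k := k) hxs hxs fun v hv hvr hvi => ?_
      rw [linePt_re, uIcc_self, mem_singleton_iff] at hvr
      rw [him his, uIcc_of_ge (by change -(ε / M) ≤ ε / M; linarith)] at hvi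
      rw [plusPt_mem_SigmaMinus_iff hv]
      exact ⟨i, his, leg_subset (Inner.mem_leg h (s := -1) (by rw [hvr]; exact hx)
        (by rw [hvr]; exact hxi) (by linarith [hvi.2]))⟩
    · have : linePt A B ε M m k i x = ⟨x, -(ε / M)⟩ := Complex.ext rfl (him' his)
      rw [this]
      exact JoinedIn.refl (SigmaMinus_of_low hxs hi' le_rfl)

variable {R : Type u} [CommRing R]

theorem exists_mvConnecting_of_point (hA : 0 < A) (hAB : A ≠ B) (h : SmallRadius ε M)
    (hs : SmallTilt A B ε θ) (hL : levelBound A B ε M ≤ L) {p : Surface A B}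
    (hp : p ∈ SigmaPlus A B ε M ∩ SigmaMinus A B ε M) :
    ∃ x k, IsClass _ 0 (pointChain R ⟨p, hp⟩) k ∧ MVConnecting R A B ε M L θ x k := by
  obtain ⟨⟨d, hd, hd'⟩, e, he, he'⟩ := exists_joinedIn_D hA hAB h hs hL hp
  obtain ⟨k, hk⟩ := exists_isClass_zero (K := chains R (SigmaPlus A B ε M ∩ SigmaMinus A B ε M))
    (pointChain R ⟨p, hp⟩)
  obtain ⟨x, hx⟩ := exists_mvConnecting_point hp hd he hd'.symm he' hk
  exact ⟨x, k, hk, hx⟩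

theorem mvConnecting_surjective (hA : 0 < A) (hAB : A ≠ B) (h : SmallRadius ε M)
    (hs : SmallTilt A B ε θ) (hL : levelBound A B ε M ≤ L)
    (k : (chains R (SigmaPlus A B ε M ∩ SigmaMinus A B ε M)).homology 0) :
    ∃ x, MVConnecting R A B ε M L θ x k := by
  obtain ⟨c, hc⟩ := exists_isClass_rep 0 k
  suffices H : ∀ c : (chains R (SigmaPlus A B ε M ∩ SigmaMinus A B ε M)).X 0,
      ∃ x k, IsClass _ 0 c k ∧ MVConnecting R A B ε M L θ x k by
    obtain ⟨x, k', hk', hx⟩ := H c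
    exact ⟨x, hc.unique hk' ▸ hx⟩
  refine chain_induction ?_ ?_ ?_ ?_
  · exact ⟨0, 0, isClass_zero, mvConnecting_zero⟩
  · rintro c c' ⟨x, k, hk, hx⟩ ⟨x', k', hk', hx'⟩
    exact ⟨_, _, hk.add hk', hx.add hx'⟩
  · rintro r c ⟨x, k, hk, hx⟩
    exact ⟨_, _, hk.smul r, hx.smul r⟩
  · intro σ
    rw [simplexN_zero]
    exact exists_mvConnecting_of_point hA hAB h hs hL (Subtype.coe_prop _)

/-- The universal cocycle has potentials on `Σ⁺` and on `Σ⁻`, which vanish on `D⁺` and on `D⁻`. Their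
difference is given by the jumps over the real points, which span `H₁(X, D)`. -/
theorem exists_side_potentials (R : Type u) [CommRing R] (hA : 0 < A) (hAB : A ≠ B)
    (h : SmallRadius ε M) (hs : SmallTilt A B ε θ) (hL : levelBound A B ε M ≤ L) :
    ∃ v w u u' : Surface A B → RelOp R (DReg_subset A B ε M L θ),
      IsPotential (relClass R (DReg_subset A B ε M L θ)) (SigmaPlus A B ε M) u ∧
      IsPotential (relClass R (DReg_subset A B ε M L θ)) (SigmaMinus A B ε M) u' ∧
      (∀ p ∈ DPlus A B ε M L θ, u p = 0) ∧ (∀ p ∈ DMinus A B ε M L θ, u' p = 0) ∧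
      (∀ (m k : ℤ) (x : ℝ) (z : ℂ), 0 ≤ m → m < A → (k : ℝ) < x ∧ x < k + 1 →
        (k : ℝ) < z.re ∧ z.re < k + 1 → plusPt A B m x ∈ XSurf A B ε M →
        plusPt A B m z ∈ XSurf A B ε M → SameCell M (centers A B m k) k x z.re →
          u (plusPt A B m z) - u' (plusPt A B m z) = v (plusPt A B m x) - w (plusPt A B m x)) ∧
      (∀ p ∈ XSurf A B ε M, height p = 0 → w p ≠ v p →
        ∃ (n : ℤ) (z : ℂ), z ∈ cutMinus ∧ HasSheet A B n ∧ p = minusPt A B n z) ∧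
      ∀ x : (relChains R (DReg_subset A B ε M L θ)).homology 1,
        ((relChains R (DReg_subset A B ε M L θ)).homologyι 1).hom x ∈
          Submodule.span R (jumps A B ε M v w) := by
  have hη := h.height_pos
  obtain ⟨v, w, hv, hw, hv0, hw0, hne⟩ := exists_potentials R hA hAB h.hε h.hM hs hL
  have hκ := isCocycle_relClass (R := R) (DReg_subset A B ε M L θ)
  obtain ⟨J, hJ, hJ'⟩ := exists_jump_fun h hv hw
  have hP : ∀ p ∈ DPlus A B ε M L θ, ε / M ≤ height p := fun p hp => by
    obtain ⟨m, hm⟩ := mem_DPlus.1 hp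
    exact sheetDPlus_height hA h.hε h.hM hs hL hm
  have hMi : ∀ p ∈ DMinus A B ε M L θ, height p ≤ -(ε / M) := fun p hp => by
    obtain ⟨m, hm⟩ := mem_DMinus.1 hp
    exact sheetDMinus_height hAB h.hε h.hM hs hL hm
  refine ⟨v, w, potPlus v w J, potMinus v w J, isPotential_potPlus hA hAB h hκ hv hw hJ hJ',
    isPotential_potMinus hA hAB h hκ hv hw hJ hJ', ?_, ?_, ?_, hne, ?_⟩
  · intro p hp
    rw [potPlus, glue, if_pos (hη.le.trans (hP p hp)), hv0 p hp]
  · intro p hp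
    rw [potMinus, if_pos ((hMi p hp).trans (by linarith)), hw0 p hp]
  · intro m k x z hm hmA hx hz hxX hzX hc
    have e := hJ m k x z hm hmA hx hz hxX hc
    have hh := height_plusPt (A := A) (B := B) m (strip_mem_cutPlus hz)
    rw [← e]
    unfold potPlus potMinus glue
    rcases lt_trichotomy z.im 0 with h0 | h0 | h0
    · rw [if_neg (by rw [hh]; exact not_le.2 h0), if_pos (by rw [hh]; exact h0.le),
        add_sub_cancel_left]
    · rw [if_pos (by rw [hh]; exact h0.ge), if_pos (by rw [hh]; exact h0.le)]
      have hzr : z = (z.re : ℂ) := Complex.ext (by simp) (by simpa using h0)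
      have := hJ m k z.re z hm hmA hz hz (by rwa [← hzr]) (hc.symm.trans hc)
      rw [this, ← hzr]
    · rw [if_pos (by rw [hh]; exact h0.le), if_neg (by rw [hh]; exact not_le.2 h0),
        sub_sub_cancel]
  · intro x
    refine homologyι_mem_of_potential (DReg_subset A B ε M L θ) _ (fun p => glue v w p) (fun σ => ?_) (fun p hp => ?_) x
    · have h1 := relClass_sub_glue_mem hA hAB h.hε h.hM (DReg_subset A B ε M L θ) hv hw σ
      have h2 : AddSubgroup.closure (jumps A B ε M v w) ≤
          (Submodule.span R (jumps A B ε M v w)).toAddSubgroup :=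
        (AddSubgroup.closure_le _).2 Submodule.subset_span
      have h3 := h2 h1
      rw [sub_sub_eq_add_sub, add_sub_right_comm] at h3
      exact h3
    · have : glue v w (p : Surface A B) = 0 := by
        rcases hp with hp | hp
        · rw [glue, if_pos (hη.le.trans (hP p hp)), hv0 p hp]
        · rw [glue, if_neg (not_le.2 ((hMi p hp).trans_lt (by linarith))), hw0 p hp]
      rw [this]
      exact zero_mem _

/-- Next to a real point of `X` which has a coordinate `z₋` on one of the sheets `0, …, A - 1`, there is
a point of `Σ⁺ ∩ Σ⁻` on the same vertical line. -/
theorem exists_vertical_mem_inter (h : SmallRadius ε M) {m k : ℤ} (hm : 0 ≤ m) (hmA : m < A) {x : ℝ}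
    (hx : (k : ℝ) < x ∧ x < k + 1) (hX : plusPt A B m x ∈ XSurf A B ε M)
    (hne : (shifts A B m k).Nonempty) :
    ∃ z : ℂ, z.re = x ∧ plusPt A B m z ∈ SigmaPlus A B ε M ∩ SigmaMinus A B ε M := by
  have hη := h.height_pos
  obtain ⟨i, hi⟩ := hne
  rcases hX with hX | hX
  · refine ⟨⟨x, -(ε / M)⟩, rfl, ?_, SigmaMinus_of_low hx hi le_rfl⟩
    rw [plusPt_mem_SigmaPlus hm hmA (strip_mem_cutPlus hx)] at hX ⊢
    exact sheetRegion_down h.hε h.hM hX rfl (by simp) (by simpa using hη.le) (by simp) (by norm_num)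
  · refine ⟨⟨x, ε / M⟩, rfl, SigmaPlus_of_high hm hmA (strip_mem_cutPlus hx) le_rfl, ?_⟩
    rw [plusPt_mem_SigmaMinus_iff hx] at hX ⊢
    obtain ⟨j, hj, hjX⟩ := hX
    exact ⟨j, hj, sheetRegion_down h.hε h.hM hjX (by simp) (by simp) (by simpa using hη.le)
      (by simp) (by norm_num)⟩

theorem exists_strip_of_height (hA : 0 < A) {p : Surface A B} (hp : height p = 0) :
    ∃ (m k : ℤ) (x : ℝ), 0 ≤ m ∧ m < A ∧ ((k : ℝ) < x ∧ x < k + 1) ∧ p = plusPt A B m x := by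
  obtain ⟨m, x, hm, hmA, hx, rfl⟩ := exists_real_of_height hA hp
  exact ⟨m, ⌊x⌋, x, hm, hmA, (floor_eq_of_strip (z := x) hx _).1 rfl, rfl⟩

theorem shifts_nonempty_of_eq_minusPt {m k n : ℤ} {x : ℝ} (hx : (k : ℝ) < x ∧ x < k + 1) {z : ℂ}
    (hz : z ∈ cutMinus) (hn : HasSheet A B n) (e : plusPt A B m x = minusPt A B n z) :
    (shifts A B m k).Nonempty := by
  obtain ⟨j, rfl, rfl⟩ := (plusPt_eq_minusPt (strip_mem_cutPlus hx) hz).1 e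
  have e1 : ⌊((x : ℝ) : ℂ).re⌋ = k :=
    (floor_eq_of_strip (z := x) (ne_int_of_mem hx.1 hx.2) k).2 hx
  rw [e1] at hn
  obtain ⟨i, h1, h2⟩ := hn
  refine ⟨-(j + i), ?_, ?_⟩
  · convert h1 using 1; ring
  · convert h2 using 1; ring

theorem sameCell_of_mem_XSurf (h : SmallRadius ε M) {m k : ℤ} (hm : 0 ≤ m) (hmA : m < A) {x : ℝ}
    (hx : (k : ℝ) < x ∧ x < k + 1) (hX : plusPt A B m x ∈ XSurf A B ε M) :
    SameCell M (centers A B m k) k x x := by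
  obtain ⟨i, hi, hxi⟩ := (real_mem_XSurf_iff h.hε h.hM hm hmA hx).1 hX
  exact sameCell_self hi (by simpa using abs_le_of_real_mem h.hε h.hM hxi)

/-- The classes of `H₁(X, D)` are spanned by the jumps, and the jump at a point is related
to the class of a point of `Σ⁺ ∩ Σ⁻` in the same cell. -/
theorem mvConnecting_total (hA : 0 < A) (hAB : A ≠ B) (h : SmallRadius ε M)
    (hs : SmallTilt A B ε θ) (hL : levelBound A B ε M ≤ L)
    (x : (relChains R (DReg_subset A B ε M L θ)).homology 1) :
    ∃ k, MVConnecting R A B ε M L θ x k := by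
  obtain ⟨v, w, u, u', hu, hu', h0, h0', hJ, hne, hspan⟩ :=
    exists_side_potentials R hA hAB h hs hL
  let N : Submodule R (RelOp R (DReg_subset A B ε M L θ)) :=
    ((mvGraph R A B ε M L θ).map (LinearMap.fst R _ _)).map ((relChains R (DReg_subset A B ε M L θ)).homologyι 1).hom
  have hN : jumps A B ε M v w ⊆ N := by
    rintro _ ⟨p, hp, hp0, rfl⟩
    by_cases e : w p = v p
    · rw [e, sub_self]
      exact N.zero_mem
    · obtain ⟨n, z, hz, hn, e'⟩ := hne p hp hp0 e
      obtain ⟨m, k, t, hm, hmA, ht, rfl⟩ := exists_strip_of_height hA hp0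
      obtain ⟨c, hc, hcC⟩ := exists_vertical_mem_inter h hm hmA ht hp
        (shifts_nonempty_of_eq_minusPt ht hz hn e')
      have ht' : (k : ℝ) < c.re ∧ c.re < k + 1 := by rwa [hc]
      obtain ⟨y, q, hq, hy⟩ := exists_mvConnecting_of_point (R := R) (θ := θ) hA hAB h hs hL hcC
      have h1 := hy.apply_eq LinearMap.id hu hu' h0 h0' hq
      rw [pointLift_pointChain, hJ m k t c hm hmA ht ht' hp (SigmaPlus_subset hcC.1)
        (by rw [hc]; exact sameCell_of_mem_XSurf h hm hmA ht hp)] at h1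
      rw [← h1]
      exact ⟨y, ⟨(y, q), hy, rfl⟩, rfl⟩
  obtain ⟨y, ⟨⟨y', q⟩, hy, rfl⟩, hxy⟩ := (Submodule.span_le.2 hN) (hspan x)
  rw [← homologyι_injective 1 hxy]
  exact ⟨q, hy⟩

/-- The potentials on `Σ⁺` and `Σ⁻` vanish on `D⁺` and `D⁻`, so their difference on `Σ⁺ ∩ Σ⁻` is a
functional which sends every class `k` to the classes `h` related to it. -/
theorem MVConnecting.eq_zero (hA : 0 < A) (hAB : A ≠ B) (h : SmallRadius ε M)
    (hs : SmallTilt A B ε θ) (hL : levelBound A B ε M ≤ L)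
    {x : (relChains R (DReg_subset A B ε M L θ)).homology 1} (hx : MVConnecting R A B ε M L θ x 0) :
    x = 0 := by
  obtain ⟨v, w, u, u', hu, hu', h0, h0', -⟩ := exists_side_potentials R hA hAB h hs hL
  have h1 := hx.apply_eq LinearMap.id hu hu' h0 h0' isClass_zero
  rw [map_zero] at h1
  exact homologyι_injective 1 (by rw [map_zero]; exact h1)

end Connecting

/-! ### Lifting circle-valued maps on simplices -/

section CircleLifts

open Set Topology

/-- The standard simplex is a retract of an open set of a vector space. -/
instance locallyPathConnectedSpace_stdSimplex (n : ℕ) :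
    LocallyPathConnectedSpace (stdSimplex ℝ (Fin (n + 1))) := by
  let U : Set (Fin (n + 1) → ℝ) := {x | 0 < ∑ i, max (x i) 0}
  have hU : IsOpen U := isOpen_lt continuous_const (by fun_prop)
  have : LocallyPathConnectedSpace U := hU.locallyPathConnectedSpace
  let r : U → stdSimplex ℝ (Fin (n + 1)) := fun x =>
    ⟨fun i => max (x.1 i) 0 / ∑ j, max (x.1 j) 0,
      fun i => div_nonneg (le_max_right _ _) (le_of_lt x.2), by
        rw [← Finset.sum_div]
        exact div_self (ne_of_gt x.2)⟩
  have hr : Continuous r := by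
    refine Continuous.subtype_mk (continuous_pi fun i => Continuous.div ?_ ?_ fun x => ne_of_gt x.2) _
    · exact ((continuous_apply i).comp continuous_subtype_val).max continuous_const
    · exact continuous_finsetSum _ fun j _ =>
        ((continuous_apply j).comp continuous_subtype_val).max continuous_const
  have hx1 : ∀ x : stdSimplex ℝ (Fin (n + 1)), ∑ i, max (x.1 i) 0 = 1 := fun x => by
    simp only [max_eq_left (x.2.1 _)]
    exact x.2.2
  let i : stdSimplex ℝ (Fin (n + 1)) → U := fun x => ⟨x.1, by
    have : (0 : ℝ) < ∑ i, max (x.1 i) 0 := by rw [hx1]; exact one_pos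
    exact this⟩
  have hi : Continuous i := Continuous.subtype_mk continuous_subtype_val _
  have hri : ∀ x, r (i x) = x := fun x => by
    apply Subtype.ext
    funext j
    change max (x.1 j) 0 / ∑ k, max (x.1 k) 0 = x.1 j
    rw [hx1, div_one, max_eq_left (x.2.1 _)]
  exact (IsQuotientMap.of_inverse hi hr hri).locallyPathConnectedSpace

instance contractibleSpace_stdSimplex (n : ℕ) :
    ContractibleSpace (stdSimplex ℝ (Fin (n + 1))) :=
  (convex_stdSimplex ℝ (Fin (n + 1))).contractibleSpace ⟨_, (stdSimplex.vertex 0).2⟩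

theorem exists_real_lift {n : ℕ} (φ : C(stdSimplex ℝ (Fin (n + 1)), AddCircle (1 : ℝ))) :
    ∃ g : C(stdSimplex ℝ (Fin (n + 1)), ℝ), ∀ x, (g x : AddCircle (1 : ℝ)) = φ x := by
  obtain ⟨e, he⟩ := QuotientAddGroup.mk_surjective (φ (stdSimplex.vertex 0))
  obtain ⟨g, ⟨-, hg⟩, -⟩ := (AddCircle.isCoveringMap_coe (1 : ℝ)).existsUnique_continuousMap_lifts φ
    (stdSimplex.vertex 0) e he
  exact ⟨g, fun x => congrFun hg x⟩

/-- The variation between two points of a real lift does not depend on the lift. -/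
theorem real_lift_sub_eq {n : ℕ} {g g' : C(stdSimplex ℝ (Fin (n + 1)), ℝ)}
    (h : ∀ x, (g x : AddCircle (1 : ℝ)) = g' x) (x y : stdSimplex ℝ (Fin (n + 1))) :
    g x - g y = g' x - g' y := by
  have h1 := (AddCircle.isCoveringMap_coe (1 : ℝ)).eq_of_comp_eq (g₁ := g)
    (g₂ := fun x => g' x + (g y - g' y)) g.continuous (g'.continuous.add continuous_const) (by
      funext x
      simp only [Function.comp_apply, AddCircle.coe_add, AddCircle.coe_sub, h]
      abel) y (by simp)
  have h2 : g x = g' x + (g y - g' y) := congrFun h1 x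
  rw [h2]
  ring

/-- The variation of a real lift of a map from an interval to the circle. -/
def winding (φ : C(stdSimplex ℝ (Fin 2), AddCircle (1 : ℝ))) : ℝ :=
  (exists_real_lift φ).choose (stdSimplex.vertex 1) - (exists_real_lift φ).choose (stdSimplex.vertex 0)

theorem winding_eq {φ : C(stdSimplex ℝ (Fin 2), AddCircle (1 : ℝ))} (g : C(stdSimplex ℝ (Fin 2), ℝ))
    (h : ∀ x, (g x : AddCircle (1 : ℝ)) = φ x) :
    winding φ = g (stdSimplex.vertex 1) - g (stdSimplex.vertex 0) :=
  real_lift_sub_eq (fun x => by rw [h, (exists_real_lift φ).choose_spec]) _ _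

/-- The variation of a real lift is additive on the boundary of a triangle. -/
theorem winding_comp_face {Y : Type} [TopologicalSpace Y] {X : Set Y}
    (f : C(X, AddCircle (1 : ℝ))) (τ : C(stdSimplex ℝ (Fin 3), X)) :
    winding (f.comp (face 1 τ)) = winding (f.comp (face 2 τ)) + winding (f.comp (face 0 τ)) := by
  obtain ⟨g, hg⟩ := exists_real_lift (f.comp τ)
  have h : ∀ i : Fin 3, winding (f.comp (face i τ)) =
      g (stdSimplex.vertex (i.succAbove 1)) - g (stdSimplex.vertex (i.succAbove 0)) := fun i => by
    rw [winding_eq (g.comp ⟨stdSimplex.map i.succAbove, by continuity⟩) fun x => hg _]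
    simp only [ContinuousMap.comp_apply, ContinuousMap.coe_mk, stdSimplex.map_vertex]
  rw [h, h, h]
  have e1 : (1 : Fin 3).succAbove 1 = 2 := rfl
  have e2 : (1 : Fin 3).succAbove 0 = 0 := rfl
  have e3 : (2 : Fin 3).succAbove 1 = 1 := rfl
  have e4 : (2 : Fin 3).succAbove 0 = 0 := rfl
  have e5 : (0 : Fin 3).succAbove 1 = 2 := rfl
  have e6 : (0 : Fin 3).succAbove 0 = 1 := rfl
  rw [e1, e2, e3, e4, e5, e6]
  ring

theorem face_vertex {Y : Type} [TopologicalSpace Y] {X : Set Y} {n : ℕ} (i : Fin (n + 2))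
    (τ : C(stdSimplex ℝ (Fin (n + 2)), X)) (j : Fin (n + 1)) :
    face i τ (stdSimplex.vertex j) = τ (stdSimplex.vertex (i.succAbove j)) := by
  simp [face, stdSimplex.map_vertex]

end CircleLifts

/-! ### Counting crossings -/

section Crossing

open Set Topology

/-- The function which increases from `0` to `1` between `-η` and `η`. -/
def ramp (η t : ℝ) : ℝ := max 0 (min 1 ((t + η) / (2 * η)))

theorem continuous_ramp (η : ℝ) : Continuous (ramp η) := by unfold ramp; fun_prop

theorem ramp_eq_one {η t : ℝ} (hη : 0 < η) (h : η ≤ t) : ramp η t = 1 := by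
  have : 1 ≤ (t + η) / (2 * η) := by rw [le_div_iff₀ (by linarith)]; linarith
  rw [ramp, min_eq_left this, max_eq_right zero_le_one]

theorem ramp_eq_zero {η t : ℝ} (hη : 0 < η) (h : t ≤ -η) : ramp η t = 0 := by
  have : (t + η) / (2 * η) ≤ 0 := div_nonpos_of_nonpos_of_nonneg (by linarith) (by linarith)
  rw [ramp, max_eq_left ((min_le_right _ _).trans this)]

variable {Y : Type} [TopologicalSpace Y]

/-- The part of the level `h = 0` in `U` is counted by an integral cocycle, if `U` is locally constant
on the part of `S` below the level `η` and on the part of `S'` above the level `-η`. It is the degree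
of a map to the circle, corrected by the variation of a function. -/
theorem exists_crossing_cocycle {X S S' U : Set Y} (hX : X = S ∪ S') {h : Y → ℝ}
    (hh : Continuous h) {η : ℝ} (hη : 0 < η)
    (hS : ∀ q ∈ S, h q ≤ η → ∃ W, IsOpen W ∧ q ∈ W ∧ (W ⊆ U ∨ Disjoint W U))
    (hS' : ∀ q ∈ S', -η ≤ h q → ∃ W, IsOpen W ∧ q ∈ W ∧ (W ⊆ U ∨ Disjoint W U))
    (N N' : Y → ℤ) (hN : ∀ q, q ∈ U → h q < η → N q = -1) (hN0 : ∀ q, q ∉ U ∨ η ≤ h q → N q = 0)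
    (hN' : ∀ q, q ∈ U → η ≤ h q → N' q = 1) (hN0' : ∀ q, q ∉ U ∨ h q < η → N' q = 0) :
    ∃ κ : C(stdSimplex ℝ (Fin 2), X) → ℤ, IsCocycle κ ∧
      (∀ σ, (∀ s, η ≤ |h (σ s)|) → κ σ = 0) ∧
      (∀ σ, (∀ s, (σ s : Y) ∈ S) →
        κ σ = N (σ (stdSimplex.vertex 1)) - N (σ (stdSimplex.vertex 0))) ∧
      ∀ σ, (∀ s, (σ s : Y) ∈ S') →
        κ σ = N' (σ (stdSimplex.vertex 1)) - N' (σ (stdSimplex.vertex 0)) := by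
  classical
  let g : Y → ℝ := fun q => if q ∈ U then ramp η (h q) else 0
  have hgU : ∀ q, q ∈ U → g q = ramp η (h q) := fun q hq => if_pos hq
  have hgU' : ∀ q, q ∉ U → g q = 0 := fun q hq => if_neg hq
  have hgc : ∀ q W, IsOpen W → q ∈ W → (W ⊆ U ∨ Disjoint W U) → ContinuousAt g q := by
    rintro q W hW hq (hWU | hWU)
    · exact ((continuous_ramp η).comp hh).continuousAt.congr
        (Filter.eventuallyEq_of_mem (hW.mem_nhds hq) fun p hp => (hgU p (hWU hp)).symm)
    · exact continuousAt_const.congr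
        (Filter.eventuallyEq_of_mem (hW.mem_nhds hq) fun p hp =>
          (hgU' p (disjoint_left.1 hWU hp)).symm)
  have one : ((1 : ℝ) : AddCircle (1 : ℝ)) = 0 := AddCircle.coe_period 1
  have hghigh : ∀ q, η ≤ h q → (g q : AddCircle (1 : ℝ)) = 0 := fun q hq => by
    by_cases hU : q ∈ U
    · rw [hgU q hU, ramp_eq_one hη hq, one]
    · rw [hgU' q hU, AddCircle.coe_zero]
  have hglow : ∀ q, h q ≤ -η → g q = 0 := fun q hq => by
    by_cases hU : q ∈ U
    · rw [hgU q hU, ramp_eq_zero hη hq]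
    · rw [hgU' q hU]
  have hf : Continuous fun q : X => (g q : AddCircle (1 : ℝ)) := by
    rw [continuous_iff_continuousAt]
    rintro ⟨q, hq⟩
    have hq' := hq
    rw [hX] at hq'
    suffices H : ContinuousAt (fun q : Y => (g q : AddCircle (1 : ℝ))) q from
      ContinuousAt.comp (f := Subtype.val) (x := (⟨q, hq⟩ : X)) H continuous_subtype_val.continuousAt
    rcases lt_or_ge η (h q) with h1 | h1
    · exact continuousAt_const.congr (Filter.eventuallyEq_of_mem
        ((isOpen_lt continuous_const hh).mem_nhds h1) fun p hp =>
          (hghigh p (le_of_lt (show η < h p from hp))).symm)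
    · rcases lt_or_ge (h q) (-η) with h2 | h2
      · exact continuousAt_const.congr (Filter.eventuallyEq_of_mem
          ((isOpen_lt hh continuous_const).mem_nhds h2) fun p hp => by
            change (0 : AddCircle (1 : ℝ)) = _
            rw [hglow p (le_of_lt (show h p < -η from hp)), AddCircle.coe_zero])
      · obtain ⟨W, hW, hqW, hWU⟩ : ∃ W, IsOpen W ∧ q ∈ W ∧ (W ⊆ U ∨ Disjoint W U) :=
          hq'.elim (fun hq => hS q hq h1) (fun hq => hS' q hq h2)
        exact (AddCircle.continuous_mk' (1 : ℝ)).continuousAt.comp (hgc q W hW hqW hWU)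
  let f : C(X, AddCircle (1 : ℝ)) := ⟨_, hf⟩
  -- a discontinuous real lift of `f`
  let s : Y → ℝ := fun q => if h q < η then g q else 0
  have hs1 : ∀ q, h q < η → s q = g q := fun q hq => if_pos hq
  have hs2 : ∀ q, η ≤ h q → s q = 0 := fun q hq => if_neg (not_lt.2 hq)
  have hsf : ∀ q, (s q : AddCircle (1 : ℝ)) = g q := fun q => by
    rcases lt_or_ge (h q) η with h1 | h1
    · rw [hs1 q h1]
    · rw [hs2 q h1, hghigh q h1, AddCircle.coe_zero]
  have hint : ∀ σ : C(stdSimplex ℝ (Fin 2), X), ∃ n : ℤ, (n : ℝ) = winding (f.comp σ) -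
      (s (σ (stdSimplex.vertex 1)) - s (σ (stdSimplex.vertex 0))) := by
    intro σ
    obtain ⟨G, hG⟩ := exists_real_lift (f.comp σ)
    rw [winding_eq G hG]
    have h0 : ((G (stdSimplex.vertex 1) - G (stdSimplex.vertex 0) -
        (s (σ (stdSimplex.vertex 1)) - s (σ (stdSimplex.vertex 0))) : ℝ) : AddCircle (1 : ℝ)) = 0 := by
      rw [AddCircle.coe_sub, AddCircle.coe_sub, AddCircle.coe_sub, hG, hG, hsf, hsf]
      change (g _ : AddCircle (1 : ℝ)) - g _ - (g _ - g _) = 0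
      simp only [sub_self]
    obtain ⟨n, hn⟩ := (AddCircle.coe_eq_zero_iff 1).1 h0
    exact ⟨n, by rw [← hn]; simp⟩
  choose κ hκ using hint
  have key : ∀ (F : Y → ℝ) (T : Set Y), ContinuousOn F T →
      (∀ q ∈ T, (F q : AddCircle (1 : ℝ)) = g q) → ∀ σ : C(stdSimplex ℝ (Fin 2), X),
      (∀ t, (σ t : Y) ∈ T) → (κ σ : ℝ) =
        (F (σ (stdSimplex.vertex 1)) - s (σ (stdSimplex.vertex 1))) -
          (F (σ (stdSimplex.vertex 0)) - s (σ (stdSimplex.vertex 0))) := by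
    intro F T hF hFg σ hσ
    rw [hκ, winding_eq ⟨fun t => F (σ t), hF.comp_continuous
      (continuous_subtype_val.comp σ.continuous) hσ⟩ fun t => hFg _ (hσ t)]
    simp only [ContinuousMap.coe_mk]
    ring
  refine ⟨κ, ?_, ?_, ?_, ?_⟩
  · intro τ
    have h1 := winding_comp_face f τ
    have : ((κ (face 1 τ) : ℤ) : ℝ) = ((κ (face 2 τ) + κ (face 0 τ) : ℤ) : ℝ) := by
      push_cast
      rw [hκ, hκ, hκ, h1]
      simp only [face_vertex]
      have e1 : (1 : Fin 3).succAbove 1 = 2 := rfl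
      have e2 : (1 : Fin 3).succAbove 0 = 0 := rfl
      have e3 : (2 : Fin 3).succAbove 1 = 1 := rfl
      have e4 : (2 : Fin 3).succAbove 0 = 0 := rfl
      have e5 : (0 : Fin 3).succAbove 1 = 2 := rfl
      have e6 : (0 : Fin 3).succAbove 0 = 1 := rfl
      rw [e1, e2, e3, e4, e5, e6]
      ring
    exact_mod_cast this
  · intro σ hσ
    have hs0 : ∀ q, η ≤ |h q| → (g q : AddCircle (1 : ℝ)) = 0 ∧ s q = 0 := fun q hq => by
      rcases le_abs.1 hq with h1 | h1
      · exact ⟨hghigh q h1, hs2 q h1⟩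
      · have := hglow q (by linarith)
        exact ⟨by rw [this, AddCircle.coe_zero], by rw [hs1 q (by linarith), this]⟩
    have h1 := key (fun _ => 0) {q | η ≤ |h q|} continuousOn_const
      (fun q hq => by rw [(hs0 q hq).1, AddCircle.coe_zero]) σ hσ
    rw [(hs0 _ (hσ _)).2, (hs0 _ (hσ _)).2] at h1
    have : (κ σ : ℝ) = ((0 : ℤ) : ℝ) := by rw [h1]; simp
    exact_mod_cast this
  · intro σ hσ
    -- on `S`, the function `g - 1` on `U`, extended by `0`, is continuous
    let F : Y → ℝ := fun q => if q ∈ U then g q - 1 else 0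
    have hF1 : ∀ q, q ∈ U → F q = g q - 1 := fun q hq => if_pos hq
    have hF2 : ∀ q, q ∉ U → F q = 0 := fun q hq => if_neg hq
    have hFs : ∀ q, F q - s q = N q := fun q => by
      by_cases hU : q ∈ U
      · rcases lt_or_ge (h q) η with h1 | h1
        · rw [hF1 q hU, hs1 q h1, hN q hU h1]
          push_cast
          ring
        · rw [hF1 q hU, hs2 q h1, hN0 q (Or.inr h1), hgU q hU, ramp_eq_one hη h1]
          simp
      · rw [hF2 q hU, hN0 q (Or.inl hU)]
        rcases lt_or_ge (h q) η with h1 | h1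
        · rw [hs1 q h1, hgU' q hU]; simp
        · rw [hs2 q h1]; simp
    have hFc : ContinuousOn F S := by
      intro q hq
      apply ContinuousAt.continuousWithinAt
      rcases lt_or_ge η (h q) with h1 | h1
      · refine (continuousAt_const (y := (0 : ℝ))).congr (Filter.eventuallyEq_of_mem
          ((isOpen_lt continuous_const hh).mem_nhds h1) fun p hp => ?_)
        have hp' : η ≤ h p := le_of_lt (show η < h p from hp)
        by_cases hU : p ∈ U
        · rw [hF1 p hU, hgU p hU, ramp_eq_one hη hp', sub_self]
        · rw [hF2 p hU]
      · obtain ⟨W, hW, hqW, hWU⟩ := hS q hq h1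
        have hc := hgc q W hW hqW hWU
        rcases hWU with hWU | hWU
        · exact (hc.sub continuousAt_const).congr (Filter.eventuallyEq_of_mem (hW.mem_nhds hqW)
            fun p hp => (hF1 p (hWU hp)).symm)
        · exact continuousAt_const.congr (Filter.eventuallyEq_of_mem (hW.mem_nhds hqW)
            fun p hp => (hF2 p (disjoint_left.1 hWU hp)).symm)
    have h1 := key F S hFc (fun q _ => by
      by_cases hU : q ∈ U
      · rw [hF1 q hU, AddCircle.coe_sub, one, sub_zero]
      · rw [hF2 q hU, hgU' q hU]) σ hσ
    rw [hFs, hFs] at h1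
    exact_mod_cast h1
  · intro σ hσ
    have hFs : ∀ q, g q - s q = N' q := fun q => by
      rcases lt_or_ge (h q) η with h1 | h1
      · rw [hs1 q h1, hN0' q (Or.inr h1)]; simp
      · rw [hs2 q h1]
        by_cases hU : q ∈ U
        · rw [hN' q hU h1, hgU q hU, ramp_eq_one hη h1]; simp
        · rw [hN0' q (Or.inl hU), hgU' q hU]; simp
    have hgS : ContinuousOn g S' := by
      intro q hq
      apply ContinuousAt.continuousWithinAt
      rcases lt_or_ge (h q) (-η) with h1 | h1
      · exact (continuousAt_const (y := (0 : ℝ))).congr (Filter.eventuallyEq_of_mem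
          ((isOpen_lt hh continuous_const).mem_nhds h1) fun p hp =>
            (hglow p (le_of_lt (show h p < -η from hp))).symm)
      · obtain ⟨W, hW, hqW, hWU⟩ := hS' q hq h1
        exact hgc q W hW hqW hWU
    have h1 := key g S' hgS (fun q _ => rfl) σ hσ
    rw [hFs, hFs] at h1
    exact_mod_cast h1

end Crossing

/-! ### The isomorphism `H₁(X, D) ≅ H₀(Σ⁺ ∩ Σ⁻)` -/

section PointClasses

open Set

variable {R : Type u} [CommRing R] {Y : Type} [TopologicalSpace Y] {S : Set Y}

theorem IsClass.of_joinedIn {p q : S} (h : JoinedIn S (p : Y) q) {k : (chains R S).homology 0}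
    (hk : IsClass _ 0 (pointChain R p) k) : IsClass _ 0 (pointChain R q) k := by
  obtain ⟨σ, h0, h1⟩ := exists_simplex_of_joinedIn h
  have h2 : IsClass (chains R S) 0 (pointChain R q - pointChain R p) 0 := by
    rw [isClass_zero_iff]
    refine ⟨simplexN R (n := 1) σ, ?_⟩
    rw [d_simplexN_one]
    congr 2
    · exact Subtype.ext h1
    · exact Subtype.ext h0
  have h3 := hk.add h2
  rwa [add_sub_cancel, add_zero] at h3

/-- Points which meet all path components span `H₀`. -/
theorem mem_span_pointClasses {ι : Type*} {c : ι → S} {kc : ι → (chains R S).homology 0}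
    (hk : ∀ t, IsClass _ 0 (pointChain R (c t)) (kc t))
    (hall : ∀ p : S, ∃ t, JoinedIn S (p : Y) (c t)) (k : (chains R S).homology 0) :
    k ∈ Submodule.span R (range kc) := by
  obtain ⟨x, hx⟩ := exists_isClass_rep 0 k
  suffices H : ∀ x : (chains R S).X 0, ∃ k ∈ Submodule.span R (range kc), IsClass _ 0 x k by
    obtain ⟨k', hk', hx'⟩ := H x
    exact hx.unique hx' ▸ hk'
  refine chain_induction ?_ ?_ ?_ ?_
  · exact ⟨0, zero_mem _, isClass_zero⟩
  · rintro x y ⟨k, hk, hx⟩ ⟨k', hk', hx'⟩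
    exact ⟨_, add_mem hk hk', hx.add hx'⟩
  · rintro r x ⟨k, hk, hx⟩
    exact ⟨_, Submodule.smul_mem _ r hk, hx.smul r⟩
  · intro σ
    rw [simplexN_zero]
    obtain ⟨t, ht⟩ := hall (σ (stdSimplex.vertex 0))
    exact ⟨kc t, Submodule.subset_span ⟨t, rfl⟩, (hk t).of_joinedIn ht.symm⟩

theorem isPotential_of_simplex {Q : Type*} [AddCommGroup Q] {X : Set Y}
    {κ : C(stdSimplex ℝ (Fin 2), X) → Q} {u : Y → Q} (hS : S ⊆ X)
    (h : ∀ σ : C(stdSimplex ℝ (Fin 2), X), (∀ s, (σ s : Y) ∈ S) →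
      κ σ = u (σ (stdSimplex.vertex 1)) - u (σ (stdSimplex.vertex 0))) : IsPotential κ S u := by
  intro γ hγ hm
  have hs : ContinuousOn γ (_root_.segment ℝ (0 : ℝ) 1) ∧ MapsTo γ (_root_.segment ℝ (0 : ℝ) 1) X := by
    rw [segment_zero_one]
    exact ⟨hγ, hm.mono le_rfl hS⟩
  unfold val
  rw [edge_eq hs, h]
  · simp [edgeSimplex]
  · intro s
    exact hm (by rw [← segment_zero_one]; exact mem_segment_of_stdSimplex _ _ s)

end PointClasses

section Isomorphism

open Set Topology

variable {A B : ℕ} {ε M L θ : ℝ}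

/-- On the balls removed around the integers, `|Im z|` is larger than this bound. -/
theorem ne_int_of_leg (h : SmallRadius ε M) {s : ℝ} {z : ℂ} (hz : z ∈ leg s ε M)
    (h1 : |z.im| ≤ ε / (2 * (1 + M))) (k : ℤ) : z.re ≠ k := by
  intro hk
  have hM := h.hM
  have hε := h.hε
  have h2 := hz.2.2 k
  have h3 : z - k = z.im * Complex.I := Complex.ext (by simp [hk]) (by simp)
  have hkM : |(k : ℝ)| ≤ M := hk ▸ hz.1
  rw [h3, norm_mul, Complex.norm_I, mul_one, Complex.norm_real, Real.norm_eq_abs] at h2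
  have h4 : ε / (1 + M) ≤ ε / (1 + |(k : ℝ)|) := by gcongr
  have h5 : ε / (2 * (1 + M)) = ε / (1 + M) / 2 := by field_simp
  have h6 : 0 < ε / (1 + M) := by positivity
  linarith

theorem SmallRadius.half_lt (h : SmallRadius ε M) : ε / (2 * (1 + M)) < ε / M :=
  div_lt_div_of_pos_left h.hε h.hM (by linarith [h.hM])

/-- A point of `Σ⁺` under the removed balls lies in a cell. -/
theorem exists_cell_of_SigmaPlus (h : SmallRadius ε M) {q : Surface A B}
    (hq : q ∈ SigmaPlus A B ε M) (hh : height q ≤ ε / (2 * (1 + M))) :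
    ∃ (m k : ℤ) (z : ℂ), 0 ≤ m ∧ m < A ∧ ((k : ℝ) < z.re ∧ z.re < k + 1) ∧ q = plusPt A B m z ∧
      ∃ i ∈ centers A B m k, |z.re - i| ≤ M := by
  have h0 := hh.trans_lt h.half_lt
  obtain ⟨m, z, hm, hmA, hz, hzs, rfl⟩ := exists_plusPt_of_mem_SigmaPlus hq
  rw [height_plusPt m hz] at hh h0
  have hleg := mem_leg_of_lt hzs (by simpa using h0)
  have hne : ∀ k : ℤ, z.re ≠ k := by
    by_contra! hk
    obtain ⟨k, hk⟩ := hk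
    have him := (mem_cutPlus.1 hz).resolve_left (fun h => h k hk)
    exact ne_int_of_leg h hleg (by rwa [abs_of_pos him]) k hk
  exact ⟨m, ⌊z.re⌋, z, hm, hmA, (floor_eq_of_strip hne _).1 rfl, rfl, 0, mem_insert _ _,
    by simpa using hleg.1⟩

/-- A point of `Σ⁻` above the removed balls lies in a cell. -/
theorem exists_cell_of_SigmaMinus (hA : 0 < A) (h : SmallRadius ε M) {q : Surface A B}
    (hq : q ∈ SigmaMinus A B ε M) (hh : -(ε / (2 * (1 + M))) ≤ height q) :
    ∃ (m k : ℤ) (z : ℂ), 0 ≤ m ∧ m < A ∧ ((k : ℝ) < z.re ∧ z.re < k + 1) ∧ q = plusPt A B m z ∧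
      ∃ i ∈ centers A B m k, |z.re - i| ≤ M := by
  have h0 := h.half_lt
  obtain ⟨n, z, -, -, hz, hzs, rfl⟩ := exists_minusPt_of_mem_SigmaMinus hq
  rw [height_minusPt n hz] at hh
  have hleg := mem_leg_of_lt hzs (by linarith)
  have hne : ∀ k : ℤ, z.re ≠ k := by
    by_contra! hk
    obtain ⟨k, hk⟩ := hk
    have him := (mem_cutMinus.1 hz).resolve_left (fun h => h k hk)
    exact ne_int_of_leg h hleg (by rw [abs_of_neg him]; linarith) k hk
  obtain ⟨m, j, hm, hmA, e⟩ := exists_normalized_plusPt (B := B) hA (n - B * ⌊z.re⌋)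
    (mem_cutPlus.2 (Or.inl hne))
  rw [minusPt_eq_plusPt_floor n hne, e] at hq ⊢
  have hne' : ∀ k : ℤ, (z + j).re ≠ k := by
    simpa using (ne_int_add j).2 hne
  have hs := (floor_eq_of_strip hne' _).1 rfl
  obtain ⟨i, hi, hzi⟩ := (plusPt_mem_SigmaMinus_iff hs).1 hq
  refine ⟨m, _, _, hm, hmA, hs, rfl, i, mem_insert_of_mem _ hi, ?_⟩
  have := (mem_leg_of_lt hzi (by simp; linarith)).1
  simpa using this

variable {R : Type u} [CommRing R]

open Classical in
/-- Every path component of `Σ⁺ ∩ Σ⁻` is detected by a functional on `H₁(X, D)`, which counts the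
crossings of the real line in one cell. -/
theorem exists_component_functional (R : Type u) [CommRing R] (hA : 0 < A) (hAB : A ≠ B)
    (h : SmallRadius ε M) (hs : SmallTilt A B ε θ) (hL : levelBound A B ε M ≤ L) {p : Surface A B}
    (hp : p ∈ SigmaPlus A B ε M ∩ SigmaMinus A B ε M) :
    ∃ (U : Set (Surface A B)) (Φ : RelOp R (DReg_subset A B ε M L θ) →ₗ[R] R),
      (∀ q ∈ SigmaPlus A B ε M ∩ SigmaMinus A B ε M,
        q ∈ U ↔ JoinedIn (SigmaPlus A B ε M ∩ SigmaMinus A B ε M) p q) ∧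
      (∀ q ∈ U, ∃ (m k : ℤ) (z w : ℂ), 0 ≤ m ∧ m < A ∧ ((k : ℝ) < z.re ∧ z.re < k + 1) ∧
        ((k : ℝ) < w.re ∧ w.re < k + 1) ∧ p = plusPt A B m z ∧ q = plusPt A B m w) ∧
      ∀ x k c, MVConnecting R A B ε M L θ x k → IsClass _ 0 c k →
        Φ (((relChains R (DReg_subset A B ε M L θ)).homologyι 1).hom x) =
          pointLift (fun q => if q ∈ U then (1 : R) else 0) c := by
  have hη := h.height_pos
  have hM := h.hM
  have hε := h.hε
  have hη' : 0 < ε / (2 * (1 + M)) := by positivity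
  have hlt := h.half_lt
  set η := ε / (2 * (1 + M)) with hηdef
  obtain ⟨m, z, hm, hmA, hz, -, rfl⟩ := exists_plusPt_of_mem_SigmaPlus hp.1
  have hzk := (floor_eq_of_strip (plusPt_mem_SigmaMinus hz hp.2) _).1 rfl
  set k := ⌊z.re⌋
  let V : Set ℂ := {y | ((k : ℝ) < y.re ∧ y.re < k + 1) ∧ SameCell M (centers A B m k) k z.re y.re}
  let U : Set (Surface A B) := plusPt A B m '' V
  have hpU : plusPt A B m z ∈ U := by
    refine ⟨z, ⟨hzk, ?_⟩, rfl⟩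
    rcases lt_trichotomy z.re (k + 1 / 2) with h1 | h1 | h1
    · exact Or.inr (Or.inl ⟨h1, h1⟩)
    · obtain ⟨m', k', z', hm', hmA', hz', e, i, hi, hzi⟩ : ∃ (m' k' : ℤ) (z' : ℂ), 0 ≤ m' ∧ m' < A ∧
          ((k' : ℝ) < z'.re ∧ z'.re < k' + 1) ∧ plusPt A B m z = plusPt A B m' z' ∧
          ∃ i ∈ centers A B m' k', |z'.re - i| ≤ M :=
        (le_total (height (plusPt A B m z)) 0).elim
          (fun h0 => exists_cell_of_SigmaPlus h hp.1 (h0.trans hη'.le))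
          (fun h0 => exists_cell_of_SigmaMinus hA h hp.2 (by linarith))
      obtain ⟨rfl, rfl⟩ := plusPt_normalized_eq hm hmA hm' hmA' hz (strip_mem_cutPlus hz') e
      obtain rfl : k = k' := (floor_eq_of_strip (ne_int_of_mem hz'.1 hz'.2) k').2 hz'
      exact sameCell_self hi hzi
    · exact Or.inr (Or.inr ⟨h1, h1⟩)
  -- the cells are open, and disjoint or equal
  have hcell : ∀ q : Surface A B, (∃ (m k : ℤ) (z : ℂ), 0 ≤ m ∧ m < A ∧
      ((k : ℝ) < z.re ∧ z.re < k + 1) ∧ q = plusPt A B m z ∧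
      ∃ i ∈ centers A B m k, |z.re - i| ≤ M) →
      ∃ W, IsOpen W ∧ q ∈ W ∧ (W ⊆ U ∨ Disjoint W U) := by
    rintro q ⟨m', k', z', hm', hmA', hz', rfl, i, hi, hzi⟩
    obtain ⟨W, hW, hqW, hWc⟩ := exists_cell_nhds hz' hi hzi
    refine ⟨W, hW, hqW, ?_⟩
    by_cases hd : Disjoint W U
    · exact Or.inr hd
    · left
      obtain ⟨r, hrW, y, ⟨hy, hzy⟩, rfl⟩ := not_disjoint_iff.1 hd
      obtain ⟨y', hy', hzy', e⟩ := hWc _ hrW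
      obtain ⟨rfl, rfl⟩ := plusPt_normalized_eq hm hmA hm' hmA' (strip_mem_cutPlus hy)
        (strip_mem_cutPlus hy') e
      obtain rfl : k = k' := by
        rw [← (floor_eq_of_strip (ne_int_of_mem hy.1 hy.2) k).2 hy,
          ← (floor_eq_of_strip (ne_int_of_mem hy'.1 hy'.2) k').2 hy']
      intro r hr
      obtain ⟨t, ht, hzt, rfl⟩ := hWc r hr
      exact ⟨t, ⟨ht, hzy.trans (hzy'.symm.trans hzt)⟩, rfl⟩
  let N : Surface A B → ℤ := fun q => if q ∈ U ∧ height q < η then -1 else 0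
  let N' : Surface A B → ℤ := fun q => if q ∈ U ∧ η ≤ height q then 1 else 0
  obtain ⟨κ, hκ, hκ0, hκS, hκS'⟩ := exists_crossing_cocycle (X := XSurf A B ε M) rfl
    (continuous_height (A := A) (B := B)) hη'
    (fun q hq hh => hcell q (exists_cell_of_SigmaPlus h hq hh))
    (fun q hq hh => hcell q (exists_cell_of_SigmaMinus hA h hq hh)) N N'
    (fun q h1 h2 => if_pos ⟨h1, h2⟩)
    (fun q hq => if_neg (by rintro ⟨h1, h2⟩; exact hq.elim (· h1) (fun h3 => h2.not_ge h3)))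
    (fun q h1 h2 => if_pos ⟨h1, h2⟩)
    (fun q hq => if_neg (by rintro ⟨h1, h2⟩; exact hq.elim (· h1) (fun h3 => h3.not_ge h2)))
  have hNN : ∀ q, N' q - N q = if q ∈ U then 1 else 0 := fun q => by
    simp only [N, N']
    by_cases hU : q ∈ U
    · rcases lt_or_ge (height q) η with h1 | h1
      · simp [hU, h1, h1.not_ge]
      · simp [hU, h1, h1.not_gt]
    · simp [hU]
  have hDh : ∀ q ∈ DReg A B ε M L θ, (q ∈ DPlus A B ε M L θ → η ≤ height q) ∧
      (q ∈ DMinus A B ε M L θ → height q ≤ -η) := fun q _ => by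
    refine ⟨fun hq => ?_, fun hq => ?_⟩
    · obtain ⟨m, hm⟩ := mem_DPlus.1 hq
      exact hlt.le.trans (sheetDPlus_height hA h.hε h.hM hs hL hm)
    · obtain ⟨m, hm⟩ := mem_DMinus.1 hq
      linarith [sheetDMinus_height hAB h.hε h.hM hs hL hm]
  obtain ⟨Φ, hΦ⟩ := exists_relOp_lift (R := R) (DReg_subset A B ε M L θ)
    (κ := fun σ => -((κ σ : ℤ) : R)) (fun τ => by have h := hκ τ; simp only [h]; push_cast; ring) (fun σ hσ => by
      rw [hκ0 σ fun s => ?_]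
      · simp
      · rcases hσ s with h1 | h1
        · exact le_abs.2 (Or.inl ((hDh _ (hσ s)).1 h1))
        · exact le_abs.2 (Or.inr (by linarith [(hDh _ (hσ s)).2 h1])))
  refine ⟨U, Φ, fun q hq => ⟨?_, fun hj => ?_⟩,
    fun q ⟨y, hy, e⟩ => ⟨m, k, z, y, hm, hmA, hzk, hy.1, rfl, e.symm⟩, fun x kk c hx hc => ?_⟩
  · rintro ⟨y, ⟨hy, hzy⟩, rfl⟩
    exact joinedIn_of_sameCell h hm hmA hzk hy hp hq hzy
  · -- the indicator of the cell is constant on paths in the intersection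
    obtain ⟨σ, h0, h1⟩ := exists_simplex_of_joinedIn hj
    let σ' : C(stdSimplex ℝ (Fin 2), XSurf A B ε M) :=
      (⟨Set.inclusion (inter_subset_left.trans SigmaPlus_subset), continuous_inclusion _⟩ :
        C((SigmaPlus A B ε M ∩ SigmaMinus A B ε M : Set _), XSurf A B ε M)).comp σ
    have e1 := hκS σ' fun s => (σ s).2.1
    have e2 := hκS' σ' fun s => (σ s).2.2
    change _ = N (σ _) - N (σ _) at e1
    change _ = N' (σ _) - N' (σ _) at e2
    rw [h0, h1] at e1 e2
    have e3 : N' q - N q = N' (plusPt A B m z) - N (plusPt A B m z) := by linarith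
    rw [hNN, hNN, if_pos hpU] at e3
    by_contra hU
    rw [if_neg hU] at e3
    exact zero_ne_one e3
  · have hu : IsPotential (fun σ => Φ (relClass R (DReg_subset A B ε M L θ) σ)) (SigmaPlus A B ε M)
        fun q => -((N q : ℤ) : R) := isPotential_of_simplex SigmaPlus_subset fun σ hσ => by
      rw [hΦ, hκS σ hσ]; push_cast; ring
    have hu' : IsPotential (fun σ => Φ (relClass R (DReg_subset A B ε M L θ) σ))
        (SigmaMinus A B ε M) fun q => -((N' q : ℤ) : R) :=
      isPotential_of_simplex SigmaMinus_subset fun σ hσ => by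
        rw [hΦ, hκS' σ hσ]; push_cast; ring
    rw [hx.apply_eq Φ hu hu' (fun q hq => ?_) (fun q hq => ?_) hc]
    · congr 1
      congr 1
      funext q
      have := congrArg (fun n : ℤ => (n : R)) (hNN q)
      push_cast at this
      rw [← this]
      ring
    · have : N q = 0 := if_neg fun h => h.2.not_ge ((hDh q (Or.inl hq)).1 hq)
      rw [this]; simp
    · have : N' q = 0 := if_neg fun h => by linarith [h.2, (hDh q (Or.inr hq)).2 hq]
      rw [this]; simp

/-- The crossing cocycle of each path component of `Σ⁺ ∩ Σ⁻` detects the coefficient of that component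
in `k`, and it vanishes on the zero class. -/
theorem MVConnecting.eq_zero_right (hA : 0 < A) (hAB : A ≠ B) (h : SmallRadius ε M)
    (hs : SmallTilt A B ε θ) (hL : levelBound A B ε M ≤ L)
    {k : (chains R (SigmaPlus A B ε M ∩ SigmaMinus A B ε M)).homology 0}
    (hk : MVConnecting R A B ε M L θ 0 k) : k = 0 := by
  classical
  let S : Set (Surface A B) := SigmaPlus A B ε M ∩ SigmaMinus A B ε M
  let c : ZerothHomotopy S → S := Quotient.out
  choose kc hkc using fun t => exists_isClass_zero (K := chains R S) (pointChain R (c t))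
  have hc : ∀ p : S, Joined p (c (Quotient.mk (pathSetoid S) p)) := fun p =>
    Quotient.exact (s := pathSetoid S) (Quotient.out_eq (Quotient.mk (pathSetoid S) p)).symm
  have hspan := mem_span_pointClasses hkc (fun p => ⟨Quotient.mk (pathSetoid S) p,
    (joinedIn_iff_joined p.2 (c _).2).2 (hc p)⟩) k
  obtain ⟨a, rfl⟩ := (Finsupp.mem_span_range_iff_exists_finsupp).1 hspan
  have ha : a = 0 := by
    ext t
    obtain ⟨U, Φ, hU, -, hΦ⟩ := exists_component_functional R hA hAB h hs hL (c t).2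
    have hcls : IsClass (chains R S) 0 (a.sum fun i r => r • pointChain R (c i))
        (a.sum fun i r => r • kc i) := by
      unfold Finsupp.sum
      induction a.support using Finset.induction_on with
      | empty => simpa using isClass_zero
      | insert i s hi ih =>
        rw [Finset.sum_insert hi, Finset.sum_insert hi]
        exact ((hkc i).smul _).add ih
    have h1 := hΦ 0 _ _ hk hcls
    rw [map_zero, map_zero, Finsupp.sum, map_sum] at h1
    have h2 : ∀ i, pointLift (fun q => if q ∈ U then (1 : R) else 0) (a i • pointChain R (c i)) =
        if i = t then a t else 0 := by
      intro i
      rw [map_smul, pointLift_pointChain, smul_eq_mul]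
      by_cases hi : i = t
      · subst hi
        rw [if_pos ((hU _ (c i).2).2 (JoinedIn.refl (c i).2)), if_pos rfl, mul_one]
      · rw [if_neg hi, if_neg, mul_zero]
        intro hiU
        apply hi
        have h3 := (hU _ (c i).2).1 hiU
        have h4 : Quotient.mk (pathSetoid S) (c t) = Quotient.mk (pathSetoid S) (c i) :=
          Quotient.sound ((joinedIn_iff_joined (c t).2 (c i).2).1 h3)
        exact ((Quotient.out_eq i).symm.trans h4.symm).trans (Quotient.out_eq t)
    rw [Finset.sum_congr rfl fun i _ => h2 i, Finset.sum_ite_eq'] at h1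
    by_cases ht : t ∈ a.support
    · rw [if_pos ht] at h1
      exact h1.symm
    · exact Finsupp.notMem_support_iff.1 ht
  rw [ha]
  simp

/-- The Mayer–Vietoris connecting map is an isomorphism. -/
theorem exists_mvEquiv (R : Type u) [CommRing R] (hA : 0 < A) (hAB : A ≠ B) (h : SmallRadius ε M)
    (hs : SmallTilt A B ε θ) (hL : levelBound A B ε M ≤ L) :
    ∃ e : (relChains R (DReg_subset A B ε M L θ)).homology 1 ≃ₗ[R]
        (chains R (SigmaPlus A B ε M ∩ SigmaMinus A B ε M)).homology 0,
      ∀ x k, MVConnecting R A B ε M L θ x k ↔ e x = k :=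
  exists_linearEquiv_of_graph (mvGraph R A B ε M L θ) (mvConnecting_total hA hAB h hs hL)
    (mvConnecting_surjective hA hAB h hs hL) (fun _ hx => MVConnecting.eq_zero hA hAB h hs hL hx)
    (fun _ hk => hk.eq_zero_right hA hAB h hs hL)

end Isomorphism

/-! ### Bases of `H₁(X, D_L)` -/

section PointBasis

open Set

variable {A B : ℕ} {ε M L θ : ℝ} {R : Type u} [CommRing R]

/-- Relative classes whose images under the connecting map are the negatives of the classes of
points, one in every path component of `Σ⁺ ∩ Σ⁻`, form a basis. -/
theorem basis_of_points (hA : 0 < A) (hAB : A ≠ B) (h : SmallRadius ε M)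
    (hs : SmallTilt A B ε θ) (hL : levelBound A B ε M ≤ L) {ι : Type*}
    (c : ι → (SigmaPlus A B ε M ∩ SigmaMinus A B ε M : Set (Surface A B)))
    (hall : ∀ p : (SigmaPlus A B ε M ∩ SigmaMinus A B ε M : Set (Surface A B)),
      ∃ i, JoinedIn (SigmaPlus A B ε M ∩ SigmaMinus A B ε M) (p : Surface A B) (c i))
    (hdisj : ∀ (i j : ι) (m k : ℤ) (z w : ℂ), 0 ≤ m → m < A → (k : ℝ) < z.re ∧ z.re < k + 1 →
      (k : ℝ) < w.re ∧ w.re < k + 1 → (c i : Surface A B) = plusPt A B m z →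
      (c j : Surface A B) = plusPt A B m w → i = j)
    (ξ : ι → (relChains R (DReg_subset A B ε M L θ)).homology 1)
    (k : ι → (chains R (SigmaPlus A B ε M ∩ SigmaMinus A B ε M)).homology 0)
    (hk : ∀ i, IsClass _ 0 (-pointChain R (c i)) (k i))
    (hξ : ∀ i, MVConnecting R A B ε M L θ (ξ i) (k i)) :
    LinearIndependent R ξ ∧ ⊤ ≤ Submodule.span R (range ξ) := by
  classical
  constructor
  · choose U Φ hU hUc hΦ using fun i => exists_component_functional R hA hAB h hs hL (c i).2
    have key : ∀ i j, -Φ i (((relChains R (DReg_subset A B ε M L θ)).homologyι 1).hom (ξ j)) =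
        if (c j : Surface A B) ∈ U i then 1 else 0 := fun i j => by
      rw [hΦ i _ _ _ (hξ j) (hk j), map_neg, neg_neg, pointLift_pointChain]
    refine LinearIndependent.of_pairwise_dual_eq_zero_one ξ
      (fun i => -((Φ i).comp ((relChains R (DReg_subset A B ε M L θ)).homologyι 1).hom)) ?_ ?_
    · intro i j hij
      refine (key i j).trans (if_neg fun hj => hij ?_)
      obtain ⟨m, k, z, w, h1, h2, h3, h4, h5, h6⟩ := hUc i _ hj
      exact hdisj i j m k z w h1 h2 h3 h4 h5 h6
    · intro i
      exact (key i i).trans (if_pos ((hU i _ (c i).2).2 (JoinedIn.refl (c i).2)))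
  · obtain ⟨e, he⟩ := exists_mvEquiv R hA hAB h hs hL
    rintro x -
    have hk' : ∀ i, IsClass _ 0 (pointChain R (c i)) (-e (ξ i)) := fun i => by
      have := (hk i).smul (-1 : R)
      rwa [neg_one_smul, neg_one_smul, neg_neg, ← (he _ _).1 (hξ i)] at this
    have h1 := mem_span_pointClasses hk' hall (e x)
    have h2 : Submodule.span R (range fun i => -e (ξ i)) ≤
        (Submodule.span R (range ξ)).map (e : _ →ₗ[R] _) := by
      rw [Submodule.span_le]
      rintro _ ⟨i, rfl⟩
      exact neg_mem (Submodule.mem_map_of_mem (Submodule.subset_span ⟨i, rfl⟩))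
    obtain ⟨y, hy, hyx⟩ := h2 h1
    rwa [← e.injective hyx]

end PointBasis

/-! ### The flow along the directions of decay -/

section Flow

open Set Topology

variable {A B : ℕ} {ε M L θ : ℝ}

open Classical in
/-- The flow which translates the upper half planes by `|t| ω` and the lower half planes
by `-|t| ω'`. -/
def flow (A B : ℕ) (ω ω' : ℂ) (t : ℝ) (p : Surface A B) : Surface A B :=
  if h : ∃ (m : ℤ) (z : ℂ), 0 < z.im ∧ p = plusPt A B m z then
    plusPt A B h.choose (h.choose_spec.choose + |t| * ω)
  else if h : ∃ (n : ℤ) (z : ℂ), z.im < 0 ∧ p = minusPt A B n z then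
    minusPt A B h.choose (h.choose_spec.choose - |t| * ω')
  else p

variable {ω ω' : ℂ}

theorem flow_plusPt (hω : 0 ≤ ω.im) (t : ℝ) (m : ℤ) {z : ℂ} (hz : 0 < z.im) :
    flow A B ω ω' t (plusPt A B m z) = plusPt A B m (z + |t| * ω) := by
  have h : ∃ (m' : ℤ) (z' : ℂ), 0 < z'.im ∧ plusPt A B m z = plusPt A B m' z' := ⟨m, z, hz, rfl⟩
  rw [flow, dif_pos h]
  obtain ⟨h1, h2⟩ := h.choose_spec.choose_spec
  obtain ⟨j, h3, h4⟩ := (plusPt_eq_plusPt (pos_im_mem_cutPlus hz) (pos_im_mem_cutPlus h1)).1 h2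
  rw [h3, h4, add_right_comm, plusPt_shift]
  apply pos_im_mem_cutPlus
  have := mul_nonneg (abs_nonneg t) hω
  simp only [Complex.add_im, Complex.im_ofReal_mul]
  linarith

theorem flow_minusPt (hω' : 0 ≤ ω'.im) (t : ℝ) (n : ℤ) {z : ℂ} (hz : z.im < 0) :
    flow A B ω ω' t (minusPt A B n z) = minusPt A B n (z - |t| * ω') := by
  have h' : ¬ ∃ (m' : ℤ) (z' : ℂ), 0 < z'.im ∧ minusPt A B n z = plusPt A B m' z' := by
    rintro ⟨m, w, hw, e⟩
    have := congrArg height e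
    rw [height_minusPt n (neg_im_mem_cutMinus hz), height_plusPt m (pos_im_mem_cutPlus hw)] at this
    linarith
  have h : ∃ (m' : ℤ) (z' : ℂ), z'.im < 0 ∧ minusPt A B n z = minusPt A B m' z' := ⟨n, z, hz, rfl⟩
  rw [flow, dif_neg h', dif_pos h]
  obtain ⟨h1, h2⟩ := h.choose_spec.choose_spec
  obtain ⟨j, h3, h4⟩ := (minusPt_eq_minusPt (neg_im_mem_cutMinus hz) (neg_im_mem_cutMinus h1)).1 h2
  rw [h3, h4, add_sub_right_comm, minusPt_shift]
  apply neg_im_mem_cutMinus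
  have := mul_nonneg (abs_nonneg t) hω'
  simp only [Complex.sub_im, Complex.im_ofReal_mul]
  linarith

theorem continuousOn_flow (hA : 0 < A) (hAB : A ≠ B) (hω : 0 ≤ ω.im) (hω' : 0 ≤ ω'.im) :
    ContinuousOn (fun x : ℝ × Surface A B => flow A B ω ω' x.1 x.2) {x | height x.2 ≠ 0} := by
  rintro ⟨t, p⟩ hp
  apply ContinuousAt.continuousWithinAt
  rcases lt_or_gt_of_ne hp with hp | hp
  · obtain ⟨n, z, -, -, hz, rfl⟩ := exists_minusPt_of_height hA hAB hp.le
    have hz' : z.im < 0 := by rw [← height_minusPt n hz]; exact hp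
    have hV : {z : ℂ | z.im < 0} ⊆ cutMinus := fun z hz => neg_im_mem_cutMinus hz
    have hopen := isOpen_image_minusPt (A := A) (B := B) n
      (isOpen_lt Complex.continuous_im (continuous_const (y := (0 : ℝ))))
    rw [inter_eq_left.2 hV] at hopen
    have hW : (univ : Set ℝ) ×ˢ (minusPt A B n '' {z : ℂ | z.im < 0}) ∈ 𝓝 (t, minusPt A B n z) :=
      (isOpen_univ.prod hopen).mem_nhds ⟨trivial, z, hz', rfl⟩
    refine ContinuousOn.continuousAt (s := univ ×ˢ (minusPt A B n '' {z : ℂ | z.im < 0})) ?_ hW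
    have h1 : ContinuousOn (fun x : ℝ × Surface A B => coordMinus n x.2 - (|x.1| : ℝ) * ω')
        (univ ×ˢ (minusPt A B n '' {z : ℂ | z.im < 0})) :=
      (((continuousOn_coordMinus hAB n).mono (image_mono hV)).comp continuousOn_snd
        (fun x hx => hx.2)).sub (by fun_prop)
    have him : ∀ (t : ℝ) (w : ℂ), w.im < 0 → (w - |t| * ω').im < 0 := fun t w hw => by
      have := mul_nonneg (abs_nonneg t) hω'
      simp only [Complex.sub_im, Complex.im_ofReal_mul]
      linarith
    refine ((continuousOn_minusPt (A := A) (B := B) n).comp h1 ?_).congr ?_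
    · rintro ⟨s, _⟩ ⟨-, w, hw, rfl⟩
      simp only [coordMinus_minusPt hAB n (hV hw)]
      exact hV (him s w hw)
    · rintro ⟨s, _⟩ ⟨-, w, hw, rfl⟩
      simp only [Function.comp, coordMinus_minusPt hAB n (hV hw)]
      exact flow_minusPt hω' s n hw
  · obtain ⟨n, z, -, -, hz, rfl⟩ := exists_plusPt_of_height hA hp.le
    have hz' : 0 < z.im := by rw [← height_plusPt n hz]; exact hp
    have hV : {z : ℂ | 0 < z.im} ⊆ cutPlus := fun z hz => pos_im_mem_cutPlus hz
    have hopen := isOpen_image_plusPt (A := A) (B := B) n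
      (isOpen_lt (continuous_const (y := (0 : ℝ))) Complex.continuous_im)
    rw [inter_eq_left.2 hV] at hopen
    have hW : (univ : Set ℝ) ×ˢ (plusPt A B n '' {z : ℂ | 0 < z.im}) ∈ 𝓝 (t, plusPt A B n z) :=
      (isOpen_univ.prod hopen).mem_nhds ⟨trivial, z, hz', rfl⟩
    refine ContinuousOn.continuousAt (s := univ ×ˢ (plusPt A B n '' {z : ℂ | 0 < z.im})) ?_ hW
    have h1 : ContinuousOn (fun x : ℝ × Surface A B => coordPlus n x.2 + (|x.1| : ℝ) * ω)
        (univ ×ˢ (plusPt A B n '' {z : ℂ | 0 < z.im})) :=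
      (((continuousOn_coordPlus hA n).mono (image_mono hV)).comp continuousOn_snd
        (fun x hx => hx.2)).add (by fun_prop)
    have him : ∀ (t : ℝ) (w : ℂ), 0 < w.im → 0 < (w + |t| * ω).im := fun t w hw => by
      have := mul_nonneg (abs_nonneg t) hω
      simp only [Complex.add_im, Complex.im_ofReal_mul]
      linarith
    refine ((continuousOn_plusPt (A := A) (B := B) n).comp h1 ?_).congr ?_
    · rintro ⟨s, _⟩ ⟨-, w, hw, rfl⟩
      simp only [coordPlus_plusPt hA n (hV hw)]
      exact hV (him s w hw)
    · rintro ⟨s, _⟩ ⟨-, w, hw, rfl⟩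
      simp only [Function.comp, coordPlus_plusPt hA n (hV hw)]
      exact flow_plusPt hω s n hw

theorem flow_zero (hω : 0 ≤ ω.im) (hω' : 0 ≤ ω'.im) {p : Surface A B} (hA : 0 < A) (hAB : A ≠ B)
    (hp : height p ≠ 0) : flow A B ω ω' 0 p = p := by
  rcases lt_or_gt_of_ne hp with hp | hp
  · obtain ⟨n, z, -, -, hz, rfl⟩ := exists_minusPt_of_height hA hAB hp.le
    rw [flow_minusPt hω' 0 n (by rw [← height_minusPt n hz]; exact hp)]
    simp
  · obtain ⟨n, z, -, -, hz, rfl⟩ := exists_plusPt_of_height hA hp.le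
    rw [flow_plusPt hω 0 n (by rw [← height_plusPt n hz]; exact hp)]
    simp

/-- The flow maps `D_L` to itself and moves it towards infinity. -/
theorem flow_mem_DReg (hA : 0 < A) (hAB : A ≠ B) (hε : 0 < ε) (hM : 0 < M)
    (hs : SmallTilt A B ε θ) (hL : levelBound A B ε M ≤ L) (t : ℝ) {L' : ℝ}
    (hL' : L' ≤ L + t ^ 2 * min (quad (coefPlus A θ) (dirPlus A ε θ))
      (quad (coefMinus A B θ) (dirMinus A B ε θ))) (hL'' : levelBound A B ε M ≤ L')
    {p : Surface A B} (hp : p ∈ DReg A B ε M L θ) :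
    flow A B (dirPlus A ε θ) (dirMinus A B ε θ) t p ∈ DReg A B ε M L' θ := by
  have hη : 0 < ε / M := by positivity
  have ht : |t| ^ 2 = t ^ 2 := sq_abs t
  rcases hp with hp | hp
  · obtain ⟨m, hm⟩ := mem_DPlus.1 hp
    rw [sheetDPlus_eq hA hε hM hs hL] at hm
    obtain ⟨z, hz, rfl⟩ := hm
    refine Or.inl (mem_DPlus.2 ⟨m, ?_⟩)
    rw [sheetDPlus_eq hA hε hM hs hL'', flow_plusPt hs.imPlus.le t _ (hη.trans_le hz.1)]
    refine ⟨_, decay_mono ?_ (decay_translate hs.quadPlus hs.imPlus hz (abs_nonneg t)), rfl⟩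
    rw [ht]
    refine hL'.trans ?_
    gcongr
    exact min_le_left _ _
  · obtain ⟨m, hm⟩ := mem_DMinus.1 hp
    rw [sheetDMinus_eq hAB hε hM hs hL] at hm
    obtain ⟨z, hz, rfl⟩ := hm
    refine Or.inr (mem_DMinus.2 ⟨m, ?_⟩)
    have hz0 : (-z).im < 0 := by simpa using hη.trans_le hz.1
    dsimp only
    rw [sheetDMinus_eq hAB hε hM hs hL'', flow_minusPt hs.imMinus.le t _ hz0]
    refine ⟨z + |t| * dirMinus A B ε θ,
      decay_mono ?_ (decay_translate hs.quadMinus hs.imMinus hz (abs_nonneg t)), ?_⟩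
    · rw [ht]
      refine hL'.trans ?_
      gcongr
      exact min_le_right _ _
    · simp only [neg_add, sub_eq_add_neg]

theorem height_ne_zero_of_mem_DReg (hA : 0 < A) (hAB : A ≠ B) (hε : 0 < ε) (hM : 0 < M)
    (hs : SmallTilt A B ε θ) (hL : levelBound A B ε M ≤ L) {p : Surface A B}
    (hp : p ∈ DReg A B ε M L θ) : height p ≠ 0 := by
  have hη : 0 < ε / M := by positivity
  rcases hp with hp | hp
  · obtain ⟨m, hm⟩ := mem_DPlus.1 hp
    exact (hη.trans_le (sheetDPlus_height hA hε hM hs hL hm)).ne'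
  · obtain ⟨m, hm⟩ := mem_DMinus.1 hp
    have := sheetDMinus_height hAB hε hM hs hL hm
    exact (by linarith : height p < 0).ne

/-- `D_L` is deformed into `D_{L'}` inside itself. -/
theorem exists_deformation (hA : 0 < A) (hAB : A ≠ B) (hε : 0 < ε) (hM : 0 < M)
    (hs : SmallTilt A B ε θ) (hL : levelBound A B ε M ≤ L) {L' : ℝ} (hL' : L ≤ L') :
    ∃ H : C(ℝ × DReg A B ε M L θ, DReg A B ε M L θ), (∀ p, H (0, p) = p) ∧
      (∀ p, (H (1, p) : Surface A B) ∈ DReg A B ε M L' θ) ∧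
      ∀ (t : ℝ) (p : DReg A B ε M L θ), (p : Surface A B) ∈ DReg A B ε M L' θ → (H (t, p) : Surface A B) ∈ DReg A B ε M L' θ := by
  set μ := min (quad (coefPlus A θ) (dirPlus A ε θ)) (quad (coefMinus A B θ) (dirMinus A B ε θ))
    with hμ
  have hμ0 : 0 < μ := lt_min hs.quadPlus hs.quadMinus
  set T := √((L' - L) / μ)
  have hT : T ^ 2 * μ = L' - L := by
    rw [Real.sq_sqrt (div_nonneg (sub_nonneg.2 hL') hμ0.le), div_mul_cancel₀ _ hμ0.ne']
  have hne := fun p : DReg A B ε M L θ => height_ne_zero_of_mem_DReg hA hAB hε hM hs hL p.2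
  have hmem : ∀ (t : ℝ) (p : DReg A B ε M L θ),
      flow A B (dirPlus A ε θ) (dirMinus A B ε θ) (t * T) p ∈ DReg A B ε M L θ := fun t p =>
    flow_mem_DReg hA hAB hε hM hs hL _
      (by have := mul_nonneg (sq_nonneg (t * T)) hμ0.le; linarith) hL p.2
  refine ⟨⟨fun x => ⟨_, hmem x.1 x.2⟩, ?_⟩, fun p => Subtype.ext ?_, fun p => ?_, fun t p hp => ?_⟩
  · refine Continuous.subtype_mk ?_ _
    exact (continuousOn_flow hA hAB hs.imPlus.le hs.imMinus.le).comp_continuous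
      (f := fun x : ℝ × DReg A B ε M L θ => (x.1 * T, (x.2 : Surface A B))) (by fun_prop)
      fun x => hne x.2
  · change flow A B _ _ (0 * T) (p : Surface A B) = p
    rw [zero_mul]
    exact flow_zero hs.imPlus.le hs.imMinus.le hA hAB (hne p)
  · exact flow_mem_DReg hA hAB hε hM hs hL _ (by rw [one_mul, hT]; linarith) (hL.trans hL') p.2
  · exact flow_mem_DReg hA hAB hε hM hs (hL.trans hL') _
      (by have := mul_nonneg (sq_nonneg (t * T)) hμ0.le; linarith) (hL.trans hL') hp

end Flow

/-! ### Affine simplices and deformations of chains -/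

section Affine

variable {Y : Type} [TopologicalSpace Y] {S : Set Y} {R : Type u} [CommRing R]
  {E : Type*} [NormedAddCommGroup E] [NormedSpace ℝ E]

theorem continuous_stdSimplex_apply {n : ℕ} (i : Fin n) :
    Continuous fun s : stdSimplex ℝ (Fin n) => s.1 i :=
  (continuous_apply i).comp continuous_subtype_val

/-- The image under `G` of the affine path from `a` to `b`. -/
def lineSimplex (G : C(E, S)) (a b : E) : C(stdSimplex ℝ (Fin 2), S) :=
  G.comp ⟨fun s => s.1 0 • a + s.1 1 • b,
    ((continuous_stdSimplex_apply 0).smul continuous_const).add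
      ((continuous_stdSimplex_apply 1).smul continuous_const)⟩

/-- The image under `G` of the affine triangle with vertices `a`, `b`, `c`. -/
def triangle (G : C(E, S)) (a b c : E) : C(stdSimplex ℝ (Fin 3), S) :=
  G.comp ⟨fun s => s.1 0 • a + s.1 1 • b + s.1 2 • c,
    (((continuous_stdSimplex_apply 0).smul continuous_const).add
      ((continuous_stdSimplex_apply 1).smul continuous_const)).add
      ((continuous_stdSimplex_apply 2).smul continuous_const)⟩

theorem d_triangle (G : C(E, S)) (a b c : E) :
    ((chains R S).d 2 1).hom (simplexN R (n := 2) (triangle G a b c)) =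
      simplexN R (n := 1) (lineSimplex G b c) - simplexN R (n := 1) (lineSimplex G a c) +
        simplexN R (n := 1) (lineSimplex G a b) := by
  rw [d_simplexN_two]
  congr 3 <;>
  · ext s
    simp [face, triangle, lineSimplex, stdSimplex_map_apply, Fin.sum_univ_two, Fin.succAbove]

theorem d_lineSimplex (G : C(E, S)) (a b : E) :
    ((chains R S).d 1 0).hom (simplexN R (n := 1) (lineSimplex G a b)) =
      pointChain R (G b) - pointChain R (G a) := by
  rw [d_simplexN_one]
  congr 2 <;> simp [lineSimplex, stdSimplex.vertex]

/-- The singular `1`-simplex as a map defined on the line. -/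
def pathMap (σ : C(stdSimplex ℝ (Fin 2), S)) : C(ℝ, S) :=
  ⟨fun t => ⟨toPath σ t, toPath_mem σ t⟩, (continuous_toPath σ).subtype_mk _⟩

theorem lineSimplex_pathMap (σ : C(stdSimplex ℝ (Fin 2), S)) :
    lineSimplex (pathMap σ) (0 : ℝ) 1 = σ := by
  ext s
  simpa [lineSimplex, pathMap] using toPath_apply σ s

theorem chainsIncl_injective {T : Set Y} (h : S ⊆ T) (n : ℕ) :
    Function.Injective ((chainsIncl R h).f n).hom := by
  classical
  let r : (chains R T).X n →ₗ[R] (chains R S).X n := chainLift fun σ =>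
    if hσ : ∀ s, (σ s : Y) ∈ S then
      simplexN R ⟨fun s => ⟨σ s, hσ s⟩, (continuous_subtype_val.comp σ.continuous).subtype_mk _⟩
    else 0
  have : r ∘ₗ ((chainsIncl R h).f n).hom = LinearMap.id := by
    refine chain_hom_ext fun σ => ?_
    rw [LinearMap.comp_apply, chainsIncl_simplexN, chainLift_simplexN]
    exact dif_pos fun s => (σ s).2
  exact Function.LeftInverse.injective (LinearMap.congr_fun this)

/-- If `D` is deformed inside itself into `D' ⊆ D`, then every relative `1`-cycle of `(D, D')` is a
boundary. The homotopy between a chain and its image under the deformation is the prism operator. -/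
theorem exists_boundary_of_deformation {D D' : Set Y} (hD : D' ⊆ D) (H : C(ℝ × D, D))
    (h0 : ∀ p, H (0, p) = p) (h1 : ∀ p, (H (1, p) : Y) ∈ D')
    (h' : ∀ (t : ℝ) (p : D), (p : Y) ∈ D' → (H (t, p) : Y) ∈ D') (a : (chains R D).X 1)
    (c : (chains R D').X 0)
    (hc : ((chains R D).d 1 0).hom a = ((chainsIncl R hD).f 0).hom c) :
    ∃ (w : (chains R D).X 2) (a' : (chains R D').X 1),
      ((chains R D).d 2 1).hom w = a - ((chainsIncl R hD).f 1).hom a' := by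
  let Hp : D → C(ℝ, D) := fun p => H.comp ((ContinuousMap.id ℝ).prodMk (ContinuousMap.const ℝ p))
  let P₀ : (chains R D).X 0 →ₗ[R] (chains R D).X 1 :=
    chainLift (n := 0) fun σ => simplexN R (n := 1)
      (lineSimplex (Hp (σ (stdSimplex.vertex 0))) (0 : ℝ) 1)
  have hP₀ : ∀ p, P₀ (pointChain R p) = simplexN R (n := 1) (lineSimplex (Hp p) (0 : ℝ) 1) :=
    fun p => chainLift_simplexN _ _
  let T : (chains R D).X 1 →ₗ[R] (chains R D').X 1 :=
    chainLift (n := 1) fun σ => simplexN R (n := 1)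
      ⟨fun s => ⟨H (1, σ s), h1 _⟩, by fun_prop⟩
  let G : C(stdSimplex ℝ (Fin 2), D) → C(ℝ × ℝ, D) := fun σ =>
    H.comp ((ContinuousMap.id ℝ).prodMap (pathMap σ))
  let P₁ : (chains R D).X 1 →ₗ[R] (chains R D).X 2 :=
    chainLift (n := 1) fun σ => simplexN R (n := 2) (triangle (G σ) ((0, 0) : ℝ × ℝ) (0, 1) (1, 1)) -
      simplexN R (n := 2) (triangle (G σ) ((0, 0) : ℝ × ℝ) (1, 0) (1, 1))
  have key : ((chains R D).d 2 1).hom ∘ₗ P₁ =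
      LinearMap.id - ((chainsIncl R hD).f 1).hom ∘ₗ T + P₀ ∘ₗ ((chains R D).d 1 0).hom := by
    refine chain_hom_ext (n := 1) fun σ => ?_
    simp only [LinearMap.comp_apply, LinearMap.add_apply, LinearMap.sub_apply, LinearMap.id_apply,
      P₁, T, chainLift_simplexN, map_sub, d_triangle, d_simplexN_one, hP₀, chainsIncl_simplexN]
    have e1 : lineSimplex (G σ) ((0, 0) : ℝ × ℝ) (0, 1) = σ := by
      refine Eq.trans ?_ (lineSimplex_pathMap σ)
      ext s
      simp [lineSimplex, G, h0]
    have e2 : lineSimplex (G σ) ((0, 1) : ℝ × ℝ) (1, 1) =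
        lineSimplex (Hp (σ (stdSimplex.vertex 1))) (0 : ℝ) 1 := by
      ext s
      have hs : s.1 0 + s.1 1 = 1 := by have := s.2.2; simpa [Fin.sum_univ_two] using this
      have : pathMap σ 1 = σ (stdSimplex.vertex 1) := Subtype.ext (toPath_one σ)
      simp [lineSimplex, G, Hp, hs, this]
    have e3 : lineSimplex (G σ) ((0, 0) : ℝ × ℝ) (1, 0) =
        lineSimplex (Hp (σ (stdSimplex.vertex 0))) (0 : ℝ) 1 := by
      ext s
      have : pathMap σ 0 = σ (stdSimplex.vertex 0) := Subtype.ext (toPath_zero σ)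
      simp [lineSimplex, G, Hp, this]
    have e4 : lineSimplex (G σ) ((1, 0) : ℝ × ℝ) (1, 1) =
        (⟨Set.inclusion hD, continuous_inclusion hD⟩ : C(D', D)).comp
          (⟨fun s => ⟨H (1, σ s), h1 _⟩, by fun_prop⟩ : C(stdSimplex ℝ (Fin 2), D')) := by
      ext s
      have hs : s.1 0 + s.1 1 = 1 := by have := s.2.2; simpa [Fin.sum_univ_two] using this
      have : pathMap σ (s.1 1) = σ s := Subtype.ext (toPath_apply σ s)
      simp [lineSimplex, G, hs, this]
    rw [e1, e2, e3, e4]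
    abel
  have hP : ∀ c : (chains R D').X 0, ∃ y, ((chainsIncl R hD).f 1).hom y =
      P₀ (((chainsIncl R hD).f 0).hom c) := by
    refine chain_induction ?_ ?_ ?_ ?_
    · exact ⟨0, by simp⟩
    · rintro x y ⟨v, hv⟩ ⟨w, hw⟩
      exact ⟨v + w, by rw [map_add, map_add, map_add, hv, hw]⟩
    · rintro r x ⟨v, hv⟩
      exact ⟨r • v, by rw [map_smul, map_smul, map_smul, hv]⟩
    · intro σ
      rw [simplexN_zero, chainsIncl_pointChain, hP₀]
      refine ⟨simplexN R (n := 1) ⟨fun s => ⟨Hp ⟨_, hD (σ (stdSimplex.vertex 0)).2⟩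
        (s.1 0 • 0 + s.1 1 • 1), h' _ _ (σ (stdSimplex.vertex 0)).2⟩, ?_⟩, ?_⟩
      · refine Continuous.subtype_mk (continuous_subtype_val.comp ?_) _
        exact (Hp _).continuous.comp (((continuous_stdSimplex_apply 0).smul continuous_const).add
          ((continuous_stdSimplex_apply 1).smul continuous_const))
      · rw [chainsIncl_simplexN]
        rfl
  obtain ⟨y, hy⟩ := hP c
  refine ⟨P₁ a, T a - y, ?_⟩
  have := LinearMap.congr_fun key a
  simp only [LinearMap.comp_apply, LinearMap.add_apply, LinearMap.sub_apply, LinearMap.id_apply,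
    hc, ← hy] at this
  rw [this, map_sub]
  abel

end Affine

/-! ### The inverse limit of the relative chain complexes -/

section Limit

variable {A B : ℕ} {ε M θ : ℝ} {R : Type u} [CommRing R]

/-- The projections of the inverse limit. -/
def limπ (R : Type u) [CommRing R] (A B : ℕ) (ε M θ : ℝ) (L : {L : ℝ // M ≤ L}) (n : ℕ) : (relChainsInf R A B ε M θ).X n →ₗ[R]
    (relChains R (DReg_subset A B ε M L θ)).X n :=
  ((limit.π (relSystem R A B ε M θ) (Opposite.op L)).f n).hom

theorem d_limπ (L : {L : ℝ // M ≤ L}) (i j : ℕ) (x : (relChainsInf R A B ε M θ).X i) :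
    ((relChains R (DReg_subset A B ε M L θ)).d i j).hom (limπ R A B ε M θ L i x) =
      limπ R A B ε M θ L j (((relChainsInf R A B ε M θ).d i j).hom x) :=
  comm_apply (limit.π (relSystem R A B ε M θ) (Opposite.op L)) i j x

theorem relProj_limπ {L L' : {L : ℝ // M ≤ L}} (h : (L : ℝ) ≤ L') (n : ℕ)
    (x : (relChainsInf R A B ε M θ).X n) :
    ((relProj R (DReg_antitone A B ε M θ h) (DReg_subset A B ε M L θ)).f n).hom
      (limπ R A B ε M θ L' n x) = limπ R A B ε M θ L n x := by
  have := limit.w (relSystem R A B ε M θ) (homOfLE (show L ≤ L' from h)).op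
  exact congrArg (fun f => (f.f n).hom x) this

/-- The linear map `R → V` with value `v` at `1`. -/
def elementMap {V : ModuleCat.{u} R} (v : V) : ModuleCat.of R R ⟶ V :=
  ModuleCat.ofHom (LinearMap.toSpanSingleton R V v)

theorem elementMap_one {V : ModuleCat.{u} R} (v : V) : (elementMap v).hom (1 : R) = v :=
  one_smul R v

theorem elementMap_comp {V W : ModuleCat.{u} R} (v : V) (f : V ⟶ W) :
    elementMap v ≫ f = elementMap (f.hom v) := by
  apply ModuleCat.hom_ext
  apply LinearMap.ext_ring
  exact (congrArg f.hom (elementMap_one v)).trans (elementMap_one _).symm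

theorem limπ_ext {n : ℕ} {x y : (relChainsInf R A B ε M θ).X n}
    (h : ∀ L, limπ R A B ε M θ L n x = limπ R A B ε M θ L n y) : x = y := by
  have key := (isLimitOfPreserves (HomologicalComplex.eval (ModuleCat.{u} R) (ComplexShape.down ℕ) n)
    (limit.isLimit (relSystem R A B ε M θ))).hom_ext (f := elementMap x) (f' := elementMap y)
    fun L => (elementMap_comp x _).trans
      ((congrArg elementMap (h L.unop)).trans (elementMap_comp y _).symm)
  exact (elementMap_one x).symm.trans
    ((congrArg (fun f => f.hom (1 : R)) key).trans (elementMap_one y))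

theorem exists_limπ (n : ℕ)
    (x : ∀ L : {L : ℝ // M ≤ L}, (relChains R (DReg_subset A B ε M L θ)).X n)
    (hx : ∀ (L L' : {L : ℝ // M ≤ L}) (h : (L : ℝ) ≤ L'),
      ((relProj R (DReg_antitone A B ε M θ h) (DReg_subset A B ε M L θ)).f n).hom (x L') = x L) :
    ∃ y : (relChainsInf R A B ε M θ).X n, ∀ L, limπ R A B ε M θ L n y = x L := by
  let c : Cone (relSystem R A B ε M θ ⋙
      HomologicalComplex.eval (ModuleCat.{u} R) (ComplexShape.down ℕ) n) :=
    { pt := ModuleCat.of R R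
      π :=
        { app := fun L => elementMap (x L.unop)
          naturality := fun L L' f => (Category.id_comp _).trans
            ((congrArg elementMap (hx L'.unop L.unop (leOfHom f.unop)).symm).trans
              (elementMap_comp (x L.unop) _).symm) } }
  have hl := isLimitOfPreserves
    (HomologicalComplex.eval (ModuleCat.{u} R) (ComplexShape.down ℕ) n)
    (limit.isLimit (relSystem R A B ε M θ))
  refine ⟨(hl.lift c).hom (1 : R), fun L => ?_⟩
  have := congrArg (fun f => f.hom (1 : R)) (hl.fac c (Opposite.op L))
  exact this.trans (elementMap_one (x L))

theorem relProj_relProj {L L' L'' : ℝ} (h : L ≤ L') (h' : L' ≤ L'') (n : ℕ)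
    (x : (relChains R (DReg_subset A B ε M L'' θ)).X n) :
    ((relProj R (DReg_antitone A B ε M θ h) (DReg_subset A B ε M L θ)).f n).hom
      (((relProj R (DReg_antitone A B ε M θ h') (DReg_subset A B ε M L' θ)).f n).hom x) =
      ((relProj R (DReg_antitone A B ε M θ (h.trans h')) (DReg_subset A B ε M L θ)).f n).hom x := by
  obtain ⟨x, rfl⟩ := relπ_surjective _ n x
  rw [relProj_relπ, relProj_relπ, relProj_relπ]

/-- A primitive of a relative cycle modulo `D_L` lifts to a primitive modulo `D_{L'}`. -/
theorem exists_lift_primitive (hA : 0 < A) (hAB : A ≠ B) (hε : 0 < ε) (hM : 0 < M)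
    (hs : SmallTilt A B ε θ) {L L' : ℝ} (hL : levelBound A B ε M ≤ L) (h : L ≤ L')
    (x : (relChains R (DReg_subset A B ε M L' θ)).X 1)
    (hx : ((relChains R (DReg_subset A B ε M L' θ)).d 1 0).hom x = 0)
    (y : (relChains R (DReg_subset A B ε M L θ)).X 2)
    (hy : ((relChains R (DReg_subset A B ε M L θ)).d 2 1).hom y =
      ((relProj R (DReg_antitone A B ε M θ h) (DReg_subset A B ε M L θ)).f 1).hom x) :
    ∃ y' : (relChains R (DReg_subset A B ε M L' θ)).X 2,
      ((relChains R (DReg_subset A B ε M L' θ)).d 2 1).hom y' = x ∧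
      ((relProj R (DReg_antitone A B ε M θ h) (DReg_subset A B ε M L θ)).f 2).hom y' = y := by
  obtain ⟨x, rfl⟩ := relπ_surjective _ 1 x
  obtain ⟨y, rfl⟩ := relπ_surjective _ 2 y
  rw [relProj_relπ, d_relπ, ← sub_eq_zero, ← map_sub, relπ_eq_zero_iff] at hy
  obtain ⟨a, ha⟩ := hy
  rw [d_relπ, relπ_eq_zero_iff] at hx
  obtain ⟨c, hc⟩ := hx
  obtain ⟨H, h0, h1, h2⟩ := exists_deformation hA hAB hε hM hs hL h
  -- the boundary of `a` lies in `D_{L'}`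
  have hca : ((chains R (DReg A B ε M L θ)).d 1 0).hom a =
      ((chainsIncl R (DReg_antitone A B ε M θ h)).f 0).hom (-c) := by
    apply chainsIncl_injective (DReg_subset A B ε M L θ) 0
    have e : ((chainsIncl R (DReg_subset A B ε M L θ)).f 0).hom
        (((chainsIncl R (DReg_antitone A B ε M θ h)).f 0).hom (-c)) =
        ((chainsIncl R (DReg_subset A B ε M L' θ)).f 0).hom (-c) :=
      congrArg (fun f => (f.f 0).hom (-c))
        (chainsIncl_comp R (DReg_antitone A B ε M θ h) (DReg_subset A B ε M L θ))
    rw [e, map_neg, hc, ← comm_apply, ha, map_sub, d_comp_d_apply, zero_sub]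
  obtain ⟨w, a', hw⟩ := exists_boundary_of_deformation _ H h0 h1 h2 a _ hca
  refine ⟨relπ R _ 2 (y - ((chainsIncl R (DReg_subset A B ε M L θ)).f 2).hom w), ?_, ?_⟩
  · rw [d_relπ, map_sub, comm_apply, hw, ← sub_eq_zero, ← map_sub, relπ_eq_zero_iff]
    refine ⟨a', ?_⟩
    have e : ((chainsIncl R (DReg_subset A B ε M L θ)).f 1).hom
        (((chainsIncl R (DReg_antitone A B ε M θ h)).f 1).hom a') =
        ((chainsIncl R (DReg_subset A B ε M L' θ)).f 1).hom a' :=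
      congrArg (fun f => (f.f 1).hom a')
        (chainsIncl_comp R (DReg_antitone A B ε M θ h) (DReg_subset A B ε M L θ))
    rw [map_sub, ha, e]
    abel
  · rw [relProj_relπ, map_sub, (relπ_eq_zero_iff _ 2 _).2 ⟨w, rfl⟩, sub_zero]

/-- A cycle of the inverse limit which is a boundary modulo `D_L` for one large `L` is a
boundary. -/
theorem exists_primitive_inf (hA : 0 < A) (hAB : A ≠ B) (hε : 0 < ε) (hM : 0 < M)
    (hs : SmallTilt A B ε θ) (L : {L : ℝ // M ≤ L}) (hL : levelBound A B ε M ≤ L)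
    (x : (relChainsInf R A B ε M θ).X 1) (hx : ((relChainsInf R A B ε M θ).d 1 0).hom x = 0)
    (y : (relChains R (DReg_subset A B ε M L θ)).X 2)
    (hy : ((relChains R (DReg_subset A B ε M L θ)).d 2 1).hom y = limπ R A B ε M θ L 1 x) :
    ∃ z, ((relChainsInf R A B ε M θ).d 2 1).hom z = x := by
  have hl : ∀ n : ℕ, (L : ℝ) ≤ L + n := fun n => le_add_of_nonneg_right n.cast_nonneg
  let l : ℕ → {L : ℝ // M ≤ L} := fun n => ⟨L + n, L.2.trans (hl n)⟩
  have hls : ∀ n, (l n : ℝ) ≤ l (n + 1) := fun n => by simp [l]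
  have step : ∀ n (y : (relChains R (DReg_subset A B ε M (l n) θ)).X 2),
      ((relChains R (DReg_subset A B ε M (l n) θ)).d 2 1).hom y = limπ R A B ε M θ (l n) 1 x →
      ∃ y' : (relChains R (DReg_subset A B ε M (l (n + 1)) θ)).X 2,
        ((relChains R (DReg_subset A B ε M (l (n + 1)) θ)).d 2 1).hom y' =
          limπ R A B ε M θ (l (n + 1)) 1 x ∧
        ((relProj R (DReg_antitone A B ε M θ (hls n)) (DReg_subset A B ε M (l n) θ)).f 2).hom y' =
          y := fun n y hy =>
    exists_lift_primitive hA hAB hε hM hs (hL.trans (hl n)) (hls n) _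
      (by rw [d_limπ, hx, map_zero]) y (by rw [hy, relProj_limπ (hls n)])
  choose! f hf hf' using step
  have h0 : ((relChains R (DReg_subset A B ε M L θ)).d 2 1).hom y = limπ R A B ε M θ L 1 x := hy
  obtain ⟨y0, hy0⟩ : ∃ y0 : (relChains R (DReg_subset A B ε M (l 0) θ)).X 2,
      ((relChains R (DReg_subset A B ε M (l 0) θ)).d 2 1).hom y0 = limπ R A B ε M θ (l 0) 1 x := by
    have : l 0 = L := Subtype.ext (by simp [l])
    rw [this]
    exact ⟨y, hy⟩
  let Y : ∀ n, (relChains R (DReg_subset A B ε M (l n) θ)).X 2 := fun n => Nat.rec y0 f n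
  have hY : ∀ n, ((relChains R (DReg_subset A B ε M (l n) θ)).d 2 1).hom (Y n) =
      limπ R A B ε M θ (l n) 1 x := fun n => by
    induction n with
    | zero => exact hy0
    | succ n ih => exact hf n _ ih
  have hmono : ∀ {n n' : ℕ}, n ≤ n' → (l n : ℝ) ≤ l n' := fun h => by simpa [l] using h
  have hYY : ∀ (n n' : ℕ) (h : n ≤ n'), ((relProj R (DReg_antitone A B ε M θ (hmono h))
      (DReg_subset A B ε M (l n) θ)).f 2).hom (Y n') = Y n := by
    intro n n' h
    induction n', h using Nat.le_induction with
    | base =>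
      obtain ⟨z, hz⟩ := relπ_surjective _ 2 (Y n)
      rw [← hz, relProj_relπ]
    | succ n' h ih =>
      rw [← relProj_relProj (hmono h) (hls n')]
      exact (congrArg _ (hf' n' _ (hY n'))).trans ih
  let N : ℝ → ℕ := fun L' => ⌈L' - L⌉₊
  have hN : ∀ L', L' ≤ l (N L') := fun L' => by
    have := Nat.le_ceil (L' - L)
    change L' ≤ L + (⌈L' - L⌉₊ : ℝ)
    linarith
  obtain ⟨z, hz⟩ := exists_limπ (R := R) (A := A) (B := B) (ε := ε) (M := M) (θ := θ) 2
    (fun L' => ((relProj R (DReg_antitone A B ε M θ (hN L')) (DReg_subset A B ε M L' θ)).f 2).hom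
      (Y (N L'))) (fun L₁ L₂ h => by
        have h12 : N L₁ ≤ N L₂ := Nat.ceil_mono (sub_le_sub_right h _)
        rw [relProj_relProj h (hN L₂), ← hYY _ _ h12, relProj_relProj (hN L₁) (hmono h12)])
  refine ⟨z, limπ_ext fun L' => ?_⟩
  rw [← d_limπ, hz, comm_apply, hY, relProj_limπ (hN L')]

end Limit

/-! ### The contours -/

section Contour

open Set Topology

variable {A B : ℕ} {ε M θ : ℝ}

/-- The largest number which can be added to the absolute values smaller than `M` of the
half-integers without exceeding `M`. -/
def gap (M : ℝ) : ℝ := M - 1 / 2 - (⌈M - 1 / 2⌉ - 1)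

theorem gap_pos : 0 < gap M := by
  have := Int.ceil_lt_add_one (M - 1 / 2)
  unfold gap
  linarith

theorem add_gap_le {n : ℤ} (h : |(n : ℝ) + 1 / 2| < M) : |(n : ℝ) + 1 / 2| + gap M ≤ M := by
  have key : ∀ n : ℤ, (n : ℝ) + 1 / 2 < M → (n : ℝ) + 1 / 2 + gap M ≤ M := fun n hn => by
    have h1 : n ≤ ⌈M - 1 / 2⌉ - 1 := by
      have : n < ⌈M - 1 / 2⌉ := Int.lt_ceil.2 (by linarith)
      omega
    have h2 : (n : ℝ) ≤ ⌈M - 1 / 2⌉ - 1 := by exact_mod_cast h1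
    unfold gap
    linarith
  rcases abs_cases ((n : ℝ) + 1 / 2) with ⟨h1, -⟩ | ⟨h1, -⟩
  · rw [h1] at h ⊢
    exact key n h
  · have h2 := key (-n - 1) (by push_cast; linarith)
    push_cast at h2
    linarith

/-- The part of the contours at height at most `ε/M` is close to its real point. -/
structure SmallContour (A B : ℕ) (ε M θ : ℝ) : Prop where
  quarter : ε ≤ 1 / 4
  plus : ε / M ≤ min (1 / 4) (gap M) * (dirPlus A ε θ).im
  minus : ε / M ≤ min (1 / 4) (gap M) * (dirMinus A B ε θ).im

/-- The imaginary parts of the two directions tend to `sin (θ / 2) > 0` as `ε → 0`. -/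
theorem exists_smallContour (A B : ℕ) (hθ : 0 < θ) (hθ' : θ < 2 * Real.pi) :
    ∃ ε₀ > 0, ∀ ε, 0 < ε → ε < ε₀ → SmallContour A B ε M θ := by
  have hsin : 0 < Real.sin (θ / 2) :=
    Real.sin_pos_of_pos_of_lt_pi (by linarith) (by linarith)
  have hδ : 0 < min (1 / 4) (gap M) := lt_min (by norm_num) gap_pos
  have h1 : ∀ a : ℝ, ∀ᶠ ε in 𝓝 (0 : ℝ),
      ε / M < min (1 / 4) (gap M) * (Complex.exp ((θ / 2 - a * ε : ℝ) * Complex.I)).im := by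
    intro a
    simp only [Complex.exp_ofReal_mul_I_im]
    have hc : ContinuousAt (fun ε : ℝ => min (1 / 4) (gap M) * Real.sin (θ / 2 - a * ε) - ε / M) 0 := by
      fun_prop
    have := hc.eventually (lt_mem_nhds (a := 0) (by simpa using mul_pos hδ hsin))
    filter_upwards [this] with ε hε
    linarith
  have h2 : ∀ᶠ ε in 𝓝 (0 : ℝ), ε < 1 / 4 := gt_mem_nhds (by norm_num)
  obtain ⟨ε₀, hε₀, h⟩ := Metric.eventually_nhds_iff.1 ((h1 A).and ((h1 (A - B)).and h2))
  refine ⟨ε₀, hε₀, fun ε hε hε' => ?_⟩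
  obtain ⟨h3, h4, h5⟩ := h (y := ε) (by rw [Real.dist_eq, sub_zero, abs_of_pos hε]; exact hε')
  exact ⟨h5.le, h3.le, h4.le⟩

/-- The contour through the real point `c`, as a path in the plane. -/
def contourPt (A B : ℕ) (ε θ c t : ℝ) : ℂ :=
  c + t * if 0 ≤ t then dirPlus A ε θ else dirMinus A B ε θ

/-- The contour through the midpoint of the strip `k < x < k + 1`, as a path in `Σ`. -/
def contour (A B : ℕ) (ε θ : ℝ) (m k : ℤ) (t : ℝ) : Surface A B :=
  if 0 ≤ t then plusPt A B m (contourPt A B ε θ (k + 1 / 2) t)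
  else minusPt A B (m + B * k) (contourPt A B ε θ (k + 1 / 2) t)

theorem contourPt_im (c t : ℝ) : (contourPt A B ε θ c t).im =
    t * if 0 ≤ t then (dirPlus A ε θ).im else (dirMinus A B ε θ).im := by
  unfold contourPt
  split_ifs <;> simp

theorem contourPt_im_mono (hs : SmallTilt A B ε θ) (c : ℝ) :
    Monotone fun t => (contourPt A B ε θ c t).im := by
  intro s t hst
  simp only [contourPt_im]
  have h1 := hs.imPlus
  have h2 := hs.imMinus
  split_ifs with h3 h4 h4
  · exact mul_le_mul_of_nonneg_right hst h1.le
  · linarith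
  · exact (mul_nonpos_of_nonpos_of_nonneg (not_le.1 h3).le h2.le).trans (mul_nonneg h4 h1.le)
  · exact mul_le_mul_of_nonneg_right hst h2.le

theorem contourPt_zero (c : ℝ) : contourPt A B ε θ c 0 = c := by simp [contourPt]

theorem contourPt_near (h : SmallContour A B ε M θ) (hs : SmallTilt A B ε θ) {c t : ℝ}
    (ht : |(contourPt A B ε θ c t).im| ≤ ε / M) :
    |(contourPt A B ε θ c t).re - c| ≤ min (1 / 4) (gap M) := by
  have key : ∀ φ : ℝ, 0 < (Complex.exp (φ * Complex.I)).im →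
      |t * (Complex.exp (φ * Complex.I)).im| ≤
        min (1 / 4) (gap M) * (Complex.exp (φ * Complex.I)).im →
      |t * (Complex.exp (φ * Complex.I)).re| ≤ min (1 / 4) (gap M) := by
    intro φ h1 h2
    rw [abs_mul, abs_of_pos h1] at h2
    have h3 := le_of_mul_le_mul_right h2 h1
    rw [abs_mul, Complex.exp_ofReal_mul_I_re]
    exact (mul_le_of_le_one_right (abs_nonneg t) (Real.abs_cos_le_one φ)).trans h3
  rw [contourPt_im] at ht
  unfold contourPt
  split_ifs at ht ⊢
  · simpa [dirPlus] using key _ hs.imPlus (ht.trans h.plus)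
  · simpa [dirMinus] using key _ hs.imMinus (ht.trans h.minus)

theorem contourPt_strip (h : SmallContour A B ε M θ) (hs : SmallTilt A B ε θ) {k : ℤ} {t : ℝ}
    (ht : |(contourPt A B ε θ (k + 1 / 2) t).im| ≤ ε / M) :
    Inner ε k (contourPt A B ε θ (k + 1 / 2) t).re := by
  have h1 := (contourPt_near h hs ht).trans (min_le_left _ _)
  have h2 := h.quarter
  rw [abs_le] at h1
  exact ⟨by linarith [h1.1], by linarith [h1.2]⟩

theorem strip_mid (k : ℤ) : (k : ℝ) < ((k + 1 / 2 : ℝ) : ℂ).re ∧ ((k + 1 / 2 : ℝ) : ℂ).re < k + 1 := by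
  rw [Complex.ofReal_re]
  constructor <;> linarith

theorem contourPt_mem_cutPlus (hs : SmallTilt A B ε θ) {k : ℤ} {t : ℝ} (ht : 0 ≤ t) :
    contourPt A B ε θ (k + 1 / 2) t ∈ cutPlus := by
  rcases ht.eq_or_lt with rfl | ht'
  · rw [contourPt_zero]
    exact strip_mem_cutPlus (strip_mid k)
  · apply pos_im_mem_cutPlus
    rw [contourPt_im, if_pos ht]
    exact mul_pos ht' hs.imPlus

theorem contourPt_mem_cutMinus (hs : SmallTilt A B ε θ) {k : ℤ} {t : ℝ} (ht : t ≤ 0) :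
    contourPt A B ε θ (k + 1 / 2) t ∈ cutMinus := by
  rcases ht.eq_or_lt with rfl | ht'
  · rw [contourPt_zero]
    exact strip_mem_cutMinus (strip_mid k)
  · apply neg_im_mem_cutMinus
    rw [contourPt_im, if_neg ht'.not_ge]
    exact mul_neg_of_neg_of_pos ht' hs.imMinus

theorem plusPt_eq_minusPt_strip (m : ℤ) {k : ℤ} {z : ℂ} (hz : (k : ℝ) < z.re ∧ z.re < k + 1) :
    plusPt A B m z = minusPt A B (m + B * k) z := by
  have h1 := ne_int_of_mem hz.1 hz.2
  rw [plusPt_eq_minusPt_floor m h1, (floor_eq_of_strip h1 k).2 hz]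

theorem contour_of_nonpos {m k : ℤ} {t : ℝ} (ht : t ≤ 0) : contour A B ε θ m k t =
    minusPt A B (m + B * k) (contourPt A B ε θ (k + 1 / 2) t) := by
  rcases ht.eq_or_lt with rfl | ht
  · rw [contour, if_pos le_rfl, contourPt_zero]
    exact plusPt_eq_minusPt_strip m (strip_mid k)
  · exact if_neg ht.not_ge

theorem contour_of_strip {m k : ℤ} {t : ℝ} (ht : (k : ℝ) < (contourPt A B ε θ (k + 1 / 2) t).re ∧
    (contourPt A B ε θ (k + 1 / 2) t).re < k + 1) :
    contour A B ε θ m k t = plusPt A B m (contourPt A B ε θ (k + 1 / 2) t) := by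
  unfold contour
  split_ifs
  · rfl
  · exact (plusPt_eq_minusPt_strip m ht).symm

theorem continuous_contour (hs : SmallTilt A B ε θ) (m k : ℤ) :
    Continuous (contour A B ε θ m k) := by
  rw [← continuousOn_univ, ← Iic_union_Ici (a := (0 : ℝ))]
  refine ContinuousOn.union_of_isClosed ?_ ?_ isClosed_Iic isClosed_Ici
  · refine ((continuousOn_minusPt (m + B * k)).comp (s := Iic 0)
      (f := fun t : ℝ => ((k + 1 / 2 : ℝ) : ℂ) + t * dirMinus A B ε θ) (by fun_prop) ?_).congr ?_
    · intro t ht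
      rcases (mem_Iic.1 ht).eq_or_lt with rfl | ht'
      · simpa using strip_mem_cutMinus (strip_mid k)
      · have := contourPt_mem_cutMinus (k := k) hs ht
        rwa [contourPt, if_neg ht'.not_ge] at this
    · intro t ht
      rw [contour_of_nonpos ht, Function.comp, contourPt]
      split_ifs with h
      · rw [le_antisymm ht h]; simp
      · rfl
  · refine ((continuousOn_plusPt m).comp (s := Ici 0)
      (f := fun t : ℝ => ((k + 1 / 2 : ℝ) : ℂ) + t * dirPlus A ε θ) (by fun_prop) ?_).congr ?_
    · intro t ht
      have := contourPt_mem_cutPlus (k := k) hs ht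
      rwa [contourPt, if_pos (mem_Ici.1 ht)] at this
    · intro t ht
      rw [contour, if_pos (mem_Ici.1 ht), Function.comp, contourPt, if_pos (mem_Ici.1 ht)]

theorem contour_high {m k : ℤ} (hs : SmallTilt A B ε θ) (hη : 0 < ε / M) (hm : 0 ≤ m)
    (hmA : m < A) {t : ℝ} (ht : ε / M ≤ (contourPt A B ε θ (k + 1 / 2) t).im) :
    contour A B ε θ m k t ∈ SigmaPlus A B ε M := by
  have h0 : 0 ≤ t := by
    by_contra h
    have := contourPt_im_mono hs (k + 1 / 2) (not_le.1 h).le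
    simp only [contourPt_zero, Complex.ofReal_im] at this
    linarith
  rw [contour, if_pos h0]
  exact SigmaPlus_of_high hm hmA (contourPt_mem_cutPlus hs h0) ht

theorem contour_low {m k : ℤ} (hs : SmallTilt A B ε θ) (hη : 0 < ε / M)
    (hne : (shifts A B m k).Nonempty) {t : ℝ}
    (ht : (contourPt A B ε θ (k + 1 / 2) t).im ≤ -(ε / M)) :
    contour A B ε θ m k t ∈ SigmaMinus A B ε M := by
  have h0 : t ≤ 0 := by
    by_contra h
    have := contourPt_im_mono hs (k + 1 / 2) (not_le.1 h).le
    simp only [contourPt_zero, Complex.ofReal_im] at this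
    linarith
  rw [contour_of_nonpos h0]
  exact low_mem_SigmaMinus (hasSheet_iff.2 hne) (contourPt_mem_cutMinus hs h0) ht

/-- The contour passes from `Σ⁻` to `Σ⁺` in `Σ⁺ ∩ Σ⁻`. -/
theorem exists_contour_crossing (h : SmallRadius ε M) (hs : SmallTilt A B ε θ)
    (hc : SmallContour A B ε M θ) {m k : ℤ} (hm : 0 ≤ m) (hmA : m < A)
    (hne : (shifts A B m k).Nonempty) (hmid : ∃ i ∈ centers A B m k, |(k : ℝ) + 1 / 2 - i| < M) :
    ∃ t₀ : ℝ, (∀ t, t₀ ≤ t → contour A B ε θ m k t ∈ SigmaPlus A B ε M) ∧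
      (∀ t, t ≤ t₀ → contour A B ε θ m k t ∈ SigmaMinus A B ε M) ∧
      ∃ z : ℂ, ((k : ℝ) < z.re ∧ z.re < k + 1) ∧ contour A B ε θ m k t₀ = plusPt A B m z := by
  have hη := h.height_pos
  obtain ⟨i, hi, hiM⟩ := hmid
  set z := contourPt A B ε θ (k + 1 / 2) with hz
  have hnear : ∀ t, |(z t).im| ≤ ε / M → |(z t).re - i| ≤ M := fun t ht => by
    have h1 := (contourPt_near hc hs ht).trans (min_le_right _ _)
    have h2 := add_gap_le (M := M) (n := k - i) (by push_cast; rwa [sub_add_eq_add_sub])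
    push_cast at h2
    rw [sub_add_eq_add_sub] at h2
    calc |(z t).re - i| = |((z t).re - (k + 1 / 2)) + ((k : ℝ) + 1 / 2 - i)| := by ring_nf
      _ ≤ _ := (abs_add_le _ _).trans (by linarith)
  have hmono : ∀ {s t : ℝ}, s ≤ t → (z s).im ≤ (z t).im := fun hst => contourPt_im_mono hs _ hst
  rcases mem_insert_iff.1 hi with rfl | hi
  · -- the leg of `Σ⁺` reaches down to the height `-ε/M`
    have him : (z (-(ε / M / (dirMinus A B ε θ).im))).im = -(ε / M) := by
      rw [hz, contourPt_im, if_neg (by have := div_pos hη hs.imMinus; linarith), neg_mul,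
        div_mul_cancel₀ _ hs.imMinus.ne']
    refine ⟨-(ε / M / (dirMinus A B ε θ).im), fun t ht => ?_, fun t ht => ?_, _, ?_,
      contour_of_strip ((contourPt_strip hc hs ?_).strip h)⟩
    · have h1 := hmono ht
      rw [him] at h1
      rcases le_total (ε / M) (z t).im with h2 | h2
      · exact contour_high hs hη hm hmA h2
      · have h3 : |(z t).im| ≤ ε / M := abs_le.2 ⟨h1, h2⟩
        have h4 := contourPt_strip hc hs h3
        rw [contour_of_strip (h4.strip h), plusPt_mem_SigmaPlus hm hmA (strip_mem_cutPlus (h4.strip h))]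
        have := Inner.mem_leg h (s := 1) (i := 0) h4 (hnear t h3) (by rwa [one_mul])
        exact leg_subset (by simpa using this)
    · exact contour_low hs hη hne ((hmono ht).trans him.le)
    · exact (contourPt_strip hc hs (by rw [← hz, him, abs_neg, abs_of_pos hη])).strip h
    · rw [← hz, him, abs_neg, abs_of_pos hη]
  · -- a leg of `Σ⁻` reaches up to the height `ε/M`
    have him : (z (ε / M / (dirPlus A ε θ).im)).im = ε / M := by
      rw [hz, contourPt_im, if_pos (div_pos hη hs.imPlus).le, div_mul_cancel₀ _ hs.imPlus.ne']
    refine ⟨ε / M / (dirPlus A ε θ).im, fun t ht => ?_, fun t ht => ?_, _, ?_,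
      contour_of_strip ((contourPt_strip hc hs ?_).strip h)⟩
    · exact contour_high hs hη hm hmA (him.ge.trans (hmono ht))
    · have h1 := hmono ht
      rw [him] at h1
      rcases le_total (z t).im (-(ε / M)) with h2 | h2
      · exact contour_low hs hη hne h2
      · have h3 : |(z t).im| ≤ ε / M := abs_le.2 ⟨h2, h1⟩
        have h4 := contourPt_strip hc hs h3
        rw [contour_of_strip (h4.strip h), plusPt_mem_SigmaMinus_iff (h4.strip h)]
        exact ⟨i, hi, leg_subset (Inner.mem_leg h h4 (hnear t h3) (by linarith))⟩
    · exact (contourPt_strip hc hs (by rw [← hz, him, abs_of_pos hη])).strip h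
    · rw [← hz, him, abs_of_pos hη]

theorem contour_eventually_mem_DPlus (hA : 0 < A) (hε : 0 < ε) (hM : 0 < M)
    (hs : SmallTilt A B ε θ) {L : ℝ} (hL : levelBound A B ε M ≤ L) {m : ℤ} (hm : 0 ≤ m)
    (hmA : m < A) (k : ℤ) :
    ∀ᶠ t : ℝ in Filter.atTop, contour A B ε θ m k t ∈ DPlus A B ε M L θ := by
  filter_upwards [eventually_mem_decay (η := ε / M) (L := L) hs.quadPlus hs.imPlus ((k + 1 / 2 : ℝ) : ℂ),
    Filter.eventually_ge_atTop 0] with t ht ht0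
  refine mem_DPlus.2 ⟨⟨m.toNat, by omega⟩, ?_⟩
  rw [sheetDPlus_eq hA hε hM hs hL, contour, if_pos ht0, contourPt, if_pos ht0]
  exact ⟨_, ht, by simp [Int.toNat_of_nonneg hm]⟩

theorem contour_eventually_mem_DMinus (hAB : A ≠ B) (hε : 0 < ε) (hM : 0 < M)
    (hs : SmallTilt A B ε θ) {L : ℝ} (hL : levelBound A B ε M ≤ L) {m k : ℤ}
    (hne : (shifts A B m k).Nonempty) :
    ∀ᶠ t : ℝ in Filter.atTop, contour A B ε θ m k (-t) ∈ DMinus A B ε M L θ := by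
  obtain ⟨j, h1, h2⟩ := hasSheet_iff.2 hne
  filter_upwards [eventually_mem_decay (η := ε / M) (L := L) hs.quadMinus hs.imMinus
    (-((k + 1 / 2 : ℝ) : ℂ) - j), Filter.eventually_gt_atTop 0] with t ht ht0
  refine mem_DMinus.2 ⟨⟨(m + B * k + (B - A) * j).toNat, by omega⟩, ?_⟩
  rw [sheetDMinus_eq hAB hε hM hs hL, contour_of_nonpos (by linarith),
    ← minusPt_shift _ j (contourPt_mem_cutMinus hs (by linarith)), contourPt, if_neg (by linarith)]
  refine ⟨_, ht, ?_⟩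
  simp only [Int.toNat_of_nonneg h1]
  congr 1
  push_cast
  ring

/-- `i τ^{-1/2}` is a positive multiple of `e^{iθ/2}`. -/
theorem exists_contour_speed (hθ : 0 < θ) (hθ' : θ < 2 * Real.pi) (A B : ℕ) (ε : ℝ) {τ : ℂ}
    (hτ : τ ≠ 0) (h : -1 / τ = (‖1 / τ‖ : ℂ) * Complex.exp (θ * Complex.I)) :
    ∃ ρ : ℝ, 0 < ρ ∧
      Complex.I / τ ^ (1 / 2 : ℂ) * Complex.exp (-(Complex.I * A * ε)) = ρ * dirPlus A ε θ ∧
      Complex.I / τ ^ (1 / 2 : ℂ) * Complex.exp (-(Complex.I * (A - B) * ε)) =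
        ρ * dirMinus A B ε θ := by
  have hn : 0 < ‖τ‖ := norm_pos_iff.2 hτ
  have hτe : τ = Complex.exp ((Real.log ‖τ‖ : ℝ) + ((Real.pi - θ : ℝ) : ℂ) * Complex.I) := by
    have h1 : ((‖1 / τ‖ : ℝ) : ℂ) = (‖τ‖ : ℂ)⁻¹ := by simp
    rw [h1] at h
    have hn' : (‖τ‖ : ℂ) ≠ 0 := by exact_mod_cast hn.ne'
    have h2 : τ * Complex.exp (θ * Complex.I) = -‖τ‖ := by
      field_simp at h
      linear_combination -h
    rw [Complex.exp_add, ← Complex.ofReal_exp, Real.exp_log hn]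
    push_cast
    rw [sub_mul, Complex.exp_sub, Complex.exp_pi_mul_I]
    field_simp
    linear_combination h2
  have hlog : Complex.log τ = (Real.log ‖τ‖ : ℝ) + ((Real.pi - θ : ℝ) : ℂ) * Complex.I := by
    conv_lhs => rw [hτe]
    exact Complex.log_exp (by simp; linarith) (by simp; linarith)
  have hmain : Complex.I / τ ^ (1 / 2 : ℂ) = ((Real.exp (-(Real.log ‖τ‖ / 2)) : ℝ) : ℂ) *
      Complex.exp ((θ / 2 : ℝ) * Complex.I) := by
    rw [Complex.cpow_def_of_ne_zero hτ, hlog, div_eq_iff (Complex.exp_ne_zero _),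
      Complex.ofReal_exp, ← Complex.exp_add, ← Complex.exp_add]
    refine Complex.exp_pi_div_two_mul_I.symm.trans ?_
    congr 1
    push_cast
    ring
  refine ⟨Real.exp (-(Real.log ‖τ‖ / 2)), Real.exp_pos _, ?_, ?_⟩ <;>
  · rw [hmain, mul_assoc, ← Complex.exp_add]
    simp only [dirPlus, dirMinus]
    congr 2
    push_cast
    ring

end Contour

/-! ### The contours contained in `X` -/

section Index

open Set Topology

variable {A B : ℕ} {ε M θ : ℝ}

/-- The half-lines of the contour have the unit directions `dirPlus` and `-dirMinus`, so the lift is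
unique and is the standard contour through the strip `ℓ - 1`, run at speed `ρ`. -/
theorem isContourLift_iff (hs : SmallTilt A B ε θ) {τ : ℂ} {ρ : ℝ} (hρ : 0 < ρ)
    (h1 : Complex.I / τ ^ (1 / 2 : ℂ) * Complex.exp (-(Complex.I * A * ε)) = ρ * dirPlus A ε θ)
    (h2 : Complex.I / τ ^ (1 / 2 : ℂ) * Complex.exp (-(Complex.I * (A - B) * ε)) =
      ρ * dirMinus A B ε θ) {ℓ m : ℤ} {γ : ℝ → Surface A B} :
    IsContourLift A B ε τ ℓ m γ ↔ ∀ t, γ t = contour A B ε θ m (ℓ - 1) (ρ * t) := by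
  have e1 : ∀ t : ℝ, 0 ≤ t → Complex.I / τ ^ (1 / 2 : ℂ) * Complex.exp (-(Complex.I * A * ε)) * t -
      1 / 2 + ℓ = contourPt A B ε θ ((ℓ - 1 : ℤ) + 1 / 2) (ρ * t) := fun t ht => by
    rw [h1, contourPt, if_pos (mul_nonneg hρ.le ht)]
    push_cast
    ring
  have e2 : ∀ t : ℝ, t ≤ 0 → Complex.I / τ ^ (1 / 2 : ℂ) *
      Complex.exp (-(Complex.I * (A - B) * ε)) * t - 1 / 2 + ℓ =
        contourPt A B ε θ ((ℓ - 1 : ℤ) + 1 / 2) (ρ * t) := fun t ht => by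
    rcases ht.eq_or_lt with rfl | ht'
    · simp [contourPt]
      ring
    · rw [h2, contourPt, if_neg (mul_neg_of_pos_of_neg hρ ht').not_ge]
      push_cast
      ring
  have e3 : ∀ t : ℝ, 0 ≤ t → contour A B ε θ m (ℓ - 1) (ρ * t) =
      plusPt A B m (contourPt A B ε θ ((ℓ - 1 : ℤ) + 1 / 2) (ρ * t)) := fun t ht =>
    if_pos (mul_nonneg hρ.le ht)
  have e4 : ∀ t : ℝ, t ≤ 0 → contour A B ε θ m (ℓ - 1) (ρ * t) =
      minusPt A B (m + B * (ℓ - 1)) (contourPt A B ε θ ((ℓ - 1 : ℤ) + 1 / 2) (ρ * t)) := fun t ht =>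
    contour_of_nonpos (mul_nonpos_of_nonneg_of_nonpos hρ.le ht)
  constructor
  · rintro ⟨hp, hn⟩ t
    rcases le_total 0 t with ht | ht
    · obtain ⟨h, e⟩ := hp t ht
      rw [e, ptPlus_eq, e3 t ht, ← e1 t ht]
    · obtain ⟨h, e⟩ := hn t ht
      rw [e, ptMinus_eq, e4 t ht, ← e2 t ht]
  · intro h
    refine ⟨fun t ht => ?_, fun t ht => ?_⟩
    · have hc := contourPt_mem_cutPlus (k := ℓ - 1) hs (mul_nonneg hρ.le ht)
      rw [← e1 t ht] at hc
      exact ⟨hc, by rw [h t, e3 t ht, ptPlus_eq, ← e1 t ht]⟩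
    · have hc := contourPt_mem_cutMinus (k := ℓ - 1) hs (mul_nonpos_of_nonneg_of_nonpos hρ.le ht)
      rw [← e2 t ht] at hc
      exact ⟨hc, by rw [h t, e4 t ht, ptMinus_eq, ← e2 t ht]⟩

/-- If the intervals which meet `(-M, M)` have their midpoints in it, then so do the intervals which
meet `[-M, M]`. -/
theorem abs_mid_lt (hM : 0 < M) (hmid : ∀ k : ℤ, (∃ x : ℝ, (k : ℝ) < x ∧ x < k + 1 ∧ |x| < M) →
      |(k : ℝ) + 1 / 2| < M) {k : ℤ} {x : ℝ} (hx : (k : ℝ) < x ∧ x < k + 1) (hxM : |x| ≤ M) :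
    |(k : ℝ) + 1 / 2| < M := by
  rw [abs_le] at hxM
  rcases le_or_gt 0 k with hk | hk
  · have hk' : (0 : ℝ) ≤ k := by exact_mod_cast hk
    refine hmid k ⟨(x + k) / 2, by linarith, by linarith, ?_⟩
    rw [abs_lt]
    constructor <;> linarith
  · have hk' : (k : ℝ) + 1 ≤ 0 := by exact_mod_cast hk
    refine hmid k ⟨(x + (k + 1)) / 2, by linarith, by linarith, ?_⟩
    rw [abs_lt]
    constructor <;> linarith

theorem abs_mid_sub_lt (hM : 0 < M) (hmid : ∀ k : ℤ, (∃ x : ℝ, (k : ℝ) < x ∧ x < k + 1 ∧ |x| < M) →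
      |(k : ℝ) + 1 / 2| < M) {k i : ℤ} {x : ℝ} (hx : (k : ℝ) < x ∧ x < k + 1) (hxM : |x - i| ≤ M) :
    |(k : ℝ) + 1 / 2 - i| < M := by
  have := abs_mid_lt hM hmid (k := k - i) (x := x - i)
    (by push_cast; constructor <;> linarith) hxM
  push_cast at this
  rwa [sub_add_eq_add_sub] at this

/-- A contour stays in `X` exactly when it arrives on a sheet of `Σ⁻` and its real point lies on one of
the legs over its strip. -/
theorem mem_contourIndex_iff (h : SmallRadius ε M) (hs : SmallTilt A B ε θ)
    (hc : SmallContour A B ε M θ)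
    (hmid : ∀ k : ℤ, (∃ x : ℝ, (k : ℝ) < x ∧ x < k + 1 ∧ |x| < M) → |(k : ℝ) + 1 / 2| < M)
    {τ : ℂ} {ρ : ℝ} (hρ : 0 < ρ)
    (h1 : Complex.I / τ ^ (1 / 2 : ℂ) * Complex.exp (-(Complex.I * A * ε)) = ρ * dirPlus A ε θ)
    (h2 : Complex.I / τ ^ (1 / 2 : ℂ) * Complex.exp (-(Complex.I * (A - B) * ε)) =
      ρ * dirMinus A B ε θ) {ℓ : ℤ} {m : Fin A} :
    (ℓ, m) ∈ contourIndex A B ε M τ ↔ (shifts A B (m : ℕ) (ℓ - 1)).Nonempty ∧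
      ∃ i ∈ centers A B (m : ℕ) (ℓ - 1), |((ℓ - 1 : ℤ) : ℝ) + 1 / 2 - i| < M := by
  have hη := h.height_pos
  have hm : (0 : ℤ) ≤ (m : ℕ) := by positivity
  have hmA : ((m : ℕ) : ℤ) < A := by exact_mod_cast m.2
  have hst : ((ℓ - 1 : ℤ) : ℝ) < ((ℓ - 1 : ℤ) : ℝ) + 1 / 2 ∧
      ((ℓ - 1 : ℤ) : ℝ) + 1 / 2 < ((ℓ - 1 : ℤ) : ℝ) + 1 := by constructor <;> linarith
  constructor
  · rintro ⟨γ, hγ⟩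
    rw [isContourLift_iff hs hρ h1 h2] at hγ
    constructor
    · -- a point of the contour below the legs
      set T := -(2 * (ε / M) / (dirMinus A B ε θ).im)
      have hT : T < 0 := neg_neg_of_pos (div_pos (by linarith) hs.imMinus)
      have him : (contourPt A B ε θ ((ℓ - 1 : ℤ) + 1 / 2) T).im = -(2 * (ε / M)) := by
        rw [contourPt_im, if_neg hT.not_ge, neg_mul, div_mul_cancel₀ _ hs.imMinus.ne']
      have hcut := contourPt_mem_cutMinus (k := ℓ - 1) hs hT.le
      have hX := (γ (T / ρ)).2
      have e := hγ (T / ρ)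
      dsimp only at e
      rw [e, mul_div_cancel₀ _ hρ.ne', contour_of_nonpos hT.le] at hX
      rcases hX with hX | hX
      · obtain ⟨m', z, -, -, hz, hzr, e'⟩ := exists_plusPt_of_mem_SigmaPlus hX
        have e'' := congrArg height e'
        rw [height_minusPt _ hcut, height_plusPt _ hz, him] at e''
        have := (mem_leg_of_lt hzr (by linarith)).2.1
        linarith
      · obtain ⟨j, h3, h4, -⟩ := (minusPt_mem_SigmaMinus hcut).1 hX
        exact hasSheet_iff.1 ⟨j, h3, h4⟩
    · have hX := (γ 0).2
      have e := hγ 0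
      dsimp only at e
      rw [e, mul_zero, contour, if_pos le_rfl, contourPt_zero,
        real_mem_XSurf_iff h.hε h.hM hm hmA hst] at hX
      obtain ⟨i, hi, hX⟩ := hX
      refine ⟨i, hi, abs_mid_sub_lt h.hM hmid hst ?_⟩
      exact abs_le_of_real_mem h.hε h.hM hX
  · rintro ⟨hne, hi⟩
    obtain ⟨t₀, h3, h4, -⟩ := exists_contour_crossing h hs hc hm hmA hne hi
    refine ⟨⟨fun t => ⟨contour A B ε θ (m : ℕ) (ℓ - 1) (ρ * t), ?_⟩, ?_⟩,
      (isContourLift_iff hs hρ h1 h2).2 fun t => rfl⟩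
    · exact (le_total t₀ (ρ * t)).elim (fun h => SigmaPlus_subset (h3 _ h))
        fun h => SigmaMinus_subset (h4 _ h)
    · exact ((continuous_contour hs _ _).comp (continuous_const.mul continuous_id)).subtype_mk _

theorem abs_sub_half_lt {n c : ℤ} (h : |(n : ℝ) - 1 / 2| < c) : 1 - c ≤ n ∧ n ≤ c := by
  rw [abs_lt] at h
  constructor
  · have : ((-c : ℤ) : ℝ) < n := by push_cast; linarith [h.1]
    have : -c < n := by exact_mod_cast this
    omega
  · have : (n : ℝ) < ((c + 1 : ℤ) : ℝ) := by push_cast; linarith [h.2]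
    have : n < c + 1 := by exact_mod_cast this
    omega

/-- Either the centre `i` is `0`, or it is a shift `j` with `0 ≤ m + B k + (B - A) j < A`; the distance
from `ℓ - 1/2` to `i` being less than `⌈M⌉`, solving for `ℓ` bounds it. -/
theorem index_bound {ℓ m i : ℤ} (hM : 0 < M) (hm : 0 ≤ m) (hmA : m < A)
    (hi : i ∈ centers A B m (ℓ - 1)) (h : |((ℓ - 1 : ℤ) : ℝ) + 1 / 2 - i| < M) :
    (A : ℤ) * (|ℓ| - 2) < max (A : ℤ) |(A : ℤ) - B| * ⌈M⌉ := by
  have hc : 0 < ⌈M⌉ := Int.ceil_pos.2 hM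
  obtain ⟨h1, h2⟩ := abs_sub_half_lt (n := ℓ - i) (c := ⌈M⌉) (by
    refine lt_of_le_of_lt (le_of_eq ?_) (h.trans_le (Int.le_ceil M))
    push_cast
    ring_nf)
  have hA0 : (0 : ℤ) < A := hm.trans_lt hmA
  set c := ⌈M⌉
  rcases mem_insert_iff.1 hi with rfl | hi
  · have h3 : |ℓ| ≤ c := abs_le.2 ⟨by linarith, by linarith⟩
    calc (A : ℤ) * (|ℓ| - 2) < A * c := mul_lt_mul_of_pos_left (by linarith) hA0
      _ ≤ _ := mul_le_mul_of_nonneg_right (le_max_left _ _) hc.le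
  · obtain ⟨h3, h4⟩ := hi
    have h5 : |ℓ - i - 1| ≤ c := abs_le.2 ⟨by linarith, by linarith⟩
    have h6 : |((A : ℤ) - B) * (ℓ - i - 1)| ≤ |(A : ℤ) - B| * c := by
      rw [abs_mul]
      exact mul_le_mul_of_nonneg_left h5 (abs_nonneg _)
    have h7 : |(A : ℤ) - B| * c ≤ max (A : ℤ) |(A : ℤ) - B| * c :=
      mul_le_mul_of_nonneg_right (le_max_right _ _) hc.le
    have h8 : (A : ℤ) * |ℓ| = |A * ℓ| := by rw [abs_mul, abs_of_pos hA0]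
    have h9 : (A : ℤ) * ℓ = (m + B * (ℓ - 1) - (B - A) * i) - m + A + (A - B) * (ℓ - i - 1) := by
      ring
    have h10 : |(A : ℤ) * ℓ| < 2 * A + |(A : ℤ) - B| * c := by
      rw [h9]
      rw [abs_le] at h6
      rw [abs_lt]
      constructor <;> linarith [h6.1, h6.2]
    rw [mul_sub, h8]
    linarith

theorem shifts_nonempty_of_le (hAB : A ≠ B) (h : B ≤ 2 * A) (m k : ℤ) :
    (shifts A B m k).Nonempty := by
  have hne : (B : ℤ) - A ≠ 0 := by omega
  have h1 : |(B : ℤ) - A| ≤ A := abs_le.2 ⟨by omega, by omega⟩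
  have h2 := Int.emod_add_mul_ediv (m + B * k) (B - A)
  have e : m + B * k - (B - A) * ((m + B * k) / (B - A)) = (m + B * k) % (B - A) := by linarith
  refine ⟨(m + B * k) / (B - A), ?_, ?_⟩
  · rw [e]
    exact Int.emod_nonneg _ hne
  · rw [e]
    exact (Int.emod_lt_abs _ hne).trans_le h1

end Index

/-! ### The classes of the contours -/

section ContourClass

open Set Topology

variable {R : Type u} [CommRing R]

theorem IsClass.map {K K' : ChainComplex (ModuleCat.{u} R) ℕ} (φ : K ⟶ K') {n : ℕ} {x : K.X n}
    {h : K.homology n} (hx : IsClass K n x h) :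
    IsClass K' n ((φ.f n).hom x) ((HomologicalComplex.homologyMap φ n).hom h) := by
  obtain ⟨z, rfl, rfl⟩ := hx
  refine ⟨(HomologicalComplex.cyclesMap φ n).hom z, ?_, ?_⟩
  · exact congrArg (fun f => f.hom z) (HomologicalComplex.cyclesMap_i φ n)
  · exact (congrArg (fun f => f.hom z) (HomologicalComplex.homologyπ_naturality φ n)).symm

theorem IsClass.add_boundary {K : ChainComplex (ModuleCat.{u} R) ℕ} {n : ℕ} {x : K.X n}
    {h : K.homology n} (hx : IsClass K n x h) (w : K.X (n + 1)) :
    IsClass K n (x + (K.d (n + 1) n).hom w) h := by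
  have := hx.add (isClass_zero_iff.2 ⟨w, rfl⟩)
  rwa [add_zero] at this

section Segments

variable {Y : Type} [TopologicalSpace Y] {S : Set Y}

theorem segment_eq_lineSimplex (γ : C(ℝ, S)) (n : ℤ) :
    segment γ n = lineSimplex γ (n : ℝ) (n + 1) := by
  ext s
  have hs : s.1 0 = 1 - s.1 1 := by
    have := s.2.2
    rw [Fin.sum_univ_two] at this
    exact eq_sub_of_add_eq this
  have : (n : ℝ) + s.1 1 = s.1 0 • (n : ℝ) + s.1 1 • ((n : ℝ) + 1) := by
    rw [hs, smul_eq_mul, smul_eq_mul]; ring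
  exact congrArg (fun t => (γ t : Y)) this

/-- Up to boundaries, the sum of consecutive segments is one segment. -/
theorem exists_sum_segment (R : Type u) [CommRing R] (γ : C(ℝ, S)) (a : ℤ) (n : ℕ) :
    ∃ w, ∑ i ∈ Finset.Ico a (a + n), simplexChain R (segment γ i) =
      simplexN R (n := 1) (lineSimplex γ (a : ℝ) (a + n)) +
        ((chains R S).d 2 1).hom w := by
  induction n with
  | zero =>
    refine ⟨-simplexN R (n := 2) (triangle γ (a : ℝ) a a), ?_⟩
    rw [map_neg, d_triangle]
    simp
  | succ n ih =>
    obtain ⟨w, hw⟩ := ih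
    have e : (a + (n + 1 : ℕ) : ℤ) = (a + n) + 1 := by push_cast; ring
    rw [e, ← Finset.insert_Ico_right_eq_Ico_add_one (by omega), Finset.sum_insert (by simp), hw,
      simplexChain_eq_simplexN, segment_eq_lineSimplex]
    refine ⟨w + simplexN R (n := 2) (triangle γ (a : ℝ) (a + n) (a + n + 1)), ?_⟩
    rw [map_add, d_triangle]
    push_cast
    rw [add_assoc (a : ℝ)]
    abel

end Segments

variable {A B : ℕ} {ε M L θ : ℝ}

/-- The connecting map sends the class of a path from `D⁻` to `D⁺`, which passes from `Σ⁻` to `Σ⁺`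
at one point, to minus the class of this point. -/
theorem mvConnecting_line (γ : C(ℝ, XSurf A B ε M)) {a t₀ b : ℝ} (hat : a ≤ t₀) (htb : t₀ ≤ b)
    (hp : ∀ t, t₀ ≤ t → (γ t : Surface A B) ∈ SigmaPlus A B ε M)
    (hn : ∀ t, t ≤ t₀ → (γ t : Surface A B) ∈ SigmaMinus A B ε M)
    (ha : (γ a : Surface A B) ∈ DMinus A B ε M L θ) (hb : (γ b : Surface A B) ∈ DPlus A B ε M L θ)
    {ξ : (relChains R (DReg_subset A B ε M L θ)).homology 1}
    (hξ : IsClass (relChains R (DReg_subset A B ε M L θ)) 1 (relπ R (DReg_subset A B ε M L θ) 1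
      (simplexN R (n := 1) (lineSimplex γ a b))) ξ)
    {k : (chains R (SigmaPlus A B ε M ∩ SigmaMinus A B ε M)).homology 0}
    {q : (SigmaPlus A B ε M ∩ SigmaMinus A B ε M : Set (Surface A B))}
    (hq : (q : Surface A B) = γ t₀)
    (hk : IsClass (chains R (SigmaPlus A B ε M ∩ SigmaMinus A B ε M)) 0 (-pointChain R q) k) :
    MVConnecting R A B ε M L θ ξ k := by
  let γp : C(ℝ, SigmaPlus A B ε M) := ⟨fun t => ⟨γ (max t t₀), hp _ (le_max_right _ _)⟩, by fun_prop⟩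
  let γn : C(ℝ, SigmaMinus A B ε M) := ⟨fun t => ⟨γ (min t t₀), hn _ (min_le_right _ _)⟩, by fun_prop⟩
  have hsum : ∀ s : stdSimplex ℝ (Fin 2), s.1 0 + s.1 1 = 1 := fun s => by
    have := s.2.2; simpa [Fin.sum_univ_two] using this
  refine mvConnecting_iff.2 ⟨simplexN R (n := 1) (lineSimplex γp t₀ b),
    simplexN R (n := 1) (lineSimplex γn a t₀), -pointChain R q,
    pointChain R (⟨γ b, hb⟩ : DPlus A B ε M L θ), -pointChain R (⟨γ a, ha⟩ : DMinus A B ε M L θ),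
    ?_, ?_, ?_, hk⟩
  · have e1 : γp t₀ = ⟨q, q.2.1⟩ := Subtype.ext (by simp [γp, hq])
    have e2 : γp b = ⟨γ b, DPlus_subset A B ε M L θ hb⟩ := Subtype.ext (by simp [γp, htb])
    rw [d_lineSimplex, map_neg, chainsIncl_pointChain, chainsIncl_pointChain, sub_eq_neg_add, e1, e2]
  · have e1 : γn t₀ = ⟨q, q.2.2⟩ := Subtype.ext (by simp [γn, hq])
    have e2 : γn a = ⟨γ a, DMinus_subset A B ε M L θ ha⟩ := Subtype.ext (by simp [γn, hat])
    rw [d_lineSimplex, map_neg, map_neg, chainsIncl_pointChain, chainsIncl_pointChain, neg_neg,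
      sub_eq_add_neg, e1, e2]
  · have e1 : ((chainsIncl R SigmaPlus_subset).f 1).hom
        (simplexN R (n := 1) (lineSimplex γp t₀ b)) =
          simplexN R (n := 1) (lineSimplex γ t₀ b) := by
      rw [chainsIncl_simplexN]
      congr 1
      ext s
      have : t₀ ≤ s.1 0 * t₀ + s.1 1 * b := by
        have h0 : s.1 0 = 1 - s.1 1 := eq_sub_of_add_eq (hsum s)
        have h1 : 0 ≤ s.1 1 * (b - t₀) := mul_nonneg (s.2.1 1) (sub_nonneg.2 htb)
        rw [h0]
        linarith
      exact congrArg (fun t => (γ t : Surface A B)) (max_eq_left this)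
    have e2 : ((chainsIncl R SigmaMinus_subset).f 1).hom
        (simplexN R (n := 1) (lineSimplex γn a t₀)) =
          simplexN R (n := 1) (lineSimplex γ a t₀) := by
      rw [chainsIncl_simplexN]
      congr 1
      ext s
      have : s.1 0 * a + s.1 1 * t₀ ≤ t₀ := by
        have h0 : s.1 1 = 1 - s.1 0 := eq_sub_of_add_eq' (hsum s)
        have h1 : 0 ≤ s.1 0 * (t₀ - a) := mul_nonneg (s.2.1 0) (sub_nonneg.2 hat)
        rw [h0]
        linarith
      exact congrArg (fun t => (γ t : Surface A B)) (min_eq_left this)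
    rw [e1, e2]
    have := hξ.add_boundary (relπ R (DReg_subset A B ε M L θ) 2
      (simplexN R (n := 2) (triangle γ a t₀ b)))
    rw [d_relπ, ← map_add, d_triangle] at this
    convert this using 2
    abel

/-- A path which tends to infinity in `D` at both ends represents a class of the inverse limit. -/
theorem exists_represents (γ : C(ℝ, XSurf A B ε M)) (hγ : ∀ L : ℝ, ∀ᶠ t : ℝ in Filter.atTop,
      (γ t : Surface A B) ∈ DReg A B ε M L θ ∧ (γ (-t) : Surface A B) ∈ DReg A B ε M L θ) :
    ∃ h : (relChainsInf R A B ε M θ).homology 1, Represents R A B ε M θ γ h := by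
  let s : ℕ → (chains R (XSurf A B ε M)).X 1 := fun N =>
    ∑ n ∈ Finset.Ico (-N : ℤ) N, simplexChain R (segment γ n)
  have hN : ∀ L : ℝ, ∃ N : ℕ, ∀ t : ℝ, (N : ℝ) ≤ t →
      (γ t : Surface A B) ∈ DReg A B ε M L θ ∧ (γ (-t) : Surface A B) ∈ DReg A B ε M L θ := by
    intro L
    obtain ⟨T, hT⟩ := Filter.eventually_atTop.1 (hγ L)
    exact ⟨⌈T⌉₊, fun t ht => hT t ((Nat.le_ceil T).trans ht)⟩
  choose N hN using hN
  -- a segment in `D` vanishes in the relative chains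
  have hzero : ∀ (L : ℝ) (n : ℤ), (∀ t : ℝ, (n : ℝ) ≤ t → t ≤ n + 1 →
      (γ t : Surface A B) ∈ DReg A B ε M L θ) →
      relπ R (DReg_subset A B ε M L θ) 1 (simplexChain R (segment γ n)) = 0 := by
    intro L n h
    have hs : ∀ x : stdSimplex ℝ (Fin 2), (segment γ n x : Surface A B) ∈ DReg A B ε M L θ :=
      fun x => h _ (le_add_of_nonneg_right (x.2.1 1)) (by
        have h1 := x.2.2
        rw [Fin.sum_univ_two] at h1
        have h2 := x.2.1 0
        change (n : ℝ) + x.1 1 ≤ n + 1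
        linarith)
    refine (relπ_eq_zero_iff _ 1 _).2 ⟨simplexN R (n := 1) ⟨fun x => ⟨segment γ n x, hs x⟩, ?_⟩, ?_⟩
    · exact (continuous_subtype_val.comp (segment γ n).continuous).subtype_mk _
    · rw [chainsIncl_simplexN]
      rfl
  have hconst : ∀ (L : ℝ) (N₀ : ℕ), (∀ t : ℝ, (N₀ : ℝ) ≤ t → (γ t : Surface A B) ∈ DReg A B ε M L θ ∧
      (γ (-t) : Surface A B) ∈ DReg A B ε M L θ) → ∀ n, N₀ ≤ n →
      relπ R (DReg_subset A B ε M L θ) 1 (s n) = relπ R (DReg_subset A B ε M L θ) 1 (s N₀) := by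
    intro L N₀ h n hn
    simp only [s, map_sum]
    symm
    apply Finset.sum_subset
    · intro i hi
      rw [Finset.mem_Ico] at hi ⊢
      omega
    · intro i hi hi'
      rw [Finset.mem_Ico] at hi hi'
      rcases le_or_gt (N₀ : ℤ) i with h1 | h1
      · exact hzero L i fun t ht _ => (h t (le_trans (by exact_mod_cast h1) ht)).1
      · have h2 : i + 1 ≤ -(N₀ : ℤ) := by omega
        have h3 : (i : ℝ) + 1 ≤ -(N₀ : ℝ) := by exact_mod_cast h2
        refine hzero L i fun t _ ht => ?_
        have := (h (-t) (by linarith)).2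
        rwa [neg_neg] at this
  obtain ⟨x, hx⟩ := exists_limπ (R := R) (A := A) (B := B) (ε := ε) (M := M) (θ := θ) 1
    (fun L => relπ R (DReg_subset A B ε M L θ) 1 (s (N L))) (fun L L' h => by
      rw [relProj_relπ, ← hconst L _ (hN L) _ (le_max_left (N L) (N L'))]
      symm
      exact hconst L (N L') (fun t ht => ⟨DReg_antitone A B ε M θ h (hN L' t ht).1,
        DReg_antitone A B ε M θ h (hN L' t ht).2⟩) _ (le_max_right _ _))
  have hdx : ((relChainsInf R A B ε M θ).d 1 0).hom x = 0 := by
    refine limπ_ext fun L => ?_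
    rw [← d_limπ, hx, d_relπ, map_zero, relπ_eq_zero_iff]
    obtain ⟨w, hw⟩ := exists_sum_segment R γ (-(N L : ℤ)) (2 * N L)
    have e : (-(N L : ℤ) + (2 * N L : ℕ) : ℤ) = N L := by push_cast; ring
    have e' : (-(N L : ℝ) + (2 * N L : ℕ) : ℝ) = N L := by push_cast; ring
    rw [e] at hw
    push_cast at hw
    push_cast at e'
    rw [e'] at hw
    refine ⟨pointChain R (⟨γ (N L), (hN L _ le_rfl).1⟩ : DReg A B ε M L θ) -
      pointChain R (⟨γ (-N L), (hN L _ le_rfl).2⟩ : DReg A B ε M L θ), ?_⟩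
    rw [map_sub, chainsIncl_pointChain, chainsIncl_pointChain]
    change _ = ((chains R (XSurf A B ε M)).d 1 0).hom
      (∑ n ∈ Finset.Ico (-(N L : ℤ)) (N L), simplexChain R (segment γ n))
    rw [hw, map_add, d_comp_d_apply, add_zero, d_lineSimplex]
  obtain ⟨h, hh⟩ := exists_isClass_succ 0 x hdx
  exact ⟨h, x, hh, fun L => ⟨N L, fun n hn => (hx L).trans (hconst L _ (hN L) n hn).symm⟩⟩

end ContourClass

/-! ### The basis of contours -/

section ContourBasis

open Set Topology

variable {R : Type u} [CommRing R] {A B : ℕ} {ε M θ : ℝ}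

variable (R A B ε M θ) in
/-- The map from the homology of the inverse limit to `H₁(X, D_L)`. -/
def homologyLimπ (L : {L : ℝ // M ≤ L}) : (relChainsInf R A B ε M θ).homology 1 →ₗ[R]
    (relChains R (DReg_subset A B ε M L θ)).homology 1 :=
  (HomologicalComplex.homologyMap (limit.π (relSystem R A B ε M θ) (Opposite.op L)) 1).hom

theorem IsClass.limπ {x : (relChainsInf R A B ε M θ).X 1}
    {h : (relChainsInf R A B ε M θ).homology 1} (hx : IsClass _ 1 x h) (L : {L : ℝ // M ≤ L}) :
    IsClass (relChains R (DReg_subset A B ε M L θ)) 1 (StateInt.limπ R A B ε M θ L 1 x)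
      (homologyLimπ R A B ε M θ L h) :=
  hx.map (limit.π (relSystem R A B ε M θ) (Opposite.op L))

/-- `D_L` flows inside itself into every `D_{L'}`, so a primitive modulo `D_L` of a cycle of the limit
can be corrected successively to a primitive modulo all of them. -/
theorem homologyLimπ_injective (hA : 0 < A) (hAB : A ≠ B) (hε : 0 < ε) (hM : 0 < M)
    (hs : SmallTilt A B ε θ) (L : {L : ℝ // M ≤ L}) (hL : levelBound A B ε M ≤ L) :
    Function.Injective (homologyLimπ R A B ε M θ L) := by
  rw [← LinearMap.ker_eq_bot, LinearMap.ker_eq_bot']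
  intro h hh
  obtain ⟨x, hx⟩ := exists_isClass_rep 1 h
  have h1 := hx.limπ L
  rw [hh] at h1
  obtain ⟨y, hy⟩ := isClass_zero_iff.1 h1
  obtain ⟨z, hz⟩ := exists_primitive_inf hA hAB hε hM hs L hL x hx.d_eq_zero y hy
  exact hx.unique (isClass_zero_iff.2 ⟨z, hz⟩)

/-- The connecting map sends the class of a contour to minus the class of its crossing point. -/
theorem Represents.mvConnecting {γ : C(ℝ, XSurf A B ε M)}
    {h : (relChainsInf R A B ε M θ).homology 1} (hγ : Represents R A B ε M θ γ h)
    (L : {L : ℝ // M ≤ L}) {t₀ : ℝ}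
    (hp : ∀ t, t₀ ≤ t → (γ t : Surface A B) ∈ SigmaPlus A B ε M)
    (hn : ∀ t, t ≤ t₀ → (γ t : Surface A B) ∈ SigmaMinus A B ε M)
    (hDp : ∀ᶠ t : ℝ in Filter.atTop, (γ t : Surface A B) ∈ DPlus A B ε M L θ)
    (hDn : ∀ᶠ t : ℝ in Filter.atTop, (γ (-t) : Surface A B) ∈ DMinus A B ε M L θ)
    {q : (SigmaPlus A B ε M ∩ SigmaMinus A B ε M : Set (Surface A B))}
    (hq : (q : Surface A B) = γ t₀)
    {k : (chains R (SigmaPlus A B ε M ∩ SigmaMinus A B ε M)).homology 0}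
    (hk : IsClass (chains R (SigmaPlus A B ε M ∩ SigmaMinus A B ε M)) 0 (-pointChain R q) k) :
    MVConnecting R A B ε M L θ (homologyLimπ R A B ε M θ L h) k := by
  obtain ⟨x, hx, hxL⟩ := hγ
  obtain ⟨N₀, hN₀⟩ := hxL L
  obtain ⟨N, ⟨hN1, hN2, hN3⟩, hN4⟩ := (((tendsto_natCast_atTop_atTop (R := ℝ)).eventually
    (hDp.and (hDn.and (Filter.eventually_ge_atTop |t₀|)))).and
    (Filter.eventually_ge_atTop N₀)).exists
  have h1 : IsClass _ 1 (relπ R (DReg_subset A B ε M L θ) 1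
      (∑ n ∈ Finset.Ico (-N : ℤ) N, simplexChain R (segment γ n))) (homologyLimπ R A B ε M θ L h) := by
    have h2 := hx.limπ L
    have h3 : StateInt.limπ R A B ε M θ L 1 x = relπ R (DReg_subset A B ε M L θ) 1
      (∑ n ∈ Finset.Ico (-N : ℤ) N, simplexChain R (segment γ n)) := hN₀ N hN4
    rwa [h3] at h2
  obtain ⟨w, hw⟩ := exists_sum_segment R γ (-(N : ℤ)) (2 * N)
  have e : (-(N : ℤ) + (2 * N : ℕ) : ℤ) = N := by push_cast; ring
  have e' : (-(N : ℝ) + 2 * N : ℝ) = N := by ring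
  rw [e] at hw
  push_cast at hw
  rw [e'] at hw
  have h4 := h1.add_boundary (relπ R (DReg_subset A B ε M L θ) 2 (-w))
  rw [d_relπ, ← map_add, hw, map_neg, add_neg_cancel_right] at h4
  have h5 := abs_le.1 hN3
  exact mvConnecting_line γ (a := -(N : ℝ)) (b := N) h5.1 h5.2 hp hn hN2 hN1 h4 hq hk

set_option maxHeartbeats 2000000 in
/-- The contours give classes of the limit, whose images in `H₁(X, D_L)` the connecting map sends to
minus their real points. There is one contour in `X` for each component of `Σ⁺ ∩ Σ⁻`, so the images
form a basis, and the projection to `H₁(X, D_L)` is injective. -/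
theorem exists_contour_basis (R : Type u) [CommRing R] (hA : 0 < A) (hAB : A ≠ B)
    (h : SmallRadius ε M) (hs : SmallTilt A B ε θ) (hc : SmallContour A B ε M θ)
    (hmid : ∀ k : ℤ, (∃ x : ℝ, (k : ℝ) < x ∧ x < k + 1 ∧ |x| < M) → |(k : ℝ) + 1 / 2| < M)
    {τ : ℂ} {ρ : ℝ} (hρ : 0 < ρ)
    (h1 : Complex.I / τ ^ (1 / 2 : ℂ) * Complex.exp (-(Complex.I * A * ε)) = ρ * dirPlus A ε θ)
    (h2 : Complex.I / τ ^ (1 / 2 : ℂ) * Complex.exp (-(Complex.I * (A - B) * ε)) =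
      ρ * dirMinus A B ε θ) :
    ∃ b : Module.Basis (contourIndex A B ε M τ) R ((relChainsInf R A B ε M θ).homology 1),
      ∀ (q : contourIndex A B ε M τ) (γ : C(ℝ, XSurf A B ε M)),
        IsContourLift A B ε τ q.1.1 (q.1.2 : ℕ) (fun t => γ t) →
          Represents R A B ε M θ γ (b q) := by
  choose γ hγ using fun q : contourIndex A B ε M τ => q.2
  have hγ' : ∀ q t, (γ q t : Surface A B) = contour A B ε θ (q.1.2 : ℕ) (q.1.1 - 1) (ρ * t) :=
    fun q => (isContourLift_iff hs hρ h1 h2).1 (hγ q)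
  have hm : ∀ m : Fin A, (0 : ℤ) ≤ (m : ℕ) := fun m => by positivity
  have hmA : ∀ m : Fin A, ((m : ℕ) : ℤ) < A := fun m => by exact_mod_cast m.2
  have hidx := fun q : contourIndex A B ε M τ =>
    (mem_contourIndex_iff h hs hc hmid hρ h1 h2 (ℓ := q.1.1) (m := q.1.2)).1 q.2
  have htend : Filter.Tendsto (fun t : ℝ => ρ * t) Filter.atTop Filter.atTop :=
    Filter.tendsto_id.const_mul_atTop hρ
  have hDp : ∀ (q : contourIndex A B ε M τ) (L : ℝ), levelBound A B ε M ≤ L →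
      ∀ᶠ t : ℝ in Filter.atTop, (γ q t : Surface A B) ∈ DPlus A B ε M L θ := fun q L hL => by
    filter_upwards [htend.eventually (contour_eventually_mem_DPlus hA h.hε h.hM hs hL (hm q.1.2)
      (hmA q.1.2) (q.1.1 - 1))] with t ht
    rwa [hγ']
  have hDn : ∀ (q : contourIndex A B ε M τ) (L : ℝ), levelBound A B ε M ≤ L →
      ∀ᶠ t : ℝ in Filter.atTop, (γ q (-t) : Surface A B) ∈ DMinus A B ε M L θ := fun q L hL => by
    filter_upwards [htend.eventually (contour_eventually_mem_DMinus hAB h.hε h.hM hs hL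
      (hidx q).1)] with t ht
    rwa [hγ', mul_neg]
  choose b hb using fun q => exists_represents (R := R) (θ := θ) (γ q) fun L => by
    filter_upwards [hDp q _ (le_max_right L _), hDn q _ (le_max_right L _)] with t ht ht'
    exact ⟨DReg_antitone A B ε M θ (le_max_left L _) (Or.inl ht),
      DReg_antitone A B ε M θ (le_max_left L _) (Or.inr ht')⟩
  choose t₀ hp hn z hz hzt using fun q =>
    exists_contour_crossing h hs hc (hm q.1.2) (hmA q.1.2) (hidx q).1 (hidx q).2
  let c : contourIndex A B ε M τ → (SigmaPlus A B ε M ∩ SigmaMinus A B ε M : Set (Surface A B)) :=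
    fun q => ⟨_, hp q _ le_rfl, hn q _ le_rfl⟩
  choose k hk using fun q => exists_isClass_zero
    (K := chains R (SigmaPlus A B ε M ∩ SigmaMinus A B ε M)) (-pointChain R (c q))
  let L : {L : ℝ // M ≤ L} := ⟨max M (levelBound A B ε M), le_max_left _ _⟩
  have hL : levelBound A B ε M ≤ L := le_max_right _ _
  have hMV : ∀ q, MVConnecting R A B ε M L θ (homologyLimπ R A B ε M θ L (b q)) (k q) := by
    intro q
    refine (hb q).mvConnecting L (t₀ := t₀ q / ρ) (fun t ht => ?_) (fun t ht => ?_) (hDp q L hL)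
      (hDn q L hL) ?_ (hk q)
    · rw [hγ']
      exact hp q _ ((div_le_iff₀' hρ).1 ht)
    · rw [hγ']
      exact hn q _ ((le_div_iff₀' hρ).1 ht)
    · rw [hγ', mul_div_cancel₀ _ hρ.ne']
  have hall : ∀ p : (SigmaPlus A B ε M ∩ SigmaMinus A B ε M : Set (Surface A B)),
      ∃ i, JoinedIn (SigmaPlus A B ε M ∩ SigmaMinus A B ε M) (p : Surface A B) (c i) := by
    intro p
    obtain ⟨m, w, hm', hmA', hw, -, e⟩ := exists_plusPt_of_mem_SigmaPlus p.2.1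
    have hpC := p.2
    rw [e] at hpC ⊢
    have hwk := (floor_eq_of_strip (plusPt_mem_SigmaMinus hw hpC.2) _).1 rfl
    obtain ⟨i, hi, x, hx, hxi, -, -, -⟩ := exists_joinedIn_line h hm' hmA' hwk hpC
    have hmid' := abs_mid_sub_lt h.hM hmid (hx.strip h) hxi
    obtain ⟨j, hj, -⟩ := (plusPt_mem_SigmaMinus_iff hwk).1 hpC.2
    have hmn : ((m.toNat : ℕ) : ℤ) = m := Int.toNat_of_nonneg hm'
    have hq : ((⌊w.re⌋ + 1, ⟨m.toNat, by omega⟩) : ℤ × Fin A) ∈ contourIndex A B ε M τ := by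
      rw [mem_contourIndex_iff h hs hc hmid hρ h1 h2]
      simp only [hmn, add_sub_cancel_right]
      exact ⟨⟨j, hj⟩, i, hi, hmid'⟩
    refine ⟨⟨_, hq⟩, ?_⟩
    have hcq := (c ⟨_, hq⟩).2
    have hzq := hz ⟨_, hq⟩
    have heq : (c ⟨_, hq⟩ : Surface A B) = _ := hzt ⟨_, hq⟩
    simp only [hmn, add_sub_cancel_right] at hzq heq
    rw [heq] at hcq ⊢
    exact joinedIn_of_sameCell h hm' hmA' hwk hzq hpC hcq (Or.inl ⟨i, hi, hmid'.le⟩)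
  have hdisj : ∀ (i j : contourIndex A B ε M τ) (m k : ℤ) (z w : ℂ), 0 ≤ m → m < A →
      (k : ℝ) < z.re ∧ z.re < k + 1 → (k : ℝ) < w.re ∧ w.re < k + 1 →
      (c i : Surface A B) = plusPt A B m z → (c j : Surface A B) = plusPt A B m w → i = j := by
    intro i j m k' z' w' hm' hmA' hz' hw' ei ej
    have key : ∀ q : contourIndex A B ε M τ, ∀ y : ℂ, (k' : ℝ) < y.re ∧ y.re < k' + 1 →
        (c q : Surface A B) = plusPt A B m y → ((q.1.2 : ℕ) : ℤ) = m ∧ q.1.1 - 1 = k' := by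
      intro q y hy ey
      obtain ⟨e1, e2⟩ := plusPt_normalized_eq (hm q.1.2) (hmA q.1.2) hm' hmA'
        (strip_mem_cutPlus (hz q)) (strip_mem_cutPlus hy) ((hzt q).symm.trans ey)
      refine ⟨e1, ?_⟩
      have hzq := hz q
      rw [e2] at hzq
      rw [← (floor_eq_of_strip (ne_int_of_mem hy.1 hy.2) k').2 hy,
        (floor_eq_of_strip (ne_int_of_mem hy.1 hy.2) _).2 hzq]
    obtain ⟨i1, i2⟩ := key i z' hz' ei
    obtain ⟨j1, j2⟩ := key j w' hw' ej
    exact Subtype.ext (Prod.ext (by omega) (Fin.ext (by omega)))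
  obtain ⟨hli, hspan⟩ := basis_of_points hA hAB h hs hL c hall hdisj
    (fun q => homologyLimπ R A B ε M θ L (b q)) k hk hMV
  have hli' : LinearIndependent R b := LinearIndependent.of_comp _ hli
  have hspan' : ⊤ ≤ Submodule.span R (range b) := by
    rintro x -
    have h3 := hspan (Submodule.mem_top (x := homologyLimπ R A B ε M θ L x))
    rw [show (fun q => homologyLimπ R A B ε M θ L (b q)) = homologyLimπ R A B ε M θ L ∘ b from rfl,
      range_comp, ← Submodule.map_span] at h3
    obtain ⟨y, hy, hyx⟩ := h3
    rwa [← homologyLimπ_injective hA hAB h.hε h.hM hs L hL hyx]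
  refine ⟨Module.Basis.mk hli' hspan', fun q γ' hγq => ?_⟩
  have : γ' = γ q := by
    ext t
    rw [hγ']
    exact (isContourLift_iff hs hρ h1 h2).1 hγq t
  rw [Module.Basis.mk_apply, this]
  exact hb q

end ContourBasis

end

end StateInt

theorem mainTheorem7 {R : Type*} [CommRing R] (A B : ℕ) (hA : 0 < A) (hB : 0 < B) (hAB : A ≠ B)
    (θ : ℝ) (hθ : 0 < θ) (hθ' : θ < 2 * Real.pi) :
    (∀ ε M L : ℝ, 0 < ε → 0 < M → 0 < L →
      Module.Finite R ((StateInt.relChains R (StateInt.DReg_subset A B ε M L θ)).homology 1)) ∧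
    (∀ M : ℝ, 0 < M → ∃ ε₀ : ℝ, 0 < ε₀ ∧ ∀ ε : ℝ, 0 < ε → ε < ε₀ →
      (∃ L₀ : ℝ, ∀ L : ℝ, L₀ ≤ L →
        ∃ e : (StateInt.relChains R (StateInt.DReg_subset A B ε M L θ)).homology 1 ≃ₗ[R]
            (StateInt.chains R
              (StateInt.SigmaPlus A B ε M ∩ StateInt.SigmaMinus A B ε M)).homology 0,
          ∀ h k, StateInt.MVConnecting R A B ε M L θ h k ↔ e h = k) ∧
      ((∀ k : ℤ, (∃ x : ℝ, (k : ℝ) < x ∧ x < k + 1 ∧ |x| < M) → |(k : ℝ) + 1 / 2| < M) →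
        ∀ τ : ℂ, τ ≠ 0 → -1 / τ = (‖1 / τ‖ : ℂ) * Complex.exp (θ * Complex.I) →
          (∃ b : Module.Basis (StateInt.contourIndex A B ε M τ) R
              ((StateInt.relChainsInf R A B ε M θ).homology 1),
            ∀ (q : StateInt.contourIndex A B ε M τ) (γ : C(ℝ, StateInt.XSurf A B ε M)),
              StateInt.IsContourLift A B ε τ q.1.1 (q.1.2 : ℕ) (fun t => γ t) →
                StateInt.Represents R A B ε M θ γ (b q)) ∧
          (∀ (ℓ : ℤ) (m : Fin A), (ℓ, m) ∈ StateInt.contourIndex A B ε M τ →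
            (A : ℤ) * (|ℓ| - 2) < max (A : ℤ) |(A : ℤ) - B| * ⌈M⌉) ∧
          (B ≤ 2 * A → ∀ (ℓ : ℤ) (m : Fin A), |(ℓ : ℝ)| < M →
            (ℓ, m) ∈ StateInt.contourIndex A B ε M τ))) := by
  refine ⟨fun ε M L hε hM _ => StateInt.finite_homology R hA hAB hε hM, fun M hM => ?_⟩
  obtain ⟨ε₁, hε₁, h₁⟩ := StateInt.exists_smallRadius hM
  obtain ⟨ε₂, hε₂, h₂⟩ := StateInt.exists_smallTilt hA hAB hθ hθ'
  obtain ⟨ε₃, hε₃, h₃⟩ := StateInt.exists_smallContour (M := M) A B hθ hθ'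
  refine ⟨min ε₁ (min ε₂ ε₃), lt_min hε₁ (lt_min hε₂ hε₃), fun ε hε hlt => ?_⟩
  rw [lt_min_iff, lt_min_iff] at hlt
  have h := h₁ ε hε hlt.1
  have hs := h₂ ε hε hlt.2.1
  have hc := h₃ ε hε hlt.2.2
  refine ⟨⟨StateInt.levelBound A B ε M, fun L hL => StateInt.exists_mvEquiv R hA hAB h hs hL⟩,
    fun hmid τ hτ hτθ => ?_⟩
  obtain ⟨ρ, hρ, e₁, e₂⟩ := StateInt.exists_contour_speed hθ hθ' A B ε hτ hτθ
  have hidx := fun (ℓ : ℤ) (m : Fin A) =>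
    StateInt.mem_contourIndex_iff h hs hc hmid hρ e₁ e₂ (ℓ := ℓ) (m := m)
  refine ⟨StateInt.exists_contour_basis R hA hAB h hs hc hmid hρ e₁ e₂, fun ℓ m hq => ?_,
    fun hBA ℓ m hℓ => ?_⟩
  · obtain ⟨-, i, hi, hiM⟩ := (hidx ℓ m).1 hq
    exact StateInt.index_bound hM (by positivity) (by exact_mod_cast m.2) hi hiM
  · refine (hidx ℓ m).2 ⟨StateInt.shifts_nonempty_of_le hAB hBA _ _, 0, Set.mem_insert _ _, ?_⟩
    -- the interval to the left of `ℓ` meets `(-M, M)`, since `ℓ` belongs to it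
    rw [Int.cast_zero, sub_zero]
    rw [abs_lt] at hℓ
    obtain ⟨x, hx, hxℓ⟩ := exists_between (max_lt (sub_one_lt (ℓ : ℝ)) hℓ.1)
    rw [max_lt_iff] at hx
    refine hmid (ℓ - 1) ⟨x, ?_, ?_, abs_lt.2 ⟨hx.2, hxℓ.trans hℓ.2⟩⟩
    · push_cast
      exact hx.1
    · push_cast
      linarith
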